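/- **Conventions.** For a (pseudo-)Riemannian four-manifold $(M,g)$ and $p\in M$, the holonomy group $\mathrm{Hol}_p(M,g)$ is the set of all Levi-Civita parallel transport maps $T_pM\to T_pM$ around piecewise $C^1$ loops at $p$; the restricted holonomy group $\mathrm{Hol}^0_p(M,g)$ uses only the contractible loops. For an abelian field strength $F_{\mu\nu}$ on a domain $U$ of flat $\mathbb R^4$ (Minkowski, signature $(-,+,+,+)$, or Euclidean metric $\eta$, Cartesian coordinates) with coupling $\kappa\neq0$, the single copy holonomy (SCH) operator of a closed piecewise $C^1$ curve $C:\ s\mapsto x(s)$, $0\le s\le S$, in $U$ is $$\Phi_F(C)=\mathcal P\exp\Big[-\frac{i\kappa}{2}\oint_C ds\,F_{ab}(x(s))\,M^{ab}\Big],\qquad (M^{ab})^c{}_d=i(\eta^{ac}\delta^b_d-\eta^{bc}\delta^a_d),$$ and the SCH group is the matrix group generated by the operators $\Phi_F(C)$. The statements below hold for every class of admissible closed curves (with world-line parameter $s$) that contains the curves at constant $x^0$ parametrised by arc length; in particular for all parametrised closed curves. $SO(1,3)$ denotes the identity component of the Lorentz group (determinant one, preserving the direction of time), and $SO(3)\subset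 SO(1,3)$ the spatial rotations. On an oriented Euclidean four-space, $SU(2)_+\subset SO(4)$ is the group of exponentials of the self-dual antisymmetric matrices $X_{ab}=\tfrac12\epsilon_{abcd}X_{cd}$. **Claims.** 1. (Schwarzschild.) Let $m\neq0$, $r=(x^2+y^2+z^2)^{1/2}$ and $g=\eta+\frac{m}{4\pi r}\,k\otimes k$ with $k=dt+dr$. For every $\rho\ge0$ and every point $p$ of the region $\{r>\rho\}$, orthonormal frames at $p$ exist, and in each of them the holonomy group at $p$ of $g$ on $\{r>\rho\}$ is $SO(1,3)$. 2. (Point charge.) For $Q\ne0$, the SCH group of $F_{0i}=E_i$, $F_{ij}=0$, $\vec E=\frac{Q}{4\pi r^2}\hat r$ on $\{r>0\}$ in Minkowski space is $SO(1,3)$. 3. (Pure NUT charge.) Let $N\neq0$ and let $g$ be the Taub–NUT metric with zero mass, $$g=-A(dt+2N\cos\theta\,d\varphi)^2+A^{-1}dr^2+(r^2+N^2)(d\theta^2+\sin^2\theta\,d\varphi^2),\qquad A=\frac{r^2-N^2}{r^2+N^2},$$ on the region $r>|N|$, $\theta\ne0,\pi$ ($\varphi$ being $2\pi$-periodic). At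 every point of this region, orthonormal frames exist, and in each of them the holonomy group is $SO(1,3)$. 4. (Magnetic monopole.) For $q\ne0$, the SCH group of $F_{0i}=0$, $F_{ij}=\epsilon_{ijk}B_k$, $\vec B=\frac{q}{4\pi r^2}\hat r$ on $\{r>0\}$ in Minkowski space is $SO(3)$. 5. (Self-dual solutions.) $SU(2)_+$ is isomorphic to $SU(2)$, and: (a) Let $(M,g)$ be a connected oriented smooth Riemannian four-manifold whose Riemann tensor is self-dual (its anti-self-dual part $R^-$ vanishes). In every oriented orthonormal frame at every point $p$, $\mathrm{Hol}^0_p(M,g)\subseteq SU(2)_+$. If $g$ is not flat, then $\mathrm{Hol}^0_p(M,g)=SU(2)_+$, and if moreover $M$ is simply connected, then $\mathrm{Hol}_p(M,g)=SU(2)_+$. (b) Let $F$ be a continuous self-dual ($F^-=0$) two-form on an open subset $U$ of Euclidean $\mathbb R^4$. Its SCH group is contained in $SU(2)_+$, and it is equal to $SU(2)_+$ if and only if $F$ takes two linearly independent values, that is, unless all values of $F$ are multiples of one fixed two-form. -/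

import Mathlib

open scoped Manifold ContDiff Matrix

-- With this instance out of the way, `ℝ⁴` is found to be a manifold in the standard way,
-- with the identity as its only chart.
attribute [-instance] TopCat.of.chartedSpace

noncomputable section

namespace SingleCopyHolonomy

/-- The model space `ℝ⁴`, coordinates numbered `0, 1, 2, 3`. -/
abbrev E4 := EuclideanSpace ℝ (Fin 4)

/-- Real `4 × 4` matrices. -/
abbrev Mat4 := Matrix (Fin 4) (Fin 4) ℝ

/-- The coordinate basis vectors of `ℝ⁴`. -/
def basisVec (i : Fin 4) : E4 := EuclideanSpace.single i 1

/-- The Minkowski metric, signature `(-,+,+,+)`. -/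
def minkowski : Mat4 := Matrix.diagonal ![-1, 1, 1, 1]

/-- The totally antisymmetric symbol `ε_{abcd}` with `ε_{0123} = 1`. -/
def leviCivita (a b c d : Fin 4) : ℝ :=
  Matrix.det (Matrix.of fun i j : Fin 4 => if ![a, b, c, d] i = j then (1 : ℝ) else 0)

/-- `P` holds on every interval of some finite partition of `[a, b]`. -/
def OnPieces (P : ℝ → ℝ → Prop) (a b : ℝ) : Prop :=
  ∃ (n : ℕ) (t : ℕ → ℝ), StrictMono t ∧ t 0 = a ∧ t n = b ∧ ∀ i < n, P (t i) (t (i + 1))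

/-! ### Local differential geometry of a metric `G_{ij}` given in coordinates -/

/-- The Christoffel symbol `Γ^k_{ij}` at `y`. -/
def christoffel (G : E4 → Mat4) (y : E4) (k i j : Fin 4) : ℝ :=
  (1 / 2) * ∑ l, (G y)⁻¹ k l *
    (fderiv ℝ (fun z => G z j l) y (basisVec i) + fderiv ℝ (fun z => G z i l) y (basisVec j)
      - fderiv ℝ (fun z => G z i j) y (basisVec l))

/-- The Riemann tensor `R^ρ_{σμν} = ∂_μ Γ^ρ_{νσ} - ∂_ν Γ^ρ_{μσ} + Γ^ρ_{μλ} Γ^λ_{νσ} -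
Γ^ρ_{νλ} Γ^λ_{μσ}` at `y`. -/
def riemann (G : E4 → Mat4) (y : E4) (ρ σ μ ν : Fin 4) : ℝ :=
  fderiv ℝ (fun z => christoffel G z ρ ν σ) y (basisVec μ)
    - fderiv ℝ (fun z => christoffel G z ρ μ σ) y (basisVec ν)
    + ∑ l, (christoffel G y ρ μ l * christoffel G y l ν σ
        - christoffel G y ρ ν l * christoffel G y l μ σ)

/-- The Hodge dual `(⋆X)_{ρσ} = ½ √(det G) ε_{ρσκλ} G^{κα} G^{λβ} X_{αβ}` of a two-form `X`
with respect to a positive definite matrix `G` and the standard orientation. -/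
def hodgeDual (G X : Mat4) : Mat4 :=
  Matrix.of fun ρ σ => (1 / 2) * Real.sqrt G.det *
    ∑ κ, ∑ l, leviCivita ρ σ κ l * (G⁻¹ * X * (G⁻¹)ᵀ) κ l

/-- The anti-self-dual part of a two-form (up to normalisation):
the two-form is self-dual when this vanishes. -/
def antiSelfDualPart (G X : Mat4) : Mat4 := X - hodgeDual G X

/-! ### Metrics on four-manifolds, parallel transport, holonomy

A metric on `M` is a field `g` of bilinear forms on the tangent spaces.  In Mathlib the tangent
space at `x` is `E4`, a vector being identified with its components in the preferred chart
at `x`. -/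

section Manifold

variable {M : Type*} [TopologicalSpace M] [ChartedSpace E4 M]

/-- The components of a tangent vector at `x`, in the preferred chart at `x`. -/
def coords {x : M} (v : TangentSpace 𝓘(ℝ, E4) x) : E4 := v

/-- The components `g_{ij}` of the metric in the preferred chart around `x₀`,
as functions on that chart. -/
def chartMetric (g : ∀ x : M, TangentSpace 𝓘(ℝ, E4) x → TangentSpace 𝓘(ℝ, E4) x → ℝ)
    (x₀ : M) (y : E4) : Mat4 :=
  Matrix.of fun i j =>
    g ((extChartAt 𝓘(ℝ, E4) x₀).symm y)
      (mfderiv 𝓘(ℝ, E4) 𝓘(ℝ, E4) (extChartAt 𝓘(ℝ, E4) x₀).symm y (basisVec i))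
      (mfderiv 𝓘(ℝ, E4) 𝓘(ℝ, E4) (extChartAt 𝓘(ℝ, E4) x₀).symm y (basisVec j))

/-- The vector field `V` along `γ` satisfies the parallel transport equation
`dV^k/dt + Γ^k_{ij} (dx^i/dt) V^j = 0` at all times `t ∈ s`; at time `t` the equation is
written in the preferred chart around `γ t`. -/
def IsParallelOn (g : ∀ x : M, TangentSpace 𝓘(ℝ, E4) x → TangentSpace 𝓘(ℝ, E4) x → ℝ)
    (γ : ℝ → M) (V : ∀ t, TangentSpace 𝓘(ℝ, E4) (γ t)) (s : Set ℝ) : Prop :=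
  ∀ t ∈ s, ∀ k : Fin 4,
    HasDerivWithinAt
      (fun τ => coords (mfderiv 𝓘(ℝ, E4) 𝓘(ℝ, E4) (extChartAt 𝓘(ℝ, E4) (γ t)) (γ τ) (V τ)) k)
      (-∑ i, ∑ j,
        christoffel (chartMetric g (γ t)) (extChartAt 𝓘(ℝ, E4) (γ t) (γ t)) k i j
          * (derivWithin (fun τ => extChartAt 𝓘(ℝ, E4) (γ t) (γ τ)) s t) i
          * coords (V t) j)
      s t

/-- `γ`, restricted to `[0, 1]`, is a piecewise `C¹` loop in `U` based at `p`. -/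
def IsLoop (U : Set M) (p : M) (γ : ℝ → M) : Prop :=
  γ 0 = p ∧ γ 1 = p ∧ Set.MapsTo γ (Set.Icc 0 1) U ∧
    OnPieces (fun a b => ContMDiffOn 𝓘(ℝ, ℝ) 𝓘(ℝ, E4) 1 γ (Set.Icc a b)) 0 1

/-- `γ`, restricted to `[0, 1]`, can be contracted in `U` to the constant loop at `p`
with fixed end points. -/
def IsContractible (U : Set M) (p : M) (γ : ℝ → M) : Prop :=
  ∃ H : ℝ × ℝ → M, ContinuousOn H (Set.Icc 0 1 ×ˢ Set.Icc 0 1) ∧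
    Set.MapsTo H (Set.Icc 0 1 ×ˢ Set.Icc 0 1) U ∧
    (∀ t ∈ Set.Icc (0 : ℝ) 1, H (0, t) = γ t ∧ H (1, t) = p) ∧
    (∀ s ∈ Set.Icc (0 : ℝ) 1, H (s, 0) = p ∧ H (s, 1) = p)

/-- `A` is the parallel transport map of `γ` from time `0` to time `1`. -/
def IsParallelTransport (g : ∀ x : M, TangentSpace 𝓘(ℝ, E4) x → TangentSpace 𝓘(ℝ, E4) x → ℝ)
    (γ : ℝ → M) (A : E4 →ₗ[ℝ] E4) : Prop :=
  ∀ v : E4, ∃ V : ℝ → E4, V 0 = v ∧ V 1 = A v ∧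
    OnPieces (fun a b => ContMDiffOn 𝓘(ℝ, ℝ) 𝓘(ℝ, E4) 1 γ (Set.Icc a b) ∧
      IsParallelOn g γ V (Set.Icc a b)) 0 1

/-- The holonomy group at `p` of the metric `g` restricted to the open set `U`:
all parallel transport maps of loops in `U` based at `p`. -/
def holonomyGroup (g : ∀ x : M, TangentSpace 𝓘(ℝ, E4) x → TangentSpace 𝓘(ℝ, E4) x → ℝ)
    (U : Set M) (p : M) : Set (TangentSpace 𝓘(ℝ, E4) p →ₗ[ℝ] TangentSpace 𝓘(ℝ, E4) p) :=
  {A | ∃ γ : ℝ → M, IsLoop U p γ ∧ IsParallelTransport g γ A}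

/-- The restricted holonomy group at `p`: only loops contractible in `U` are used. -/
def restrictedHolonomyGroup
    (g : ∀ x : M, TangentSpace 𝓘(ℝ, E4) x → TangentSpace 𝓘(ℝ, E4) x → ℝ)
    (U : Set M) (p : M) : Set (TangentSpace 𝓘(ℝ, E4) p →ₗ[ℝ] TangentSpace 𝓘(ℝ, E4) p) :=
  {A | ∃ γ : ℝ → M, IsLoop U p γ ∧ IsContractible U p γ ∧ IsParallelTransport g γ A}

/-- `e` is a frame at `p` with `g(e_a, e_b) = η_{ab}`. -/
def IsFrame (g : ∀ x : M, TangentSpace 𝓘(ℝ, E4) x → TangentSpace 𝓘(ℝ, E4) x → ℝ)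
    (η : Mat4) (p : M) (e : Fin 4 → TangentSpace 𝓘(ℝ, E4) p) : Prop :=
  ∀ a b, g p (e a) (e b) = η a b

/-- The frame `e` at `p` is positively oriented with respect to the preferred chart at `p`. -/
def IsPositiveFrame (p : M) (e : Fin 4 → TangentSpace 𝓘(ℝ, E4) p) : Prop :=
  0 < Matrix.det (Matrix.of fun i a : Fin 4 => coords (e a) i)

/-- The matrices, relative to the frame `e`, of a set of endomorphisms of the tangent space. -/
def matricesInFrame {p : M} (e : Fin 4 → TangentSpace 𝓘(ℝ, E4) p)
    (H : Set (TangentSpace 𝓘(ℝ, E4) p →ₗ[ℝ] TangentSpace 𝓘(ℝ, E4) p)) : Set Mat4 :=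
  {Λ | ∃ A ∈ H, ∀ b, A (e b) = ∑ a, Λ a b • e a}

/-- The curvature component `R^ρ_{σμν}` at `x`, in the preferred chart at `x`. -/
def riemannAt (g : ∀ x : M, TangentSpace 𝓘(ℝ, E4) x → TangentSpace 𝓘(ℝ, E4) x → ℝ)
    (x : M) (ρ σ μ ν : Fin 4) : ℝ :=
  riemann (chartMetric g x) (extChartAt 𝓘(ℝ, E4) x x) ρ σ μ ν

/-- For fixed `μ ν`, the two-form `R_{ρσμν} = g_{ρλ} R^λ_{σμν}` (indices `ρ σ`) at `x`. -/
def curvatureForm (g : ∀ x : M, TangentSpace 𝓘(ℝ, E4) x → TangentSpace 𝓘(ℝ, E4) x → ℝ)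
    (x : M) (μ ν : Fin 4) : Mat4 :=
  Matrix.of fun ρ σ =>
    ∑ l, chartMetric g x (extChartAt 𝓘(ℝ, E4) x x) ρ l * riemannAt g x l σ μ ν

/-- The Riemann tensor is self-dual (in its first pair of indices):
its anti-self-dual part vanishes. -/
def HasSelfDualCurvature
    (g : ∀ x : M, TangentSpace 𝓘(ℝ, E4) x → TangentSpace 𝓘(ℝ, E4) x → ℝ) : Prop :=
  ∀ (x : M) (μ ν : Fin 4),
    antiSelfDualPart (chartMetric g x (extChartAt 𝓘(ℝ, E4) x x)) (curvatureForm g x μ ν) = 0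

variable (M) in
/-- The atlas of `M` is oriented: all coordinate changes have positive Jacobian. -/
def IsOrientedAtlas : Prop :=
  ∀ c ∈ atlas E4 M, ∀ c' ∈ atlas E4 M, ∀ x ∈ c.source ∩ c'.source,
    0 < (fderiv ℝ (fun y : E4 => c' (c.symm y)) (c x)).det

end Manifold

/-! ### The groups -/

/-- The restricted Lorentz group: the identity component of `SO(1,3)`, i.e. the Lorentz
matrices of determinant one that preserve the direction of time. -/
def lorentzGroup : Set Mat4 :=
  {Λ | Λᵀ * minkowski * Λ = minkowski ∧ Λ.det = 1 ∧ 0 < Λ 0 0}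

/-- The rotation `R` of space, acting on space-time and fixing the time axis. -/
def spatialRotation (R : Matrix (Fin 3) (Fin 3) ℝ) : Mat4 :=
  Matrix.of fun a b =>
    Fin.cases (Fin.cases (1 : ℝ) (fun _ => 0) b)
      (fun i => Fin.cases (0 : ℝ) (fun j => R i j) b) a

/-- `SO(3)` as the group of spatial rotations of space-time. -/
def rotationGroup : Set Mat4 :=
  {Λ | ∃ R ∈ Matrix.specialOrthogonalGroup (Fin 3) ℝ, Λ = spatialRotation R}

/-- The self-dual factor `SU(2)` of `SO(4)`: the exponentials of the antisymmetric matrices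
that are self-dual. -/
def selfDualSU2 : Set Mat4 :=
  {Λ | ∃ X : Mat4, Xᵀ = -X ∧ antiSelfDualPart 1 X = 0 ∧ Λ = NormedSpace.exp X}

/-- The set `S` of matrices is, with matrix multiplication, a group isomorphic to `SU(2)`. -/
def IsSU2 (S : Set Mat4) : Prop :=
  ∃ f : Matrix.specialUnitaryGroup (Fin 2) ℂ →* Mat4,
    Continuous f ∧ Function.Injective f ∧ Set.range f = S

/-! ### The single copy holonomy (SCH) operator of an abelian gauge field on flat space -/

/-- The real generators `L^{ab}` with `(L^{ab})^c_d = η^{ac} δ^b_d - η^{bc} δ^a_d`, where `η` is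
the (diagonal, hence self-inverse) flat metric; the spin-1 generators of physics are
`M^{ab} = i L^{ab}`. -/
def generator (η : Mat4) (a b : Fin 4) : Mat4 :=
  Matrix.of fun c d =>
    η a c * (if b = d then 1 else 0) - η b c * (if a = d then 1 else 0)

/-- The integrand `-(i κ / 2) F_{ab} M^{ab} = (κ / 2) F_{ab} L^{ab}` of the SCH operator,
for the field strength `F` (at one point) and the coupling constant `κ`. -/
def schIntegrand (η : Mat4) (κ : ℝ) (F : Mat4) : Mat4 :=
  (κ / 2) • ∑ a, ∑ b, F a b • generator η a b

/-- A closed piecewise `C¹` curve `s ↦ x(s)`, `0 ≤ s ≤ S`, with its world-line parameter `s`. -/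
structure ClosedCurve where
  S : ℝ
  S_pos : 0 < S
  x : ℝ → E4
  closed : x 0 = x S
  piecewise : OnPieces (fun a b => ContDiffOn ℝ 1 x (Set.Icc a b)) 0 S

/-- The closed curves at constant `x⁰` that are parametrised by arc length. -/
def arcLengthCurves : Set ClosedCurve :=
  {C | OnPieces (fun a b => ContDiffOn ℝ 1 C.x (Set.Icc a b) ∧ ∀ s ∈ Set.Icc a b,
    (derivWithin C.x (Set.Icc a b) s) 0 = 0 ∧ ‖derivWithin C.x (Set.Icc a b) s‖ = 1) 0 C.S}

/-- `Φ` is the SCH operator `𝒫 exp ∮_C ds (κ / 2) F_{ab}(x(s)) L^{ab}` of the closed curve `C`: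
the value at `s = S` of the solution of `W' = B W`, `W(0) = 1`, with `B` the integrand. -/
def IsSCHOperator (η : Mat4) (κ : ℝ) (F : E4 → Mat4) (C : ClosedCurve) (Φ : Mat4) : Prop :=
  ∃ W : ℝ → Mat4, W 0 = 1 ∧ W C.S = Φ ∧ ∀ s ∈ Set.Icc 0 C.S, ∀ c d,
    HasDerivWithinAt (fun τ => W τ c d) ((schIntegrand η κ (F (C.x s)) * W s) c d)
      (Set.Icc 0 C.S) s

/-- The SCH group of the gauge field `F` on the domain `U`: the group of matrices generated by
the SCH operators of the closed curves in `U` belonging to the class `𝒞`. -/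
def schGroup (η : Mat4) (κ : ℝ) (F : E4 → Mat4) (U : Set E4) (𝒞 : Set ClosedCurve) :
    Set Mat4 :=
  {Λ | ∃ u ∈ Subgroup.closure {u : Mat4ˣ | ∃ C ∈ 𝒞, Set.MapsTo C.x (Set.Icc 0 C.S) U ∧
    IsSCHOperator η κ F C (u : Mat4)}, Λ = (u : Mat4)}

/-! ### The explicit solutions; Cartesian coordinates `(t, x, y, z)` -/

/-- The spatial radius `r`. -/
def radius (x : E4) : ℝ := Real.sqrt (x 1 ^ 2 + x 2 ^ 2 + x 3 ^ 2)

/-- The Euclidean product of the spatial parts. -/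
def spatialDot (u v : E4) : ℝ := u 1 * v 1 + u 2 * v 2 + u 3 * v 3

/-- The one-form `dr` at `x`. -/
def dRadius (x u : E4) : ℝ := spatialDot x u / radius x

/-- The one-form `dφ` (azimuthal angle around the `z`-axis) at `x`. -/
def dAzimuth (x u : E4) : ℝ := (x 1 * u 2 - x 2 * u 1) / (x 1 ^ 2 + x 2 ^ 2)

/-- The Schwarzschild metric in Kerr–Schild form, `g = η + (m / 4πr) k ⊗ k`, `k = dt + dr`. -/
def schwarzschild (m : ℝ) (x u v : E4) : ℝ :=
  -(u 0 * v 0) + spatialDot u v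
    + m / (4 * Real.pi * radius x) * ((u 0 + dRadius x u) * (v 0 + dRadius x v))

/-- The radius `r_+ = m + √(m² + N²)` of the outer Taub-NUT horizon; `r_-` has the other sign. -/
def rPlus (m N : ℝ) : ℝ := m + Real.sqrt (m ^ 2 + N ^ 2)

/-- See `rPlus`. -/
def rMinus (m N : ℝ) : ℝ := m - Real.sqrt (m ^ 2 + N ^ 2)

/-- The function `A(r) = (r - r_+)(r - r_-) / (r² + N²)` of the Taub-NUT metric. -/
def nutA (m N r : ℝ) : ℝ := (r - rPlus m N) * (r - rMinus m N) / (r ^ 2 + N ^ 2)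

/-- The one-form `dt + 2N cos θ dφ` at `x`. -/
def nutForm (N : ℝ) (x u : E4) : ℝ := u 0 + 2 * N * (x 3 / radius x) * dAzimuth x u

/-- The Taub-NUT metric
`-A (dt + 2N cos θ dφ)² + A⁻¹ dr² + (r² + N²) (dθ² + sin² θ dφ²)`. -/
def taubNUT (m N : ℝ) (x u v : E4) : ℝ :=
  -(nutA m N (radius x)) * (nutForm N x u * nutForm N x v)
    + (nutA m N (radius x))⁻¹ * (dRadius x u * dRadius x v)
    + (radius x ^ 2 + N ^ 2) *
      ((spatialDot u v - dRadius x u * dRadius x v) / radius x ^ 2)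

/-- The Taub-NUT space-time region outside the horizon, away from the axis `θ = 0, π`. -/
def nutRegion (m N : ℝ) : Set E4 := {x | rPlus m N < radius x ∧ (x 1 ≠ 0 ∨ x 2 ≠ 0)}

/-- The field strength of a point charge: `F_{0i} = E_i`, `E = Q x / 4πr³`, `F_{ij} = 0`. -/
def pointCharge (Q : ℝ) (x : E4) : Mat4 :=
  Matrix.of fun a b =>
    Q / (4 * Real.pi * radius x ^ 3) *
      ((if a = 0 ∧ b ≠ 0 then x b else 0) - (if b = 0 ∧ a ≠ 0 then x a else 0))

/-- The field strength of a magnetic monopole: `F_{0i} = 0`, `F_{ij} = ε_{ijk} B_k`,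
`B = q x / 4πr³`. -/
def monopole (q : ℝ) (x : E4) : Mat4 :=
  Matrix.of fun a b => q / (4 * Real.pi * radius x ^ 3) * ∑ c, leviCivita 0 a b c * x c

end SingleCopyHolonomy

end

/-!
All the groups in question are treated as bare sets `H` of invertible matrices that are closed
under multiplication and inversion; no closedness or Lie structure is assumed.  The velocities at
`1` of the strictly differentiable curves in `H` form a linear space closed under commutators
(`tangentSpaceOne`, `lie_mem_tangentSpaceOne`).  If `H` lies in the group of matrices that are
orthogonal for a linear anti-involution and its tangent space is the whole Lie algebra, then, by
the inverse function theorem, `H` contains a neighbourhood of `1` in that group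
(`eventually_mem_of_le_tangentSpaceOne`), hence all one-parameter subgroups, and these generate
(`lorentzGroup_eq_of_tangent`, `selfDualSU2_eq_of_tangent`).  Each claim is thus reduced to an
inclusion `H ⊆ G` and to exhibiting enough tangent vectors.

*Single copy.*  A curve that runs a short way along a segment and back is closed, and the
velocity of its SCH operators is the integrand at its starting point
(`schIntegrand_mem_tangentSpaceOne`).  For the point charge these integrands are the boosts, whose
commutators are the rotations; for the monopole they are the rotations; a self-dual field gives
self-dual matrices, and two independent ones generate `su(2)` because the cross product of two
independent vectors is independent of both.  If the values of the field are all proportional, the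
group commutes with them, which `SU(2)₊` does not.  The inclusions hold since the defining equation has coefficients in the Lie
algebra.

*Curvature and holonomy.*  The transport around a small parallelogram, to first order in each side,
is the curvature; so the curvature operators at any point, carried to the base point by parallel
transport, are tangent to the (restricted) holonomy group (`curvatureAt_mem_tangentSpaceOne`).

*Schwarzschild and Taub–NUT.*  Both metrics have a continuous global field of orthonormal frames,
along which the transport matrices stay in the identity component, so the holonomy is in
`SO(1,3)`.  In retarded coordinates both are the metric `nutModel A N`, with `N = 0` for
Schwarzschild.  At a point of the equator four of its curvature operators generate all of
`so(1,3)` unless `A'` and `N` satisfy one degenerate relation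
(`mem_of_nutCurvature_mem`, `holonomyGroup_eq_lorentzGroup`).

*Self-dual metrics.*  `SU(2)₊` consists of the left multiplications by unit quaternions, that is, of
the orthogonal matrices commuting with the anti-self-dual ones.  An endomorphism that is
anti-self-dual in oriented orthonormal frames commutes with the self-dual curvature, so it extends
to a parallel field near any point (transport along the rays), and these local fields fit together
over the square of a homotopy.  Hence transport around a null-homotopic loop commutes with the
anti-self-dual endomorphisms (`IsCurvatureInvariant.commute_of_homotopic`), and the restricted
holonomy is in `SU(2)₊`.  If the curvature does not vanish at some point, the first Bianchi identity
makes two of its components independent there (`exists_linearIndependent_curvature`), and they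
generate `su(2)`.
-/

section

open scoped Manifold ContDiff Matrix Quaternion
open Set Filter Topology

noncomputable section

namespace SingleCopyHolonomy

/-- The preferred chart at a point, as a partial equivalence with `ℝ⁴`. -/
local notation "extChart" => extChartAt 𝓘(ℝ, E4)

/-! ### Tangent spaces of subgroups of a normed algebra -/

section TangentSpaceOfGroup

variable {𝔸 : Type*} [NormedRing 𝔸] [NormedAlgebra ℝ 𝔸]

/-- The set `H` of elements of an algebra is a group under multiplication. -/
structure IsUnitGroup {𝔸 : Type*} [Monoid 𝔸] (H : Set 𝔸) : Prop where
  one_mem : (1 : 𝔸) ∈ H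
  mul_mem : ∀ {a b}, a ∈ H → b ∈ H → a * b ∈ H
  exists_inv : ∀ {a}, a ∈ H → ∃ b ∈ H, a * b = 1 ∧ b * a = 1

theorem IsUnitGroup.isUnit {𝔸 : Type*} [Monoid 𝔸] {H : Set 𝔸} (hH : IsUnitGroup H)
    {a : 𝔸} (ha : a ∈ H) :
    IsUnit a := by
  obtain ⟨b, -, h1, h2⟩ := hH.exists_inv ha
  exact ⟨⟨a, b, h1, h2⟩, rfl⟩

theorem IsUnitGroup.inverse_mem {𝔸 : Type*} [Ring 𝔸] {H : Set 𝔸} (hH : IsUnitGroup H)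
    {a : 𝔸} (ha : a ∈ H) :
    Ring.inverse a ∈ H := by
  obtain ⟨b, hb, h1, h2⟩ := hH.exists_inv ha
  have : Ring.inverse a = b := Ring.inverse_unit (⟨a, b, h1, h2⟩ : 𝔸ˣ)
  rwa [this]

theorem IsUnitGroup.pow_mem {𝔸 : Type*} [Monoid 𝔸] {H : Set 𝔸} (hH : IsUnitGroup H)
    {a : 𝔸} (ha : a ∈ H) (n : ℕ) :
    a ^ n ∈ H := by
  induction n with
  | zero => simpa using hH.one_mem
  | succ n ih => rw [pow_succ]; exact hH.mul_mem ih ha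

/-- The tangent space at `1` of a group `H` in a normed algebra: the velocities at `1` of the
strictly differentiable curves with values in `H`.  Strict differentiability is what makes the
inverse function theorem applicable to products of such curves, although `H` is not assumed to
be closed. -/
def tangentSpaceOne {H : Set 𝔸} (hH : IsUnitGroup H) : Submodule ℝ 𝔸 where
  carrier := {X | ∃ c : ℝ → 𝔸, c 0 = 1 ∧ HasStrictDerivAt c X 0 ∧ ∀ᶠ s in 𝓝 0, c s ∈ H}
  zero_mem' := ⟨fun _ => 1, rfl, hasStrictDerivAt_const _ _, .of_forall fun _ => hH.one_mem⟩
  add_mem' := by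
    rintro X Y ⟨c, hc0, hc, hcH⟩ ⟨d, hd0, hd, hdH⟩
    refine ⟨fun s => c s * d s, by simp [hc0, hd0], ?_, ?_⟩
    · have := hc.mul hd
      simp only [hc0, hd0, mul_one, one_mul] at this
      exact this
    · filter_upwards [hcH, hdH] with s h1 h2 using hH.mul_mem h1 h2
  smul_mem' := by
    rintro a X ⟨c, hc0, hc, hcH⟩
    have hlin : HasStrictDerivAt (fun s : ℝ => a * s) a 0 := by
      simpa using (hasStrictDerivAt_id (0 : ℝ)).const_mul a
    refine ⟨fun s => c (a * s), by simp [hc0], ?_, ?_⟩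
    · have hc' : HasStrictDerivAt c X (a * 0) := by simpa using hc
      exact hc'.scomp (0 : ℝ) hlin
    · have : Tendsto (fun s : ℝ => a * s) (𝓝 0) (𝓝 0) := by
        simpa using hlin.hasDerivAt.continuousAt.tendsto
      exact this.eventually hcH

theorem conj_mem_tangentSpaceOne {H : Set 𝔸} (hH : IsUnitGroup H) {X h : 𝔸}
    (hX : X ∈ tangentSpaceOne hH) (hh : h ∈ H) :
    h * X * Ring.inverse h ∈ tangentSpaceOne hH := by
  obtain ⟨c, hc0, hc, hcH⟩ := hX
  refine ⟨fun s => h * c s * Ring.inverse h, ?_, (hc.const_mul h).mul_const _, ?_⟩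
  · simp [hc0, Ring.mul_inverse_cancel _ (hH.isUnit hh)]
  · filter_upwards [hcH] with s hs using hH.mul_mem (hH.mul_mem hh hs) (hH.inverse_mem hh)

/-- A strictly differentiable curve that is only known to lie in `H` for `s ≥ 0` can be continued
to `s < 0` by `s ↦ c(-s)⁻¹`. -/
theorem mem_tangentSpaceOne_of_nonneg [CompleteSpace 𝔸] {H : Set 𝔸} (hH : IsUnitGroup H)
    {X : 𝔸} {c : ℝ → 𝔸} (hc0 : c 0 = 1) (hc : HasStrictDerivAt c X 0)
    (hcH : ∀ᶠ s in 𝓝[≥] 0, c s ∈ H) : X ∈ tangentSpaceOne hH := by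
  set d : ℝ → 𝔸 := fun s => Ring.inverse (c (-s)) with hd_def
  have hneg : HasStrictDerivAt (fun s : ℝ => -s) (-1) 0 := (hasStrictDerivAt_id (0 : ℝ)).neg
  have hd0 : d 0 = 1 := by simp [hd_def, hc0]
  have hd : HasStrictDerivAt d X 0 := by
    have h1 : HasStrictDerivAt (fun s : ℝ => c (-s)) ((-1 : ℝ) • X) 0 := by
      have hc' : HasStrictDerivAt c X (-0) := by simpa using hc
      exact hc'.scomp (0 : ℝ) hneg
    have h2 : HasStrictFDerivAt Ring.inverse
        (-ContinuousLinearMap.mulLeftRight ℝ 𝔸 ↑(1 : 𝔸ˣ)⁻¹ ↑(1 : 𝔸ˣ)⁻¹) (c (-0)) := by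
      simpa [hc0] using hasStrictFDerivAt_ringInverse (𝕜 := ℝ) (1 : 𝔸ˣ)
    have h3 := h2.comp_hasStrictDerivAt (0 : ℝ) h1
    simp only [ContinuousLinearMap.neg_apply, ContinuousLinearMap.mulLeftRight_apply, inv_one,
      Units.val_one, one_mul, mul_one, neg_smul, one_smul, neg_neg] at h3
    exact h3
  refine ⟨fun s => if 0 ≤ s then c s else d s, by simp [hc0], ?_, ?_⟩
  · rw [hasStrictDerivAt_iff_hasStrictFDerivAt, hasStrictFDerivAt_iff_isLittleO,
      Asymptotics.isLittleO_iff] at hc hd ⊢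
    intro ε hε
    have hc1 := hc hε
    have hd1 := hd hε
    simp only [ContinuousLinearMap.toSpanSingleton_apply] at hc1 hd1 ⊢
    have key : ∀ s s' : ℝ, 0 ≤ s → s' < 0 →
        ‖c s - c 0 - (s - 0) • X‖ ≤ ε * ‖s - 0‖ → ‖d s' - d 0 - (s' - 0) • X‖ ≤ ε * ‖s' - 0‖ →
        ‖c s - d s' - (s - s') • X‖ ≤ ε * ‖s - s'‖ := by
      intro s s' hs hs' h1 h2
      have e : c s - d s' - (s - s') • X
          = (c s - c 0 - (s - 0) • X) - (d s' - d 0 - (s' - 0) • X) := by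
        rw [hc0, hd0, sub_zero, sub_zero, sub_smul]; abel
      rw [e]
      refine (norm_sub_le _ _).trans ((add_le_add h1 h2).trans (le_of_eq ?_))
      rw [← mul_add, sub_zero, sub_zero, Real.norm_of_nonneg hs, Real.norm_of_nonpos hs'.le,
        Real.norm_of_nonneg (by linarith : (0 : ℝ) ≤ s - s')]
      ring
    have hfst : Tendsto (fun p : ℝ × ℝ => (p.1, (0 : ℝ))) (𝓝 ((0 : ℝ), (0 : ℝ))) (𝓝 (0, 0)) :=
      (Continuous.tendsto (by fun_prop) _)
    have hsnd : Tendsto (fun p : ℝ × ℝ => (p.2, (0 : ℝ))) (𝓝 ((0 : ℝ), (0 : ℝ))) (𝓝 (0, 0)) :=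
      (Continuous.tendsto (by fun_prop) _)
    filter_upwards [hc1, hd1, hfst.eventually hc1, hfst.eventually hd1, hsnd.eventually hc1,
      hsnd.eventually hd1] with p q1 q2 q3 q4 q5 q6
    by_cases h1 : 0 ≤ p.1 <;> by_cases h2 : 0 ≤ p.2
    · simpa [h1, h2] using q1
    · simpa [h1, h2] using key p.1 p.2 h1 (not_le.1 h2) q3 q6
    · have := key p.2 p.1 h2 (not_le.1 h1) q5 q4
      simp only [h1, h2, if_true, if_false]
      have e : d p.1 - c p.2 - (p.1 - p.2) • X = -(c p.2 - d p.1 - (p.2 - p.1) • X) := by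
        module
      rw [e, norm_neg, norm_sub_rev p.1]
      exact this
    · simpa [h1, h2] using q2
  · have h1 : ∀ᶠ s in 𝓝 (0 : ℝ), 0 ≤ s → c s ∈ H := eventually_nhdsWithin_iff.1 hcH
    have h2 : Tendsto (fun s : ℝ => -s) (𝓝 0) (𝓝 0) := by
      simpa using hneg.hasDerivAt.continuousAt.tendsto
    filter_upwards [h1, h2.eventually h1] with s q1 q2
    by_cases h : 0 ≤ s
    · simpa [h] using q1 h
    · simpa [h] using hH.inverse_mem (q2 (by linarith [not_le.1 h]))

theorem deriv_mem_of_eventually_mem [FiniteDimensional ℝ 𝔸] (T : Submodule ℝ 𝔸) {f : ℝ → 𝔸}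
    {f' : 𝔸} {x : ℝ} (hf : HasDerivWithinAt f f' (Ici x) x) (hx : f x ∈ T)
    (hT : ∀ᶠ s in 𝓝[>] x, f s ∈ T) : f' ∈ T := by
  have h1 : Tendsto (slope f x) (𝓝[>] x) (𝓝 f') := by
    have := hasDerivWithinAt_iff_tendsto_slope.1 hf
    rwa [Ici_sdiff_left] at this
  refine T.closed_of_finiteDimensional.mem_of_tendsto h1 ?_
  filter_upwards [hT] with s hs
  rw [slope_def_module]
  exact T.smul_mem _ (T.sub_mem hs hx)

/-- The conjugates of `Y` by the elements of a curve in `H` stay in the tangent space, and so does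
the derivative of this family, the space being closed. -/
theorem lie_mem_tangentSpaceOne [FiniteDimensional ℝ 𝔸] {H : Set 𝔸} (hH : IsUnitGroup H)
    {X Y : 𝔸} (hX : X ∈ tangentSpaceOne hH) (hY : Y ∈ tangentSpaceOne hH) :
    X * Y - Y * X ∈ tangentSpaceOne hH := by
  have : CompleteSpace 𝔸 := FiniteDimensional.complete ℝ 𝔸
  obtain ⟨c, hc0, hc, hcH⟩ := hX
  have h2 : HasStrictFDerivAt Ring.inverse
      (-ContinuousLinearMap.mulLeftRight ℝ 𝔸 ↑(1 : 𝔸ˣ)⁻¹ ↑(1 : 𝔸ˣ)⁻¹) (c 0) := by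
    simpa [hc0] using hasStrictFDerivAt_ringInverse (𝕜 := ℝ) (1 : 𝔸ˣ)
  have h3 := (hc.mul_const Y).mul (h2.comp_hasStrictDerivAt (0 : ℝ) hc)
  have h4 : HasDerivAt (fun s => c s * Y * Ring.inverse (c s)) (X * Y - Y * X) 0 := by
    have h5 := h3.hasDerivAt
    simp only [Function.comp_apply, hc0, one_mul, ContinuousLinearMap.neg_apply,
      ContinuousLinearMap.mulLeftRight_apply, inv_one, Units.val_one, Ring.inverse_one, mul_one,
      mul_neg, ← sub_eq_add_neg] at h5
    exact h5
  have hmem : ∀ᶠ s in 𝓝 (0 : ℝ), c s * Y * Ring.inverse (c s) ∈ tangentSpaceOne hH := by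
    filter_upwards [hcH] with s hs using conj_mem_tangentSpaceOne hH hY hs
  exact deriv_mem_of_eventually_mem _ h4.hasDerivWithinAt hmem.self_of_nhds
    (hmem.filter_mono nhdsWithin_le_nhds)

/-- Finitely many tangent vectors are integrated simultaneously by a product of curves. -/
theorem exists_chart_of_tangentSpaceOne {H : Set 𝔸} (hH : IsUnitGroup H) :
    ∀ (n : ℕ) (X : Fin n → 𝔸), (∀ i, X i ∈ tangentSpaceOne hH) →
      ∃ Φ : (Fin n → ℝ) → 𝔸, Φ 0 = 1 ∧
        HasStrictFDerivAt Φ (∑ i, (ContinuousLinearMap.proj (R := ℝ) (φ := fun _ : Fin n => ℝ)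
          i).smulRight (X i)) 0 ∧ ∀ᶠ s in 𝓝 0, Φ s ∈ H := by
  intro n
  induction n with
  | zero =>
    intro X _
    refine ⟨fun _ => 1, rfl, ?_, .of_forall fun _ => hH.one_mem⟩
    simpa using hasStrictFDerivAt_const (𝕜 := ℝ) (1 : 𝔸) (0 : Fin 0 → ℝ)
  | succ n ih =>
    intro X hX
    obtain ⟨Φ, hΦ0, hΦ, hΦH⟩ := ih (fun i => X i.succ) (fun i => hX _)
    obtain ⟨c, hc0, hc, hcH⟩ := hX 0
    let τ : (Fin (n + 1) → ℝ) →L[ℝ] (Fin n → ℝ) :=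
      ContinuousLinearMap.pi fun i => ContinuousLinearMap.proj i.succ
    let π : (Fin (n + 1) → ℝ) →L[ℝ] ℝ := ContinuousLinearMap.proj 0
    have hτ : HasStrictFDerivAt (fun s => Φ (τ s)) _ 0 :=
      HasStrictFDerivAt.comp (0 : Fin (n + 1) → ℝ)
        (by simpa using hΦ : HasStrictFDerivAt Φ _ (τ 0)) τ.hasStrictFDerivAt
    have hπ : HasStrictFDerivAt (fun s => c (π s)) _ 0 :=
      HasStrictFDerivAt.comp (0 : Fin (n + 1) → ℝ)
        (by simpa using hc.hasStrictFDerivAt : HasStrictFDerivAt c _ (π 0)) π.hasStrictFDerivAt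
    refine ⟨fun s => c (π s) * Φ (τ s), by simp [hc0, hΦ0], ?_, ?_⟩
    · refine (hπ.mul' hτ).congr_fderiv ?_
      ext s
      simp only [map_zero, hc0, hΦ0, Fin.sum_univ_succ]
      simp [π, τ, add_comm]
    · have h1 : Tendsto τ (𝓝 0) (𝓝 0) := by simpa using τ.continuous.tendsto 0
      have h2 : Tendsto π (𝓝 0) (𝓝 0) := by simpa using π.continuous.tendsto 0
      filter_upwards [h1.eventually hΦH, h2.eventually hcH] with s q1 q2 using hH.mul_mem q2 q1

/-- If the tangent space of `H` is as large as it can be for a subgroup of `G`, where `G` is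
contained in the unitary group of a linear anti-automorphism `σ` with `σ 1 = 1`, then `H` contains
a neighbourhood of `1` in `G`.  The skew part `Λ - σ Λ` serves as a chart of `G` at `1`. -/
theorem eventually_mem_of_le_tangentSpaceOne [FiniteDimensional ℝ 𝔸] {H G : Set 𝔸}
    (hH : IsUnitGroup H) (hHG : H ⊆ G) (σ : 𝔸 →ₗ[ℝ] 𝔸) (hσ1 : σ 1 = 1)
    (𝔤 : Submodule ℝ 𝔸) (hG : ∀ Λ ∈ G, σ Λ * Λ = 1 ∧ Λ - σ Λ ∈ 𝔤) (h𝔤 : ∀ X ∈ 𝔤, σ X = -X)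
    (hT : 𝔤 ≤ tangentSpaceOne hH) : ∀ᶠ Λ in 𝓝 1, Λ ∈ G → Λ ∈ H := by
  have : CompleteSpace 𝔸 := FiniteDimensional.complete ℝ 𝔸
  let b := Module.finBasis ℝ 𝔤
  obtain ⟨Φ, hΦ0, hΦ, hΦH⟩ := exists_chart_of_tangentSpaceOne hH _ (fun i => (b i : 𝔸))
    (fun i => hT (b i).2)
  obtain ⟨P, hP⟩ := 𝔤.exists_isCompl
  let p : 𝔸 →ₗ[ℝ] 𝔤 := Submodule.projectionOnto 𝔤 P hP
  have hp : ∀ X : 𝔤, p X = X := fun X => by simp [p]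
  let A : 𝔸 →L[ℝ] 𝔤 := LinearMap.toContinuousLinearMap (p ∘ₗ (LinearMap.id - σ))
  have hA : ∀ Λ, A Λ = p (Λ - σ Λ) := fun Λ => by simp [A]
  have hAX : ∀ X : 𝔤, A X = (2 : ℝ) • X := fun X => by
    rw [hA, h𝔤 X X.2, sub_neg_eq_add, ← two_smul ℝ, map_smul, hp]
  have hF : HasStrictFDerivAt (fun s => A (Φ s)) _ 0 := A.hasStrictFDerivAt.comp 0 hΦ
  have hsurj := hF.map_nhds_eq_of_surj (by
    rw [LinearMap.range_eq_top]
    intro Y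
    refine ⟨(2⁻¹ : ℝ) • b.repr Y, ?_⟩
    have : ∀ i, A (b i : 𝔸) = (2 : ℝ) • b i := fun i => hAX (b i)
    simp only [ContinuousLinearMap.coe_coe, ContinuousLinearMap.comp_apply,
      sum_apply, map_sum, ContinuousLinearMap.smulRight_apply, map_smul, this]
    conv_rhs => rw [← b.sum_repr Y]
    rw [Finset.smul_sum]
    refine Finset.sum_congr rfl fun i _ => ?_
    rw [smul_comm, ContinuousLinearMap.proj_apply, smul_smul (2⁻¹ : ℝ)]
    norm_num)
  have hA1 : A 1 = 0 := by rw [hA, hσ1]; simp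
  rw [hΦ0, hA1] at hsurj
  have hσc : Continuous σ := σ.continuous_of_finiteDimensional
  have hsmall : ∀ᶠ Λ in 𝓝 (1 : 𝔸), ‖Λ - 1‖ < 1 ∧ ‖σ Λ - 1‖ < 1 := by
    refine Filter.Eventually.and ?_ ?_
    · have : Tendsto (fun Λ : 𝔸 => ‖Λ - 1‖) (𝓝 1) (𝓝 0) := by
        have := (by fun_prop : Continuous fun Λ : 𝔸 => ‖Λ - 1‖).tendsto 1
        simpa using this
      exact this.eventually_lt_const one_pos
    · have : Tendsto (fun Λ : 𝔸 => ‖σ Λ - 1‖) (𝓝 1) (𝓝 0) := by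
        have := (by fun_prop : Continuous fun Λ : 𝔸 => ‖σ Λ - 1‖).tendsto 1
        simpa [hσ1] using this
      exact this.eventually_lt_const one_pos
  have hinj : ∀ Λ ∈ G, ∀ Λ' ∈ G, ‖Λ - 1‖ < 1 → ‖σ Λ' - 1‖ < 1 → A Λ = A Λ' → Λ = Λ' := by
    intro Λ hΛ Λ' hΛ' h1 h2 h3
    have h4 : Λ - σ Λ = Λ' - σ Λ' := by
      rw [hA, hA] at h3
      have e1 := hp ⟨_, (hG Λ hΛ).2⟩
      have e2 := hp ⟨_, (hG Λ' hΛ').2⟩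
      simp only at e1 e2
      rw [e1, e2] at h3
      exact congrArg Subtype.val h3
    set D := Λ - Λ' with hD
    have hD' : D = σ Λ - σ Λ' := by
      rw [hD, sub_eq_sub_iff_add_eq_add]
      have := sub_eq_sub_iff_add_eq_add.1 h4
      rw [this, add_comm]
    have h5 : D * Λ + σ Λ' * D = 0 := by
      calc D * Λ + σ Λ' * D = (σ Λ - σ Λ') * Λ + σ Λ' * (Λ - Λ') := by rw [← hD', hD]
        _ = σ Λ * Λ - σ Λ' * Λ' := by noncomm_ring
        _ = 0 := by rw [(hG Λ hΛ).1, (hG Λ' hΛ').1, sub_self]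
    have h6 : (2 : ℝ) • D = -(D * (Λ - 1) + (σ Λ' - 1) * D) := by
      have : D * (Λ - 1) + (σ Λ' - 1) * D = (D * Λ + σ Λ' * D) - (D + D) := by noncomm_ring
      rw [this, h5, two_smul]; simp
    have h7 : 2 * ‖D‖ ≤ ‖D‖ * ‖Λ - 1‖ + ‖σ Λ' - 1‖ * ‖D‖ := by
      calc 2 * ‖D‖ = ‖(2 : ℝ) • D‖ := by rw [norm_smul]; simp
        _ ≤ _ := by
          rw [h6, norm_neg]
          exact (norm_add_le _ _).trans (add_le_add (norm_mul_le _ _) (norm_mul_le _ _))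
    have h8 : ‖D‖ = 0 := by
      by_contra hne
      have : 0 < ‖D‖ := lt_of_le_of_ne (norm_nonneg _) (Ne.symm hne)
      nlinarith
    exact sub_eq_zero.1 (norm_eq_zero.1 h8)
  have hΦt : Tendsto Φ (𝓝 0) (𝓝 1) := by
    have := hΦ.continuousAt.tendsto
    rwa [hΦ0] at this
  have hmem : {Y | ∃ s, A (Φ s) = Y ∧ Φ s ∈ H ∧ ‖σ (Φ s) - 1‖ < 1} ∈ 𝓝 (0 : 𝔤) := by
    rw [← hsurj, mem_map]
    filter_upwards [hΦH, hΦt.eventually hsmall] with s h1 h2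
    exact ⟨s, rfl, h1, h2.2⟩
  have hAt : Tendsto A (𝓝 1) (𝓝 0) := by
    have := A.continuous.tendsto 1
    rwa [hA1] at this
  filter_upwards [hsmall, hAt.eventually hmem] with Λ h1 h2 h3
  obtain ⟨s, e, hs, hs'⟩ := h2
  rw [hinj Λ h3 (Φ s) (hHG hs) h1.1 hs' e.symm]
  exact hs

/-- A one-parameter group in `G` is generated by its small elements, which lie in `H`. -/
theorem oneParameter_mem {H G : Set 𝔸} (hH : IsUnitGroup H)
    (hHG : ∀ᶠ Λ in 𝓝 1, Λ ∈ G → Λ ∈ H) {ρ : ℝ → 𝔸} (hρ0 : ρ 0 = 1) (hρ : ContinuousAt ρ 0)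
    (hadd : ∀ s t, ρ (s + t) = ρ s * ρ t) (hG : ∀ t, ρ t ∈ G) (t : ℝ) : ρ t ∈ H := by
  have h1 : ∀ᶠ s in 𝓝 (0 : ℝ), ρ s ∈ H := by
    have h : Tendsto ρ (𝓝 0) (𝓝 1) := by simpa [hρ0] using hρ.tendsto
    filter_upwards [h.eventually hHG] with s hs using hs (hG s)
  have h2 : Tendsto (fun n : ℕ => t / (n + 1 : ℝ)) atTop (𝓝 0) :=
    tendsto_const_div_atTop_nhds_zero_nat t |>.comp (tendsto_add_atTop_nat 1) |>.congr
      fun n => by simp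
  obtain ⟨n, hn⟩ := (h2.eventually h1).exists
  have hpow : ∀ (k : ℕ) (s : ℝ), ρ (k * s) = ρ s ^ k := by
    intro k s
    induction k with
    | zero => simp [hρ0]
    | succ k ih => rw [pow_succ, ← ih, ← hadd]; congr 1; push_cast; ring
  have : ρ t = ρ (t / (n + 1 : ℝ)) ^ (n + 1) := by
    rw [← hpow]; congr 1; push_cast; field_simp
  rw [this]
  exact hH.pow_mem hn _

end TangentSpaceOfGroup

/-! ### Linear differential equations -/

section LinearODE

variable {𝔸 : Type*} [NormedRing 𝔸] [NormedAlgebra ℝ 𝔸] [CompleteSpace 𝔸]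

/-- The terms of the Picard series of the linear equation `L' = A L`, `L 0 = 1`. -/
def picardTerm (A : ℝ → 𝔸) : ℕ → ℝ → 𝔸
  | 0, _ => 1
  | n + 1, t => ∫ τ in (0 : ℝ)..t, A τ * picardTerm A n τ

/-- The path-ordered exponential: the solution of `L' = A L`, `L 0 = 1`. -/
def pathOrderedExp (A : ℝ → 𝔸) (t : ℝ) : 𝔸 := ∑' n, picardTerm A n t

variable {A : ℝ → 𝔸}

theorem continuous_picardTerm (hA : Continuous A) (n : ℕ) : Continuous (picardTerm A n) := by
  induction n with
  | zero => exact continuous_const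
  | succ n ih =>
    exact continuous_iff_continuousAt.2 fun t =>
      ((hA.mul ih).integral_hasStrictDerivAt 0 t).hasDerivAt.continuousAt

theorem hasDerivAt_picardTerm_succ (hA : Continuous A) (n : ℕ) (t : ℝ) :
    HasDerivAt (picardTerm A (n + 1)) (A t * picardTerm A n t) t :=
  ((hA.mul (continuous_picardTerm hA n)).integral_hasStrictDerivAt 0 t).hasDerivAt

theorem norm_picardTerm_le {T K : ℝ}
    (hK : ∀ t, |t| ≤ T → ‖A t‖ ≤ K) (n : ℕ) {t : ℝ} (ht : |t| ≤ T) :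
    ‖picardTerm A n t‖ ≤ ‖(1 : 𝔸)‖ * (K ^ n * |t| ^ n / n.factorial) := by
  have hK0 : 0 ≤ K := (norm_nonneg _).trans (hK t ht)
  induction n generalizing t with
  | zero => simp [picardTerm]
  | succ n ih =>
    have h1 : ∀ τ ∈ uIoc 0 t, ‖A τ * picardTerm A n τ‖
        ≤ ‖(1 : 𝔸)‖ * K ^ (n + 1) / n.factorial * |τ - 0| ^ n := by
      intro τ hτ
      have hτt : |τ| ≤ |t| := by
        rcases le_total 0 t with h | h
        · rw [uIoc_of_le h] at hτ
          rw [abs_of_pos hτ.1, abs_of_nonneg h]; exact hτ.2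
        · rw [uIoc_of_ge h] at hτ
          rw [abs_of_nonpos hτ.2, abs_of_nonpos h]; linarith [hτ.1]
      calc ‖A τ * picardTerm A n τ‖ ≤ ‖A τ‖ * ‖picardTerm A n τ‖ := norm_mul_le _ _
        _ ≤ K * (‖(1 : 𝔸)‖ * (K ^ n * |τ| ^ n / n.factorial)) :=
          mul_le_mul (hK τ (hτt.trans ht)) (ih (hτt.trans ht)) (norm_nonneg _) hK0
        _ = _ := by rw [sub_zero]; ring
    have h2 : ‖picardTerm A (n + 1) t‖
        ≤ ∫ τ in uIoc 0 t, ‖(1 : 𝔸)‖ * K ^ (n + 1) / n.factorial * |τ - 0| ^ n := by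
      rw [picardTerm, intervalIntegral.norm_intervalIntegral_eq]
      refine MeasureTheory.norm_integral_le_of_norm_le ?_
        ((MeasureTheory.ae_restrict_mem measurableSet_uIoc).mono h1)
      exact (Continuous.integrableOn_uIoc (by fun_prop))
    refine h2.trans (le_of_eq ?_)
    rw [MeasureTheory.integral_const_mul, integral_pow_abs_sub_uIoc, sub_zero, Nat.factorial_succ]
    push_cast
    field_simp

theorem summable_exp_bound (C K T : ℝ) :
    Summable fun n : ℕ => C * (K ^ n * T ^ n / n.factorial) := by
  refine Summable.mul_left C ?_
  simpa [mul_pow] using Real.summable_pow_div_factorial (K * T)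

theorem summable_picardTerm (hA : Continuous A) (t : ℝ) :
    Summable fun n => picardTerm A n t := by
  obtain ⟨K, hK⟩ := (isCompact_Icc (a := -|t|) (b := |t|)).exists_bound_of_continuousOn
    hA.continuousOn
  exact Summable.of_norm_bounded (summable_exp_bound ‖(1 : 𝔸)‖ K |t|)
    fun n => norm_picardTerm_le (T := |t|) (fun τ hτ => hK τ (abs_le.1 hτ)) n le_rfl

theorem pathOrderedExp_zero : pathOrderedExp A 0 = 1 := by
  rw [pathOrderedExp, tsum_eq_single 0]
  · rfl
  · intro n hn
    obtain ⟨m, rfl⟩ := Nat.exists_eq_succ_of_ne_zero hn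
    simp [picardTerm]

theorem hasDerivAt_pathOrderedExp (hA : Continuous A) (t : ℝ) :
    HasDerivAt (pathOrderedExp A) (A t * pathOrderedExp A t) t := by
  set T := |t| + 1 with hT
  obtain ⟨K, hK⟩ := (isCompact_Icc (a := -T) (b := T)).exists_bound_of_continuousOn hA.continuousOn
  have hK' : ∀ τ, |τ| ≤ T → ‖A τ‖ ≤ K := fun τ hτ => hK τ (abs_le.1 hτ)
  have hT0 : 0 ≤ T := by positivity
  have hK0 : 0 ≤ K := (norm_nonneg _).trans (hK' 0 (by simpa using hT0))
  have htT : t ∈ Ioo (-T) T := abs_lt.1 (by rw [hT]; linarith)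
  have h := hasDerivAt_tsum_of_isPreconnected (𝕜 := ℝ) (t := Ioo (-T) T)
    (g := fun n => picardTerm A (n + 1)) (g' := fun n τ => A τ * picardTerm A n τ)
    (summable_exp_bound (K * ‖(1 : 𝔸)‖) K T) isOpen_Ioo isPreconnected_Ioo
    (fun n τ _ => hasDerivAt_picardTerm_succ hA n τ)
    (fun n τ hτ => by
      have hτT : |τ| ≤ T := (abs_lt.2 hτ).le
      calc ‖A τ * picardTerm A n τ‖ ≤ ‖A τ‖ * ‖picardTerm A n τ‖ := norm_mul_le _ _
        _ ≤ K * (‖(1 : 𝔸)‖ * (K ^ n * |τ| ^ n / n.factorial)) :=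
          mul_le_mul (hK' τ hτT) (norm_picardTerm_le hK' n hτT) (norm_nonneg _) hK0
        _ ≤ K * (‖(1 : 𝔸)‖ * (K ^ n * T ^ n / n.factorial)) := by gcongr
        _ = _ := by ring)
    htT ((summable_nat_add_iff 1).2 (summable_picardTerm hA t)) htT
  have e : pathOrderedExp A = fun τ => 1 + ∑' n, picardTerm A (n + 1) τ := by
    ext τ
    rw [pathOrderedExp, (summable_picardTerm hA τ).tsum_eq_zero_add]
    rfl
  have e2 : ∑' n, A t * picardTerm A n t = A t * pathOrderedExp A t :=
    (summable_picardTerm hA t).tsum_mul_left _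
  rw [e2] at h
  rw [e]
  simpa [e] using h.const_add (1 : 𝔸)

theorem continuous_pathOrderedExp (hA : Continuous A) : Continuous (pathOrderedExp A) :=
  continuous_iff_continuousAt.2 fun t => (hasDerivAt_pathOrderedExp hA t).continuousAt

end LinearODE

/-- Uniqueness for linear equations, in terms of right derivatives. -/
theorem linearODE_unique {E : Type*} [NormedAddCommGroup E] [NormedSpace ℝ E]
    {B : ℝ → E →L[ℝ] E} {a b : ℝ} (hB : ContinuousOn B (Icc a b)) {f g : ℝ → E}
    (hf : ContinuousOn f (Icc a b)) (hg : ContinuousOn g (Icc a b))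
    (hf' : ∀ t ∈ Ico a b, HasDerivWithinAt f (B t (f t)) (Ici t) t)
    (hg' : ∀ t ∈ Ico a b, HasDerivWithinAt g (B t (g t)) (Ici t) t)
    (h : f a = g a) : EqOn f g (Icc a b) := by
  obtain ⟨K, hK⟩ := isCompact_Icc.exists_bound_of_continuousOn hB
  refine ODE_solution_unique_of_mem_Icc_right (v := fun t x => B t x) (s := fun _ => univ)
    (K := K.toNNReal) (fun t ht => ?_) hf hf' (fun _ _ => mem_univ _) hg hg'
    (fun _ _ => mem_univ _) h
  have h1 : ‖B t‖₊ ≤ K.toNNReal := by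
    rw [← NNReal.coe_le_coe]
    exact (hK t (Ico_subset_Icc_self ht)).trans (Real.le_coe_toNNReal K)
  exact ((B t).lipschitz.weaken h1).lipschitzOnWith

section Inverse

variable {𝔸 : Type*} [NormedRing 𝔸] [NormedAlgebra ℝ 𝔸] [CompleteSpace 𝔸]

/-- The solution of `N' = -N A`, `N 0 = 1`, which is inverse to the path-ordered exponential. -/
theorem exists_inverse_pathOrderedExp {A : ℝ → 𝔸} (hA : Continuous A) :
    ∃ N : ℝ → 𝔸, N 0 = 1 ∧ (∀ t, HasDerivAt N (-(N t * A t)) t) ∧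
      ∀ t, 0 ≤ t → N t * pathOrderedExp A t = 1 ∧ pathOrderedExp A t * N t = 1 := by
  let e := (MulOpposite.opContinuousLinearEquiv ℝ : 𝔸 ≃L[ℝ] 𝔸ᵐᵒᵖ)
  have hB : Continuous fun t => MulOpposite.op (-A t) := by fun_prop
  let N : ℝ → 𝔸 := fun t => MulOpposite.unop (pathOrderedExp (fun t => MulOpposite.op (-A t)) t)
  have hN : ∀ t, HasDerivAt N (-(N t * A t)) t := by
    intro t
    have : HasDerivAt N _ t :=
      e.symm.toContinuousLinearMap.hasFDerivAt.comp_hasDerivAt t (hasDerivAt_pathOrderedExp hB t)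
    refine this.congr_deriv ?_
    simp [e, N]
  have hN0 : N 0 = 1 := by simp [N, pathOrderedExp_zero]
  clear_value N
  have hL := fun t => hasDerivAt_pathOrderedExp hA t
  refine ⟨N, hN0, hN, fun t ht => ⟨?_, ?_⟩⟩
  · have h1 : ∀ s, HasDerivAt (fun s => N s * pathOrderedExp A s) 0 s := fun s => by
      refine ((hN s).mul (hL s)).congr_deriv ?_
      noncomm_ring
    have h2 := is_const_of_deriv_eq_zero (fun s => (h1 s).differentiableAt)
      (fun s => (h1 s).deriv) t 0
    simpa [hN0, pathOrderedExp_zero] using h2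
  · let B : ℝ → 𝔸 →L[ℝ] 𝔸 := fun s =>
      ContinuousLinearMap.mul ℝ 𝔸 (A s) - (ContinuousLinearMap.mul ℝ 𝔸).flip (A s)
    have h1 : ∀ s, HasDerivAt (fun s => pathOrderedExp A s * N s)
        (B s (pathOrderedExp A s * N s)) s := fun s => by
      refine ((hL s).mul (hN s)).congr_deriv ?_
      simp [B]
      noncomm_ring
    have h2 : ∀ s, HasDerivAt (fun _ : ℝ => (1 : 𝔸)) (B s 1) s := fun s => by
      refine (hasDerivAt_const s (1 : 𝔸)).congr_deriv ?_
      simp [B]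
    have := linearODE_unique (a := 0) (b := t) (B := B) (by fun_prop)
      (f := fun s => pathOrderedExp A s * N s) (g := fun _ => 1)
      (fun s _ => (h1 s).continuousAt.continuousWithinAt) continuousOn_const
      (fun s _ => (h1 s).hasDerivWithinAt) (fun s _ => (h2 s).hasDerivWithinAt)
      (by simp [hN0, pathOrderedExp_zero])
    exact this (right_mem_Icc.2 ht)

end Inverse

section

attribute [local instance] Matrix.linftyOpNormedRing Matrix.linftyOpNormedAlgebra

/-! ### The Lorentz and rotation groups -/

/-- The generator of boosts along the axis `i`. -/
def boostGen (i : Fin 3) : Mat4 := Matrix.single 0 i.succ 1 + Matrix.single i.succ 0 1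

/-- The generator of rotations in the plane of the spatial axes `i`, `j`. -/
def rotGen (i j : Fin 3) : Mat4 :=
  Matrix.single i.succ j.succ 1 - Matrix.single j.succ i.succ 1

theorem lie_boostGen (i j : Fin 3) (h : i ≠ j) :
    boostGen i * boostGen j - boostGen j * boostGen i = rotGen i j := by
  simp [boostGen, rotGen, mul_add, add_mul, Fin.succ_ne_zero, h, h.symm,
    (Fin.succ_ne_zero _).symm]

/-- Rotations in the plane of the second and third spatial axes. -/
def rotYZ (θ : ℝ) : Mat4 :=
  !![1, 0, 0, 0; 0, 1, 0, 0; 0, 0, Real.cos θ, Real.sin θ; 0, 0, -Real.sin θ, Real.cos θ]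

/-- Rotations in the plane of the first and second spatial axes. -/
def rotXY (θ : ℝ) : Mat4 :=
  !![1, 0, 0, 0; 0, Real.cos θ, Real.sin θ, 0; 0, -Real.sin θ, Real.cos θ, 0; 0, 0, 0, 1]

/-- Boosts along the first spatial axis. -/
def boostX (l : ℝ) : Mat4 :=
  !![Real.cosh l, Real.sinh l, 0, 0; Real.sinh l, Real.cosh l, 0, 0; 0, 0, 1, 0; 0, 0, 0, 1]

theorem rotYZ_add (s t : ℝ) : rotYZ (s + t) = rotYZ s * rotYZ t := by
  ext a b
  fin_cases a <;> fin_cases b <;>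
    simp [rotYZ, Matrix.mul_apply, Fin.sum_univ_four, Real.cos_add, Real.sin_add] <;> ring

theorem rotXY_add (s t : ℝ) : rotXY (s + t) = rotXY s * rotXY t := by
  ext a b
  fin_cases a <;> fin_cases b <;>
    simp [rotXY, Matrix.mul_apply, Fin.sum_univ_four, Real.cos_add, Real.sin_add] <;> ring

theorem boostX_add (s t : ℝ) : boostX (s + t) = boostX s * boostX t := by
  ext a b
  fin_cases a <;> fin_cases b <;>
    simp [boostX, Matrix.mul_apply, Fin.sum_univ_four, Real.cosh_add, Real.sinh_add] <;> ring

theorem mat4_eq_one_iff {Λ : Mat4} : Λ = !![1, 0, 0, 0; 0, 1, 0, 0; 0, 0, 1, 0; 0, 0, 0, 1] ↔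
    Λ = 1 := by
  have : (1 : Mat4) = !![1, 0, 0, 0; 0, 1, 0, 0; 0, 0, 1, 0; 0, 0, 0, 1] := by
    ext a b; fin_cases a <;> fin_cases b <;> rfl
  rw [this]

theorem rotYZ_zero : rotYZ 0 = 1 := by rw [← mat4_eq_one_iff]; simp [rotYZ]
theorem rotXY_zero : rotXY 0 = 1 := by rw [← mat4_eq_one_iff]; simp [rotXY]
theorem boostX_zero : boostX 0 = 1 := by rw [← mat4_eq_one_iff]; simp [boostX]

theorem continuous_rotYZ : Continuous rotYZ := by
  refine continuous_matrix fun a b => ?_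
  fin_cases a <;> fin_cases b <;> simp [rotYZ] <;> fun_prop

theorem continuous_rotXY : Continuous rotXY := by
  refine continuous_matrix fun a b => ?_
  fin_cases a <;> fin_cases b <;> simp [rotXY] <;> fun_prop

theorem continuous_boostX : Continuous boostX := by
  refine continuous_matrix fun a b => ?_
  fin_cases a <;> fin_cases b <;> simp [boostX] <;> fun_prop

/-- The Lorentz adjoint `Λ ↦ η Λᵀ η`. -/
def lorentzAdjoint : Mat4 →ₗ[ℝ] Mat4 where
  toFun Λ := minkowski * Λᵀ * minkowski
  map_add' _ _ := by simp [mul_add, add_mul]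
  map_smul' _ _ := by simp

theorem minkowski_mul_self : minkowski * minkowski = 1 := by
  rw [minkowski, Matrix.diagonal_mul_diagonal, ← Matrix.diagonal_one]
  congr 1
  ext i; fin_cases i <;> simp

theorem lorentzAdjoint_apply (Λ : Mat4) : lorentzAdjoint Λ = minkowski * Λᵀ * minkowski := rfl

theorem lorentzAdjoint_mul_self {Λ : Mat4} (h : Λᵀ * minkowski * Λ = minkowski) :
    lorentzAdjoint Λ * Λ = 1 := by
  rw [lorentzAdjoint_apply, mul_assoc, mul_assoc, ← mul_assoc Λᵀ, h, minkowski_mul_self]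

theorem lorentz_row {Λ : Mat4} (h : Λᵀ * minkowski * Λ = minkowski) :
    Λ * minkowski * Λᵀ = minkowski := by
  have h1 := mul_eq_one_comm.1 (lorentzAdjoint_mul_self h)
  rw [lorentzAdjoint_apply, ← mul_assoc, ← mul_assoc] at h1
  calc Λ * minkowski * Λᵀ = Λ * minkowski * Λᵀ * minkowski * minkowski := by
        rw [mul_assoc _ minkowski minkowski, minkowski_mul_self, mul_one]
    _ = minkowski := by rw [h1, one_mul]

theorem lorentz_col_zero {Λ : Mat4} (h : Λᵀ * minkowski * Λ = minkowski) :
    Λ 0 0 ^ 2 = 1 + (Λ 1 0 ^ 2 + Λ 2 0 ^ 2 + Λ 3 0 ^ 2) := by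
  have := congrFun (congrFun h 0) 0
  simp [minkowski, Matrix.mul_apply, Fin.sum_univ_four, Matrix.diagonal_apply] at this
  linarith

theorem lorentz_row_zero {Λ : Mat4} (h : Λᵀ * minkowski * Λ = minkowski) :
    Λ 0 0 ^ 2 = 1 + (Λ 0 1 ^ 2 + Λ 0 2 ^ 2 + Λ 0 3 ^ 2) := by
  have := lorentz_col_zero (Λ := Λᵀ) (by simpa using lorentz_row h)
  simpa using this

theorem lorentzGroup_one : (1 : Mat4) ∈ lorentzGroup := by simp [lorentzGroup]

theorem lorentzGroup_mul {Λ Λ' : Mat4} (h : Λ ∈ lorentzGroup) (h' : Λ' ∈ lorentzGroup) :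
    Λ * Λ' ∈ lorentzGroup := by
  obtain ⟨h1, h2, h3⟩ := h
  obtain ⟨h1', h2', h3'⟩ := h'
  refine ⟨?_, by rw [Matrix.det_mul, h2, h2', one_mul], ?_⟩
  · calc (Λ * Λ')ᵀ * minkowski * (Λ * Λ') = Λ'ᵀ * (Λᵀ * minkowski * Λ) * Λ' := by
          rw [Matrix.transpose_mul]; simp only [mul_assoc]
      _ = minkowski := by rw [h1, h1']
  · have e1 := lorentz_row_zero h1
    have e2 := lorentz_col_zero h1'
    rw [Matrix.mul_apply, Fin.sum_univ_four]
    set a1 := Λ 0 1; set a2 := Λ 0 2; set a3 := Λ 0 3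
    set b1 := Λ' 1 0; set b2 := Λ' 2 0; set b3 := Λ' 3 0
    have hsq : (a1 * b1 + a2 * b2 + a3 * b3) ^ 2 < (Λ 0 0 * Λ' 0 0) ^ 2 := by
      rw [mul_pow, e1, e2]
      nlinarith [sq_nonneg (a1 * b2 - a2 * b1), sq_nonneg (a1 * b3 - a3 * b1),
        sq_nonneg (a2 * b3 - a3 * b2), sq_nonneg a1, sq_nonneg a2, sq_nonneg a3, sq_nonneg b1,
        sq_nonneg b2, sq_nonneg b3]
    have := (abs_lt_of_sq_lt_sq hsq (by positivity))
    linarith [(abs_lt.1 this).1]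

theorem lorentzAdjoint_mem {Λ : Mat4} (h : Λ ∈ lorentzGroup) :
    lorentzAdjoint Λ ∈ lorentzGroup := by
  obtain ⟨h1, h2, h3⟩ := h
  have hT : minkowskiᵀ = minkowski := by simp [minkowski]
  have hd : minkowski.det = -1 := by simp [minkowski, Fin.prod_univ_four]
  refine ⟨?_, ?_, ?_⟩
  · rw [lorentzAdjoint_apply]
    simp only [Matrix.transpose_mul, Matrix.transpose_transpose, hT]
    calc minkowski * (Λ * minkowski) * minkowski * (minkowski * Λᵀ * minkowski)
        = minkowski * (Λ * minkowski * (minkowski * minkowski) * Λᵀ) * minkowski := by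
          simp only [mul_assoc]
      _ = minkowski := by
        rw [minkowski_mul_self, mul_one, lorentz_row h1, minkowski_mul_self, one_mul]
  · rw [lorentzAdjoint_apply, Matrix.det_mul, Matrix.det_mul, Matrix.det_transpose, h2, hd]
    norm_num
  · simpa [lorentzAdjoint_apply, minkowski, Matrix.mul_apply, Fin.sum_univ_four,
      Matrix.diagonal_apply] using h3

theorem isUnitGroup_lorentzGroup : IsUnitGroup lorentzGroup where
  one_mem := lorentzGroup_one
  mul_mem := lorentzGroup_mul
  exists_inv h := ⟨_, lorentzAdjoint_mem h, mul_eq_one_comm.1 (lorentzAdjoint_mul_self h.1),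
    lorentzAdjoint_mul_self h.1⟩

theorem rotYZ_mem (θ : ℝ) : rotYZ θ ∈ lorentzGroup := by
  refine ⟨?_, ?_, by simp [rotYZ]⟩
  · ext a b
    fin_cases a <;> fin_cases b <;> simp [rotYZ, minkowski, Matrix.mul_apply, Fin.sum_univ_four,
      Matrix.diagonal_apply] <;> nlinarith [Real.sin_sq_add_cos_sq θ]
  · simp [rotYZ, Matrix.det_succ_row_zero, Fin.sum_univ_succ]
    nlinarith [Real.sin_sq_add_cos_sq θ]

theorem rotXY_mem (θ : ℝ) : rotXY θ ∈ lorentzGroup := by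
  refine ⟨?_, ?_, by simp [rotXY]⟩
  · ext a b
    fin_cases a <;> fin_cases b <;> simp [rotXY, minkowski, Matrix.mul_apply, Fin.sum_univ_four,
      Matrix.diagonal_apply] <;> nlinarith [Real.sin_sq_add_cos_sq θ]
  · simp [rotXY, Matrix.det_succ_row_zero, Fin.sum_univ_succ, Fin.succAbove]
    nlinarith [Real.sin_sq_add_cos_sq θ]

theorem boostX_mem (l : ℝ) : boostX l ∈ lorentzGroup := by
  refine ⟨?_, ?_, by simp [boostX, Real.cosh_pos]⟩
  · ext a b
    fin_cases a <;> fin_cases b <;> simp [boostX, minkowski, Matrix.mul_apply, Fin.sum_univ_four,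
      Matrix.diagonal_apply] <;> nlinarith [Real.cosh_sq l]
  · simp [boostX, Matrix.det_succ_row_zero, Fin.sum_univ_succ, Fin.succAbove]
    nlinarith [Real.cosh_sq l]

theorem exists_angle (a b : ℝ) : ∃ θ : ℝ, -Real.sin θ * a + Real.cos θ * b = 0 ∧
    0 ≤ Real.cos θ * a + Real.sin θ * b := by
  refine ⟨Complex.arg ⟨a, b⟩, ?_⟩
  have h1 := Complex.norm_mul_cos_arg ⟨a, b⟩
  have h2 := Complex.norm_mul_sin_arg ⟨a, b⟩
  simp only at h1 h2
  set r := ‖(⟨a, b⟩ : ℂ)‖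
  set θ := Complex.arg ⟨a, b⟩
  have hr : 0 ≤ r := norm_nonneg _
  constructor
  · rw [← h1, ← h2]; ring
  · rw [← h1, ← h2]
    nlinarith [sq_nonneg (Real.cos θ), sq_nonneg (Real.sin θ),
      mul_nonneg hr (sq_nonneg (Real.cos θ)),
      mul_nonneg hr (sq_nonneg (Real.sin θ))]

theorem IsUnitGroup.mem_of_mul_mem {H : Set Mat4} (hH : IsUnitGroup H) {a b : Mat4} (ha : a ∈ H)
    (hab : a * b ∈ H) : b ∈ H := by
  obtain ⟨c, hc, h1, h2⟩ := hH.exists_inv ha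
  have := hH.mul_mem hc hab
  rwa [← mul_assoc, h2, one_mul] at this

theorem eq_one_of_mul_self_eq_one {a : ℝ} (h : a * a = 1) (ha : 0 ≤ a) : a = 1 := by
  rcases mul_self_eq_one_iff.1 h with h | h
  · exact h
  · linarith

theorem lorentz_eq_one_of_upperTriangular {Λ : Mat4} (hΛ : Λ ∈ lorentzGroup) (s1 : Λ 1 0 = 0)
    (s2 : Λ 2 0 = 0) (s3 : Λ 3 0 = 0) (s5 : Λ 2 1 = 0) (s4 : Λ 3 1 = 0) (s7 : Λ 3 2 = 0)
    (s6 : 0 ≤ Λ 1 1) (s8 : 0 ≤ Λ 2 2) : Λ = 1 := by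
  obtain ⟨hη, hdet, hpos⟩ := hΛ
  have e : ∀ a b, (Λᵀ * minkowski * Λ) a b = minkowski a b := fun a b => by rw [hη]
  simp only [minkowski, Matrix.mul_apply, Fin.sum_univ_four, Matrix.diagonal_apply,
    Matrix.transpose_apply] at e
  have e00 := e 0 0
  simp [s1, s2, s3] at e00
  have t00 : Λ 0 0 = 1 := eq_one_of_mul_self_eq_one e00 hpos.le
  have e01 := e 0 1; have e02 := e 0 2; have e03 := e 0 3
  simp [s1, s2, s3, t00] at e01 e02 e03
  have e11 := e 1 1
  simp [s5, s4, e01] at e11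
  have t11 : Λ 1 1 = 1 := eq_one_of_mul_self_eq_one e11 s6
  have e12 := e 1 2; have e13 := e 1 3
  simp [s5, s4, e01, t11] at e12 e13
  have e22 := e 2 2
  simp [s7, e02, e12] at e22
  have t22 : Λ 2 2 = 1 := eq_one_of_mul_self_eq_one e22 s8
  have e23 := e 2 3
  simp [s7, e02, e12, t22] at e23
  have t33 : Λ 3 3 = 1 := by
    simpa [Matrix.det_succ_row_zero, Fin.sum_univ_succ, Fin.succAbove, s1, s2, s3, s4, s5, s7, t00,
      e01, e02, e03, t11, t22, e12, e13, e23] using hdet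
  ext a b
  fin_cases a <;> fin_cases b <;> simp [s1, s2, s3, s4, s5, s7, t00, e01, e02, e03, t11, t22, e12,
    e13, e23, t33]

/-- Euler's decomposition of a rotation. -/
theorem mem_of_euler {H : Set Mat4} (hH : IsUnitGroup H) (h12 : ∀ θ, rotXY θ ∈ H)
    (h23 : ∀ θ, rotYZ θ ∈ H) {Λ : Mat4} (hΛ : Λ ∈ lorentzGroup) (h1 : Λ 1 0 = 0) (h2 : Λ 2 0 = 0)
    (h3 : Λ 3 0 = 0) : Λ ∈ H := by
  obtain ⟨θ, hθ, -⟩ := exists_angle (Λ 2 1) (Λ 3 1)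
  refine hH.mem_of_mul_mem (h23 θ) ?_
  have hΛ1 := lorentzGroup_mul (rotYZ_mem θ) hΛ
  obtain ⟨q1, q2, q3⟩ : (rotYZ θ * Λ) 1 0 = 0 ∧ (rotYZ θ * Λ) 2 0 = 0 ∧ (rotYZ θ * Λ) 3 0 = 0 := by
    simp [rotYZ, Matrix.mul_apply, Fin.sum_univ_four, h1, h2, h3]
  have q4 : (rotYZ θ * Λ) 3 1 = 0 := by
    simp [rotYZ, Matrix.mul_apply, Fin.sum_univ_four]; linarith
  generalize rotYZ θ * Λ = Λ at *
  obtain ⟨θ, hθ, hp⟩ := exists_angle (Λ 1 1) (Λ 2 1)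
  refine hH.mem_of_mul_mem (h12 θ) ?_
  have hΛ2 := lorentzGroup_mul (rotXY_mem θ) hΛ1
  obtain ⟨r1, r2, r3, r4⟩ : (rotXY θ * Λ) 1 0 = 0 ∧ (rotXY θ * Λ) 2 0 = 0 ∧
      (rotXY θ * Λ) 3 0 = 0 ∧ (rotXY θ * Λ) 3 1 = 0 := by
    simp [rotXY, Matrix.mul_apply, Fin.sum_univ_four, q1, q2, q3, q4]
  obtain ⟨r5, r6⟩ : (rotXY θ * Λ) 2 1 = 0 ∧ 0 ≤ (rotXY θ * Λ) 1 1 := by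
    simp [rotXY, Matrix.mul_apply, Fin.sum_univ_four]; constructor <;> linarith
  generalize rotXY θ * Λ = Λ at *
  obtain ⟨θ, hθ, hp⟩ := exists_angle (Λ 2 2) (Λ 3 2)
  refine hH.mem_of_mul_mem (h23 θ) ?_
  have hΛ3 := lorentzGroup_mul (rotYZ_mem θ) hΛ2
  obtain ⟨s1, s2, s3, s4, s5, s6⟩ : (rotYZ θ * Λ) 1 0 = 0 ∧ (rotYZ θ * Λ) 2 0 = 0 ∧
      (rotYZ θ * Λ) 3 0 = 0 ∧ (rotYZ θ * Λ) 3 1 = 0 ∧ (rotYZ θ * Λ) 2 1 = 0 ∧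
      0 ≤ (rotYZ θ * Λ) 1 1 := by
    simp [rotYZ, Matrix.mul_apply, Fin.sum_univ_four, r1, r2, r3, r4, r5, r6]
  obtain ⟨s7, s8⟩ : (rotYZ θ * Λ) 3 2 = 0 ∧ 0 ≤ (rotYZ θ * Λ) 2 2 := by
    simp [rotYZ, Matrix.mul_apply, Fin.sum_univ_four]; constructor <;> linarith
  generalize rotYZ θ * Λ = Λ at *
  -- what is left is upper triangular with a non-negative diagonal
  rw [lorentz_eq_one_of_upperTriangular hΛ3 s1 s2 s3 s5 s4 s7 s6 s8]
  exact hH.one_mem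

/-- Rotations bring the image of the time axis into the plane of the times and the first spatial
axis, and a boost brings it back to the time axis; what is left is a rotation. -/
theorem lorentzGroup_subset {H : Set Mat4} (hH : IsUnitGroup H) (h12 : ∀ θ, rotXY θ ∈ H)
    (h23 : ∀ θ, rotYZ θ ∈ H) (h01 : ∀ l, boostX l ∈ H) : lorentzGroup ⊆ H := by
  intro Λ hΛ
  obtain ⟨θ, hθ, -⟩ := exists_angle (Λ 2 0) (Λ 3 0)
  refine hH.mem_of_mul_mem (h23 θ) ?_
  have hΛ1 := lorentzGroup_mul (rotYZ_mem θ) hΛ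
  have q3 : (rotYZ θ * Λ) 3 0 = 0 := by
    simp [rotYZ, Matrix.mul_apply, Fin.sum_univ_four]; linarith
  generalize rotYZ θ * Λ = Λ at *
  obtain ⟨θ, hθ, -⟩ := exists_angle (Λ 1 0) (Λ 2 0)
  refine hH.mem_of_mul_mem (h12 θ) ?_
  have hΛ2 := lorentzGroup_mul (rotXY_mem θ) hΛ1
  have r3 : (rotXY θ * Λ) 3 0 = 0 := by simp [rotXY, Matrix.mul_apply, Fin.sum_univ_four, q3]
  have r2 : (rotXY θ * Λ) 2 0 = 0 := by
    simp [rotXY, Matrix.mul_apply, Fin.sum_univ_four]; linarith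
  generalize rotXY θ * Λ = Λ at *
  have hs : Real.sinh (Real.arsinh (-Λ 1 0)) = -Λ 1 0 := Real.sinh_arsinh _
  have hc : Real.cosh (Real.arsinh (-Λ 1 0)) = Λ 0 0 := by
    have e := lorentz_col_zero hΛ2.1
    rw [r2, r3] at e
    rw [Real.cosh_arsinh, Real.sqrt_eq_iff_mul_self_eq_of_pos hΛ2.2.2]
    nlinarith
  refine hH.mem_of_mul_mem (h01 (Real.arsinh (-Λ 1 0))) ?_
  refine mem_of_euler hH h12 h23 (lorentzGroup_mul (boostX_mem _) hΛ2) ?_ ?_ ?_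
  · simp only [boostX, hs, hc]
    simp [Matrix.mul_apply, Fin.sum_univ_four]; ring
  · simp [boostX, Matrix.mul_apply, Fin.sum_univ_four, r2]
  · simp [boostX, Matrix.mul_apply, Fin.sum_univ_four, r3]

/-- The Lie algebra `so(1,3)`. -/
def lorentzAlgebra : Submodule ℝ Mat4 where
  carrier := {X | lorentzAdjoint X = -X}
  zero_mem' := by simp
  add_mem' {a b} ha hb := by
    simp only [mem_setOf_eq] at *
    rw [map_add, ha, hb, neg_add]
  smul_mem' c {a} ha := by
    simp only [mem_setOf_eq] at *
    rw [map_smul, ha, smul_neg]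

theorem eq_sum_of_mem_lorentzAlgebra {X : Mat4} (hX : X ∈ lorentzAlgebra) :
    X = X 0 1 • boostGen 0 + X 0 2 • boostGen 1 + X 0 3 • boostGen 2 + X 1 2 • rotGen 0 1
      + X 1 3 • rotGen 0 2 + X 2 3 • rotGen 1 2 := by
  have e : ∀ a b, lorentzAdjoint X a b = -X a b := fun a b => by
    have : lorentzAdjoint X = -X := hX
    rw [this]; rfl
  simp only [lorentzAdjoint_apply, minkowski, Matrix.mul_apply, Fin.sum_univ_four,
    Matrix.diagonal_apply] at e
  ext a b
  have := e a b
  fin_cases a <;> fin_cases b <;>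
    simp [boostGen, rotGen] at this ⊢ <;> linarith

theorem lorentzGroup_eq_of_tangent {H : Set Mat4} (hH : IsUnitGroup H) (hHG : H ⊆ lorentzGroup)
    (hT : lorentzAlgebra ≤ tangentSpaceOne hH) : H = lorentzGroup := by
  refine Subset.antisymm hHG ?_
  have hn : ∀ᶠ Λ in 𝓝 1, Λ ∈ lorentzGroup → Λ ∈ H := by
    refine eventually_mem_of_le_tangentSpaceOne hH hHG lorentzAdjoint ?_ lorentzAlgebra ?_
      (fun X hX => hX) hT
    · simp [lorentzAdjoint_apply, minkowski_mul_self]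
    · intro Λ hΛ
      refine ⟨lorentzAdjoint_mul_self hΛ.1, ?_⟩
      change lorentzAdjoint (Λ - lorentzAdjoint Λ) = _
      have h2 : lorentzAdjoint (lorentzAdjoint Λ) = Λ := by
        have hT : minkowskiᵀ = minkowski := by simp [minkowski]
        simp only [lorentzAdjoint_apply, Matrix.transpose_mul, Matrix.transpose_transpose, hT]
        calc minkowski * (minkowski * (Λ * minkowski)) * minkowski
            = (minkowski * minkowski) * Λ * (minkowski * minkowski) := by simp only [mul_assoc]
          _ = Λ := by rw [minkowski_mul_self, one_mul, mul_one]
      rw [map_sub, h2, neg_sub]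
  exact lorentzGroup_subset hH
    (oneParameter_mem hH hn rotXY_zero continuous_rotXY.continuousAt rotXY_add rotXY_mem)
    (oneParameter_mem hH hn rotYZ_zero continuous_rotYZ.continuousAt rotYZ_add rotYZ_mem)
    (oneParameter_mem hH hn boostX_zero continuous_boostX.continuousAt boostX_add boostX_mem)

theorem lorentzAlgebra_le_of_boostGen {H : Set Mat4} (hH : IsUnitGroup H)
    (h : ∀ i, boostGen i ∈ tangentSpaceOne hH) : lorentzAlgebra ≤ tangentSpaceOne hH := by
  intro X hX
  have hr : ∀ i j, i ≠ j → rotGen i j ∈ tangentSpaceOne hH := fun i j hij => by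
    rw [← lie_boostGen i j hij]
    exact lie_mem_tangentSpaceOne hH (h i) (h j)
  rw [eq_sum_of_mem_lorentzAlgebra hX]
  have m := fun (c : ℝ) {Y} (hY : Y ∈ tangentSpaceOne hH) => (tangentSpaceOne hH).smul_mem c hY
  exact add_mem (add_mem (add_mem (add_mem (add_mem (m _ (h 0)) (m _ (h 1))) (m _ (h 2)))
    (m _ (hr 0 1 (by decide)))) (m _ (hr 0 2 (by decide)))) (m _ (hr 1 2 (by decide)))

theorem minkowski_zero_zero : minkowski 0 0 = -1 := by simp [minkowski]

theorem minkowski_zero_succ (j : Fin 3) : minkowski 0 j.succ = 0 := by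
  simp [minkowski, (Fin.succ_ne_zero j).symm]

theorem minkowski_succ_zero (i : Fin 3) : minkowski i.succ 0 = 0 := by
  simp [minkowski, Fin.succ_ne_zero i]

theorem minkowski_succ_succ (i j : Fin 3) :
    minkowski i.succ j.succ = (1 : Matrix (Fin 3) (Fin 3) ℝ) i j := by
  fin_cases i <;> fin_cases j <;> simp [minkowski]

theorem mem_rotationGroup_iff {Λ : Mat4} :
    Λ ∈ rotationGroup ↔ Λ ∈ lorentzGroup ∧ Λ 0 0 = 1 ∧ ∀ i : Fin 3, Λ i.succ 0 = 0 := by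
  constructor
  · rintro ⟨R, hR, rfl⟩
    rw [Matrix.mem_specialOrthogonalGroup_iff, Matrix.mem_orthogonalGroup_iff'] at hR
    obtain ⟨hR, hd⟩ := hR
    have hR' : ∀ i j, (Rᵀ * R) i j = (1 : Matrix (Fin 3) (Fin 3) ℝ) i j := fun i j => by
      rw [← hR]
    simp only [Matrix.mul_apply, Fin.sum_univ_three, Matrix.transpose_apply] at hR'
    refine ⟨⟨?_, ?_, one_pos⟩, rfl, fun i => rfl⟩
    · ext a b
      simp only [Matrix.mul_apply, Fin.sum_univ_succ (n := 3), Matrix.transpose_apply]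
      refine Fin.cases ?_ (fun i => ?_) a <;> refine Fin.cases ?_ (fun j => ?_) b <;>
      simp only [spatialRotation, Matrix.of_apply, Fin.cases_zero, Fin.cases_succ,
        minkowski_zero_zero, minkowski_zero_succ, minkowski_succ_zero, minkowski_succ_succ] <;>
      first
      | (simp; done)
      | (rw [← hR']; simp [Fin.sum_univ_three, Matrix.one_apply])
    · rw [Matrix.det_succ_row_zero, Fin.sum_univ_succ]
      have : (spatialRotation R).submatrix Fin.succ (Fin.succAbove 0) = R := by
        ext i j
        simp only [Matrix.submatrix_apply, Fin.succAbove_zero]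
        rfl
      rw [this, hd]
      simp [spatialRotation]
  · rintro ⟨⟨h1, h2, h3⟩, h4, h5⟩
    have h6 : ∀ i : Fin 3, Λ 0 i.succ = 0 := by
      have := lorentz_row_zero h1
      rw [h4] at this
      intro i
      fin_cases i <;> simp <;> nlinarith [sq_nonneg (Λ 0 1), sq_nonneg (Λ 0 2), sq_nonneg (Λ 0 3)]
    have hΛ : Λ = spatialRotation (Λ.submatrix Fin.succ Fin.succ) := by
      ext a b
      refine Fin.cases ?_ (fun i => ?_) a <;> refine Fin.cases ?_ (fun j => ?_) b <;>
        simp [spatialRotation, h4, h5, h6]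
    refine ⟨_, ?_, hΛ⟩
    rw [Matrix.mem_specialOrthogonalGroup_iff, Matrix.mem_orthogonalGroup_iff']
    constructor
    · ext i j
      have := congrFun (congrFun h1 i.succ) j.succ
      simp [minkowski, Matrix.mul_apply, Fin.sum_univ_succ, Matrix.diagonal_apply, h6] at this
      fin_cases i <;> fin_cases j <;>
        simp [Matrix.mul_apply, Fin.sum_univ_three] at this ⊢ <;>
        linarith
    · rw [Matrix.det_succ_row_zero, Fin.sum_univ_succ] at h2
      simpa [h4, h6] using h2

theorem isUnitGroup_rotationGroup : IsUnitGroup rotationGroup where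
  one_mem := mem_rotationGroup_iff.2 ⟨lorentzGroup_one, by simp, fun i => by simp⟩
  mul_mem {a b} ha hb := by
    rw [mem_rotationGroup_iff] at *
    refine ⟨lorentzGroup_mul ha.1 hb.1, ?_, fun i => ?_⟩
    · rw [Matrix.mul_apply, Fin.sum_univ_succ]; simp [ha.2.1, hb.2.1, hb.2.2]
    · rw [Matrix.mul_apply, Fin.sum_univ_succ]; simp [ha.2.2, hb.2.2]
  exists_inv {a} ha := by
    rw [mem_rotationGroup_iff] at ha
    refine ⟨lorentzAdjoint a, mem_rotationGroup_iff.2 ⟨lorentzAdjoint_mem ha.1, ?_, fun i => ?_⟩,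
      mul_eq_one_comm.1 (lorentzAdjoint_mul_self ha.1.1), lorentzAdjoint_mul_self ha.1.1⟩
    · simp [lorentzAdjoint_apply, minkowski, ha.2.1]
    · have := lorentz_row_zero ha.1.1
      rw [ha.2.1] at this
      simp only [lorentzAdjoint_apply, minkowski, Matrix.mul_diagonal, Matrix.diagonal_mul,
        Matrix.transpose_apply]
      fin_cases i <;> simp <;> nlinarith [sq_nonneg (a 0 1), sq_nonneg (a 0 2), sq_nonneg (a 0 3)]

theorem rotationGroup_eq_of_tangent {H : Set Mat4} (hH : IsUnitGroup H) (hHG : H ⊆ rotationGroup)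
    (hT : ∀ i j, i ≠ j → rotGen i j ∈ tangentSpaceOne hH) : H = rotationGroup := by
  refine Subset.antisymm hHG ?_
  have hn : ∀ᶠ Λ in 𝓝 1, Λ ∈ rotationGroup → Λ ∈ H := by
    refine eventually_mem_of_le_tangentSpaceOne hH hHG lorentzAdjoint ?_
      (Submodule.span ℝ {X | ∃ i j : Fin 3, i ≠ j ∧ X = rotGen i j}) ?_ ?_ ?_
    · simp [lorentzAdjoint_apply, minkowski_mul_self]
    · intro Λ hΛ
      obtain ⟨h1, h2, h3⟩ := mem_rotationGroup_iff.1 hΛ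
      have h4 : ∀ i : Fin 3, Λ 0 i.succ = 0 := by
        have := lorentz_row_zero h1.1
        rw [h2] at this
        intro i
        fin_cases i <;> simp <;>
          nlinarith [sq_nonneg (Λ 0 1), sq_nonneg (Λ 0 2), sq_nonneg (Λ 0 3)]
      refine ⟨lorentzAdjoint_mul_self h1.1, ?_⟩
      have e : Λ - lorentzAdjoint Λ = (Λ 1 2 - Λ 2 1) • rotGen 0 1 + (Λ 1 3 - Λ 3 1) • rotGen 0 2
          + (Λ 2 3 - Λ 3 2) • rotGen 1 2 := by
        have a1 := h3 0; have a2 := h3 1; have a3 := h3 2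
        have b1 := h4 0; have b2 := h4 1; have b3 := h4 2
        simp at a1 a2 a3 b1 b2 b3
        ext a b
        simp only [lorentzAdjoint_apply, minkowski, Matrix.mul_diagonal, Matrix.diagonal_mul,
          Matrix.transpose_apply, Matrix.sub_apply]
        fin_cases a <;> fin_cases b <;>
          simp [rotGen, a1, a2, a3, b1, b2, b3]
      rw [e]
      have m : ∀ (c : ℝ) (i j : Fin 3), i ≠ j → c • rotGen i j ∈
          Submodule.span ℝ {X | ∃ i j : Fin 3, i ≠ j ∧ X = rotGen i j} := fun c i j h =>
        Submodule.smul_mem _ _ (Submodule.subset_span ⟨i, j, h, rfl⟩)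
      exact add_mem (add_mem (m _ _ _ (by decide)) (m _ _ _ (by decide))) (m _ _ _ (by decide))
    · intro X hX
      refine (Submodule.span_le (p := lorentzAlgebra)).2 ?_ hX
      rintro _ ⟨i, j, h, rfl⟩
      change lorentzAdjoint _ = _
      ext a b
      simp only [lorentzAdjoint_apply, minkowski, Matrix.mul_diagonal, Matrix.diagonal_mul,
        Matrix.transpose_apply]
      refine Fin.cases ?_ (fun k => ?_) a <;> refine Fin.cases ?_ (fun l => ?_) b
      · simp [rotGen]
      · simp [rotGen]
      · simp [rotGen]
      · have : ∀ k : Fin 3, (![-1, 1, 1, 1] : Fin 4 → ℝ) k.succ = 1 := fun k => by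
          fin_cases k <;> rfl
        simp only [this, rotGen, Matrix.sub_apply, Matrix.single_apply, Fin.succ_inj,
          Matrix.neg_apply, and_comm (a := i = l), and_comm (a := j = l)]
        ring
    · refine Submodule.span_le.2 ?_
      rintro _ ⟨i, j, h, rfl⟩
      exact hT i j h
  have r1 : ∀ θ, rotXY θ ∈ rotationGroup := fun θ =>
    mem_rotationGroup_iff.2 ⟨rotXY_mem θ, by simp [rotXY], fun i => by
      fin_cases i <;> simp [rotXY]⟩
  have r2 : ∀ θ, rotYZ θ ∈ rotationGroup := fun θ =>
    mem_rotationGroup_iff.2 ⟨rotYZ_mem θ, by simp [rotYZ], fun i => by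
      fin_cases i <;> simp [rotYZ]⟩
  intro Λ hΛ
  obtain ⟨h1, -, h3⟩ := mem_rotationGroup_iff.1 hΛ
  exact mem_of_euler hH
    (oneParameter_mem hH hn rotXY_zero continuous_rotXY.continuousAt rotXY_add r1)
    (oneParameter_mem hH hn rotYZ_zero continuous_rotYZ.continuousAt rotYZ_add r2) h1
    (h3 0) (h3 1) (h3 2)

/-! ### Self-dual matrices and unit quaternions -/

/-- The totally antisymmetric symbol as an integer, the sign of a permutation being read off from
its inversions. -/
def permSign (a b c d : Fin 4) : ℤ :=
  if a = b ∨ a = c ∨ a = d ∨ b = c ∨ b = d ∨ c = d then 0 else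
    (if a < b then 1 else -1) * (if a < c then 1 else -1) * (if a < d then 1 else -1) *
      (if b < c then 1 else -1) * (if b < d then 1 else -1) * (if c < d then 1 else -1)

theorem det_eq_permSign : ∀ a b c d : Fin 4,
    Matrix.det (Matrix.of fun i j : Fin 4 => if ![a, b, c, d] i = j then (1 : ℤ) else 0)
      = permSign a b c d := by
  decide +kernel

theorem leviCivita_eq (a b c d : Fin 4) : leviCivita a b c d = permSign a b c d := by
  rw [← det_eq_permSign, leviCivita]
  refine Eq.trans ?_ ((Int.castRingHom ℝ).map_det _).symm
  congr 1
  ext i j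
  simp [apply_ite]

theorem hodgeDual_one (X : Mat4) : hodgeDual 1 X = (1 / 2 : ℝ) •
    !![0, X 2 3 - X 3 2, X 3 1 - X 1 3, X 1 2 - X 2 1;
      X 3 2 - X 2 3, 0, X 0 3 - X 3 0, X 2 0 - X 0 2;
      X 1 3 - X 3 1, X 3 0 - X 0 3, 0, X 0 1 - X 1 0;
      X 2 1 - X 1 2, X 0 2 - X 2 0, X 1 0 - X 0 1, 0] := by
  ext a b
  simp only [hodgeDual, leviCivita_eq, Fin.sum_univ_four, Matrix.of_apply, inv_one,
    Matrix.transpose_one, mul_one, one_mul, Matrix.det_one, Real.sqrt_one]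
  fin_cases a <;> fin_cases b <;> simp [permSign] <;> ring

/-- The matrices by which quaternions act on `ℝ⁴`; the imaginary quaternions give the self-dual
antisymmetric matrices. -/
def quatMat : ℍ[ℝ] →ₐ[ℝ] Mat4 :=
  AlgHom.ofLinearMap
    { toFun := fun q => !![q.re, q.imI, q.imJ, -q.imK; -q.imI, q.re, -q.imK, -q.imJ;
        -q.imJ, q.imK, q.re, q.imI; q.imK, q.imJ, -q.imI, q.re]
      map_add' := fun p q => by
        ext a b; fin_cases a <;> fin_cases b <;> simp <;> ring
      map_smul' := fun c q => by
        ext a b; fin_cases a <;> fin_cases b <;> simp }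
    (by ext a b; fin_cases a <;> fin_cases b <;> simp)
    (fun p q => by
      ext a b
      fin_cases a <;> fin_cases b <;> simp [Matrix.mul_apply, Fin.sum_univ_four] <;> ring)

theorem quatMat_apply (q : ℍ[ℝ]) :
    quatMat q = !![q.re, q.imI, q.imJ, -q.imK; -q.imI, q.re, -q.imK, -q.imJ;
        -q.imJ, q.imK, q.re, q.imI; q.imK, q.imJ, -q.imI, q.re] := rfl

/-- The quaternion with the given components. -/
def mkQuat (a b c d : ℝ) : ℍ[ℝ] := ⟨a, b, c, d⟩

@[simp] theorem mkQuat_re (a b c d : ℝ) : (mkQuat a b c d).re = a := rfl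
@[simp] theorem mkQuat_imI (a b c d : ℝ) : (mkQuat a b c d).imI = b := rfl
@[simp] theorem mkQuat_imJ (a b c d : ℝ) : (mkQuat a b c d).imJ = c := rfl
@[simp] theorem mkQuat_imK (a b c d : ℝ) : (mkQuat a b c d).imK = d := rfl

theorem quatMat_injective : Function.Injective quatMat := by
  intro p q h
  have e : ∀ b, quatMat p 0 b = quatMat q 0 b := fun b => by rw [h]
  have e0 := e 0; have e1 := e 1; have e2 := e 2; have e3 := e 3
  simp [quatMat_apply] at e0 e1 e2 e3
  ext <;> assumption

theorem quatMat_star (q : ℍ[ℝ]) : quatMat (star q) = (quatMat q)ᵀ := by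
  ext a b; fin_cases a <;> fin_cases b <;> simp [quatMat_apply]

theorem continuous_quatMat : Continuous quatMat :=
  quatMat.toLinearMap.continuous_of_finiteDimensional

/-- The space of self-dual antisymmetric matrices. -/
def selfDualAlgebra : Submodule ℝ Mat4 where
  carrier := {X | antiSelfDualPart 1 X = 0}
  zero_mem' := by
    simp only [mem_setOf_eq, antiSelfDualPart, hodgeDual_one]
    ext a b; fin_cases a <;> fin_cases b <;> simp
  add_mem' {a b} ha hb := by
    simp only [mem_setOf_eq] at *
    have h : antiSelfDualPart 1 (a + b) = antiSelfDualPart 1 a + antiSelfDualPart 1 b := by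
      simp only [antiSelfDualPart, hodgeDual_one]
      ext i j; fin_cases i <;> fin_cases j <;> simp <;> ring
    rw [h, ha, hb, add_zero]
  smul_mem' c {a} ha := by
    simp only [mem_setOf_eq] at *
    have h : antiSelfDualPart 1 (c • a) = c • antiSelfDualPart 1 a := by
      simp only [antiSelfDualPart, hodgeDual_one]
      ext i j; fin_cases i <;> fin_cases j <;> simp <;> ring
    rw [h, ha, smul_zero]

theorem mem_selfDualAlgebra_iff {X : Mat4} :
    X ∈ selfDualAlgebra ↔ ∃ q : ℍ[ℝ], q.re = 0 ∧ quatMat q = X := by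
  change antiSelfDualPart 1 X = 0 ↔ _
  rw [antiSelfDualPart, hodgeDual_one]
  constructor
  · intro h
    have e : ∀ a b, (X - (1 / 2 : ℝ) •
    !![0, X 2 3 - X 3 2, X 3 1 - X 1 3, X 1 2 - X 2 1;
      X 3 2 - X 2 3, 0, X 0 3 - X 3 0, X 2 0 - X 0 2;
      X 1 3 - X 3 1, X 3 0 - X 0 3, 0, X 0 1 - X 1 0;
      X 2 1 - X 1 2, X 0 2 - X 2 0, X 1 0 - X 0 1, 0]) a b = 0 := fun a b => by rw [h]; rfl
    refine ⟨mkQuat 0 (X 0 1) (X 0 2) (-X 0 3), rfl, ?_⟩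
    have e01 := e 0 1; have e02 := e 0 2; have e03 := e 0 3; have e12 := e 1 2
    have e13 := e 1 3; have e23 := e 2 3; have e10 := e 1 0; have e20 := e 2 0
    have e30 := e 3 0; have e21 := e 2 1; have e31 := e 3 1; have e32 := e 3 2
    have e00 := e 0 0; have e11 := e 1 1; have e22 := e 2 2; have e33 := e 3 3
    simp at e01 e02 e03 e12 e13 e23 e10 e20 e30 e21 e31 e32 e00 e11 e22 e33
    ext a b
    fin_cases a <;> fin_cases b <;> simp [quatMat_apply] <;> linarith
  · rintro ⟨q, hq, rfl⟩
    ext a b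
    fin_cases a <;> fin_cases b <;> simp [quatMat_apply, hq] <;> ring

theorem transpose_of_mem_selfDualAlgebra {X : Mat4} (hX : X ∈ selfDualAlgebra) : Xᵀ = -X := by
  obtain ⟨q, hq, rfl⟩ := mem_selfDualAlgebra_iff.1 hX
  rw [← quatMat_star, ← map_neg, Quaternion.star_eq_neg.2 hq]

theorem mem_selfDualSU2_iff_exp {Λ : Mat4} :
    Λ ∈ selfDualSU2 ↔ ∃ X ∈ selfDualAlgebra, Λ = NormedSpace.exp X :=
  ⟨fun ⟨X, _, h2, h3⟩ => ⟨X, h2, h3⟩,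
    fun ⟨X, h2, h3⟩ => ⟨X, transpose_of_mem_selfDualAlgebra h2, h2, h3⟩⟩

/-- The group `SU(2)₊` consists of the matrices of the unit quaternions. -/
theorem mem_selfDualSU2_iff {Λ : Mat4} :
    Λ ∈ selfDualSU2 ↔ ∃ q : ℍ[ℝ], Quaternion.normSq q = 1 ∧ quatMat q = Λ := by
  rw [mem_selfDualSU2_iff_exp]
  let _ : NormedAlgebra ℚ ℍ[ℝ] := NormedAlgebra.restrictScalars ℚ ℝ _
  have hexp : ∀ q : ℍ[ℝ], quatMat (NormedSpace.exp q) = NormedSpace.exp (quatMat q) := fun q =>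
    NormedSpace.map_exp quatMat continuous_quatMat q
  constructor
  · rintro ⟨X, hX, rfl⟩
    obtain ⟨q, hq, rfl⟩ := mem_selfDualAlgebra_iff.1 hX
    refine ⟨NormedSpace.exp q, ?_, hexp q⟩
    rw [Quaternion.normSq_exp, hq]; simp
  · rintro ⟨q, hq, rfl⟩
    have hn : q.re ^ 2 + ‖q.im‖ ^ 2 = 1 := by
      have h1 : ‖q.im‖ ^ 2 = q.imI ^ 2 + q.imJ ^ 2 + q.imK ^ 2 := by
        rw [pow_two, ← Quaternion.normSq_eq_norm_mul_self, Quaternion.normSq_def']; simp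
      rw [Quaternion.normSq_def'] at hq
      rw [h1]; linarith
    -- polar form `q = cos θ + sin θ u` with a unit imaginary quaternion `u`
    have hex : ∃ p : ℍ[ℝ], p.re = 0 ∧ NormedSpace.exp p = q := by
      by_cases him : q.im = 0
      · rw [him] at hn
        have hre : q = (q.re : ℍ[ℝ]) := by
          conv_lhs => rw [← Quaternion.re_add_im q, him, add_zero]
        have : q.re = 1 ∨ q.re = -1 := by
          have : q.re ^ 2 = 1 := by simpa using hn
          rcases mul_self_eq_one_iff.1 ((pow_two _).symm.trans this) with h | h
          · exact Or.inl h
          · exact Or.inr h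
        rcases this with h | h
        · exact ⟨0, rfl, by rw [NormedSpace.exp_zero, hre, h]; rfl⟩
        · refine ⟨mkQuat 0 Real.pi 0 0, rfl, ?_⟩
          have hnorm : ‖(mkQuat 0 Real.pi 0 0)‖ = Real.pi := by
            have h2 : ‖(mkQuat 0 Real.pi 0 0)‖ ^ 2 = Real.pi ^ 2 := by
              rw [pow_two, ← Quaternion.normSq_eq_norm_mul_self, Quaternion.normSq_def']; simp
            exact (pow_left_inj₀ (norm_nonneg _) Real.pi_pos.le two_ne_zero).1 h2
          rw [Quaternion.exp_of_re_eq_zero _ rfl, hnorm, hre, h]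
          simp
      · have hpos : 0 < ‖q.im‖ := norm_pos_iff.2 him
        set θ := Complex.arg ⟨q.re, ‖q.im‖⟩ with hθ
        have hz : ‖(⟨q.re, ‖q.im‖⟩ : ℂ)‖ = 1 := by
          rw [Complex.norm_eq_sqrt_sq_add_sq, hn, Real.sqrt_one]
        have hc : Real.cos θ = q.re := by
          have := Complex.norm_mul_cos_arg ⟨q.re, ‖q.im‖⟩
          rwa [hz, one_mul] at this
        have hs : Real.sin θ = ‖q.im‖ := by
          have := Complex.norm_mul_sin_arg ⟨q.re, ‖q.im‖⟩
          rwa [hz, one_mul] at this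
        have hθ0 : 0 ≤ θ := Complex.arg_nonneg_iff.2 hpos.le
        have hθpos : 0 < θ := by
          refine lt_of_le_of_ne hθ0 fun h0 => ?_
          rw [← h0, Real.sin_zero] at hs
          exact hpos.ne hs
        refine ⟨(θ / ‖q.im‖) • q.im, by simp, ?_⟩
        rw [Quaternion.exp_of_re_eq_zero _ (by simp), norm_smul,
          Real.norm_of_nonneg (by positivity),
          div_mul_cancel₀ _ hpos.ne', hc, hs, smul_smul]
        have : ‖q.im‖ / θ * (θ / ‖q.im‖) = 1 := by field_simp
        rw [this, one_smul]
        exact Quaternion.re_add_im q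
    obtain ⟨p, hp, rfl⟩ := hex
    exact ⟨quatMat p, mem_selfDualAlgebra_iff.2 ⟨p, hp, rfl⟩, hexp p⟩

theorem quatMat_transpose_mul_self {q : ℍ[ℝ]} (hq : Quaternion.normSq q = 1) :
    (quatMat q)ᵀ * quatMat q = 1 := by
  rw [← quatMat_star, ← map_mul, Quaternion.star_mul_self, hq]; simp

theorem selfDualSU2_transpose_mul {Λ : Mat4} (hΛ : Λ ∈ selfDualSU2) : Λᵀ * Λ = 1 := by
  obtain ⟨q, hq, rfl⟩ := mem_selfDualSU2_iff.1 hΛ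
  exact quatMat_transpose_mul_self hq

theorem isUnitGroup_selfDualSU2 : IsUnitGroup selfDualSU2 where
  one_mem := mem_selfDualSU2_iff.2 ⟨1, by simp, by simp⟩
  mul_mem {a b} ha hb := by
    obtain ⟨p, hp, rfl⟩ := mem_selfDualSU2_iff.1 ha
    obtain ⟨q, hq, rfl⟩ := mem_selfDualSU2_iff.1 hb
    exact mem_selfDualSU2_iff.2 ⟨p * q, by rw [map_mul, hp, hq, one_mul], map_mul _ _ _⟩
  exists_inv {a} ha := by
    obtain ⟨p, hp, rfl⟩ := mem_selfDualSU2_iff.1 ha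
    refine ⟨quatMat (star p), mem_selfDualSU2_iff.2 ⟨_, by rwa [Quaternion.normSq_star], rfl⟩,
      mul_eq_one_comm.1 ?_, ?_⟩ <;>
    · rw [quatMat_star]; exact quatMat_transpose_mul_self hp

/-- The anti-self-dual matrix by which the quaternion unit `i` acts from the other side. -/
def antiSelfDualI : Mat4 := !![0, 1, 0, 0; -1, 0, 0, 0; 0, 0, 0, -1; 0, 0, 1, 0]

/-- The anti-self-dual matrix by which the quaternion unit `j` acts from the other side. -/
def antiSelfDualJ : Mat4 := !![0, 0, 1, 0; 0, 0, 0, 1; -1, 0, 0, 0; 0, -1, 0, 0]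

/-- An orthogonal matrix that commutes with the anti-self-dual matrices lies in `SU(2)₊`; it is
enough to test with two anti-self-dual matrices. -/
theorem mem_selfDualSU2_of_commute {Λ : Mat4} (h1 : Λᵀ * Λ = 1)
    (h2 : Λ * antiSelfDualI = antiSelfDualI * Λ) (h3 : Λ * antiSelfDualJ = antiSelfDualJ * Λ) :
    Λ ∈ selfDualSU2 := by
  have hq : quatMat (mkQuat (Λ 0 0) (Λ 0 1) (Λ 0 2) (-Λ 0 3)) = Λ := by
    have a00 := congrFun (congrFun h2 0) 0; have a01 := congrFun (congrFun h2 0) 1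
    have a02 := congrFun (congrFun h2 0) 2; have a03 := congrFun (congrFun h2 0) 3
    have a20 := congrFun (congrFun h2 2) 0; have a21 := congrFun (congrFun h2 2) 1
    have a22 := congrFun (congrFun h2 2) 2; have a23 := congrFun (congrFun h2 2) 3
    have b00 := congrFun (congrFun h3 0) 0; have b01 := congrFun (congrFun h3 0) 1
    have b02 := congrFun (congrFun h3 0) 2; have b03 := congrFun (congrFun h3 0) 3
    simp only [antiSelfDualI, antiSelfDualJ] at a00 a01 a02 a03 a20 a21 a22 a23 b00 b01 b02 b03
    simp [Matrix.mul_apply, Fin.sum_univ_four] at a00 a01 a02 a03 a20 a21 a22 a23 b00 b01 b02 b03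
    ext a b
    fin_cases a <;> fin_cases b <;> simp [quatMat_apply] <;> linarith
  refine mem_selfDualSU2_iff.2 ⟨_, ?_, hq⟩
  have := congrFun (congrFun h1 0) 0
  rw [← hq, ← quatMat_star, ← map_mul, Quaternion.star_mul_self] at this
  simpa [quatMat_apply] using this

theorem selfDualSU2_eq_of_tangent {H : Set Mat4} (hH : IsUnitGroup H) (hHG : H ⊆ selfDualSU2)
    (hT : selfDualAlgebra ≤ tangentSpaceOne hH) : H = selfDualSU2 := by
  refine Subset.antisymm hHG ?_
  have hn : ∀ᶠ Λ in 𝓝 1, Λ ∈ selfDualSU2 → Λ ∈ H := by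
    refine eventually_mem_of_le_tangentSpaceOne hH hHG
      (Matrix.transposeLinearEquiv (Fin 4) (Fin 4) ℝ ℝ).toLinearMap ?_ selfDualAlgebra ?_
      (fun X hX => transpose_of_mem_selfDualAlgebra hX) hT
    · simp
    · intro Λ hΛ
      refine ⟨selfDualSU2_transpose_mul hΛ, ?_⟩
      obtain ⟨q, hq, rfl⟩ := mem_selfDualSU2_iff.1 hΛ
      refine mem_selfDualAlgebra_iff.2 ⟨q - star q, by simp, ?_⟩
      rw [map_sub, quatMat_star]; rfl
  intro Λ hΛ
  obtain ⟨X, hX, rfl⟩ := mem_selfDualSU2_iff_exp.1 hΛ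
  have h := oneParameter_mem hH hn (ρ := fun t : ℝ => NormedSpace.exp (t • X)) (by simp)
    ((NormedSpace.exp_continuous.comp (by fun_prop : Continuous fun t : ℝ => t • X)).continuousAt)
    (fun s t => by
      simp only [add_smul]
      exact Matrix.exp_add_of_commute _ _ (((Commute.refl X).smul_left s).smul_right t))
    (fun t => mem_selfDualSU2_iff_exp.2 ⟨_, selfDualAlgebra.smul_mem t hX, rfl⟩) 1
  simpa using h

/-- Two linearly independent self-dual matrices generate the Lie algebra of all of them. -/
theorem selfDualAlgebra_le_of_linearIndependent {H : Set Mat4} (hH : IsUnitGroup H) {X Y : Mat4}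
    (hX : X ∈ selfDualAlgebra) (hY : Y ∈ selfDualAlgebra) (hXY : LinearIndependent ℝ ![X, Y])
    (hXT : X ∈ tangentSpaceOne hH) (hYT : Y ∈ tangentSpaceOne hH) :
    selfDualAlgebra ≤ tangentSpaceOne hH := by
  obtain ⟨p, hp, rfl⟩ := mem_selfDualAlgebra_iff.1 hX
  obtain ⟨q, hq, rfl⟩ := mem_selfDualAlgebra_iff.1 hY
  have hL := lie_mem_tangentSpaceOne hH hXT hYT
  rw [LinearIndependent.pair_iff] at hXY
  -- the components of the cross product `p × q`
  set u := p.imJ * q.imK - p.imK * q.imJ with hu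
  set v := p.imK * q.imI - p.imI * q.imK with hv
  set w := p.imI * q.imJ - p.imJ * q.imI with hw
  have hne : u ^ 2 + v ^ 2 + w ^ 2 ≠ 0 := by
    intro h0
    have hu0 : u = 0 := by nlinarith [sq_nonneg u, sq_nonneg v, sq_nonneg w]
    have hv0 : v = 0 := by nlinarith [sq_nonneg u, sq_nonneg v, sq_nonneg w]
    have hw0 : w = 0 := by nlinarith [sq_nonneg u, sq_nonneg v, sq_nonneg w]
    have key : ∀ s t : ℝ, s • p + t • q = 0 → s = 0 ∧ t = 0 := fun s t h =>
      hXY s t (by rw [← map_smul, ← map_smul, ← map_add, h, map_zero])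
    have hI := key q.imI (-p.imI) (by
      ext <;> simp [hp, hq] <;> linarith)
    have hJ := key q.imJ (-p.imJ) (by
      ext <;> simp [hp, hq] <;> linarith)
    have hK := key q.imK (-p.imK) (by
      ext <;> simp [hp, hq] <;> linarith)
    have hp0 : p = 0 := by
      ext
      · exact hp
      · simpa using hI.2
      · simpa using hJ.2
      · simpa using hK.2
    exact one_ne_zero (key 1 0 (by simp [hp0])).1
  intro Z hZ
  obtain ⟨r, hr, rfl⟩ := mem_selfDualAlgebra_iff.1 hZ
  -- Cramer's rule in the basis `p`, `q`, `p × q`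
  set D := u ^ 2 + v ^ 2 + w ^ 2
  have e : r = (((q.imJ * w - q.imK * v) * r.imI + (q.imK * u - q.imI * w) * r.imJ
      + (q.imI * v - q.imJ * u) * r.imK) / D) • p
      + (((p.imK * v - p.imJ * w) * r.imI + (p.imI * w - p.imK * u) * r.imJ
      + (p.imJ * u - p.imI * v) * r.imK) / D) • q
      + ((u * r.imI + v * r.imJ + w * r.imK) / (2 * D)) • (p * q - q * p) := by
    have hD : D = u ^ 2 + v ^ 2 + w ^ 2 := rfl
    have c1 : (p * q - q * p).imI = 2 * u := by simp [hu]; ring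
    have c2 : (p * q - q * p).imJ = 2 * v := by simp [hv]; ring
    have c3 : (p * q - q * p).imK = 2 * w := by simp [hw]; ring
    have c0 : (p * q - q * p).re = 0 := by simp; ring
    ext
    · simp only [Quaternion.re_add, Quaternion.re_smul, c0, hp, hq, hr]; simp
    · simp only [Quaternion.imI_add, Quaternion.imI_smul, c1, smul_eq_mul]
      field_simp
      rw [hD, hu, hv, hw]; ring
    · simp only [Quaternion.imJ_add, Quaternion.imJ_smul, c2, smul_eq_mul]
      field_simp
      rw [hD, hu, hv, hw]; ring
    · simp only [Quaternion.imK_add, Quaternion.imK_smul, c3, smul_eq_mul]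
      field_simp
      rw [hD, hu, hv, hw]; ring
  rw [e]
  simp only [map_add, map_smul, map_sub, map_mul]
  exact add_mem (add_mem (Submodule.smul_mem _ _ hXT) (Submodule.smul_mem _ _ hYT))
    (Submodule.smul_mem _ _ hL)

/-- The quaternion of an element `!![α, β; -β̄, ᾱ]` of `SU(2)`. -/
def quatOfSU2 (u : Matrix.specialUnitaryGroup (Fin 2) ℂ) : ℍ[ℝ] :=
  mkQuat (u.1 0 0).re (u.1 0 0).im (u.1 0 1).re (u.1 0 1).im

theorem specialUnitary_entries (u : Matrix.specialUnitaryGroup (Fin 2) ℂ) :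
    u.1 1 1 = star (u.1 0 0) ∧ u.1 1 0 = -star (u.1 0 1) ∧
      Complex.normSq (u.1 0 0) + Complex.normSq (u.1 0 1) = 1 := by
  obtain ⟨h1, h2⟩ := Matrix.mem_specialUnitaryGroup_iff.1 u.2
  rw [Matrix.mem_unitaryGroup_iff] at h1
  have h3 : star u.1 = u.1.adjugate := by
    have : u.1 * u.1.adjugate = 1 := by rw [Matrix.mul_adjugate, h2, one_smul]
    calc star u.1 = star u.1 * (u.1 * u.1.adjugate) := by rw [this, mul_one]
      _ = u.1.adjugate := by rw [← mul_assoc, mul_eq_one_comm.1 h1, one_mul]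
  rw [Matrix.adjugate_fin_two] at h3
  have e00 := congrFun (congrFun h3 0) 0
  have e10 := congrFun (congrFun h3 1) 0
  have e := congrFun (congrFun h1 0) 0
  simp [Matrix.star_apply] at e00 e10
  simp [Matrix.mul_apply, Matrix.star_apply, Complex.mul_conj] at e
  refine ⟨e00.symm, ?_, by exact_mod_cast e⟩
  rw [eq_neg_iff_add_eq_zero]; simp [e10]

theorem isSU2_selfDualSU2 : IsSU2 selfDualSU2 := by
  have hmul : ∀ u v, quatOfSU2 (u * v) = quatOfSU2 u * quatOfSU2 v := by
    intro u v
    obtain ⟨v1, v2, -⟩ := specialUnitary_entries v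
    have e0 : (u * v).1 0 0 = u.1 0 0 * v.1 0 0 + u.1 0 1 * v.1 1 0 := by
      simp [Matrix.mul_apply]
    have e1 : (u * v).1 0 1 = u.1 0 0 * v.1 0 1 + u.1 0 1 * v.1 1 1 := by
      simp [Matrix.mul_apply]
    ext <;> simp [quatOfSU2, e0, e1, v1, v2] <;> ring
  have hone : quatOfSU2 1 = 1 := by ext <;> simp [quatOfSU2]
  refine ⟨{ toFun := fun u => quatMat (quatOfSU2 u), map_one' := by rw [hone, map_one],
            map_mul' := fun u v => by rw [hmul, map_mul] }, ?_, ?_, ?_⟩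
  · refine continuous_matrix fun a b => ?_
    have h0 : Continuous fun u : Matrix.specialUnitaryGroup (Fin 2) ℂ => u.1 0 0 :=
      continuous_subtype_val.matrix_elem 0 0
    have h1 : Continuous fun u : Matrix.specialUnitaryGroup (Fin 2) ℂ => u.1 0 1 :=
      continuous_subtype_val.matrix_elem 0 1
    have c0 := Complex.continuous_re.comp h0
    have c1 := Complex.continuous_im.comp h0
    have c2 := Complex.continuous_re.comp h1
    have c3 := Complex.continuous_im.comp h1
    fin_cases a <;> fin_cases b <;> simp [quatMat_apply, quatOfSU2] <;>
      first
      | exact c0 | exact c1 | exact c2 | exact c3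
      | exact c0.neg | exact c1.neg | exact c2.neg | exact c3.neg
  · intro u v h
    have h' := quatMat_injective h
    have q0 := congrArg QuaternionAlgebra.re h'
    have q1 := congrArg QuaternionAlgebra.imI h'
    have q2 := congrArg QuaternionAlgebra.imJ h'
    have q3 := congrArg QuaternionAlgebra.imK h'
    simp only [quatOfSU2, mkQuat_re, mkQuat_imI, mkQuat_imJ, mkQuat_imK] at q0 q1 q2 q3
    have r0 : u.1 0 0 = v.1 0 0 := Complex.ext q0 q1
    have r1 : u.1 0 1 = v.1 0 1 := Complex.ext q2 q3
    obtain ⟨u1, u2, -⟩ := specialUnitary_entries u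
    obtain ⟨v1, v2, -⟩ := specialUnitary_entries v
    ext a b
    fin_cases a <;> fin_cases b <;> simp [r0, r1, u1, u2, v1, v2]
  · ext Λ
    rw [mem_selfDualSU2_iff]
    constructor
    · rintro ⟨u, rfl⟩
      refine ⟨quatOfSU2 u, ?_, rfl⟩
      have := (specialUnitary_entries u).2.2
      rw [Quaternion.normSq_def']
      simp only [Complex.normSq_apply] at this
      simp only [quatOfSU2, mkQuat_re, mkQuat_imI, mkQuat_imJ, mkQuat_imK]
      linarith
    · rintro ⟨q, hq, rfl⟩
      rw [Quaternion.normSq_def'] at hq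
      refine ⟨⟨!![⟨q.re, q.imI⟩, ⟨q.imJ, q.imK⟩; ⟨-q.imJ, q.imK⟩, ⟨q.re, -q.imI⟩], ?_⟩, ?_⟩
      · rw [Matrix.mem_specialUnitaryGroup_iff, Matrix.mem_unitaryGroup_iff]
        constructor
        · ext a b
          fin_cases a <;> fin_cases b <;>
            simp [Matrix.mul_apply, Matrix.star_apply, Complex.ext_iff] <;>
            (constructor <;> linarith)
        · simp [Matrix.det_fin_two, Complex.ext_iff]
          constructor <;> linarith
      · change quatMat (quatOfSU2 _) = _
        congr 1

/-! ### The single copy holonomy group -/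

theorem hasDerivWithinAt_matrix_iff {W : ℝ → Mat4} {W' : Mat4} {s : Set ℝ} {t : ℝ} :
    HasDerivWithinAt W W' s t ↔
      ∀ c d, HasDerivWithinAt (fun τ => W τ c d) (W' c d) s t := by
  constructor
  · intro h c d
    exact (LinearMap.toContinuousLinearMap
      (Matrix.entryLinearMap ℝ ℝ c d)).hasFDerivAt.comp_hasDerivWithinAt t h
  · intro h
    have h1 : HasDerivWithinAt (fun τ => ∑ c, ∑ d, W τ c d • Matrix.single c d (1 : ℝ))
        (∑ c, ∑ d, W' c d • Matrix.single c d (1 : ℝ)) s t :=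
      HasDerivWithinAt.fun_sum fun c _ => HasDerivWithinAt.fun_sum fun d _ =>
        (h c d).smul_const _
    have e : ∀ X : Mat4, ∑ c, ∑ d, X c d • Matrix.single c d (1 : ℝ) = X := fun X => by
      conv_rhs => rw [Matrix.matrix_eq_sum_single X]
      simp
    simpa only [e] using h1

/-- If the coefficients are skew for a linear anti-automorphism `σ`, the solution is unitary. -/
theorem adjoint_mul_self_of_skew {σ : Mat4 →ₗ[ℝ] Mat4} (hσ1 : σ 1 = 1)
    (hσ : ∀ a b, σ (a * b) = σ b * σ a) {B W : ℝ → Mat4} {S : ℝ} (hS : 0 ≤ S)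
    (hW : ∀ s ∈ Icc 0 S, HasDerivWithinAt W (B s * W s) (Icc 0 S) s) (hW0 : W 0 = 1)
    (hB : ∀ s ∈ Icc 0 S, σ (B s) = -B s) : ∀ s ∈ Icc 0 S, σ (W s) * W s = 1 := by
  have h1 : ∀ s ∈ Icc 0 S, HasDerivWithinAt (fun s => σ (W s) * W s) 0 (Icc 0 S) s := by
    intro s hs
    have h2 : HasDerivWithinAt (fun s => σ (W s)) (σ (B s * W s)) (Icc 0 S) s :=
      (LinearMap.toContinuousLinearMap σ).hasFDerivAt.comp_hasDerivWithinAt s (hW s hs)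
    refine (h2.mul (hW s hs)).congr_deriv ?_
    rw [hσ, hB s hs]
    noncomm_ring
  intro s hs
  have h3 := constant_of_derivWithin_zero (fun s hs => (h1 s hs).differentiableWithinAt)
    (fun s hs => (h1 s (Ico_subset_Icc_self hs)).derivWithin
      (uniqueDiffOn_Icc (lt_of_le_of_lt hs.1 hs.2) s (Ico_subset_Icc_self hs))) s hs
  simpa [hW0, hσ1] using h3

/-- What commutes with the coefficients commutes with the solution. -/
theorem commute_of_commute {B W : ℝ → Mat4} {S : ℝ} (hB : ContinuousOn B (Icc 0 S))
    (hW : ∀ s ∈ Icc 0 S, HasDerivWithinAt W (B s * W s) (Icc 0 S) s) (hW0 : W 0 = 1) {Y : Mat4}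
    (hY : ∀ s ∈ Icc 0 S, B s * Y = Y * B s) : ∀ s ∈ Icc 0 S, W s * Y = Y * W s := by
  have hc : ContinuousOn W (Icc 0 S) := fun s hs => (hW s hs).continuousWithinAt
  have hr : ∀ s ∈ Ico 0 S, HasDerivWithinAt W (B s * W s) (Ici s) s := fun s hs =>
    (hW s (Ico_subset_Icc_self hs)).mono_of_mem_nhdsWithin (Icc_mem_nhdsGE_of_mem hs)
  refine linearODE_unique (B := fun s => ContinuousLinearMap.mul ℝ Mat4 (B s)) (by fun_prop)
    (by fun_prop) (by fun_prop) (fun s hs => ?_) (fun s hs => ?_) (by simp [hW0])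
  · simpa [mul_assoc] using (hr s hs).mul_const Y
  · refine ((hr s hs).const_mul Y).congr_deriv ?_
    simp only [ContinuousLinearMap.mul_apply']
    rw [← mul_assoc, ← mul_assoc, hY s (Ico_subset_Icc_self hs)]

theorem pos_of_continuousOn_of_ne_zero {f : ℝ → ℝ} {S : ℝ} (hS : 0 ≤ S)
    (hf : ContinuousOn f (Icc 0 S)) (h0 : 0 < f 0) (hne : ∀ s ∈ Icc 0 S, f s ≠ 0) : 0 < f S := by
  by_contra h
  obtain ⟨s, hs, h1⟩ := intermediate_value_Icc' hS hf ⟨not_lt.1 h, h0.le⟩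
  exact hne s hs h1

theorem mem_lorentzGroup_of_path {W : ℝ → Mat4} {S : ℝ} (hS : 0 ≤ S)
    (hW : ContinuousOn W (Icc 0 S)) (hW0 : W 0 = 1)
    (h : ∀ s ∈ Icc 0 S, (W s)ᵀ * minkowski * W s = minkowski) : W S ∈ lorentzGroup := by
  have hmem : S ∈ Icc 0 S := right_mem_Icc.2 hS
  have hd : minkowski.det = -1 := by simp [minkowski, Fin.prod_univ_four]
  have hdet : ∀ s ∈ Icc 0 S, (W s).det * (W s).det = 1 := fun s hs => by
    have := congrArg Matrix.det (h s hs)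
    rw [Matrix.det_mul, Matrix.det_mul, Matrix.det_transpose, hd] at this
    linarith
  refine ⟨h S hmem, eq_one_of_mul_self_eq_one (hdet S hmem) ?_, ?_⟩
  · have hc : Continuous (fun Λ : Mat4 => Λ.det) := continuous_id.matrix_det
    refine (pos_of_continuousOn_of_ne_zero hS (hc.comp_continuousOn hW) (by simp [hW0])
      fun s hs h0 => ?_).le
    have := hdet s hs
    simp only [Function.comp_apply] at h0
    rw [h0] at this; simp at this
  · have hc : Continuous (fun Λ : Mat4 => Λ 0 0) := continuous_id.matrix_elem 0 0
    refine pos_of_continuousOn_of_ne_zero (f := fun s => W s 0 0) hS (hc.comp_continuousOn hW)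
      (by simp [hW0]) fun s hs h0 => ?_
    have := lorentz_col_zero (h s hs)
    rw [h0] at this
    nlinarith [sq_nonneg (W s 1 0), sq_nonneg (W s 2 0), sq_nonneg (W s 3 0)]

/-- The velocity at time `0` of the solution along a path that runs out for the time `s / 2` and
back for the time `s / 2`. -/
theorem hasStrictDerivAt_outAndBack {𝔸 : Type*} [NormedRing 𝔸] [NormedAlgebra ℝ 𝔸]
    [CompleteSpace 𝔸] {b : ℝ → 𝔸} (hb : Continuous b) :
    HasStrictDerivAt (fun s : ℝ => Ring.inverse (pathOrderedExp (fun a => -b a) (s / 2)) *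
      pathOrderedExp b (s / 2)) (b 0) 0 := by
  have hstrict : ∀ {b : ℝ → 𝔸}, Continuous b →
      HasStrictDerivAt (fun s : ℝ => pathOrderedExp b (s / 2)) ((1 / 2 : ℝ) • b 0) 0 := by
    intro b hb
    have hc := continuous_pathOrderedExp hb
    have h := hasStrictDerivAt_of_hasDerivAt_of_continuousAt (f := pathOrderedExp b)
      (f' := fun t => b t * pathOrderedExp b t) (x := 0 / 2)
      (.of_forall (hasDerivAt_pathOrderedExp hb)) (by fun_prop)
    have hhalf : HasStrictDerivAt (fun s : ℝ => s / 2) (1 / 2) 0 :=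
      (hasStrictDerivAt_id (0 : ℝ)).div_const 2
    have h2 := HasStrictDerivAt.scomp (0 : ℝ) h hhalf
    simp only [zero_div, pathOrderedExp_zero, mul_one] at h2
    exact h2
  have hinv : HasStrictFDerivAt Ring.inverse
      (-ContinuousLinearMap.mulLeftRight ℝ 𝔸 ↑(1 : 𝔸ˣ)⁻¹ ↑(1 : 𝔸ˣ)⁻¹)
      (pathOrderedExp (fun a => -b a) (0 / 2)) := by
    simpa [pathOrderedExp_zero] using hasStrictFDerivAt_ringInverse (𝕜 := ℝ) (1 : 𝔸ˣ)
  have h := (hinv.comp_hasStrictDerivAt (0 : ℝ) (hstrict hb.neg)).mul (hstrict hb)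
  refine h.congr_deriv ?_
  simp only [Function.comp_apply, zero_div, pathOrderedExp_zero, Ring.inverse_one, inv_one,
    Units.val_one, ContinuousLinearMap.neg_apply, ContinuousLinearMap.mulLeftRight_apply, one_mul,
    mul_one, Pi.neg_apply, smul_neg, neg_neg]
  module

section SCH

variable {η : Mat4} {κ : ℝ} {F : E4 → Mat4} {U : Set E4} {𝒞 : Set ClosedCurve}

theorem isUnitGroup_schGroup : IsUnitGroup (schGroup η κ F U 𝒞) where
  one_mem := ⟨1, one_mem _, rfl⟩
  mul_mem := by
    rintro _ _ ⟨u, hu, rfl⟩ ⟨v, hv, rfl⟩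
    exact ⟨u * v, mul_mem hu hv, rfl⟩
  exists_inv := by
    rintro _ ⟨u, hu, rfl⟩
    exact ⟨_, ⟨u⁻¹, inv_mem hu, rfl⟩, u.mul_inv, u.inv_mul⟩

theorem schGroup_subset {G : Set Mat4} (hG : IsUnitGroup G)
    (h : ∀ C ∈ 𝒞, MapsTo C.x (Icc 0 C.S) U → ∀ Φ, IsSCHOperator η κ F C Φ → Φ ∈ G) :
    schGroup η κ F U 𝒞 ⊆ G := by
  rintro _ ⟨u, hu, rfl⟩
  induction hu using Subgroup.closure_induction with
  | mem u hu =>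
    obtain ⟨C, hC, hCU, hop⟩ := hu
    exact h C hC hCU _ hop
  | one => exact hG.one_mem
  | mul u v _ _ hu hv => exact hG.mul_mem hu hv
  | inv u _ hu =>
    obtain ⟨b, hb, h1, h2⟩ := hG.exists_inv hu
    have : b = (u⁻¹ : Mat4ˣ) := by
      calc b = b * (u * (u⁻¹ : Mat4ˣ)) := by rw [u.mul_inv, mul_one]
        _ = _ := by rw [← mul_assoc, h2, one_mul]
    rwa [← this]

theorem isSCHOperator_iff {C : ClosedCurve} {Φ : Mat4} :
    IsSCHOperator η κ F C Φ ↔ ∃ W : ℝ → Mat4, W 0 = 1 ∧ W C.S = Φ ∧ ∀ s ∈ Icc 0 C.S,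
      HasDerivWithinAt W (schIntegrand η κ (F (C.x s)) * W s) (Icc 0 C.S) s := by
  simp only [IsSCHOperator, hasDerivWithinAt_matrix_iff]

theorem continuous_schIntegrand : Continuous (schIntegrand η κ) := by
  have : schIntegrand η κ = fun F : Mat4 => (κ / 2) • ∑ a, ∑ b, F a b • generator η a b := rfl
  rw [this]
  have h : ∀ a b, Continuous fun F : Mat4 => F a b := fun a b => continuous_id.matrix_elem a b
  fun_prop

theorem OnPieces.continuousOn {X : Type*} [TopologicalSpace X] {γ : ℝ → X} {P : ℝ → ℝ → Prop}
    {a b : ℝ} (h : OnPieces P a b) (hP : ∀ c d, P c d → ContinuousOn γ (Icc c d)) :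
    ContinuousOn γ (Icc a b) := by
  obtain ⟨n, t, ht, rfl, rfl, hp⟩ := h
  induction n with
  | zero => simp
  | succ n ih =>
    rw [← Icc_union_Icc_eq_Icc (ht.monotone (Nat.zero_le n)) (ht.monotone n.le_succ)]
    exact (ih fun i hi => hp i (hi.trans n.lt_succ_self)).union_of_isClosed
      (hP _ _ (hp n n.lt_succ_self)) isClosed_Icc isClosed_Icc

theorem ClosedCurve.continuousOn (C : ClosedCurve) : ContinuousOn C.x (Icc 0 C.S) :=
  C.piecewise.continuousOn fun _ _ h => h.continuousOn

/-- The closed curve that runs from `x₀` along the segment of direction `basisVec i` and length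
`s / 2`, and back. -/
def outAndBack (x₀ : E4) (i : Fin 4) (s : ℝ) (hs : 0 < s) : ClosedCurve where
  S := s
  S_pos := hs
  x u := x₀ + min u (s - u) • basisVec i
  closed := by simp [hs.le]
  piecewise := by
    have h1 : ContDiffOn ℝ 1 (fun u : ℝ => x₀ + u • basisVec i) univ :=
      ContDiff.contDiffOn (by fun_prop)
    have h2 : ContDiffOn ℝ 1 (fun u : ℝ => x₀ + (s - u) • basisVec i) univ :=
      ContDiff.contDiffOn (by fun_prop)
    refine ⟨2, fun k => k * (s / 2), fun a b h => by
      simpa [hs] using h, by simp, by simp; ring, fun k hk => ?_⟩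
    interval_cases k
    · refine (h1.mono (subset_univ _)).congr fun u hu => ?_
      simp only [Nat.cast_zero, zero_mul, zero_add, Nat.cast_one, one_mul, mem_Icc] at hu
      rw [min_eq_left (by linarith [hu.2])]
    · refine (h2.mono (subset_univ _)).congr fun u hu => ?_
      simp only [Nat.cast_one, one_mul, mem_Icc] at hu
      rw [min_eq_right (by linarith [hu.1])]

theorem outAndBack_mem (x₀ : E4) {i : Fin 4} (hi : i ≠ 0) {s : ℝ} (hs : 0 < s) :
    outAndBack x₀ i s hs ∈ arcLengthCurves := by
  have key : ∀ (f : ℝ → E4) (c d σ : ℝ), c < d → |σ| = 1 → ContDiff ℝ 1 f → (∀ u ∈ Icc c d,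
      (outAndBack x₀ i s hs).x u = f u) → (∀ u, HasDerivAt f (σ • basisVec i) u) →
      ContDiffOn ℝ 1 (outAndBack x₀ i s hs).x (Icc c d) ∧ ∀ u ∈ Icc c d,
        (derivWithin (outAndBack x₀ i s hs).x (Icc c d) u) 0 = 0 ∧
        ‖derivWithin (outAndBack x₀ i s hs).x (Icc c d) u‖ = 1 := by
    intro f c d σ hcd hσ hfc hf hf'
    refine ⟨hfc.contDiffOn.congr hf, fun u hu => ?_⟩
    have : derivWithin (outAndBack x₀ i s hs).x (Icc c d) u = σ • basisVec i := by
      rw [derivWithin_congr hf (hf u hu)]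
      exact (hf' u).hasDerivWithinAt.derivWithin (uniqueDiffOn_Icc hcd u hu)
    rw [this]
    constructor
    · simp [basisVec, hi.symm]
    · rw [norm_smul, Real.norm_eq_abs, hσ]; simp [basisVec]
  refine ⟨2, fun k => k * (s / 2), fun a b h => by simpa [hs] using h, by simp,
    by simp [outAndBack]; ring, fun k hk => ?_⟩
  interval_cases k
  · refine key (fun u => x₀ + u • basisVec i) _ _ 1 (by simpa using hs) (by simp) (by fun_prop)
      (fun u hu => ?_) fun u => ((hasDerivAt_id u).smul_const _).const_add _
    simp only [Nat.cast_zero, zero_mul, zero_add, Nat.cast_one, one_mul, mem_Icc] at hu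
    simp only [outAndBack]
    rw [min_eq_left (by linarith [hu.2])]
  · refine key (fun u => x₀ + (s - u) • basisVec i) _ _ (-1) (by simp; linarith) (by simp)
      (by fun_prop) (fun u hu => ?_)
      fun u => (((hasDerivAt_id u).const_sub s).smul_const _).const_add _
    simp only [Nat.cast_one, one_mul, mem_Icc] at hu
    simp only [outAndBack]
    rw [min_eq_right (by linarith [hu.1])]

/-- The integrand at each point is tangent to the SCH group: it is the velocity of the operators of
short closed curves that run out and back along a segment. -/
theorem schIntegrand_mem_tangentSpaceOne (hU : IsOpen U) (hF : ContinuousOn F U)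
    (h𝒞 : arcLengthCurves ⊆ 𝒞) {x : E4} (hx : x ∈ U) :
    schIntegrand η κ (F x) ∈
      tangentSpaceOne (isUnitGroup_schGroup (η := η) (κ := κ) (F := F) (U := U) (𝒞 := 𝒞)) := by
  obtain ⟨δ, hδ, hball⟩ := Metric.isOpen_iff.1 hU x hx
  set ε := δ / 2 with hε
  have hε0 : 0 < ε := by positivity
  set cl : ℝ → ℝ := fun a => max (-ε) (min a ε) with hcl
  have hcl_of : ∀ a, 0 ≤ a → a ≤ ε → cl a = a := fun a h0 h1 => by
    simp only [hcl]; rw [min_eq_left h1, max_eq_right (by linarith)]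
  have hclU : ∀ a, x + cl a • basisVec 1 ∈ U := fun a => by
    refine hball ?_
    have h1 : |cl a| ≤ ε := abs_le.2 ⟨le_max_left _ _, max_le (by linarith) (min_le_right _ _)⟩
    rw [Metric.mem_ball, dist_self_add_left, norm_smul]
    simp only [basisVec, PiLp.norm_single, norm_one, mul_one, Real.norm_eq_abs]
    linarith
  set b : ℝ → Mat4 := fun a => schIntegrand η κ (F (x + cl a • basisVec 1)) with hb
  have hbc : Continuous b := by
    refine continuous_schIntegrand.comp (hF.comp_continuous ?_ hclU)
    have : Continuous cl := by fun_prop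
    fun_prop
  have hb0 : b 0 = schIntegrand η κ (F x) := by
    simp only [hb]; rw [hcl_of 0 le_rfl hε0.le, zero_smul, add_zero]
  have hnb : Continuous fun a => -b a := hbc.neg
  set P := pathOrderedExp b
  set R := pathOrderedExp fun a => -b a
  have hP := hasDerivAt_pathOrderedExp hbc
  have hR := hasDerivAt_pathOrderedExp hnb
  have hP0 : P 0 = 1 := pathOrderedExp_zero
  have hR0 : R 0 = 1 := pathOrderedExp_zero
  have hPc : Continuous P := continuous_pathOrderedExp hbc
  have hRc : Continuous R := continuous_pathOrderedExp hnb
  obtain ⟨NR, -, -, hNR⟩ := exists_inverse_pathOrderedExp hnb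
  obtain ⟨NP, -, -, hNP⟩ := exists_inverse_pathOrderedExp hbc
  have hRinv : ∀ t, 0 ≤ t → Ring.inverse (R t) = NR t := fun t ht =>
    Ring.inverse_unit (⟨R t, NR t, (hNR t ht).2, (hNR t ht).1⟩ : Mat4ˣ)
  refine mem_tangentSpaceOne_of_nonneg _ (c := fun s => Ring.inverse (R (s / 2)) * P (s / 2))
    (by simp [hP0, hR0]) ?_ ?_
  · rw [← hb0]
    exact hasStrictDerivAt_outAndBack hbc
  have hmem : ∀ s : ℝ, 0 < s → s < 2 * ε →
      Ring.inverse (R (s / 2)) * P (s / 2) ∈ schGroup η κ F U 𝒞 := by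
    intro s hs hsε
    have hs2 : 0 ≤ s / 2 := by positivity
    rw [hRinv _ hs2]
    refine ⟨⟨NR (s / 2) * P (s / 2), NP (s / 2) * R (s / 2), ?_, ?_⟩, Subgroup.subset_closure
      ⟨outAndBack x 1 s hs, h𝒞 (outAndBack_mem x (by decide) hs), ?_, ?_⟩, rfl⟩
    · rw [mul_assoc, ← mul_assoc (P _), (hNP _ hs2).2, one_mul, (hNR _ hs2).1]
    · rw [mul_assoc, ← mul_assoc (R _), (hNR _ hs2).2, one_mul, (hNP _ hs2).1]
    · intro u hu
      replace hu : 0 ≤ u ∧ u ≤ s := hu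
      have h1 := hclU (min u (s - u))
      rwa [hcl_of _ (le_min hu.1 (by linarith [hu.2])) (by
        rcases le_total u (s / 2) with h | h
        · exact (min_le_left _ _).trans (by linarith)
        · exact (min_le_right _ _).trans (by linarith))] at h1
    · rw [isSCHOperator_iff]
      let A : ℝ → Mat4 := fun u => b (min u (s - u))
      have hA : ∀ u ∈ Icc 0 s, A u = schIntegrand η κ (F ((outAndBack x 1 s hs).x u)) := by
        intro u hu
        simp only [A, hb]
        rw [hcl_of _ (le_min hu.1 (by linarith [hu.2])) (by
          rcases le_total u (s / 2) with h | h
          · exact (min_le_left _ _).trans (by linarith)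
          · exact (min_le_right _ _).trans (by linarith))]
        rfl
      have hAc : Continuous A := by fun_prop
      have hW := hasDerivAt_pathOrderedExp hAc
      have hWc : Continuous (pathOrderedExp A) := continuous_pathOrderedExp hAc
      have h1 : EqOn (pathOrderedExp A) P (Icc 0 (s / 2)) := by
        refine linearODE_unique (B := fun u => ContinuousLinearMap.mul ℝ Mat4 (A u)) (by fun_prop)
          hWc.continuousOn hPc.continuousOn (fun u hu => (hW u).hasDerivWithinAt) (fun u hu => ?_)
          (by rw [pathOrderedExp_zero, hP0])
        have : A u = b u := by
          simp only [A]; rw [min_eq_left (by linarith [hu.2])]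
        simp only [ContinuousLinearMap.mul_apply', this]
        exact (hP u).hasDerivWithinAt
      have h2 : EqOn (pathOrderedExp A) (fun u => R (s - u) * (NR (s / 2) * P (s / 2)))
          (Icc (s / 2) s) := by
        refine linearODE_unique (B := fun u => ContinuousLinearMap.mul ℝ Mat4 (A u)) (by fun_prop)
          hWc.continuousOn (by fun_prop) (fun u hu => (hW u).hasDerivWithinAt) (fun u hu => ?_) ?_
        · have : A u = b (s - u) := by
            simp only [A]; rw [min_eq_right (by linarith [hu.1])]
          simp only [ContinuousLinearMap.mul_apply', this]
          have h3 : HasDerivAt (fun u => R (s - u)) _ u :=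
            (hR (s - u)).scomp u ((hasDerivAt_id u).const_sub s)
          refine (h3.mul_const _).hasDerivWithinAt.congr_deriv ?_
          simp [R, mul_assoc]
        · have e : s - s / 2 = s / 2 := by ring
          rw [h1 (right_mem_Icc.2 hs2), e, ← mul_assoc, (hNR _ hs2).2, one_mul]
      refine ⟨pathOrderedExp A, pathOrderedExp_zero, ?_, fun u hu => ?_⟩
      · have := h2 (right_mem_Icc.2 (by linarith))
        simp only [sub_self, hR0, one_mul] at this
        exact this
      · rw [← hA u hu]
        exact (hW u).hasDerivWithinAt
  have : Ico 0 (2 * ε) ∈ 𝓝[≥] (0 : ℝ) := Ico_mem_nhdsGE (by positivity)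
  filter_upwards [this] with s hs
  rcases hs.1.eq_or_lt with h | h
  · simp only [← h, zero_div, hR0, hP0, Ring.inverse_one, mul_one]
    exact isUnitGroup_schGroup.one_mem
  · exact hmem s h hs.2

end SCH

theorem lorentzAdjoint_mul (a b : Mat4) :
    lorentzAdjoint (a * b) = lorentzAdjoint b * lorentzAdjoint a := by
  simp only [lorentzAdjoint_apply, Matrix.transpose_mul]
  calc minkowski * (bᵀ * aᵀ) * minkowski
      = minkowski * bᵀ * (minkowski * minkowski) * aᵀ * minkowski := by
        rw [minkowski_mul_self, mul_one]; simp only [mul_assoc]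
    _ = _ := by simp only [mul_assoc]

theorem lorentzAdjoint_one : lorentzAdjoint 1 = 1 := by
  simp [lorentzAdjoint_apply, minkowski_mul_self]

theorem lorentz_of_lorentzAdjoint_mul {Λ : Mat4} (h : lorentzAdjoint Λ * Λ = 1) :
    Λᵀ * minkowski * Λ = minkowski := by
  calc Λᵀ * minkowski * Λ = (minkowski * minkowski) * Λᵀ * minkowski * Λ := by
        rw [minkowski_mul_self, one_mul]
    _ = minkowski * (lorentzAdjoint Λ * Λ) := by
        rw [lorentzAdjoint_apply]; simp only [mul_assoc]
    _ = minkowski := by rw [h, mul_one]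

theorem boostGen_mem (i : Fin 3) : boostGen i ∈ lorentzAlgebra := by
  change lorentzAdjoint _ = _
  ext a b
  simp only [lorentzAdjoint_apply, minkowski, Matrix.mul_diagonal, Matrix.diagonal_mul,
    Matrix.transpose_apply]
  fin_cases i <;> fin_cases a <;> fin_cases b <;> simp [boostGen]

theorem rotGen_mem (i j : Fin 3) : rotGen i j ∈ lorentzAlgebra := by
  change lorentzAdjoint _ = _
  ext a b
  simp only [lorentzAdjoint_apply, minkowski, Matrix.mul_diagonal, Matrix.diagonal_mul,
    Matrix.transpose_apply]
  fin_cases i <;> fin_cases j <;> fin_cases a <;> fin_cases b <;>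
    simp [rotGen]

theorem schIntegrand_pointCharge (κ Q : ℝ) (x : E4) :
    schIntegrand minkowski κ (pointCharge Q x) = -(κ * Q / (4 * Real.pi * radius x ^ 3)) •
      (x 1 • boostGen 0 + x 2 • boostGen 1 + x 3 • boostGen 2) := by
  ext c d
  simp only [schIntegrand, pointCharge, generator, minkowski, Matrix.smul_apply,
    Fin.sum_univ_four, Matrix.of_apply, Matrix.diagonal_apply, Matrix.add_apply]
  fin_cases c <;> fin_cases d <;> simp [boostGen] <;> ring

theorem schIntegrand_monopole (κ q : ℝ) (x : E4) :
    schIntegrand minkowski κ (monopole q x) = (κ * q / (4 * Real.pi * radius x ^ 3)) •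
      (x 1 • rotGen 1 2 + x 2 • rotGen 2 0 + x 3 • rotGen 0 1) := by
  ext c d
  simp only [schIntegrand, monopole, generator, minkowski, Matrix.smul_apply,
    Fin.sum_univ_four, Matrix.of_apply, Matrix.diagonal_apply, Matrix.add_apply, leviCivita_eq]
  fin_cases c <;> fin_cases d <;> simp [rotGen, permSign] <;> ring

theorem schIntegrand_one (κ : ℝ) {F : Mat4} (hF : Fᵀ = -F) : schIntegrand 1 κ F = κ • F := by
  have e : ∀ a b, F b a = -F a b := fun a b => congrFun (congrFun hF a) b
  have d0 : ∀ a, F a a = 0 := fun a => by linarith [e a a]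
  ext c d
  simp only [schIntegrand, generator, Matrix.smul_apply, Fin.sum_univ_four,
    Matrix.one_apply]
  fin_cases c <;> fin_cases d <;>
    simp [d0, e 0 1, e 0 2, e 0 3, e 1 2, e 1 3, e 2 3] <;> ring

theorem continuous_radius : Continuous radius := by
  unfold radius
  fun_prop

theorem isOpen_radius_gt (ρ : ℝ) : IsOpen {x : E4 | ρ < radius x} :=
  isOpen_lt continuous_const continuous_radius

theorem radius_basisVec (i : Fin 3) : radius (basisVec i.succ) = 1 := by
  fin_cases i <;> simp [radius, basisVec]

theorem continuousOn_pointCharge (Q : ℝ) :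
    ContinuousOn (pointCharge Q) {x | 0 < radius x} := by
  refine continuousOn_pi.2 fun a => continuousOn_pi.2 fun b => ?_
  have h : ContinuousOn (fun x => Q / (4 * Real.pi * radius x ^ 3)) {x | 0 < radius x} :=
    continuousOn_const.div (by have := continuous_radius; fun_prop) fun x hx => by
      have : 0 < radius x := hx
      positivity
  refine h.mul (Continuous.continuousOn ?_)
  split_ifs <;> fun_prop

theorem continuousOn_monopole (q : ℝ) : ContinuousOn (monopole q) {x | 0 < radius x} := by
  refine continuousOn_pi.2 fun a => continuousOn_pi.2 fun b => ?_
  have h : ContinuousOn (fun x => q / (4 * Real.pi * radius x ^ 3)) {x | 0 < radius x} :=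
    continuousOn_const.div (by have := continuous_radius; fun_prop) fun x hx => by
      have : 0 < radius x := hx
      positivity
  exact h.mul (Continuous.continuousOn (by fun_prop))

theorem continuousOn_integrand {η : Mat4} {κ : ℝ} {F : E4 → Mat4} {U : Set E4}
    (hF : ContinuousOn F U) {C : ClosedCurve} (hC : MapsTo C.x (Icc 0 C.S) U) :
    ContinuousOn (fun s => schIntegrand η κ (F (C.x s))) (Icc 0 C.S) :=
  continuous_schIntegrand.comp_continuousOn (hF.comp C.continuousOn hC)

theorem mem_lorentzGroup_of_isSCHOperator {κ : ℝ} {F : E4 → Mat4} {U : Set E4}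
    (hF : ∀ x ∈ U, schIntegrand minkowski κ (F x) ∈ lorentzAlgebra) {C : ClosedCurve}
    (hC : MapsTo C.x (Icc 0 C.S) U) {W : ℝ → Mat4} (hW0 : W 0 = 1)
    (hW : ∀ s ∈ Icc 0 C.S, HasDerivWithinAt W (schIntegrand minkowski κ (F (C.x s)) * W s)
      (Icc 0 C.S) s) : W C.S ∈ lorentzGroup :=
  mem_lorentzGroup_of_path C.S_pos.le (fun s hs => (hW s hs).continuousWithinAt) hW0 fun s hs =>
    lorentz_of_lorentzAdjoint_mul (adjoint_mul_self_of_skew lorentzAdjoint_one lorentzAdjoint_mul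
      C.S_pos.le hW hW0 (fun s hs => hF _ (hC hs)) s hs)

theorem schGroup_pointCharge {Q κ : ℝ} (hQ : Q ≠ 0) (hκ : κ ≠ 0) {𝒞 : Set ClosedCurve}
    (h𝒞 : arcLengthCurves ⊆ 𝒞) :
    schGroup minkowski κ (pointCharge Q) {x | 0 < radius x} 𝒞 = lorentzGroup := by
  refine lorentzGroup_eq_of_tangent isUnitGroup_schGroup
    (schGroup_subset isUnitGroup_lorentzGroup fun C _ hC Φ hΦ => ?_)
    (lorentzAlgebra_le_of_boostGen _ fun i => ?_)
  · obtain ⟨W, hW0, rfl, hW⟩ := isSCHOperator_iff.1 hΦ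
    refine mem_lorentzGroup_of_isSCHOperator (fun x _ => ?_) hC hW0 hW
    rw [schIntegrand_pointCharge]
    have m := fun (c : ℝ) (i : Fin 3) => lorentzAlgebra.smul_mem c (boostGen_mem i)
    exact lorentzAlgebra.smul_mem _ (add_mem (add_mem (m _ 0) (m _ 1)) (m _ 2))
  · have hx : basisVec i.succ ∈ {x | 0 < radius x} := by simp [radius_basisVec]
    have h := schIntegrand_mem_tangentSpaceOne (η := minkowski) (κ := κ) (isOpen_radius_gt 0)
      (continuousOn_pointCharge Q) h𝒞 hx
    have e : schIntegrand minkowski κ (pointCharge Q (basisVec i.succ))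
        = -(κ * Q / (4 * Real.pi)) • boostGen i := by
      rw [schIntegrand_pointCharge, radius_basisVec]
      fin_cases i <;> simp [basisVec]
    rw [e] at h
    exact (Submodule.smul_mem_iff _ (neg_ne_zero.2 (by positivity))).1 h

theorem schGroup_monopole {q κ : ℝ} (hq : q ≠ 0) (hκ : κ ≠ 0) {𝒞 : Set ClosedCurve}
    (h𝒞 : arcLengthCurves ⊆ 𝒞) :
    schGroup minkowski κ (monopole q) {x | 0 < radius x} 𝒞 = rotationGroup := by
  refine rotationGroup_eq_of_tangent isUnitGroup_schGroup
    (schGroup_subset isUnitGroup_rotationGroup fun C _ hC Φ hΦ => ?_) ?_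
  · obtain ⟨W, hW0, rfl, hW⟩ := isSCHOperator_iff.1 hΦ
    have hL : W C.S ∈ lorentzGroup := by
      refine mem_lorentzGroup_of_isSCHOperator (fun x _ => ?_) hC hW0 hW
      rw [schIntegrand_monopole]
      have m := fun (c : ℝ) (i j : Fin 3) => lorentzAlgebra.smul_mem c (rotGen_mem i j)
      exact lorentzAlgebra.smul_mem _ (add_mem (add_mem (m _ 1 2) (m _ 2 0)) (m _ 0 1))
    -- the integrand annihilates the time axis
    have hcomm := commute_of_commute (continuousOn_integrand (continuousOn_monopole q) hC) hW hW0
      (Y := Matrix.single 0 0 1) (fun s _ => by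
        rw [schIntegrand_monopole]
        simp [rotGen, mul_add, add_mul, mul_sub, sub_mul]) C.S (right_mem_Icc.2 C.S_pos.le)
    have hcol : ∀ i : Fin 3, W C.S i.succ 0 = 0 := fun i => by
      have := congrFun (congrFun hcomm i.succ) 0
      simpa [Matrix.mul_apply, Matrix.single_apply, (Fin.succ_ne_zero i).symm] using this
    refine mem_rotationGroup_iff.2 ⟨hL, ?_, hcol⟩
    have h0 := lorentz_col_zero hL.1
    have h1 := hcol 0; have h2 := hcol 1; have h3 := hcol 2
    simp only [Fin.succ_zero_eq_one, Fin.succ_one_eq_two] at h1 h2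
    have h3' : W C.S 3 0 = 0 := h3
    rw [h1, h2, h3'] at h0
    exact eq_one_of_mul_self_eq_one (by linarith) hL.2.2.le
  · have key : ∀ (k i j : Fin 3), schIntegrand minkowski κ (monopole q (basisVec k.succ))
        = (κ * q / (4 * Real.pi)) • rotGen i j →
        rotGen i j ∈ tangentSpaceOne (isUnitGroup_schGroup (η := minkowski) (κ := κ)
          (F := monopole q) (U := {x | 0 < radius x}) (𝒞 := 𝒞)) := by
      intro k i j e
      have hx : basisVec k.succ ∈ {x | 0 < radius x} := by simp [radius_basisVec]
      have h := schIntegrand_mem_tangentSpaceOne (η := minkowski) (κ := κ) (isOpen_radius_gt 0)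
        (continuousOn_monopole q) h𝒞 hx
      rw [e] at h
      exact (Submodule.smul_mem_iff _ (by positivity)).1 h
    have k0 := key 0 1 2 (by rw [schIntegrand_monopole, radius_basisVec]; simp [basisVec])
    have k1 := key 1 2 0 (by rw [schIntegrand_monopole, radius_basisVec]; simp [basisVec])
    have k2 := key 2 0 1 (by rw [schIntegrand_monopole, radius_basisVec]; simp [basisVec])
    have hneg : ∀ i j, rotGen j i = -rotGen i j := fun i j => by simp [rotGen]
    intro i j hij
    fin_cases i <;> fin_cases j <;> first | exact absurd rfl hij | exact k0 | exact k1 | exact k2 |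
      (refine (hneg _ _).symm ▸ Submodule.neg_mem _ ?_; first | exact k0 | exact k1 | exact k2)

theorem commute_antiSelfDualI {X : Mat4} (hX : X ∈ selfDualAlgebra) :
    X * antiSelfDualI = antiSelfDualI * X := by
  obtain ⟨q, hq, rfl⟩ := mem_selfDualAlgebra_iff.1 hX
  ext a b
  fin_cases a <;> fin_cases b <;>
    simp [quatMat_apply, antiSelfDualI, Matrix.mul_apply, Fin.sum_univ_four, hq]

theorem commute_antiSelfDualJ {X : Mat4} (hX : X ∈ selfDualAlgebra) :
    X * antiSelfDualJ = antiSelfDualJ * X := by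
  obtain ⟨q, hq, rfl⟩ := mem_selfDualAlgebra_iff.1 hX
  ext a b
  fin_cases a <;> fin_cases b <;>
    simp [quatMat_apply, antiSelfDualJ, Matrix.mul_apply, Fin.sum_univ_four, hq]

theorem schGroup_selfDual_subset {U : Set E4} {F : E4 → Mat4} {κ : ℝ} (hF : ContinuousOn F U)
    (hanti : ∀ x ∈ U, (F x)ᵀ = -F x) (hsd : ∀ x ∈ U, antiSelfDualPart 1 (F x) = 0)
    {𝒞 : Set ClosedCurve} : schGroup 1 κ F U 𝒞 ⊆ selfDualSU2 := by
  refine schGroup_subset isUnitGroup_selfDualSU2 fun C _ hC Φ hΦ => ?_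
  obtain ⟨W, hW0, rfl, hW⟩ := isSCHOperator_iff.1 hΦ
  have hB : ∀ s ∈ Icc 0 C.S, schIntegrand 1 κ (F (C.x s)) ∈ selfDualAlgebra := fun s hs => by
    rw [schIntegrand_one κ (hanti _ (hC hs))]
    exact selfDualAlgebra.smul_mem _ (hsd _ (hC hs))
  have hmem : C.S ∈ Icc 0 C.S := right_mem_Icc.2 C.S_pos.le
  have hc := continuousOn_integrand (η := 1) (κ := κ) hF hC
  refine mem_selfDualSU2_of_commute ?_
    (commute_of_commute hc hW hW0 (fun s hs => commute_antiSelfDualI (hB s hs)) C.S hmem)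
    (commute_of_commute hc hW hW0 (fun s hs => commute_antiSelfDualJ (hB s hs)) C.S hmem)
  exact adjoint_mul_self_of_skew
    (σ := (Matrix.transposeLinearEquiv (Fin 4) (Fin 4) ℝ ℝ).toLinearMap)
    (by simp) (fun a b => by simp) C.S_pos.le hW hW0
    (fun s hs => transpose_of_mem_selfDualAlgebra (hB s hs)) C.S hmem

theorem schGroup_selfDual_eq_iff {U : Set E4} {F : E4 → Mat4} {κ : ℝ} (hU : IsOpen U)
    (hF : ContinuousOn F U) (hκ : κ ≠ 0) (hanti : ∀ x ∈ U, (F x)ᵀ = -F x)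
    (hsd : ∀ x ∈ U, antiSelfDualPart 1 (F x) = 0) {𝒞 : Set ClosedCurve}
    (h𝒞 : arcLengthCurves ⊆ 𝒞) : schGroup 1 κ F U 𝒞 = selfDualSU2 ↔
      ∃ x ∈ U, ∃ y ∈ U, LinearIndependent ℝ ![F x, F y] := by
  constructor
  · intro h
    by_contra! hdep
    -- all values of the field are then multiples of one self-dual matrix `Z ≠ 0`
    obtain ⟨Z, hZ, hZ0, hmul⟩ : ∃ Z ∈ selfDualAlgebra, Z ≠ 0 ∧ ∀ x ∈ U, ∃ c : ℝ, F x = c • Z := by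
      by_cases h0 : ∀ x ∈ U, F x = 0
      · refine ⟨quatMat (mkQuat 0 1 0 0), mem_selfDualAlgebra_iff.2 ⟨_, rfl, rfl⟩, fun h => ?_,
          fun x hx => ⟨0, by rw [h0 x hx, zero_smul]⟩⟩
        have := congrArg QuaternionAlgebra.imI (quatMat_injective (h.trans (map_zero _).symm))
        simp at this
      · push Not at h0
        obtain ⟨x, hx, hx0⟩ := h0
        refine ⟨F x, hsd x hx, hx0, fun y hy => ?_⟩
        have := hdep x hx y hy
        rw [LinearIndependent.pair_iff' hx0] at this
        push Not at this
        obtain ⟨c, hc⟩ := this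
        exact ⟨c, hc.symm⟩
    have hcomm : ∀ Λ ∈ selfDualSU2, Λ * Z = Z * Λ := by
      rw [← h]
      let G : Set Mat4 := {Λ | IsUnit Λ ∧ Λ * Z = Z * Λ}
      have hG : IsUnitGroup G :=
        { one_mem := ⟨isUnit_one, by simp⟩
          mul_mem := fun {a b} ha hb => ⟨ha.1.mul hb.1, by
            rw [mul_assoc, hb.2, ← mul_assoc, ha.2, mul_assoc]⟩
          exists_inv := by
            rintro _ ⟨⟨u, rfl⟩, hu⟩
            refine ⟨_, ⟨u⁻¹.isUnit, ?_⟩, u.mul_inv, u.inv_mul⟩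
            exact ((Commute.units_inv_left_iff (a := Z) (u := u)).2 hu) }
      have hsub : schGroup 1 κ F U 𝒞 ⊆ G := by
        refine schGroup_subset hG fun C _ hC Φ hΦ => ?_
        obtain ⟨W, hW0, rfl, hW⟩ := isSCHOperator_iff.1 hΦ
        have hmem : C.S ∈ Icc 0 C.S := right_mem_Icc.2 C.S_pos.le
        constructor
        · have := adjoint_mul_self_of_skew
            (σ := (Matrix.transposeLinearEquiv (Fin 4) (Fin 4) ℝ ℝ).toLinearMap)
            (by simp) (fun a b => by simp) C.S_pos.le hW hW0 (fun s hs => by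
              rw [schIntegrand_one κ (hanti _ (hC hs))]
              exact transpose_of_mem_selfDualAlgebra
                (selfDualAlgebra.smul_mem _ (hsd _ (hC hs)))) C.S hmem
          exact IsUnit.of_mul_eq_one_right _ this
        · refine commute_of_commute (continuousOn_integrand hF hC) hW hW0 (fun s hs => ?_) C.S hmem
          rw [schIntegrand_one κ (hanti _ (hC hs))]
          obtain ⟨c, hc⟩ := hmul _ (hC hs)
          rw [hc]; simp
      exact fun Λ hΛ => (hsub hΛ).2
    obtain ⟨z, hz, rfl⟩ := mem_selfDualAlgebra_iff.1 hZ
    have key : ∀ q : ℍ[ℝ], Quaternion.normSq q = 1 → q * z = z * q := fun q hq => by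
      have := hcomm _ (mem_selfDualSU2_iff.2 ⟨q, hq, rfl⟩)
      rw [← map_mul, ← map_mul] at this
      exact quatMat_injective this
    have kI := key (mkQuat 0 1 0 0) (by rw [Quaternion.normSq_def']; simp)
    have kJ := key (mkQuat 0 0 1 0) (by rw [Quaternion.normSq_def']; simp)
    have i1 := congrArg QuaternionAlgebra.imJ kI
    have i2 := congrArg QuaternionAlgebra.imK kI
    have i3 := congrArg QuaternionAlgebra.imK kJ
    simp at i1 i2 i3
    refine hZ0 ?_
    have : z = 0 := by
      ext <;> simp <;> linarith
    rw [this, map_zero]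
  · rintro ⟨x, hx, y, hy, hxy⟩
    have hT : ∀ x ∈ U, F x ∈ tangentSpaceOne (isUnitGroup_schGroup (η := 1) (κ := κ) (F := F)
        (U := U) (𝒞 := 𝒞)) := fun x hx => by
      have := schIntegrand_mem_tangentSpaceOne (η := 1) (κ := κ) hU hF h𝒞 hx
      rw [schIntegrand_one κ (hanti x hx)] at this
      exact (Submodule.smul_mem_iff _ hκ).1 this
    exact selfDualSU2_eq_of_tangent _ (schGroup_selfDual_subset hF hanti hsd)
      (selfDualAlgebra_le_of_linearIndependent _ (hsd x hx) (hsd y hy) hxy (hT x hx) (hT y hy))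

end

/-! ### Dependence of path-ordered exponentials on parameters -/

section Parameters

variable {𝔸 : Type*} [NormedRing 𝔸] [NormedAlgebra ℝ 𝔸] [CompleteSpace 𝔸]

theorem continuous_picardTerm_param {X : Type*} [TopologicalSpace X] {A : X → ℝ → 𝔸}
    (hA : Continuous A.uncurry) (n : ℕ) :
    Continuous fun q : X × ℝ => picardTerm (A q.1) n q.2 := by
  induction n with
  | zero => exact continuous_const
  | succ n ih =>
    exact intervalIntegral.continuous_parametric_primitive_of_continuous
      (f := fun x τ => A x τ * picardTerm (A x) n τ) (hA.mul ih)

theorem continuous_pathOrderedExp_param {X : Type*} [TopologicalSpace X] [LocallyCompactSpace X]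
    {A : X → ℝ → 𝔸} (hA : Continuous A.uncurry) :
    Continuous fun q : X × ℝ => pathOrderedExp (A q.1) q.2 := by
  rw [continuous_iff_continuousAt]
  rintro ⟨x, t⟩
  obtain ⟨C, hC, hCx⟩ := exists_compact_mem_nhds x
  set T := |t| + 1
  obtain ⟨K, hK⟩ := (hC.prod (isCompact_Icc (a := -T) (b := T))).exists_bound_of_continuousOn
    hA.continuousOn
  have hn : C ×ˢ Icc (-T) T ∈ 𝓝 (x, t) := prod_mem_nhds hCx (Icc_mem_nhds
    (by have := neg_abs_le t; simp only [T]; linarith)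
    (by have := le_abs_self t; simp only [T]; linarith))
  refine ContinuousOn.continuousAt ?_ hn
  refine continuousOn_tsum (fun n => (continuous_picardTerm_param hA n).continuousOn)
    (summable_exp_bound ‖(1 : 𝔸)‖ K T) fun n q hq => ?_
  have hK' : ∀ τ, |τ| ≤ T → ‖A q.1 τ‖ ≤ K := fun τ hτ => hK (q.1, τ) ⟨hq.1, abs_le.1 hτ⟩
  have hq2 : |q.2| ≤ T := abs_le.2 hq.2
  have hK0 : 0 ≤ K := (norm_nonneg _).trans (hK' _ hq2)
  refine (norm_picardTerm_le hK' n hq2).trans ?_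
  gcongr

theorem isUnit_pathOrderedExp {A : ℝ → 𝔸} (hA : Continuous A) (t : ℝ) :
    IsUnit (pathOrderedExp A t) := by
  have key : ∀ {A : ℝ → 𝔸}, Continuous A → ∀ t, 0 ≤ t → IsUnit (pathOrderedExp A t) := by
    intro A hA t ht
    obtain ⟨N, -, -, hN⟩ := exists_inverse_pathOrderedExp hA
    exact ⟨⟨_, N t, (hN t ht).2, (hN t ht).1⟩, rfl⟩
  rcases le_total 0 t with h | h
  · exact key hA t h
  · have hB : Continuous fun τ => -A (-τ) := by fun_prop
    have h1 := linearODE_unique (a := 0) (b := -t)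
      (B := fun τ => ContinuousLinearMap.mul ℝ 𝔸 (-A (-τ))) (by fun_prop)
      (f := fun τ => pathOrderedExp A (-τ)) (g := pathOrderedExp fun τ => -A (-τ))
      ((continuous_pathOrderedExp hA).comp continuous_neg).continuousOn
      (continuous_pathOrderedExp hB).continuousOn
      (fun τ _ => by
        have := ((hasDerivAt_pathOrderedExp hA (-τ)).scomp τ (hasDerivAt_neg τ)).hasDerivWithinAt
          (s := Ici τ)
        refine this.congr_deriv ?_
        simp)
      (fun τ _ => (hasDerivAt_pathOrderedExp hB τ).hasDerivWithinAt)
      (by simp [pathOrderedExp_zero]) (right_mem_Icc.2 (by linarith))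
    simp only [neg_neg] at h1
    rw [h1]
    exact key hB _ (by linarith)

theorem hasDerivAt_inverse_pathOrderedExp {A : ℝ → 𝔸} (hA : Continuous A) (t : ℝ) :
    HasDerivAt (fun s => Ring.inverse (pathOrderedExp A s))
      (-(Ring.inverse (pathOrderedExp A t) * A t)) t := by
  obtain ⟨u, hu⟩ := isUnit_pathOrderedExp hA t
  have h := hasFDerivAt_ringInverse (𝕜 := ℝ) u
  rw [hu] at h
  refine (h.comp_hasDerivAt t (hasDerivAt_pathOrderedExp hA t)).congr_deriv ?_
  rw [← hu, Ring.inverse_unit]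
  simp [mul_assoc]

theorem continuous_inverse_pathOrderedExp_param {X : Type*} [TopologicalSpace X]
    [LocallyCompactSpace X] {A : X → ℝ → 𝔸} (hA : Continuous A.uncurry) :
    Continuous fun q : X × ℝ => Ring.inverse (pathOrderedExp (A q.1) q.2) := by
  rw [continuous_iff_continuousAt]
  intro q
  obtain ⟨u, hu⟩ := isUnit_pathOrderedExp (A := A q.1) (by fun_prop) q.2
  have h := NormedRing.inverse_continuousAt u
  rw [hu] at h
  exact ContinuousAt.comp (f := fun q : X × ℝ => pathOrderedExp (A q.1) q.2) h
    (continuous_pathOrderedExp_param hA).continuousAt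

/-- Variation of constants: comparison of the solutions for two coefficients. -/
theorem pathOrderedExp_sub {A B : ℝ → 𝔸} (hA : Continuous A) (hB : Continuous B) :
    pathOrderedExp A 1 - pathOrderedExp B 1 = ∫ u in (0 : ℝ)..1,
      pathOrderedExp B 1 * Ring.inverse (pathOrderedExp B u) *
          (A u - B u) * pathOrderedExp A u := by
  have h1 : ∀ u, HasDerivAt
      (fun u => pathOrderedExp B 1 * Ring.inverse (pathOrderedExp B u) * pathOrderedExp A u)
      (pathOrderedExp B 1 * Ring.inverse (pathOrderedExp B u) * (A u - B u) *
        pathOrderedExp A u) u := fun u => by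
    refine (((hasDerivAt_inverse_pathOrderedExp hB u).const_mul _).mul
      (hasDerivAt_pathOrderedExp hA u)).congr_deriv ?_
    noncomm_ring
  have hc := continuous_pathOrderedExp hA
  have hi : Continuous fun u => Ring.inverse (pathOrderedExp B u) :=
    continuous_iff_continuousAt.2 fun u => (hasDerivAt_inverse_pathOrderedExp hB u).continuousAt
  rw [intervalIntegral.integral_eq_sub_of_hasDerivAt (fun u _ => h1 u)
    (Continuous.intervalIntegrable (by fun_prop) _ _)]
  simp [pathOrderedExp_zero, Ring.mul_inverse_cancel _ (isUnit_pathOrderedExp hB 1)]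

variable {P : Type*} [NormedAddCommGroup P] [NormedSpace ℝ P] [LocallyCompactSpace P]

/-- The integrand of the derivative of the path-ordered exponential with respect to a
parameter. -/
def expDerivIntegrand (A : P → ℝ → 𝔸) (A' : P → ℝ → P →L[ℝ] 𝔸) (y : P) (u : ℝ) : P →L[ℝ] 𝔸 :=
  (ContinuousLinearMap.mulLeftRight ℝ 𝔸
    (pathOrderedExp (A y) 1 * Ring.inverse (pathOrderedExp (A y) u))
    (pathOrderedExp (A y) u)).comp (A' y u)

theorem expDerivIntegrand_apply (A : P → ℝ → 𝔸) (A' : P → ℝ → P →L[ℝ] 𝔸) (y : P) (u : ℝ) (h : P) :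
    expDerivIntegrand A A' y u h = pathOrderedExp (A y) 1 *
      Ring.inverse (pathOrderedExp (A y) u) * A' y u h * pathOrderedExp (A y) u := by
  simp [expDerivIntegrand]

theorem continuous_expDerivIntegrand {A : P → ℝ → 𝔸} {A' : P → ℝ → P →L[ℝ] 𝔸}
    (hA : Continuous A.uncurry) (hA' : Continuous A'.uncurry) :
    Continuous (expDerivIntegrand A A').uncurry := by
  have h1 := continuous_pathOrderedExp_param hA
  have h2 := continuous_inverse_pathOrderedExp_param hA
  have h3 : Continuous fun q : P × ℝ => pathOrderedExp (A q.1) 1 :=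
    h1.comp (continuous_fst.prodMk continuous_const)
  exact (((ContinuousLinearMap.mulLeftRight ℝ 𝔸).continuous.comp (h3.mul h2)).clm_apply
    h1).clm_comp hA'

/-- Duhamel's formula for the derivative with respect to parameters. -/
theorem hasStrictFDerivAt_pathOrderedExp {A : P → ℝ → 𝔸} {A' : P → ℝ → P →L[ℝ] 𝔸}
    (hA : Continuous A.uncurry) (hA' : Continuous A'.uncurry)
    (hd : ∀ y u, HasFDerivAt (fun y => A y u) (A' y u) y) (y₀ : P) :
    HasStrictFDerivAt (fun y => pathOrderedExp (A y) 1)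
      (∫ u in (0 : ℝ)..1, expDerivIntegrand A A' y₀ u) y₀ := by
  -- the mean derivative of the coefficients along the segment from `q.2` to `q.1`
  let D : (P × P) × ℝ → P →L[ℝ] 𝔸 := fun q =>
    ∫ θ in (0 : ℝ)..1, A' (q.1.2 + θ • (q.1.1 - q.1.2)) q.2
  have hDc : Continuous D := intervalIntegral.continuous_parametric_intervalIntegral_of_continuous'
    (f := fun (q : (P × P) × ℝ) θ => A' (q.1.2 + θ • (q.1.1 - q.1.2)) q.2)
    (hA'.comp (f := fun w : ((P × P) × ℝ) × ℝ =>
      (w.1.1.2 + w.2 • (w.1.1.1 - w.1.1.2), w.1.2)) (by fun_prop)) 0 1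
  have hD : ∀ y y' u, A y u - A y' u = D ((y, y'), u) (y - y') := by
    intro y y' u
    have h1 : ∀ θ : ℝ, HasDerivAt (fun θ : ℝ => A (y' + θ • (y - y')) u)
        (A' (y' + θ • (y - y')) u (y - y')) θ := fun θ => by
      refine (hd (y' + θ • (y - y')) u).comp_hasDerivAt θ (f := fun θ : ℝ => y' + θ • (y - y')) ?_
      simpa using ((hasDerivAt_id θ).smul_const (y - y')).const_add y'
    have hc : Continuous fun θ : ℝ => A' (y' + θ • (y - y')) u :=
      hA'.comp (f := fun θ : ℝ => (y' + θ • (y - y'), u)) (by fun_prop)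
    have h2 := intervalIntegral.integral_eq_sub_of_hasDerivAt (a := 0) (b := 1) (fun θ _ => h1 θ)
      (Continuous.intervalIntegrable (by fun_prop) _ _)
    simp only [one_smul, zero_smul, add_zero, add_sub_cancel] at h2
    rw [← h2]
    exact (ContinuousLinearMap.intervalIntegral_apply (hc.intervalIntegrable _ _) _).symm
  have hD0 : ∀ y u, D ((y, y), u) = A' y u := fun y u => by simp [D]
  let k : P × P → ℝ → P →L[ℝ] 𝔸 := fun q u => (ContinuousLinearMap.mulLeftRight ℝ 𝔸
    (pathOrderedExp (A q.2) 1 * Ring.inverse (pathOrderedExp (A q.2) u))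
    (pathOrderedExp (A q.1) u)).comp (D (q, u))
  have h1 := continuous_pathOrderedExp_param hA
  have h2 := continuous_inverse_pathOrderedExp_param hA
  have hk : Continuous k.uncurry := by
    have h3 : Continuous fun q : (P × P) × ℝ => pathOrderedExp (A q.1.2) 1 :=
      h1.comp (f := fun q : (P × P) × ℝ => (q.1.2, 1)) (by fun_prop)
    have h4 : Continuous fun q : (P × P) × ℝ => pathOrderedExp (A q.1.1) q.2 :=
      h1.comp (f := fun q : (P × P) × ℝ => (q.1.1, q.2)) (by fun_prop)
    have h5 : Continuous fun q : (P × P) × ℝ => Ring.inverse (pathOrderedExp (A q.1.2) q.2) :=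
      h2.comp (f := fun q : (P × P) × ℝ => (q.1.2, q.2)) (by fun_prop)
    exact (((ContinuousLinearMap.mulLeftRight ℝ 𝔸).continuous.comp (h3.mul h5)).clm_apply
      h4).clm_comp hDc
  let K : P × P → P →L[ℝ] 𝔸 := fun q => ∫ u in (0 : ℝ)..1, k q u
  have hK : Continuous K :=
    intervalIntegral.continuous_parametric_intervalIntegral_of_continuous' hk 0 1
  have hK0 : K (y₀, y₀) = ∫ u in (0 : ℝ)..1, expDerivIntegrand A A' y₀ u := by
    simp only [K, k, hD0]
    rfl
  have hsub : ∀ q : P × P, pathOrderedExp (A q.1) 1 - pathOrderedExp (A q.2) 1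
      = K q (q.1 - q.2) := by
    intro q
    have hkq : Continuous (k q) := hk.comp (f := fun u => (q, u)) (by fun_prop)
    rw [pathOrderedExp_sub (A := A q.1) (B := A q.2)
      (hA.comp (f := fun u => (q.1, u)) (by fun_prop))
      (hA.comp (f := fun u => (q.2, u)) (by fun_prop))]
    simp only [K]
    rw [ContinuousLinearMap.intervalIntegral_apply (hkq.intervalIntegrable _ _)]
    refine intervalIntegral.integral_congr fun u _ => ?_
    simp [k, hD]
  rw [← hK0]
  refine HasStrictFDerivAt.of_isLittleO ?_
  simp only [hsub]
  have h3 : (fun q : P × P => K q - K (y₀, y₀)) =o[𝓝 (y₀, y₀)] fun _ => (1 : ℝ) := by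
    rw [Asymptotics.isLittleO_one_iff]
    have := hK.tendsto (y₀, y₀)
    simpa using this.sub_const (K (y₀, y₀))
  have h4 := (Asymptotics.IsBigO.of_bound 1 (Eventually.of_forall fun q : P × P => by
    rw [Real.norm_of_nonneg (by positivity), one_mul]
    exact (K q - K (y₀, y₀)).le_opNorm (q.1 - q.2)) :
      (fun q : P × P => (K q - K (y₀, y₀)) (q.1 - q.2)) =O[𝓝 (y₀, y₀)]
        fun q => ‖K q - K (y₀, y₀)‖ * ‖q.1 - q.2‖)
  refine h4.trans_isLittleO ?_
  have h5 := h3.norm_left.mul_isBigO (Asymptotics.isBigO_refl (fun q : P × P => ‖q.1 - q.2‖) _)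
  simp only [one_mul] at h5
  exact h5.norm_right.trans_isBigO (by simpa using Asymptotics.isBigO_refl _ _)

end Parameters

/-! ### Christoffel symbols and curvature under changes of coordinates -/

section Christoffel

/-- The coordinate functions of `ℝ⁴`. -/
def coordMap (i : Fin 4) : E4 →L[ℝ] ℝ := EuclideanSpace.proj i

@[simp]
theorem coordMap_apply (i : Fin 4) (u : E4) : coordMap i u = u i := rfl

theorem basisVec_apply (i j : Fin 4) : basisVec i j = if j = i then 1 else 0 := by
  simp [basisVec]

/-- The bilinear form with the given matrix. -/
def bilin (X : Mat4) : E4 →L[ℝ] E4 →L[ℝ] ℝ :=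
  ∑ i, ∑ j, X i j • (coordMap i).smulRight (coordMap j)

theorem bilin_apply (X : Mat4) (u v : E4) : bilin X u v = ∑ i, ∑ j, X i j * (u i * v j) := by
  simp [bilin]

theorem bilin_basisVec (X : Mat4) (i j : Fin 4) : bilin X (basisVec i) (basisVec j) = X i j := by
  simp [bilin_apply, basisVec_apply]

theorem sum_smul_basisVec (u : E4) : ∑ i, u i • basisVec i = u := by
  ext k
  simp [basisVec_apply]

theorem ext_basisVec {E : Type*} [NormedAddCommGroup E] [NormedSpace ℝ E] {φ ψ : E4 →L[ℝ] E}
    (h : ∀ i, φ (basisVec i) = ψ (basisVec i)) : φ = ψ := by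
  ext u
  rw [← sum_smul_basisVec u]
  simp only [map_sum, map_smul, h]

theorem contDiffAt_smul_const {E F : Type*} [NormedAddCommGroup E] [NormedSpace ℝ E]
    [NormedAddCommGroup F] [NormedSpace ℝ F] {n : WithTop ℕ∞} {f : E → ℝ} {y : E}
    (h : ContDiffAt ℝ n f y) (L : F) : ContDiffAt ℝ n (fun z => f z • L) y :=
  h.smul contDiffAt_const

theorem bilin_symm {X : Mat4} (hX : ∀ i j, X i j = X j i) (u v : E4) :
    bilin X u v = bilin X v u := by
  rw [bilin_apply, bilin_apply, Finset.sum_comm]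
  refine Finset.sum_congr rfl fun i _ => Finset.sum_congr rfl fun j _ => ?_
  rw [hX]; ring

theorem bilin_eq_dotProduct (X : Mat4) (u v : E4) :
    bilin X u v = (u : Fin 4 → ℝ) ⬝ᵥ (X *ᵥ (v : Fin 4 → ℝ)) := by
  simp only [bilin_apply, dotProduct, Matrix.mulVec, Finset.mul_sum]
  refine Finset.sum_congr rfl fun i _ => Finset.sum_congr rfl fun j _ => ?_
  ring

theorem eq_zero_of_bilin {X : Mat4} (hX : X.det ≠ 0) {u : E4} (h : ∀ v, bilin X u v = 0) :
    u = 0 := by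
  have h1 : (u : Fin 4 → ℝ) ᵥ* X = 0 := by
    ext j
    have := h (basisVec j)
    rw [bilin_apply] at this
    simpa [basisVec_apply, Matrix.vecMul, dotProduct, mul_comm] using this
  have h2 := Matrix.eq_zero_of_vecMul_eq_zero hX h1
  ext i
  exact congrFun h2 i

/-- The matrix of metric components `G` is smooth, symmetric and invertible around `y`. -/
structure RegularAt (G : E4 → Mat4) (y : E4) : Prop where
  smooth : ∀ᶠ z in 𝓝 y, ∀ i j, ContDiffAt ℝ ∞ (fun z => G z i j) z
  symm : ∀ᶠ z in 𝓝 y, ∀ i j, G z i j = G z j i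
  det : (G y).det ≠ 0

theorem contDiffAt_det {n : WithTop ℕ∞} {E : Type*} [NormedAddCommGroup E] [NormedSpace ℝ E]
    {G : E → Mat4} {y : E} (h : ∀ i j, ContDiffAt ℝ n (fun z => G z i j) y) :
    ContDiffAt ℝ n (fun z => (G z).det) y := by
  simp only [Matrix.det_apply]
  refine ContDiffAt.sum fun σ _ => ?_
  exact ContDiffAt.const_smul (Equiv.Perm.sign σ) (contDiffAt_prod fun i _ => h _ _)

theorem contDiffAt_inv {n : WithTop ℕ∞} {E : Type*} [NormedAddCommGroup E] [NormedSpace ℝ E]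
    {G : E → Mat4} {y : E} (h : ∀ i j, ContDiffAt ℝ n (fun z => G z i j) y) (hd : (G y).det ≠ 0)
    (i j : Fin 4) : ContDiffAt ℝ n (fun z => (G z)⁻¹ i j) y := by
  have h1 : ContDiffAt ℝ n (fun z => (G z).adjugate i j) y := by
    simp only [Matrix.adjugate_apply]
    refine contDiffAt_det fun k l => ?_
    simp only [Matrix.updateRow_apply]
    split_ifs
    · exact contDiffAt_const
    · exact h _ _
  have h2 := ((contDiffAt_det h).inv hd).mul h1
  refine h2.congr_of_eventuallyEq (.of_forall fun z => ?_)
  simp [Matrix.inv_def, Ring.inverse_eq_inv']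

namespace RegularAt

variable {G : E4 → Mat4} {y : E4}

theorem contDiffAt (h : RegularAt G y) (i j : Fin 4) : ContDiffAt ℝ ∞ (fun z => G z i j) y :=
  h.smooth.self_of_nhds i j

theorem eventually (h : RegularAt G y) : ∀ᶠ z in 𝓝 y, RegularAt G z := by
  have hd : ∀ᶠ z in 𝓝 y, (G z).det ≠ 0 :=
    (contDiffAt_det h.contDiffAt).continuousAt.eventually_ne h.det
  filter_upwards [h.smooth.eventually_nhds, h.symm.eventually_nhds, hd] with z h1 h2 h3
  exact ⟨h1, h2, h3⟩

end RegularAt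

/-- The Christoffel symbols as a bilinear map: `Γ(u, v)^k = Γ^k_{ij} u^i v^j`. -/
def christoffelMap (G : E4 → Mat4) (y : E4) : E4 →L[ℝ] E4 →L[ℝ] E4 :=
  ∑ k, ∑ i, ∑ j, christoffel G y k i j •
    (coordMap i).smulRight ((coordMap j).smulRight (basisVec k))

theorem christoffelMap_apply (G : E4 → Mat4) (y u v : E4) (k : Fin 4) :
    christoffelMap G y u v k = ∑ i, ∑ j, christoffel G y k i j * (u i * v j) := by
  simp only [christoffelMap, ContinuousLinearMap.sum_apply, ContinuousLinearMap.smul_apply,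
    ContinuousLinearMap.smulRight_apply, coordMap_apply, smul_eq_mul,
    WithLp.ofLp_sum, Finset.sum_apply, WithLp.ofLp_smul, Pi.smul_apply]
  rw [Finset.sum_eq_single k]
  · simp [basisVec_apply]
  · intro b _ hb
    simp [basisVec_apply, hb.symm]
  · simp

theorem christoffelMap_basisVec (G : E4 → Mat4) (y : E4) (k i j : Fin 4) :
    christoffelMap G y (basisVec i) (basisVec j) k = christoffel G y k i j := by
  simp [christoffelMap_apply, basisVec_apply]

variable {G : E4 → Mat4} {y : E4}

theorem RegularAt.contDiffAt_bilin (h : RegularAt G y) :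
    ContDiffAt ℝ ∞ (fun z => bilin (G z)) y :=
  ContDiffAt.sum fun i _ => ContDiffAt.sum fun j _ => contDiffAt_smul_const (h.contDiffAt i j) _

theorem RegularAt.contDiffAt_christoffel (h : RegularAt G y) (k i j : Fin 4) :
    ContDiffAt ℝ ∞ (fun z => christoffel G z k i j) y := by
  have hd : ∀ a b c, ContDiffAt ℝ ∞
      (fun z => fderiv ℝ (fun z => G z a b) z (basisVec c)) y := fun a b c =>
    ((h.contDiffAt a b).fderiv_right (m := ∞) (by simp)).clm_apply contDiffAt_const
  refine contDiffAt_const.mul (ContDiffAt.sum fun l _ => ?_)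
  exact (contDiffAt_inv h.contDiffAt h.det k l).mul (((hd _ _ _).add (hd _ _ _)).sub (hd _ _ _))

theorem RegularAt.contDiffAt_christoffelMap (h : RegularAt G y) :
    ContDiffAt ℝ ∞ (christoffelMap G) y :=
  ContDiffAt.sum fun k _ => ContDiffAt.sum fun i _ => ContDiffAt.sum fun j _ =>
    contDiffAt_smul_const (h.contDiffAt_christoffel k i j) _

theorem RegularAt.fderiv_bilin (h : RegularAt G y) (u : E4) (i j : Fin 4) :
    fderiv ℝ (fun z => bilin (G z)) y u (basisVec i) (basisVec j)
      = fderiv ℝ (fun z => G z i j) y u := by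
  have h1 := ((h.contDiffAt_bilin.differentiableAt (by simp)).hasFDerivAt.clm_apply
    (hasFDerivAt_const (basisVec i) y)).clm_apply (hasFDerivAt_const (basisVec j) y)
  have h2 := h1.fderiv
  simp only [bilin_basisVec] at h2
  rw [h2]
  simp

theorem RegularAt.fderiv_bilin_symm (h : RegularAt G y) (u v w : E4) :
    fderiv ℝ (fun z => bilin (G z)) y u v w = fderiv ℝ (fun z => bilin (G z)) y u w v := by
  have h1 := fun v w => ((h.contDiffAt_bilin.differentiableAt (by simp)).hasFDerivAt.clm_apply
    (hasFDerivAt_const v y)).clm_apply (hasFDerivAt_const w y)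
  have h2 := (h1 v w).unique ((h1 w v).congr_of_eventuallyEq (by
    filter_upwards [h.symm] with z hz
    exact bilin_symm hz v w))
  simpa using congrArg (fun L => L u) h2

/-- The Koszul formula. -/
theorem RegularAt.bilin_christoffelMap (h : RegularAt G y) (u v w : E4) :
    bilin (G y) (christoffelMap G y u v) w = (1 / 2) *
      (fderiv ℝ (fun z => bilin (G z)) y u v w + fderiv ℝ (fun z => bilin (G z)) y v u w
        - fderiv ℝ (fun z => bilin (G z)) y w u v) := by
  set D := fderiv ℝ (fun z => bilin (G z)) y with hD
  have key : ∀ i j l, bilin (G y) (christoffelMap G y (basisVec i) (basisVec j)) (basisVec l) =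
      (1 / 2) * (D (basisVec i) (basisVec j) (basisVec l) + D (basisVec j) (basisVec i) (basisVec l)
        - D (basisVec l) (basisVec i) (basisVec j)) := by
    intro i j l
    rw [hD, h.fderiv_bilin, h.fderiv_bilin, h.fderiv_bilin, bilin_apply]
    have h1 : ∀ k, ∑ m, G y k m * (christoffelMap G y (basisVec i) (basisVec j) k *
        basisVec l m) = G y l k * christoffel G y k i j := fun k => by
      rw [← h.symm.self_of_nhds k l]
      simp [christoffelMap_basisVec, basisVec_apply]
    simp only [h1, christoffel]
    have h2 : G y * (G y)⁻¹ = 1 := Matrix.mul_nonsing_inv _ (isUnit_iff_ne_zero.2 h.det)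
    calc ∑ k, G y l k * (1 / 2 * ∑ m, (G y)⁻¹ k m *
          (fderiv ℝ (fun z => G z j m) y (basisVec i) + fderiv ℝ (fun z => G z i m) y (basisVec j)
            - fderiv ℝ (fun z => G z i j) y (basisVec m)))
        = 1 / 2 * ∑ m, (G y * (G y)⁻¹) l m *
          (fderiv ℝ (fun z => G z j m) y (basisVec i) + fderiv ℝ (fun z => G z i m) y (basisVec j)
            - fderiv ℝ (fun z => G z i j) y (basisVec m)) := by
          simp only [Matrix.mul_apply, Finset.mul_sum, Finset.sum_mul]
          rw [Finset.sum_comm]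
          refine Finset.sum_congr rfl fun a _ => Finset.sum_congr rfl fun b _ => ?_
          ring
      _ = _ := by
          rw [h2]
          simp [Matrix.one_apply]
  set Γ := christoffelMap G y
  have e1 : ∀ i j w, bilin (G y) (Γ (basisVec i) (basisVec j)) w = (1 / 2) *
      (D (basisVec i) (basisVec j) w + D (basisVec j) (basisVec i) w
        - D w (basisVec i) (basisVec j)) := fun i j w => by
    simpa using congrArg (· w) (ext_basisVec (φ := bilin (G y) (Γ (basisVec i) (basisVec j)))
      (ψ := (1 / 2 : ℝ) • (D (basisVec i) (basisVec j) + D (basisVec j) (basisVec i)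
        - (D.flip (basisVec i)).flip (basisVec j))) fun l => by simpa using key i j l)
  have e2 : ∀ i v w, bilin (G y) (Γ (basisVec i) v) w = (1 / 2) *
      (D (basisVec i) v w + D v (basisVec i) w - D w (basisVec i) v) := fun i v w => by
    simpa using congrArg (· v) (ext_basisVec (φ := ((bilin (G y)).flip w).comp (Γ (basisVec i)))
      (ψ := (1 / 2 : ℝ) • ((D (basisVec i)).flip w + (D.flip (basisVec i)).flip w
        - D w (basisVec i))) fun j => by simpa using e1 i j w)
  simpa using congrArg (· u) (ext_basisVec (φ := ((bilin (G y)).flip w).comp (Γ.flip v))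
    (ψ := (1 / 2 : ℝ) • ((D.flip v).flip w + (D v).flip w - (D w).flip v))
    fun i => by simpa using e2 i v w)

theorem RegularAt.christoffelMap_symm (h : RegularAt G y) (u v : E4) :
    christoffelMap G y u v = christoffelMap G y v u := by
  rw [← sub_eq_zero]
  refine eq_zero_of_bilin h.det fun w => ?_
  rw [map_sub, ContinuousLinearMap.sub_apply, h.bilin_christoffelMap, h.bilin_christoffelMap,
    h.fderiv_bilin_symm w u v]
  ring

/-- The Levi-Civita connection is compatible with the metric. -/
theorem RegularAt.fderiv_bilin_eq (h : RegularAt G y) (u v w : E4) :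
    fderiv ℝ (fun z => bilin (G z)) y u v w =
      bilin (G y) (christoffelMap G y u v) w + bilin (G y) v (christoffelMap G y u w) := by
  rw [bilin_symm h.symm.self_of_nhds v, h.bilin_christoffelMap, h.bilin_christoffelMap,
    h.fderiv_bilin_symm v u w, h.fderiv_bilin_symm w u v, h.fderiv_bilin_symm u v w]
  ring

theorem second_derivative_symm {E : Type*} [NormedAddCommGroup E] [NormedSpace ℝ E] {f : E4 → E}
    {y : E4} (hf : ContDiffAt ℝ ∞ f y) (u v : E4) :
    fderiv ℝ (fderiv ℝ f) y u v = fderiv ℝ (fderiv ℝ f) y v u :=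
  (hf.isSymmSndFDerivAt (by
    rw [minSmoothness_of_isRCLikeNormedField]; exact WithTop.coe_le_coe.2 le_top)).eq u v

/-- The transformation of the Christoffel symbols under an isometric change of coordinates. -/
theorem christoffelMap_transform {G' : E4 → Mat4} {f : E4 → E4} (hG : RegularAt G y)
    (hG' : RegularAt G' (f y)) (hf : ContDiffAt ℝ ∞ f y)
    (hiso : ∀ᶠ z in 𝓝 y, ∀ u v,
      bilin (G z) u v = bilin (G' (f z)) (fderiv ℝ f z u) (fderiv ℝ f z v)) (u v : E4) :
    fderiv ℝ f y (christoffelMap G y u v) =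
      christoffelMap G' (f y) (fderiv ℝ f y u) (fderiv ℝ f y v)
        + fderiv ℝ (fderiv ℝ f) y u v := by
  set J := fderiv ℝ f y with hJ0
  have hJ : ∀ u, J u = 0 → u = 0 := fun u hu => eq_zero_of_bilin hG.det fun v => by
    rw [hiso.self_of_nhds u v, show fderiv ℝ f y u = 0 from hu]; simp
  have hsurj : Function.Surjective J := by
    have h1 : Function.Injective (J : E4 →ₗ[ℝ] E4) :=
      (injective_iff_map_eq_zero (J : E4 →ₗ[ℝ] E4)).2 hJ
    exact LinearMap.injective_iff_surjective.1 h1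
  have hJ1 : HasFDerivAt f J y := (hf.differentiableAt (by simp)).hasFDerivAt
  have hJ2 : HasFDerivAt (fderiv ℝ f) (fderiv ℝ (fderiv ℝ f) y) y :=
    ((hf.fderiv_right (m := ∞) (by simp)).differentiableAt (by simp)).hasFDerivAt
  have hsym : ∀ u v, fderiv ℝ (fderiv ℝ f) y u v = fderiv ℝ (fderiv ℝ f) y v u :=
    second_derivative_symm hf
  have hβ' := (hG'.contDiffAt_bilin.differentiableAt (by simp)).hasFDerivAt
  have hE : ∀ u v w, fderiv ℝ (fun z => bilin (G z)) y u v w =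
      fderiv ℝ (fun z => bilin (G' z)) (f y) (J u) (J v) (J w)
        + bilin (G' (f y)) (fderiv ℝ (fderiv ℝ f) y u v) (J w)
        + bilin (G' (f y)) (J v) (fderiv ℝ (fderiv ℝ f) y u w) := by
    intro u v w
    have h1 := ((hG.contDiffAt_bilin.differentiableAt (by simp)).hasFDerivAt.clm_apply
      (hasFDerivAt_const v y)).clm_apply (hasFDerivAt_const w y)
    have h2 := ((hβ'.comp y hJ1).clm_apply (hJ2.clm_apply (hasFDerivAt_const v y))).clm_apply
      (hJ2.clm_apply (hasFDerivAt_const w y))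
    have h3 := h1.unique (h2.congr_of_eventuallyEq (by
      filter_upwards [hiso] with z hz
      exact hz v w))
    have h4 := congrArg (fun L => L u) h3
    simp at h4
    simp only [← hJ0] at h4
    rw [h4]
    ring
  rw [← sub_eq_zero]
  refine eq_zero_of_bilin hG'.det fun w' => ?_
  obtain ⟨w, rfl⟩ := hsurj w'
  have h5 := hG.bilin_christoffelMap u v w
  rw [hiso.self_of_nhds, hE, hE, hE] at h5
  have h6 := hG'.bilin_christoffelMap (J u) (J v) (J w)
  have hs := hG'.symm.self_of_nhds
  rw [map_sub, map_add, ContinuousLinearMap.sub_apply, ContinuousLinearMap.add_apply, h6, h5,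
    hsym w u, hsym w v, hsym v u, bilin_symm hs (J u), bilin_symm hs (J v)]
  ring

/-- The curvature of the connection `d + Γ`, whose connection form has values in an algebra. -/
def gaugeCurvature {E 𝔸 : Type*} [NormedAddCommGroup E] [NormedSpace ℝ E] [NormedRing 𝔸]
    [NormedAlgebra ℝ 𝔸] (Γ : E → E →L[ℝ] 𝔸) (y u v : E) : 𝔸 :=
  fderiv ℝ Γ y u v - fderiv ℝ Γ y v u + ((Γ y u) * (Γ y v) - (Γ y v) * (Γ y u))

theorem RegularAt.riemann_eq (h : RegularAt G y) (ρ σ μ ν : Fin 4) :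
    riemann G y ρ σ μ ν = gaugeCurvature (christoffelMap G) y (basisVec μ) (basisVec ν)
      (basisVec σ) ρ := by
  have h1 : ∀ a b c (u : E4), fderiv ℝ (fun z => christoffel G z a b c) y u =
      (fderiv ℝ (christoffelMap G) y u (basisVec b) (basisVec c)) a := by
    intro a b c u
    have h2 := ((h.contDiffAt_christoffelMap.differentiableAt (by simp)).hasFDerivAt.clm_apply
      (hasFDerivAt_const (basisVec b) y)).clm_apply (hasFDerivAt_const (basisVec c) y)
    have h3 := ((coordMap a).hasFDerivAt.comp y
      h2).fderiv
    have e : (fun z => christoffel G z a b c) =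
      (coordMap a) ∘
        fun z => christoffelMap G z (basisVec b) (basisVec c) := by
      ext z; simp [christoffelMap_basisVec]
    rw [e, h3]
    simp
  have h4 : ∀ μ ν, (christoffelMap G y (basisVec μ) (christoffelMap G y (basisVec ν)
      (basisVec σ))) ρ = ∑ l, christoffel G y ρ μ l * christoffel G y l ν σ := by
    intro μ ν
    rw [christoffelMap_apply]
    simp [christoffelMap_basisVec, basisVec_apply]
  simp only [riemann, gaugeCurvature, h1, ContinuousLinearMap.add_apply,
    ContinuousLinearMap.sub_apply, ContinuousLinearMap.mul_apply, PiLp.add_apply, PiLp.sub_apply,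
    h4, Finset.sum_sub_distrib]

/-- The transformation of the curvature under an isometric change of coordinates. -/
theorem gaugeCurvature_transform {G' : E4 → Mat4} {f : E4 → E4} (hG : RegularAt G y)
    (hG' : RegularAt G' (f y)) (hf : ∀ᶠ z in 𝓝 y, ContDiffAt ℝ ∞ f z)
    (hiso : ∀ᶠ z in 𝓝 y, ∀ u v,
      bilin (G z) u v = bilin (G' (f z)) (fderiv ℝ f z u) (fderiv ℝ f z v)) (u v w : E4) :
    fderiv ℝ f y (gaugeCurvature (christoffelMap G) y u v w) =
      gaugeCurvature (christoffelMap G') (f y) (fderiv ℝ f y u) (fderiv ℝ f y v)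
        (fderiv ℝ f y w) := by
  have hf0 := hf.self_of_nhds
  have hlaw : ∀ᶠ z in 𝓝 y, ∀ u v, fderiv ℝ f z (christoffelMap G z u v) =
      christoffelMap G' (f z) (fderiv ℝ f z u) (fderiv ℝ f z v)
        + fderiv ℝ (fderiv ℝ f) z u v := by
    filter_upwards [hG.eventually, hf0.continuousAt.eventually hG'.eventually, hf,
      hiso.eventually_nhds] with z h1 h2 h3 h4 u v
    exact christoffelMap_transform h1 h2 h3 h4 u v
  set J := fderiv ℝ f y with hJ0
  set J2 := fderiv ℝ (fderiv ℝ f) y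
  have hJ1 : HasFDerivAt f J y := (hf0.differentiableAt (by simp)).hasFDerivAt
  have hc2 : ContDiffAt ℝ ∞ (fderiv ℝ f) y := hf0.fderiv_right (m := ∞) (by simp)
  have hJ2 : HasFDerivAt (fderiv ℝ f) J2 y := (hc2.differentiableAt (by simp)).hasFDerivAt
  have hJ3 : HasFDerivAt (fderiv ℝ (fderiv ℝ f)) (fderiv ℝ (fderiv ℝ (fderiv ℝ f)) y) y :=
    ((hc2.fderiv_right (m := ∞) (by simp)).differentiableAt (by simp)).hasFDerivAt
  have hsym2 : ∀ u v, J2 u v = J2 v u :=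
    second_derivative_symm hf0
  have hsym3 : ∀ u v, fderiv ℝ (fderiv ℝ (fderiv ℝ f)) y u v =
      fderiv ℝ (fderiv ℝ (fderiv ℝ f)) y v u :=
    second_derivative_symm hc2
  have hΓ := (hG.contDiffAt_christoffelMap.differentiableAt (by simp)).hasFDerivAt
  have hΓ' := (hG'.contDiffAt_christoffelMap.differentiableAt (by simp)).hasFDerivAt
  have hD : ∀ u v w, J2 u (christoffelMap G y v w) + J (fderiv ℝ (christoffelMap G) y u v w) =
      fderiv ℝ (christoffelMap G') (f y) (J u) (J v) (J w)
        + christoffelMap G' (f y) (J2 u v) (J w) + christoffelMap G' (f y) (J v) (J2 u w)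
        + fderiv ℝ (fderiv ℝ (fderiv ℝ f)) y u v w := by
    intro u v w
    have h1 := hJ2.clm_apply ((hΓ.clm_apply (hasFDerivAt_const v y)).clm_apply
      (hasFDerivAt_const w y))
    have h2 := (((hΓ'.comp y hJ1).clm_apply (hJ2.clm_apply (hasFDerivAt_const v y))).clm_apply
      (hJ2.clm_apply (hasFDerivAt_const w y))).add
      ((hJ3.clm_apply (hasFDerivAt_const v y)).clm_apply (hasFDerivAt_const w y))
    have h3 := h1.unique (h2.congr_of_eventuallyEq (by
      filter_upwards [hlaw] with z hz
      exact hz v w))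
    have h4 := congrArg (fun L => L u) h3
    simp at h4
    simp only [← hJ0] at h4
    rw [add_comm, h4]
    abel
  have hA : ∀ u v, J (fderiv ℝ (christoffelMap G) y u v w) =
      fderiv ℝ (christoffelMap G') (f y) (J u) (J v) (J w)
        + christoffelMap G' (f y) (J2 u v) (J w) + christoffelMap G' (f y) (J v) (J2 u w)
        + fderiv ℝ (fderiv ℝ (fderiv ℝ f)) y u v w - J2 u (christoffelMap G y v w) :=
    fun u v => eq_sub_of_add_eq (by rw [add_comm]; exact hD u v w)
  have hL : ∀ u v, J (christoffelMap G y u v) =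
      christoffelMap G' (f y) (J u) (J v) + J2 u v := hlaw.self_of_nhds
  simp only [gaugeCurvature, ContinuousLinearMap.add_apply, ContinuousLinearMap.sub_apply,
    ContinuousLinearMap.mul_apply, map_add, map_sub, hA, hL, hsym2 v u, hsym3 v u]
  abel

/-- The first Bianchi identity. -/
theorem RegularAt.bianchi (h : RegularAt G y) (u v w : E4) :
    gaugeCurvature (christoffelMap G) y u v w + gaugeCurvature (christoffelMap G) y v w u
      + gaugeCurvature (christoffelMap G) y w u v = 0 := by
  have hD := (h.contDiffAt_christoffelMap.differentiableAt (by simp)).hasFDerivAt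
  have h1 : ∀ u v w, fderiv ℝ (christoffelMap G) y u v w = fderiv ℝ (christoffelMap G) y u w v := by
    intro u v w
    have h2 := fun v w => (hD.clm_apply (hasFDerivAt_const v y)).clm_apply (hasFDerivAt_const w y)
    have h3 := (h2 v w).unique ((h2 w v).congr_of_eventuallyEq (by
      filter_upwards [h.eventually] with z hz
      exact hz.christoffelMap_symm v w))
    simpa using congrArg (fun L => L u) h3
  have h2 := h.christoffelMap_symm
  simp only [gaugeCurvature, ContinuousLinearMap.add_apply, ContinuousLinearMap.sub_apply,
    ContinuousLinearMap.mul_apply]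
  rw [h1 u v w, h1 v w u, h1 w u v, h2 v w, h2 w u, h2 u v]
  abel

end Christoffel

/-! ### Changes of charts -/

section Charts

variable {M : Type*} [TopologicalSpace M] [ChartedSpace E4 M]

/-- The passage from `TangentSpace x` to components in the preferred chart at `x₀`. -/
def toChart (x₀ x : M) : E4 →L[ℝ] E4 := mfderiv 𝓘(ℝ, E4) 𝓘(ℝ, E4) (extChart x₀) x

/-- The passage from components in the preferred chart at `x₀` to the tangent space of `M`. -/
def fromChart (x₀ : M) (y : E4) : E4 →L[ℝ] E4 :=
  mfderiv 𝓘(ℝ, E4) 𝓘(ℝ, E4) (extChart x₀).symm y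

/-- The coordinate change from the preferred chart at `x₀` to the one at `x₁`. -/
def coordChange (x₀ x₁ : M) (y : E4) : E4 :=
  extChart x₁ ((extChart x₀).symm y)

variable {x₀ x₁ x : M}

theorem extChartAt_source_mem_nhds_of_mem (h : x ∈ (extChart x₀).source) :
    (extChart x₀).source ∈ 𝓝 x :=
  (isOpen_extChartAt_source x₀).mem_nhds h

theorem coordChange_extChartAt (hx : x ∈ (extChart x₀).source) :
    coordChange x₀ x₁ (extChart x₀ x) = extChart x₁ x := by
  rw [coordChange, (extChart x₀).left_inv hx]

variable [IsManifold 𝓘(ℝ, E4) ∞ M]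

theorem toChart_fromChart {y : E4} (hy : y ∈ (extChart x₀).target) (u : E4) :
    toChart x₀ ((extChart x₀).symm y) (fromChart x₀ y u) = u := by
  have : IsManifold 𝓘(ℝ, E4) 1 M := .of_le (n := ∞) (by simp)
  have h := mfderiv_extChartAt_comp_mfderivWithin_extChartAt_symm (I := 𝓘(ℝ, E4)) hy
  rw [ModelWithCorners.range_eq_univ, mfderivWithin_univ] at h
  exact congrArg (fun L : E4 →L[ℝ] E4 => L u) h

theorem fromChart_toChart (hx : x ∈ (extChart x₀).source) (u : E4) :
    fromChart x₀ (extChart x₀ x) (toChart x₀ x u) = u := by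
  have : IsManifold 𝓘(ℝ, E4) 1 M := .of_le (n := ∞) (by simp)
  have h := mfderivWithin_extChartAt_symm_comp_mfderiv_extChartAt' (I := 𝓘(ℝ, E4)) hx
  rw [ModelWithCorners.range_eq_univ, mfderivWithin_univ] at h
  exact congrArg (fun L : E4 →L[ℝ] E4 => L u) h

theorem toChart_self (x : M) (u : E4) : toChart x x u = u := by
  have : IsManifold 𝓘(ℝ, E4) 1 M := .of_le (n := ∞) (by simp)
  have h := mfderiv_chartAt_eq_tangentCoordChange (I := 𝓘(ℝ, E4)) (mem_chart_source E4 x)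
  have h2 := tangentCoordChange_self (I := 𝓘(ℝ, E4)) (x := x) (z := x) (v := u)
    (mem_extChartAt_source x)
  rw [← h] at h2
  exact h2

theorem contDiffAt_coordChange (h₀ : x ∈ (extChart x₀).source)
    (h₁ : x ∈ (extChart x₁).source) :
    ContDiffAt ℝ ∞ (coordChange x₀ x₁) (extChart x₀ x) := by
  have h := contDiffWithinAt_ext_coord_change (I := 𝓘(ℝ, E4)) (n := ∞) x₁ x₀
    (y := extChart x₀ x) (by
      rw [PartialEquiv.trans_source, PartialEquiv.symm_source]
      exact ⟨(extChart x₀).map_source h₀, by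
        change (extChart x₀).symm (extChart x₀ x) ∈
          (extChart x₁).source
        rwa [(extChart x₀).left_inv h₀]⟩)
  rw [ModelWithCorners.range_eq_univ, contDiffWithinAt_univ] at h
  exact h

theorem toChart_eq (h₀ : x ∈ (extChart x₀).source)
    (h₁ : x ∈ (extChart x₁).source) (u : E4) :
    toChart x₁ x u =
      fderiv ℝ (coordChange x₀ x₁) (extChart x₀ x) (toChart x₀ x u) := by
  have : IsManifold 𝓘(ℝ, E4) 1 M := .of_le (n := ∞) (by simp)
  have e : (extChart x₁ : M → E4) =ᶠ[𝓝 x]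
      coordChange x₀ x₁ ∘ extChart x₀ := by
    filter_upwards [extChartAt_source_mem_nhds_of_mem h₀] with z hz
    exact (coordChange_extChartAt hz).symm
  have h2 : MDifferentiableAt 𝓘(ℝ, E4) 𝓘(ℝ, E4) (coordChange x₀ x₁)
      (extChart x₀ x) :=
    ((contDiffAt_coordChange h₀ h₁).differentiableAt (by simp)).mdifferentiableAt
  have h3 : MDifferentiableAt 𝓘(ℝ, E4) 𝓘(ℝ, E4) (extChart x₀) x :=
    mdifferentiableAt_extChartAt (by simpa using h₀)
  have h4 := mfderiv_comp x h2 h3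
  rw [← e.mfderiv_eq, mfderiv_eq_fderiv] at h4
  exact congrArg (fun L : E4 →L[ℝ] E4 => L u) h4

end Charts

/-! ### Metrics and parallel fields in charts -/

section Metric

variable {M : Type*} [TopologicalSpace M] [ChartedSpace E4 M]

/-- On the open set `U` the field `g` of forms is bilinear, symmetric, nondegenerate and smooth. -/
structure IsMetricOn (g : M → E4 → E4 → ℝ) (U : Set M) : Prop where
  isOpen : IsOpen U
  bilinear : ∀ x ∈ U, ∃ B : E4 →L[ℝ] E4 →L[ℝ] ℝ, ∀ u v, g x u v = B u v
  regular : ∀ x₀ : M, ∀ x ∈ U, x ∈ (extChart x₀).source →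
    RegularAt (chartMetric g x₀) (extChart x₀ x)

variable [IsManifold 𝓘(ℝ, E4) ∞ M] {g : M → E4 → E4 → ℝ} {U : Set M} {x₀ x₁ x : M}

theorem bilin_chartMetric (hg : IsMetricOn g U) (hx : x ∈ U)
    (h₀ : x ∈ (extChart x₀).source) (u v : E4) :
    bilin (chartMetric g x₀ (extChart x₀ x)) u v =
      g x (fromChart x₀ (extChart x₀ x) u)
        (fromChart x₀ (extChart x₀ x) v) := by
  obtain ⟨B, hB⟩ := hg.bilinear x hx
  set K := fromChart x₀ (extChart x₀ x)
  have h1 : ∀ i j, chartMetric g x₀ (extChart x₀ x) i j =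
      B (K (basisVec i)) (K (basisVec j)) := by
    intro i j
    rw [← hB]
    change g ((extChart x₀).symm (extChart x₀ x)) (K (basisVec i))
      (K (basisVec j)) = _
    rw [(extChart x₀).left_inv h₀]
  rw [hB, bilin_apply]
  conv_rhs => rw [← sum_smul_basisVec u, ← sum_smul_basisVec v]
  simp only [map_sum, map_smul, ContinuousLinearMap.sum_apply, ContinuousLinearMap.smul_apply, h1,
    smul_eq_mul, Finset.mul_sum]
  rw [Finset.sum_comm]
  refine Finset.sum_congr rfl fun i _ => Finset.sum_congr rfl fun j _ => ?_
  ring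

theorem metric_eq (hg : IsMetricOn g U) (hx : x ∈ U)
    (h₀ : x ∈ (extChart x₀).source) (u v : E4) :
    g x u v = bilin (chartMetric g x₀ (extChart x₀ x)) (toChart x₀ x u)
      (toChart x₀ x v) := by
  rw [bilin_chartMetric hg hx h₀, fromChart_toChart h₀, fromChart_toChart h₀]

/-- Coordinate changes are isometries. -/
theorem eventually_isometry (hg : IsMetricOn g U) (hx : x ∈ U)
    (h₀ : x ∈ (extChart x₀).source) (h₁ : x ∈ (extChart x₁).source) :
    ∀ᶠ z in 𝓝 (extChart x₀ x), ContDiffAt ℝ ∞ (coordChange x₀ x₁) z ∧ ∀ u v,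
      bilin (chartMetric g x₀ z) u v = bilin (chartMetric g x₁ (coordChange x₀ x₁ z))
        (fderiv ℝ (coordChange x₀ x₁) z u) (fderiv ℝ (coordChange x₀ x₁) z v) := by
  have hc := continuousAt_extChartAt_symm'' ((extChart x₀).map_source h₀)
  rw [ContinuousAt, (extChart x₀).left_inv h₀] at hc
  filter_upwards [extChartAt_target_mem_nhds' ((extChart x₀).map_source h₀),
    hc.eventually_mem (hg.isOpen.mem_nhds hx),
    hc.eventually_mem (extChartAt_source_mem_nhds_of_mem h₁)] with z hz hzU hz1
  obtain ⟨w, hw⟩ : ∃ w, w = (extChart x₀).symm z := ⟨_, rfl⟩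
  have hw0 : w ∈ (extChart x₀).source := hw ▸ (extChart x₀).map_target hz
  have hzw : z = extChart x₀ w := by rw [hw, (extChart x₀).right_inv hz]
  rw [← hw] at hzU hz1
  subst hzw
  refine ⟨contDiffAt_coordChange hw0 hz1, fun u v => ?_⟩
  have hsurj : ∀ u, toChart x₀ w (fromChart x₀ (extChart x₀ w) u) = u := fun u => by
    have := toChart_fromChart ((extChart x₀).map_source hw0) u
    rwa [(extChart x₀).left_inv hw0] at this
  rw [bilin_chartMetric hg hzU hw0, metric_eq hg hzU hz1, toChart_eq hw0 hz1, toChart_eq hw0 hz1,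
    hsurj, hsurj, coordChange_extChartAt hw0]

/-- The equation of parallel transport at the time `t`, in the preferred chart at `x₀`. -/
def ParallelAt (g : M → E4 → E4 → ℝ) (x₀ : M) (γ : ℝ → M) (V : ℝ → E4) (s : Set ℝ) (t : ℝ) :
    Prop :=
  HasDerivWithinAt (fun τ => toChart x₀ (γ τ) (V τ))
    (-(christoffelMap (chartMetric g x₀) (extChart x₀ (γ t))
      (derivWithin (fun τ => extChart x₀ (γ τ)) s t) (toChart x₀ (γ t) (V t)))) s t

theorem hasDerivWithinAt_E4_iff {f : ℝ → E4} {f' : E4} {s : Set ℝ} {t : ℝ} :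
    HasDerivWithinAt f f' s t ↔ ∀ k, HasDerivWithinAt (fun τ => f τ k) (f' k) s t := by
  constructor
  · exact fun h k => (coordMap k).hasFDerivAt.comp_hasDerivWithinAt t h
  · intro h
    have h1 : HasDerivWithinAt (fun τ => ∑ k, f τ k • basisVec k) (∑ k, f' k • basisVec k) s t :=
      HasDerivWithinAt.fun_sum fun k _ => (h k).smul_const _
    simpa only [sum_smul_basisVec] using h1

theorem isParallelOn_iff {γ : ℝ → M} {V : ℝ → E4} {s : Set ℝ} :
    IsParallelOn g γ V s ↔ ∀ t ∈ s, ParallelAt g (γ t) γ V s t := by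
  refine forall₂_congr fun t _ => ?_
  rw [ParallelAt, hasDerivWithinAt_E4_iff]
  refine forall_congr' fun k => ?_
  rw [toChart_self, PiLp.neg_apply, christoffelMap_apply]
  simp only [mul_assoc]
  rfl

theorem differentiableWithinAt_chart {γ : ℝ → M} {s : Set ℝ} {t : ℝ}
    (hγ : ContMDiffWithinAt 𝓘(ℝ, ℝ) 𝓘(ℝ, E4) 1 γ s t)
    (h₀ : γ t ∈ (extChart x₀).source) :
    DifferentiableWithinAt ℝ (fun τ => extChart x₀ (γ τ)) s t := by
  have : IsManifold 𝓘(ℝ, E4) 1 M := .of_le (n := ∞) (by simp)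
  have h1 : ContMDiffAt 𝓘(ℝ, E4) 𝓘(ℝ, E4) 1 (extChart x₀) (γ t) :=
    contMDiffAt_extChartAt' (by simpa using h₀)
  exact ((h1.comp_contMDiffWithinAt t hγ).contDiffWithinAt).differentiableWithinAt (by simp)

/-- The equation of parallel transport does not depend on the chart. -/
theorem ParallelAt.change (hg : IsMetricOn g U) {γ : ℝ → M} {V : ℝ → E4} {s : Set ℝ} {t : ℝ}
    (hγ : ContMDiffWithinAt 𝓘(ℝ, ℝ) 𝓘(ℝ, E4) 1 γ s t) (hs : UniqueDiffWithinAt ℝ s t)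
    (hU : γ t ∈ U) (h₀ : γ t ∈ (extChart x₀).source)
    (h₁ : γ t ∈ (extChart x₁).source) (h : ParallelAt g x₀ γ V s t) :
    ParallelAt g x₁ γ V s t := by
  have hc := (differentiableWithinAt_chart hγ h₀).hasDerivWithinAt
  set c := fun τ => extChart x₀ (γ τ)
  set c' := derivWithin c s t
  set f := coordChange x₀ x₁ with hf
  have hfs : ContDiffAt ℝ ∞ f (c t) := contDiffAt_coordChange h₀ h₁
  have hiso := eventually_isometry hg hU h₀ h₁
  have hcont := hγ.continuousWithinAt
  have hfc : f (c t) = extChart x₁ (γ t) := coordChange_extChartAt h₀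
  have hd1 : HasDerivWithinAt (fun τ => extChart x₁ (γ τ)) (fderiv ℝ f (c t) c') s t := by
    refine ((hfs.differentiableAt (by simp)).hasFDerivAt.comp_hasDerivWithinAt t
      hc).congr_of_eventuallyEq ?_ hfc.symm
    filter_upwards [hcont.eventually_mem (extChartAt_source_mem_nhds_of_mem h₀)] with τ hτ
    exact (coordChange_extChartAt hτ).symm
  have hd2 : HasDerivWithinAt (fun τ => fderiv ℝ f (c τ)) (fderiv ℝ (fderiv ℝ f) (c t) c') s t :=
    ((hfs.fderiv_right (m := ∞) (by simp)).differentiableAt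
      (by simp)).hasFDerivAt.comp_hasDerivWithinAt t hc
  have hlaw := christoffelMap_transform (hg.regular x₀ _ hU h₀)
    (by rw [hfc]; exact hg.regular x₁ _ hU h₁) hfs
    (hiso.mono fun z hz => hz.2) c' (toChart x₀ (γ t) (V t))
  rw [ParallelAt, hd1.derivWithin hs, toChart_eq h₀ h₁]
  refine ((hd2.clm_apply h).congr_of_eventuallyEq ?_ (toChart_eq h₀ h₁ _)).congr_deriv ?_
  · filter_upwards [hcont.eventually_mem (extChartAt_source_mem_nhds_of_mem h₀),
      hcont.eventually_mem (extChartAt_source_mem_nhds_of_mem h₁)] with τ hτ0 hτ1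
    exact toChart_eq hτ0 hτ1 _
  · rw [map_neg, hlaw, ← hfc]
    abel

theorem isParallelOn_iff_chart (hg : IsMetricOn g U) {γ : ℝ → M} {V : ℝ → E4} {a b : ℝ}
    (hab : a < b) (hγ : ContMDiffOn 𝓘(ℝ, ℝ) 𝓘(ℝ, E4) 1 γ (Icc a b)) (hU : MapsTo γ (Icc a b) U)
    (h₀ : MapsTo γ (Icc a b) (extChart x₀).source) :
    IsParallelOn g γ V (Icc a b) ↔ ∀ t ∈ Icc a b, ParallelAt g x₀ γ V (Icc a b) t := by
  rw [isParallelOn_iff]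
  exact forall₂_congr fun t ht =>
    ⟨ParallelAt.change hg (hγ t ht) (uniqueDiffOn_Icc hab t ht) (hU ht) (mem_extChartAt_source _)
      (h₀ ht), ParallelAt.change hg (hγ t ht) (uniqueDiffOn_Icc hab t ht) (hU ht) (h₀ ht)
      (mem_extChartAt_source _)⟩

/-- Scalar products of parallel fields are constant. -/
theorem ParallelAt.hasDerivWithinAt_metric (hg : IsMetricOn g U) {γ : ℝ → M} {V W : ℝ → E4}
    {s : Set ℝ} {t : ℝ} (hγ : ContMDiffWithinAt 𝓘(ℝ, ℝ) 𝓘(ℝ, E4) 1 γ s t) (hU : γ t ∈ U)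
    (h₀ : γ t ∈ (extChart x₀).source)
    (hV : ParallelAt g x₀ γ V s t) (hW : ParallelAt g x₀ γ W s t) :
    HasDerivWithinAt (fun τ => g (γ τ) (V τ) (W τ)) 0 s t := by
  have hc := (differentiableWithinAt_chart hγ h₀).hasDerivWithinAt
  have hcont := hγ.continuousWithinAt
  have hr := hg.regular x₀ _ hU h₀
  have hb := (hr.contDiffAt_bilin.differentiableAt (by simp)).hasFDerivAt.comp_hasDerivWithinAt t hc
  refine (((hb.clm_apply hV).clm_apply hW).congr_of_eventuallyEq ?_
    (metric_eq hg hU h₀ _ _)).congr_deriv ?_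
  · filter_upwards [hcont.eventually_mem (extChartAt_source_mem_nhds_of_mem h₀),
      hcont.eventually_mem (hg.isOpen.mem_nhds hU)] with τ hτ0 hτU
    exact metric_eq hg hτU hτ0 _ _
  · simp only [ContinuousLinearMap.add_apply, Function.comp_apply, map_neg,
      ContinuousLinearMap.neg_apply]
    rw [hr.fderiv_bilin_eq]
    ring

/-- A parallel field on `[a, b]` satisfies the equation in terms of right derivatives. -/
theorem ParallelAt.right {γ : ℝ → M} {V : ℝ → E4} {a b t : ℝ}
    (hγ : ContMDiffOn 𝓘(ℝ, ℝ) 𝓘(ℝ, E4) 1 γ (Icc a b)) (ht : t ∈ Ico a b)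
    (h₀ : γ t ∈ (extChart x₀).source)
    (h : ParallelAt g x₀ γ V (Icc a b) t) :
    ParallelAt g x₀ γ V (Ici t) t ∧ ContMDiffWithinAt 𝓘(ℝ, ℝ) 𝓘(ℝ, E4) 1 γ (Ici t) t := by
  have hm : Icc a b ∈ 𝓝[≥] t := Icc_mem_nhdsGE_of_mem ht
  have hγ' := (hγ t (Ico_subset_Icc_self ht)).mono_of_mem_nhdsWithin hm
  have hd := (differentiableWithinAt_chart (hγ t (Ico_subset_Icc_self ht)) h₀).hasDerivWithinAt
  refine ⟨?_, hγ'⟩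
  rw [ParallelAt, (hd.mono_of_mem_nhdsWithin hm).derivWithin (uniqueDiffOn_Ici t t self_mem_Ici)]
  exact HasDerivWithinAt.mono_of_mem_nhdsWithin h hm

end Metric

/-! ### Finite partitions of intervals -/

section Pieces

variable {P Q : ℝ → ℝ → Prop} {a b c : ℝ}

theorem onPieces_iff :
    OnPieces P a b ↔ Relation.ReflTransGen (fun c d => c < d ∧ P c d) a b := by
  constructor
  · rintro ⟨n, t, ht, rfl, rfl, hp⟩
    induction n with
    | zero => exact .refl
    | succ n ih =>
      exact (ih fun i hi => hp i (hi.trans n.lt_succ_self)).tail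
        ⟨ht n.lt_succ_self, hp n n.lt_succ_self⟩
  · intro h
    induction h with
    | refl => exact ⟨0, fun i => a + i, fun i j h => by simpa using h, by simp, by simp, by simp⟩
    | @tail b d _ h ih =>
      obtain ⟨n, t, ht, h0, hn, hp⟩ := ih
      refine ⟨n + 1, fun i => if i ≤ n then t i else d + (i - (n + 1)), ?_, ?_, ?_, ?_⟩
      · refine strictMono_nat_of_lt_succ fun i => ?_
        by_cases h1 : i + 1 ≤ n
        · simp only [h1, (Nat.le_succ i).trans h1, if_true]
          exact ht i.lt_succ_self
        · by_cases h2 : i ≤ n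
          · have : i = n := by omega
            subst this
            simpa [hn] using h.1
          · simp [h1, h2]
      · simpa using h0
      · simp
      · intro i hi
        rcases (Nat.lt_succ_iff.1 hi).lt_or_eq with h1 | rfl
        · simpa [h1.le, Nat.succ_le_of_lt h1] using hp i h1
        · simpa [hn] using h.2

theorem OnPieces.trans (h : OnPieces P a b) (h' : OnPieces P b c) : OnPieces P a c :=
  onPieces_iff.2 ((onPieces_iff.1 h).trans (onPieces_iff.1 h'))

theorem OnPieces.single (hab : a < b) (h : P a b) : OnPieces P a b :=
  onPieces_iff.2 (.single ⟨hab, h⟩)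

theorem OnPieces.lift (f : ℝ → ℝ) (h : OnPieces P a b)
    (hf : ∀ c d, c < d → P c d → f c < f d ∧ Q (f c) (f d)) : OnPieces Q (f a) (f b) := by
  rw [onPieces_iff] at h ⊢
  induction h with
  | refl => exact .refl
  | tail _ h ih => exact ih.tail (hf _ _ h.1 h.2)

theorem OnPieces.lift_anti (f : ℝ → ℝ) (h : OnPieces P a b)
    (hf : ∀ c d, c < d → P c d → f d < f c ∧ Q (f d) (f c)) : OnPieces Q (f b) (f a) := by
  rw [onPieces_iff] at h ⊢
  induction h with
  | refl => exact .refl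
  | tail _ h ih => exact ih.head (hf _ _ h.1 h.2)

theorem OnPieces.mono (h : OnPieces P a b) (hPQ : ∀ c d, c < d → P c d → Q c d) :
    OnPieces Q a b :=
  h.lift id fun c d hcd hP => ⟨hcd, hPQ c d hcd hP⟩

theorem OnPieces.with_subset (h : OnPieces P a b) :
    OnPieces (fun c d => P c d ∧ Icc c d ⊆ Icc a b) a b := by
  obtain ⟨n, t, ht, rfl, rfl, hp⟩ := h
  exact ⟨n, t, ht, rfl, rfl, fun i hi => ⟨hp i hi, Icc_subset_Icc (ht.monotone (Nat.zero_le i))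
    (ht.monotone (Nat.succ_le_of_lt hi))⟩⟩

theorem OnPieces.exists_right (h : OnPieces P a b) {t : ℝ} (ht : t ∈ Ico a b) :
    ∃ c d, P c d ∧ t ∈ Ico c d := by
  rw [onPieces_iff] at h
  induction h with
  | refl => simp at ht
  | @tail c d _ h ih =>
    rcases lt_or_ge t c with h1 | h1
    · exact ih ⟨ht.1, h1⟩
    · exact ⟨c, d, h.2, h1, ht.2⟩

theorem OnPieces.continuousWithinAt {X : Type*} [TopologicalSpace X] {f : ℝ → ℝ → X}
    (h : OnPieces P a b)
    (hP : ∀ c d, P c d → ∀ t ∈ Icc c d, ContinuousWithinAt (f t) (Icc c d) t) :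
    ∀ t ∈ Icc a b, ContinuousWithinAt (f t) (Icc a b) t := by
  rw [onPieces_iff] at h
  induction h with
  | refl =>
    intro t ht
    rw [Icc_self] at ht ⊢
    rw [mem_singleton_iff.1 ht]
    exact continuousWithinAt_singleton
  | @tail c d hc h ih =>
    have hac : a ≤ c := by
      clear ih h
      induction hc with
      | refl => exact le_rfl
      | tail _ h ih => exact ih.trans h.1.le
    intro t ht
    rw [← Icc_union_Icc_eq_Icc hac h.1.le] at ht ⊢
    have key : ∀ {u v : ℝ}, (t ∈ Icc u v → ContinuousWithinAt (f t) (Icc u v) t) →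
        ContinuousWithinAt (f t) (Icc u v) t := fun {u v} h => by
      by_cases ht : t ∈ Icc u v
      · exact h ht
      · exact continuousWithinAt_of_notMem_closure (by rwa [isClosed_Icc.closure_eq])
    exact (key (ih t)).union (key (hP c d h.2 t))

end Pieces

/-! ### Parallel transport along paths -/

section Transport

variable {M : Type*} [TopologicalSpace M] [ChartedSpace E4 M]

/-- `γ` is of class `C¹` on `[a, b]`. -/
abbrev IsC1On (γ : ℝ → M) (a b : ℝ) : Prop := ContMDiffOn 𝓘(ℝ, ℝ) 𝓘(ℝ, E4) 1 γ (Icc a b)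

/-- `V` is a parallel field along the piecewise `C¹` curve `γ`. -/
def IsParallelAlong (g : M → E4 → E4 → ℝ) (γ : ℝ → M) (V : ℝ → E4) : Prop :=
  OnPieces (fun a b => IsC1On γ a b ∧ IsParallelOn g γ V (Icc a b)) 0 1

/-- `A` is the parallel transport along the path `γ`, which is piecewise `C¹` and lies in `U`. -/
structure IsTransport (g : M → E4 → E4 → ℝ) (U : Set M) {p q : M} (γ : Path p q)
    (A : E4 →ₗ[ℝ] E4) : Prop where
  mem : ∀ t, γ t ∈ U
  piecewise : OnPieces (IsC1On γ.extend) 0 1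
  transport : ∀ v, ∃ V : ℝ → E4, V 0 = v ∧ V 1 = A v ∧ IsParallelAlong g γ.extend V

variable [IsManifold 𝓘(ℝ, E4) ∞ M] {g : M → E4 → E4 → ℝ} {U : Set M}

theorem IsParallelAlong.metric_eq (hg : IsMetricOn g U) {γ : ℝ → M} {V W : ℝ → E4}
    (hU : ∀ t ∈ Icc (0 : ℝ) 1, γ t ∈ U) (hV : IsParallelAlong g γ V)
    (hW : IsParallelAlong g γ W) :
    ContinuousOn (fun t => g (γ t) (V t) (W t)) (Icc 0 1) ∧
      ∀ t ∈ Icc (0 : ℝ) 1, g (γ t) (V t) (W t) = g (γ 0) (V 0) (W 0) := by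
  have hγ : ContinuousOn γ (Icc 0 1) := hV.continuousOn fun c d h => h.1.continuousOn
  have hcont : ∀ {V : ℝ → E4}, IsParallelAlong g γ V → ∀ t ∈ Icc (0 : ℝ) 1,
      ContinuousWithinAt (fun τ => toChart (γ t) (γ τ) (V τ)) (Icc 0 1) t := fun {V} hV =>
    OnPieces.continuousWithinAt (f := fun t τ => toChart (γ t) (γ τ) (V τ)) hV
      fun c d h t ht => (isParallelOn_iff.1 h.2 t ht).continuousWithinAt
  have hc : ContinuousOn (fun t => g (γ t) (V t) (W t)) (Icc 0 1) := by
    intro t ht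
    have h1 := mem_extChartAt_source (I := 𝓘(ℝ, E4)) (γ t)
    have hb : ContinuousWithinAt (fun τ => bilin (chartMetric g (γ t)
        (extChart (γ t) (γ τ)))) (Icc 0 1) t :=
      (hg.regular (γ t) _ (hU t ht) h1).contDiffAt_bilin.continuousAt.comp_continuousWithinAt
        (f := fun τ => extChart (γ t) (γ τ))
        ((continuousAt_extChartAt (γ t)).comp_continuousWithinAt (hγ t ht))
    refine ((hb.clm_apply (hcont hV t ht)).clm_apply (hcont hW t ht)).congr_of_eventuallyEq ?_
      (SingleCopyHolonomy.metric_eq hg (hU t ht) h1 _ _)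
    filter_upwards [(hγ t ht).eventually_mem (extChartAt_source_mem_nhds_of_mem h1),
      self_mem_nhdsWithin] with τ h2 h3
    exact SingleCopyHolonomy.metric_eq hg (hU τ h3) h2 _ _
  refine ⟨hc, constant_of_has_deriv_right_zero hc fun t ht => ?_⟩
  have h1 := mem_extChartAt_source (I := 𝓘(ℝ, E4)) (γ t)
  obtain ⟨c, d, ⟨hγ1, hV1⟩, htc⟩ := hV.exists_right ht
  obtain ⟨c', d', ⟨hγ2, hW2⟩, htc'⟩ := hW.exists_right ht
  have hV3 := (isParallelOn_iff.1 hV1 t (Ico_subset_Icc_self htc)).right hγ1 htc h1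
  have hW3 := (isParallelOn_iff.1 hW2 t (Ico_subset_Icc_self htc')).right hγ2 htc' h1
  exact hV3.1.hasDerivWithinAt_metric hg hV3.2 (hU t (Ico_subset_Icc_self ht)) h1 hW3.1

/-- Affine changes of the parameter, with reversal allowed. -/
theorem isParallelOn_reparam {γ γ' : ℝ → M} {V V' : ℝ → E4} {σ β a b a' b' : ℝ}
    (hab : a < b) (hab' : a' < b') (hmaps : MapsTo (fun τ => σ * τ + β) (Icc a' b') (Icc a b))
    (hγ' : ∀ τ ∈ Icc a' b', γ' τ = γ (σ * τ + β)) (hV' : ∀ τ ∈ Icc a' b', V' τ = V (σ * τ + β))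
    (h : IsC1On γ a b ∧ IsParallelOn g γ V (Icc a b)) :
    IsC1On γ' a' b' ∧ IsParallelOn g γ' V' (Icc a' b') := by
  obtain ⟨hγ, h⟩ := h
  constructor
  · have h1 : ContMDiff 𝓘(ℝ, ℝ) 𝓘(ℝ, ℝ) 1 (fun τ : ℝ => σ * τ + β) :=
      (by fun_prop : ContDiff ℝ 1 (fun τ : ℝ => σ * τ + β)).contMDiff
    exact (hγ.comp h1.contMDiffOn hmaps).congr hγ'
  · rw [isParallelOn_iff] at h ⊢
    intro t ht
    have hℓ : HasDerivWithinAt (fun τ => σ * τ + β) σ (Icc a' b') t := by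
      simpa using (((hasDerivAt_id t).const_mul σ).add_const β).hasDerivWithinAt
    have h1 : HasDerivWithinAt (fun τ => toChart (γ (σ * t + β)) (γ τ) (V τ)) _ (Icc a b)
      ((fun τ => σ * τ + β) t) := h _ (hmaps ht)
    have hc := (differentiableWithinAt_chart (hγ _ (hmaps ht))
      (mem_extChartAt_source (γ (σ * t + β)))).hasDerivWithinAt
    rw [hγ' t ht]
    have hd : HasDerivWithinAt (fun τ => extChart (γ (σ * t + β)) (γ' τ)) _
      (Icc a' b') t := (hc.scomp t hℓ hmaps).congr (fun τ hτ => by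
        simp only [Function.comp_apply]; rw [hγ' τ hτ]) (by
        simp only [Function.comp_apply]; rw [hγ' t ht])
    rw [ParallelAt, hd.derivWithin (uniqueDiffOn_Icc hab' t ht), hγ' t ht, hV' t ht]
    refine ((HasDerivWithinAt.scomp t h1 hℓ hmaps).congr (fun τ hτ => ?_) ?_).congr_deriv ?_
    · simp only [Function.comp_apply]; rw [hγ' τ hτ, hV' τ hτ]
    · simp only [Function.comp_apply]; rw [hγ' t ht, hV' t ht]
    · simp

namespace IsTransport

variable {p q r : M} {γ : Path p q} {γ' : Path q r} {A B : E4 →ₗ[ℝ] E4}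

theorem extend_mem (h : IsTransport g U γ A) (t : ℝ) : γ.extend t ∈ U := by
  rcases le_total t 0 with h0 | h0
  · rw [Path.extend_of_le_zero _ h0, ← γ.source]; exact h.mem 0
  rcases le_total t 1 with h1 | h1
  · rw [Path.extend_apply γ ⟨h0, h1⟩]; exact h.mem _
  · rw [Path.extend_of_one_le _ h1, ← γ.target]; exact h.mem 1

theorem metric_eq (hg : IsMetricOn g U) (h : IsTransport g U γ A) (v w : E4) :
    g q (A v) (A w) = g p v w := by
  obtain ⟨V, hV0, hV1, hV⟩ := h.transport v
  obtain ⟨W, hW0, hW1, hW⟩ := h.transport w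
  have := (hV.metric_eq hg (fun t _ => h.extend_mem t) hW).2 1 (right_mem_Icc.2 zero_le_one)
  simpa [hV0, hV1, hW0, hW1] using this

theorem eq_zero_of_metric (hg : IsMetricOn g U) {x : M} (hx : x ∈ U) {v : E4}
    (h : ∀ w, g x v w = 0) : v = 0 := by
  have h1 := mem_extChartAt_source (I := 𝓘(ℝ, E4)) x
  have := eq_zero_of_bilin (hg.regular x x hx h1).det (u := v) fun w => by
    have := SingleCopyHolonomy.metric_eq hg hx h1 v w
    rw [toChart_self, toChart_self] at this
    rw [← this, h]
  exact this

theorem bijective (hg : IsMetricOn g U) (h : IsTransport g U γ A) : Function.Bijective A := by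
  have hp : p ∈ U := by simpa using h.mem 0
  have hinj : Function.Injective A := (injective_iff_map_eq_zero A).2 fun v hv =>
    eq_zero_of_metric hg hp fun w => by
      have := h.metric_eq hg v w
      obtain ⟨B, hB⟩ := hg.bilinear q (by simpa using h.mem 1)
      rw [← this, hv, hB]; simp
  exact ⟨hinj, LinearMap.injective_iff_surjective.1 hinj⟩

/-- Uniqueness of parallel fields. -/
theorem eq_of_parallel (hg : IsMetricOn g U) (h : IsTransport g U γ A) {V : ℝ → E4}
    (hV : IsParallelAlong g γ.extend V) : V 1 = A (V 0) := by
  have hq : q ∈ U := by simpa using h.mem 1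
  obtain ⟨B, hB⟩ := hg.bilinear q hq
  rw [← sub_eq_zero]
  refine eq_zero_of_metric hg hq fun w' => ?_
  obtain ⟨w, rfl⟩ := (h.bijective hg).2 w'
  obtain ⟨W, hW0, hW1, hW⟩ := h.transport w
  have h1 := (hV.metric_eq hg (fun t _ => h.extend_mem t) hW).2 1 (right_mem_Icc.2 zero_le_one)
  rw [hW0, hW1] at h1
  simp only [Path.extend_one, Path.extend_zero] at h1
  rw [hB, map_sub, ContinuousLinearMap.sub_apply, ← hB, ← hB, h1, h.metric_eq hg, sub_self]

theorem refl (hp : p ∈ U) : IsTransport g U (Path.refl p) LinearMap.id where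
  mem _ := hp
  piecewise := .single zero_lt_one (by
    rw [IsC1On, Path.refl_extend]; exact contMDiffOn_const)
  transport v := ⟨fun _ => v, rfl, rfl, .single zero_lt_one ⟨by
    rw [IsC1On, Path.refl_extend]; exact contMDiffOn_const, by
    rw [Path.refl_extend, isParallelOn_iff]
    intro t _
    simp only [ParallelAt, ContinuousMap.const_apply]
    rw [derivWithin_fun_const]
    simpa using hasDerivWithinAt_const t _ _⟩⟩

theorem trans (h : IsTransport g U γ A) (h' : IsTransport g U γ' B) :
    IsTransport g U (γ.trans γ') (B ∘ₗ A) := by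
  have e1 : ∀ t ∈ Icc (0 : ℝ) (1 / 2), (γ.trans γ').extend t = γ.extend (2 * t + 0) := by
    intro t ht
    rw [Path.extend_apply _ ⟨ht.1, ht.2.trans (by norm_num)⟩, add_zero]
    simp only [Path.trans, Path.coe_mk_mk, Function.comp_apply]
    rw [if_pos ht.2]
  have e2 : ∀ t ∈ Icc (1 / 2 : ℝ) 1, (γ.trans γ').extend t = γ'.extend (2 * t + -1) := by
    intro t ht
    rw [Path.extend_apply _ ⟨le_trans (by norm_num) ht.1, ht.2⟩]
    simp only [Path.trans, Path.coe_mk_mk, Function.comp_apply]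
    split_ifs with h1
    · have : t = 1 / 2 := le_antisymm h1 ht.1
      subst this
      norm_num
    · rfl
  have hm1 : ∀ c d : ℝ, MapsTo (fun τ => 2 * τ + 0) (Icc (c / 2) (d / 2)) (Icc c d) :=
    fun c d τ hτ => ⟨by linarith [hτ.1], by linarith [hτ.2]⟩
  have hm2 : ∀ c d : ℝ, MapsTo (fun τ => 2 * τ + -1) (Icc ((c + 1) / 2) ((d + 1) / 2)) (Icc c d) :=
    fun c d τ hτ => ⟨by linarith [hτ.1], by linarith [hτ.2]⟩
  have hs1 : ∀ {c d : ℝ}, Icc c d ⊆ Icc 0 1 → c < d → Icc (c / 2) (d / 2) ⊆ Icc 0 (1 / 2) :=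
    fun {c d} h hcd => Icc_subset_Icc (by linarith [(h (left_mem_Icc.2 hcd.le)).1])
      (by linarith [(h (right_mem_Icc.2 hcd.le)).2])
  have hs2 : ∀ {c d : ℝ}, Icc c d ⊆ Icc 0 1 → c < d →
      Icc ((c + 1) / 2) ((d + 1) / 2) ⊆ Icc (1 / 2) 1 :=
    fun {c d} h hcd => Icc_subset_Icc (by linarith [(h (left_mem_Icc.2 hcd.le)).1])
      (by linarith [(h (right_mem_Icc.2 hcd.le)).2])
  have glue : ∀ {Q : ℝ → ℝ → Prop} {P P' : ℝ → ℝ → Prop}, OnPieces P 0 1 → OnPieces P' 0 1 →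
      (∀ c d, c < d → Icc c d ⊆ Icc 0 1 → P c d → Q (c / 2) (d / 2)) →
      (∀ c d, c < d → Icc c d ⊆ Icc 0 1 → P' c d → Q ((c + 1) / 2) ((d + 1) / 2)) →
      OnPieces Q 0 1 := by
    intro Q P P' h1 h2 hP hP'
    have h3 := h1.with_subset.lift (Q := Q) (fun t => t / 2) fun c d hcd h =>
      ⟨by linarith, hP c d hcd h.2 h.1⟩
    have h4 := h2.with_subset.lift (Q := Q) (fun t => (t + 1) / 2) fun c d hcd h =>
      ⟨by linarith, hP' c d hcd h.2 h.1⟩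
    norm_num at h3 h4
    exact h3.trans h4
  have hdiff : ∀ {a b a' b' σ β : ℝ} {γ γ' : ℝ → M},
      MapsTo (fun τ => σ * τ + β) (Icc a' b') (Icc a b) →
      (∀ τ ∈ Icc a' b', γ' τ = γ (σ * τ + β)) → IsC1On γ a b → IsC1On γ' a' b' := by
    intro a b a' b' σ β γ γ' hm he hγ
    have h1 : ContMDiff 𝓘(ℝ, ℝ) 𝓘(ℝ, ℝ) 1 (fun τ : ℝ => σ * τ + β) :=
      (by fun_prop : ContDiff ℝ 1 (fun τ : ℝ => σ * τ + β)).contMDiff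
    exact (ContMDiffOn.comp hγ h1.contMDiffOn hm).congr he
  refine ⟨fun t => ?_, ?_, fun v => ?_⟩
  · rw [Path.trans_apply]
    split_ifs
    exacts [h.mem _, h'.mem _]
  · exact glue h.piecewise h'.piecewise
      (fun c d hcd hs hP => hdiff (hm1 c d) (fun τ hτ => e1 τ (hs1 hs hcd hτ)) hP)
      (fun c d hcd hs hP => hdiff (hm2 c d) (fun τ hτ => e2 τ (hs2 hs hcd hτ)) hP)
  · obtain ⟨V, hV0, hV1, hV⟩ := h.transport v
    obtain ⟨W, hW0, hW1, hW⟩ := h'.transport (A v)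
    refine ⟨fun t => if t ≤ 1 / 2 then V (2 * t + 0) else W (2 * t + -1), ?_, ?_, ?_⟩
    · norm_num [hV0]
    · norm_num [hW1]
    · refine glue hV hW
        (fun c d hcd hs hP => isParallelOn_reparam hcd (by linarith) (hm1 c d)
          (fun τ hτ => e1 τ (hs1 hs hcd hτ)) (fun τ hτ => if_pos (hs1 hs hcd hτ).2) hP)
        (fun c d hcd hs hP => isParallelOn_reparam hcd (by linarith) (hm2 c d)
          (fun τ hτ => e2 τ (hs2 hs hcd hτ)) (fun τ hτ => ?_) hP)
      split_ifs with h1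
      · have : τ = 1 / 2 := le_antisymm h1 (hs2 hs hcd hτ).1
        subst this
        norm_num [hV1, hW0]
      · rfl

theorem symm (hg : IsMetricOn g U) (h : IsTransport g U γ A) (hBA : ∀ v, A (B v) = v) :
    IsTransport g U γ.symm B := by
  have e : ∀ t, γ.symm.extend t = γ.extend (-1 * t + 1) := fun t => by
    rw [Path.extend_symm_apply]; ring_nf
  have hm : ∀ c d : ℝ, MapsTo (fun τ => -1 * τ + 1) (Icc (1 - d) (1 - c)) (Icc c d) :=
    fun c d τ hτ => ⟨by linarith [hτ.2], by linarith [hτ.1]⟩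
  refine ⟨fun t => h.mem _, ?_, fun v => ?_⟩
  · have := h.piecewise.lift_anti (Q := IsC1On γ.symm.extend) (fun t => 1 - t)
      fun c d hcd hP => ⟨by linarith, by
        have h1 : ContMDiff 𝓘(ℝ, ℝ) 𝓘(ℝ, ℝ) 1 (fun τ : ℝ => -1 * τ + 1) :=
          (by fun_prop : ContDiff ℝ 1 (fun τ : ℝ => -1 * τ + 1)).contMDiff
        exact (ContMDiffOn.comp hP h1.contMDiffOn (hm c d)).congr fun τ _ => e τ⟩
    simpa using this
  · obtain ⟨V, hV0, hV1, hV⟩ := h.transport (B v)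
    refine ⟨fun t => V (-1 * t + 1), by simp [hV1, hBA], by simp [hV0], ?_⟩
    have := OnPieces.lift_anti (Q := fun a b => IsC1On γ.symm.extend a b ∧
      IsParallelOn g γ.symm.extend (fun t => V (-1 * t + 1)) (Icc a b)) (fun t => 1 - t) hV
      fun c d hcd hP => ⟨by linarith, isParallelOn_reparam hcd (by linarith) (hm c d)
        (fun τ _ => e τ) (fun τ _ => rfl) hP⟩
    simpa [IsParallelAlong] using this

end IsTransport

end Transport

section

attribute [local instance] Matrix.linftyOpNormedRing Matrix.linftyOpNormedAlgebra

/-! ### Transport around small rectangles in coordinates -/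

section Rectangle

theorem pathOrderedExp_of_eq_zero {𝔸 : Type*} [NormedRing 𝔸] [NormedAlgebra ℝ 𝔸] {A : ℝ → 𝔸}
    (hA : ∀ t, A t = 0) (t : ℝ) : pathOrderedExp A t = 1 := by
  rw [pathOrderedExp, tsum_eq_single 0]
  · rfl
  · intro n hn
    obtain ⟨m, rfl⟩ := Nat.exists_eq_succ_of_ne_zero hn
    simp [picardTerm, hA]

section

variable {𝔸 P : Type*} [NormedRing 𝔸] [NormedAlgebra ℝ 𝔸] [NormedAddCommGroup P] [NormedSpace ℝ P]

theorem continuous_fderiv_param {A : P → ℝ → 𝔸} (hA : ContDiff ℝ ∞ A.uncurry) :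
    Continuous (Function.uncurry fun y u => fderiv ℝ (fun y => A y u) y) := by
  have h1 : ContDiff ℝ 1 fun q : P × ℝ => fderiv ℝ (fun y => A y q.2) q.1 :=
    ContDiff.fderiv (f := fun (q : P × ℝ) y => A y q.2) (m := ∞)
      (hA.comp (by fun_prop : ContDiff ℝ ∞ fun w : (P × ℝ) × P => (w.2, w.1.2)))
      contDiff_fst (by exact WithTop.coe_le_coe.2 le_top)
  exact h1.continuous

theorem hasStrictFDerivAt_pathOrderedExp_of_contDiff [CompleteSpace 𝔸] [LocallyCompactSpace P]
    {A : P → ℝ → 𝔸} (hA : ContDiff ℝ ∞ A.uncurry) (y h : P) {B : ℝ → 𝔸}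
    (hB : ∀ u, HasFDerivAt (fun y => A y u) (fderiv ℝ (fun y => A y u) y) y →
      fderiv ℝ (fun y => A y u) y h = B u) :
    ∃ L : P →L[ℝ] 𝔸, HasStrictFDerivAt (fun y => pathOrderedExp (A y) 1) L y ∧
      L h = ∫ u in (0 : ℝ)..1, pathOrderedExp (A y) 1 *
        Ring.inverse (pathOrderedExp (A y) u) * B u * pathOrderedExp (A y) u := by
  have hd : ∀ y u, HasFDerivAt (fun y => A y u) (fderiv ℝ (fun y => A y u) y) y := fun y u =>
    ((hA.comp (by fun_prop : ContDiff ℝ ∞ fun y : P => (y, u))).differentiable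
      (by simp) y).hasFDerivAt
  have hc := continuous_fderiv_param hA
  refine ⟨_, hasStrictFDerivAt_pathOrderedExp hA.continuous hc hd y, ?_⟩
  have hi : Continuous (expDerivIntegrand A (fun y u => fderiv ℝ (fun y => A y u) y) y) :=
    (continuous_expDerivIntegrand hA.continuous hc).comp (f := fun u => (y, u)) (by fun_prop)
  rw [ContinuousLinearMap.intervalIntegral_apply (hi.intervalIntegrable _ _)]
  simp only [expDerivIntegrand_apply, hB _ (hd y _)]

theorem hasStrictDerivAt_pathOrderedExp_of_contDiff [CompleteSpace 𝔸] {A : ℝ → ℝ → 𝔸}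
    (hA : ContDiff ℝ ∞ A.uncurry) {B : ℝ → 𝔸}
    (hB : ∀ u, HasDerivAt (fun s => A s u) (B u) 0) :
    HasStrictDerivAt (fun s => pathOrderedExp (A s) 1) (∫ u in (0 : ℝ)..1, pathOrderedExp (A 0) 1 *
        Ring.inverse (pathOrderedExp (A 0) u) * B u * pathOrderedExp (A 0) u) 0 := by
  obtain ⟨L, h1, h2⟩ := hasStrictFDerivAt_pathOrderedExp_of_contDiff hA 0 1 (B := B)
    fun u h => h.hasDerivAt.unique (hB u)
  rw [← h2]
  exact h1.hasStrictDerivAt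

end

variable {E 𝔸 : Type*} [NormedAddCommGroup E] [NormedSpace ℝ E] [NormedRing 𝔸] [NormedAlgebra ℝ 𝔸]
  {Γ : E → E →L[ℝ] 𝔸}

/-- The transport along the segment from `a` to `b` for the connection `d + Γ`. -/
def segmentTransport (Γ : E → E →L[ℝ] 𝔸) (a b : E) : 𝔸 :=
  pathOrderedExp (fun t => -Γ (a + t • (b - a)) (b - a)) 1

theorem continuous_segmentCoeff (hΓ : Continuous Γ) (a v : E) :
    Continuous fun t : ℝ => -Γ (a + t • v) v := by
  fun_prop

theorem segmentTransport_self (a : E) : segmentTransport Γ a a = 1 :=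
  pathOrderedExp_of_eq_zero (fun t => by simp) 1

theorem hasDerivAt_line (a v : E) (s : ℝ) : HasDerivAt (fun s : ℝ => a + s • v) v s := by
  simpa using ((hasDerivAt_id s).smul_const v).const_add a

variable [CompleteSpace 𝔸]

theorem isUnit_segmentTransport (hΓ : Continuous Γ) (a b : E) :
    IsUnit (segmentTransport Γ a b) :=
  isUnit_pathOrderedExp (continuous_segmentCoeff hΓ _ _) 1

/-- Infinitesimal transport. -/
theorem hasStrictDerivAt_segmentTransport (hΓ : ContDiff ℝ ∞ Γ) (a v : E) :
    HasStrictDerivAt (fun s : ℝ => segmentTransport Γ a (a + s • v)) (-Γ a v) 0 := by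
  let A : ℝ → ℝ → 𝔸 := fun s t => -Γ (a + t • s • v) (s • v)
  have hA : ContDiff ℝ ∞ A.uncurry := by
    refine ContDiff.neg (ContDiff.clm_apply (hΓ.comp ?_) ?_) <;> fun_prop
  have hA0 : ∀ t, A 0 t = 0 := fun t => by simp [A]
  have hd : ∀ t, HasDerivAt (fun s => A s t) (-Γ a v) 0 := by
    intro t
    have h0 : HasDerivAt (fun s : ℝ => a + t • s • v) (t • v) 0 := by
      simpa [smul_comm t] using hasDerivAt_line a (t • v) 0
    have h1 : HasFDerivAt Γ (fderiv ℝ Γ a) (a + t • (0 : ℝ) • v) := by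
      simpa using (hΓ.differentiable (by simp) a).hasFDerivAt
    have h2 : HasDerivAt (fun s : ℝ => Γ (a + t • s • v)) (fderiv ℝ Γ a (t • v)) 0 :=
      h1.comp_hasDerivAt (0 : ℝ) h0
    have h3 : HasDerivAt (fun s : ℝ => s • v) v 0 := by
      simpa using (hasDerivAt_id (0 : ℝ)).smul_const v
    refine (h2.clm_apply h3).neg.congr_deriv ?_
    simp
  have h := hasStrictDerivAt_pathOrderedExp_of_contDiff hA hd
  have e : (fun s : ℝ => segmentTransport Γ a (a + s • v)) = fun s => pathOrderedExp (A s) 1 := by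
    ext1 s
    simp only [segmentTransport, A, add_sub_cancel_left]
  rw [e]
  refine h.congr_deriv ?_
  simp [pathOrderedExp_of_eq_zero hA0]

theorem hasStrictDerivAt_inverse {𝔸 : Type*} [NormedRing 𝔸] [NormedAlgebra ℝ 𝔸] [CompleteSpace 𝔸]
    {f : ℝ → 𝔸} {f' : 𝔸} {t : ℝ} (h : HasStrictDerivAt f f' t) (hu : IsUnit (f t)) :
    HasStrictDerivAt (fun s => Ring.inverse (f s))
      (-(Ring.inverse (f t) * f' * Ring.inverse (f t))) t := by
  obtain ⟨u, hu⟩ := hu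
  have h1 := hasStrictFDerivAt_ringInverse (𝕜 := ℝ) u
  rw [hu] at h1
  refine (h1.comp_hasStrictDerivAt t h).congr_deriv ?_
  rw [← hu, Ring.inverse_unit]
  simp

/-- The transport around the parallelogram at `y` with sides `s • μ` and `ε • ν`. -/
def rectangleTransport (Γ : E → E →L[ℝ] 𝔸) (y μ ν : E) (ε s : ℝ) : 𝔸 :=
  Ring.inverse (segmentTransport Γ y (y + ε • ν)) *
    (Ring.inverse (segmentTransport Γ (y + ε • ν) (y + ε • ν + s • μ)) *
      (segmentTransport Γ (y + s • μ) (y + s • μ + ε • ν) * segmentTransport Γ y (y + s • μ)))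

/-- The curvature is the second-order part of the transport around small parallelograms, hence
tangent to every group that contains those transports. -/
theorem gaugeCurvature_mem_tangentSpaceOne (hΓ : ContDiff ℝ ∞ Γ) (y μ ν : E) {𝔹 : Type*}
    [NormedRing 𝔹] [NormedAlgebra ℝ 𝔹] [FiniteDimensional ℝ 𝔹] [CompleteSpace 𝔹] {H : Set 𝔹}
    (hH : IsUnitGroup H) (Φ : 𝔸 →L[ℝ] 𝔹) (hΦ : Φ 1 = 1) {δ : ℝ} (hδ : 0 < δ)
    (h : ∀ ε ∈ Ico 0 δ, ∀ s ∈ Ico 0 δ, Φ (rectangleTransport Γ y μ ν ε s) ∈ H) :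
    Φ (gaugeCurvature Γ y μ ν) ∈ tangentSpaceOne hH := by
  have hΓc := hΓ.continuous
  let L : ℝ → ℝ → 𝔸 := fun ε => pathOrderedExp fun t => -Γ (y + t • ε • ν) (ε • ν)
  have hS : ∀ ε, segmentTransport Γ y (y + ε • ν) = L ε 1 := fun ε => by
    simp only [segmentTransport, L, add_sub_cancel_left]
  have hLu : ∀ ε t, IsUnit (L ε t) := fun ε t =>
    isUnit_pathOrderedExp (continuous_segmentCoeff hΓc _ _) t
  have hL0 : ∀ t, L 0 t = 1 := fun t => pathOrderedExp_of_eq_zero (fun τ => by simp) t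
  -- the averaged derivative of the coefficients in the direction `μ`
  let k : ℝ → 𝔸 := fun ε => ∫ t in (0 : ℝ)..1,
    Ring.inverse (L ε t) * fderiv ℝ Γ (y + t • ε • ν) μ ν * L ε t
  have hAc : Continuous (Function.uncurry fun ε t : ℝ => -Γ (y + t • ε • ν) (ε • ν)) := by
    simp only [Function.uncurry_def]
    fun_prop
  have hDΓ : Continuous (fderiv ℝ Γ) := hΓ.continuous_fderiv (by simp)
  have hkint : Continuous (Function.uncurry fun ε t : ℝ =>
      Ring.inverse (L ε t) * fderiv ℝ Γ (y + t • ε • ν) μ ν * L ε t) := by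
    refine ((continuous_inverse_pathOrderedExp_param hAc).mul ?_).mul
      (continuous_pathOrderedExp_param hAc)
    fun_prop
  have hk : Continuous k :=
    intervalIntegral.continuous_parametric_intervalIntegral_of_continuous' hkint 0 1
  have hk0 : k 0 = fderiv ℝ Γ y μ ν := by simp [k, hL0]
  have hF2 : ∀ ε, HasStrictDerivAt
      (fun s : ℝ => segmentTransport Γ (y + s • μ) (y + s • μ + ε • ν))
      (-(L ε 1 * (ε • k ε))) 0 := by
    intro ε
    let A : ℝ → ℝ → 𝔸 := fun s t => -Γ (y + s • μ + t • ε • ν) (ε • ν)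
    have hA : ContDiff ℝ ∞ A.uncurry := by
      refine ContDiff.neg (ContDiff.clm_apply (hΓ.comp ?_) ?_) <;> fun_prop
    have hA0 : A 0 = fun t => -Γ (y + t • ε • ν) (ε • ν) := by ext1 t; simp [A]
    have hd : ∀ t, HasDerivAt (fun s => A s t) (-(ε • fderiv ℝ Γ (y + t • ε • ν) μ ν)) 0 := by
      intro t
      have h0 : HasDerivAt (fun s : ℝ => y + s • μ + t • ε • ν) μ 0 :=
        (hasDerivAt_line y μ 0).add_const _
      have h1 : HasFDerivAt Γ (fderiv ℝ Γ (y + t • ε • ν)) (y + (0 : ℝ) • μ + t • ε • ν) := by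
        simpa using (hΓ.differentiable (by simp) (y + t • ε • ν)).hasFDerivAt
      have h2 : HasDerivAt (fun s : ℝ => Γ (y + s • μ + t • ε • ν))
          (fderiv ℝ Γ (y + t • ε • ν) μ) 0 := h1.comp_hasDerivAt (0 : ℝ) h0
      refine (h2.clm_apply (hasDerivAt_const 0 (ε • ν))).neg.congr_deriv ?_
      simp
    have e : (fun s : ℝ => segmentTransport Γ (y + s • μ) (y + s • μ + ε • ν)) =
        fun s => pathOrderedExp (A s) 1 := by
      ext1 s
      simp only [segmentTransport, A, add_sub_cancel_left]
    rw [e]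
    refine (hasStrictDerivAt_pathOrderedExp_of_contDiff hA hd).congr_deriv ?_
    have hi : Continuous fun t : ℝ => Ring.inverse (L ε t) *
        fderiv ℝ Γ (y + t • ε • ν) μ ν * L ε t :=
      hkint.comp (f := fun t : ℝ => (ε, t)) (by fun_prop)
    have h1 : -(L ε 1 * (ε • k ε)) = (-ε) • (ContinuousLinearMap.mul ℝ 𝔸 (L ε 1)) (k ε) := by
      simp
    rw [h1, ← ContinuousLinearMap.intervalIntegral_comp_comm _ (hi.intervalIntegrable _ _),
      ← intervalIntegral.integral_smul]
    refine intervalIntegral.integral_congr fun t _ => ?_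
    simp only [hA0]
    simp [L, mul_assoc]
  let D : ℝ → 𝔸 := fun ε =>
    Ring.inverse (L ε 1) * Γ (y + ε • ν) μ * L ε 1 - ε • k ε - Γ y μ
  have hc : ∀ ε, HasStrictDerivAt (rectangleTransport Γ y μ ν ε) (D ε) 0 := by
    intro ε
    have h3 := hasStrictDerivAt_inverse (hasStrictDerivAt_segmentTransport hΓ (y + ε • ν) μ)
      (isUnit_segmentTransport hΓc _ _)
    have h1 := hasStrictDerivAt_segmentTransport hΓ y μ
    have h4 := (h3.mul ((hF2 ε).mul h1)).const_mul (Ring.inverse (segmentTransport Γ y (y + ε • ν)))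
    refine h4.congr_deriv ?_
    have h5 := Ring.inverse_mul_cancel _ (hLu ε 1)
    simp only [Pi.mul_apply, zero_smul, add_zero, segmentTransport_self, hS, Ring.inverse_one,
      one_mul, mul_one, neg_neg, D, mul_add, mul_neg, ← mul_assoc, h5]
    abel
  have hc1 : ∀ ε, rectangleTransport Γ y μ ν ε 0 = 1 := fun ε => by
    simp only [rectangleTransport, zero_smul, add_zero, segmentTransport_self, Ring.inverse_one,
      one_mul, mul_one]
    exact Ring.inverse_mul_cancel _ (isUnit_segmentTransport hΓc _ _)
  have hD : HasDerivAt D (-gaugeCurvature Γ y μ ν) 0 := by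
    have h1 : HasDerivAt (fun ε => L ε 1) (-Γ y ν) 0 := by
      simpa only [hS] using (hasStrictDerivAt_segmentTransport hΓ y ν).hasDerivAt
    have h2 : HasDerivAt (fun ε => Ring.inverse (L ε 1)) (Γ y ν) 0 := by
      have := hasStrictDerivAt_inverse (hasStrictDerivAt_segmentTransport hΓ y ν)
        (isUnit_segmentTransport hΓc _ _)
      simp only [hS] at this
      simpa [hL0] using this.hasDerivAt
    have h3 : HasDerivAt (fun ε : ℝ => Γ (y + ε • ν) μ) (fderiv ℝ Γ y ν μ) 0 := by
      have h1 : HasFDerivAt Γ (fderiv ℝ Γ y) (y + (0 : ℝ) • ν) := by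
        simpa using (hΓ.differentiable (by simp) y).hasFDerivAt
      have h4 : HasDerivAt (fun ε : ℝ => Γ (y + ε • ν)) (fderiv ℝ Γ y ν) 0 :=
        h1.comp_hasDerivAt (0 : ℝ) (hasDerivAt_line y ν 0)
      simpa using h4.clm_apply (hasDerivAt_const 0 μ)
    have h4 : HasDerivAt (fun ε : ℝ => ε • k ε) (k 0) 0 := by
      rw [hasDerivAt_iff_tendsto_slope]
      refine ((hk.tendsto 0).mono_left nhdsWithin_le_nhds).congr' ?_
      filter_upwards [self_mem_nhdsWithin] with ε hε
      simp only [slope, vsub_eq_sub, sub_zero, zero_smul]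
      rw [smul_smul, inv_mul_cancel₀ hε, one_smul]
    have h5 := (((h2.mul h3).mul h1).sub h4).sub_const (Γ y μ)
    refine h5.congr_deriv ?_
    simp only [Pi.mul_apply, hL0, Ring.inverse_one, zero_smul, add_zero, hk0, gaugeCurvature,
      one_mul, mul_one]
    noncomm_ring
  have hmem : ∀ ε ∈ Ico 0 δ, Φ (D ε) ∈ tangentSpaceOne hH := by
    intro ε hε
    refine mem_tangentSpaceOne_of_nonneg hH (c := fun s => Φ (rectangleTransport Γ y μ ν ε s))
      (by simp only [hc1, hΦ]) (Φ.hasStrictFDerivAt.comp_hasStrictDerivAt 0 (hc ε)) ?_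
    filter_upwards [Ico_mem_nhdsGE hδ] with s hs
    exact h ε hε s hs
  have hΦD : HasDerivWithinAt (fun ε => Φ (D ε)) (Φ (-gaugeCurvature Γ y μ ν)) (Ici 0) 0 :=
    (Φ.hasFDerivAt.comp_hasDerivAt 0 hD).hasDerivWithinAt
  have := deriv_mem_of_eventually_mem _ hΦD (hmem 0 ⟨le_rfl, hδ⟩) (by
    filter_upwards [Ioo_mem_nhdsGT hδ] with ε hε
    exact hmem ε ⟨hε.1.le, hε.2⟩)
  rwa [map_neg, Submodule.neg_mem_iff] at this

end Rectangle

/-! ### Holonomy groups in a frame -/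

section Frames

/-- The matrix of an endomorphism relative to the frame `F e₀, …, F e₃`. -/
def frameRep (F : E4 ≃L[ℝ] E4) : (E4 →ₗ[ℝ] E4) →ₗ[ℝ] Mat4 where
  toFun A := Matrix.of fun a b => F.symm (A (F (basisVec b))) a
  map_add' A B := by ext; simp
  map_smul' c A := by ext; simp

variable {F : E4 ≃L[ℝ] E4}

theorem frameRep_apply (A : E4 →ₗ[ℝ] E4) (a b : Fin 4) :
    frameRep F A a b = F.symm (A (F (basisVec b))) a := rfl

theorem frameRep_eq_iff {A : E4 →ₗ[ℝ] E4} {Λ : Mat4} :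
    frameRep F A = Λ ↔ ∀ b, A (F (basisVec b)) = ∑ a, Λ a b • F (basisVec a) := by
  have h : ∀ b, A (F (basisVec b)) = ∑ a, Λ a b • F (basisVec a) ↔
      ∀ a, F.symm (A (F (basisVec b))) a = Λ a b := fun b => by
    rw [← F.symm.injective.eq_iff]
    have : F.symm (∑ a, Λ a b • F (basisVec a)) = ∑ a, Λ a b • basisVec a := by simp
    rw [this]
    constructor
    · intro h a
      rw [h]
      simp [basisVec_apply]
    · intro h
      ext a
      rw [h]
      simp [basisVec_apply]
  simp only [h]
  constructor
  · rintro rfl b a; rfl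
  · intro h; ext a b; exact h b a

theorem frameRep_id : frameRep F LinearMap.id = 1 := by
  ext a b
  simp [frameRep_apply, basisVec_apply, Matrix.one_apply]

theorem frameRep_comp (A B : E4 →ₗ[ℝ] E4) :
    frameRep F (A ∘ₗ B) = frameRep F A * frameRep F B := by
  rw [frameRep_eq_iff]
  intro b
  have hA := frameRep_eq_iff.1 (rfl : frameRep F A = _)
  have hB := frameRep_eq_iff.1 (rfl : frameRep F B = _)
  rw [LinearMap.comp_apply, hB, map_sum]
  simp only [map_smul, hA, Matrix.mul_apply, Finset.sum_smul, Finset.smul_sum, smul_smul]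
  rw [Finset.sum_comm]
  refine Finset.sum_congr rfl fun i _ => Finset.sum_congr rfl fun j _ => ?_
  rw [mul_comm]

theorem frameRep_injective : Function.Injective (frameRep F) := by
  intro A B h
  have hA := frameRep_eq_iff.1 h
  have hB := frameRep_eq_iff.1 (rfl : frameRep F B = _)
  ext1 u
  obtain ⟨v, rfl⟩ := F.surjective u
  rw [← sum_smul_basisVec v]
  simp only [map_sum, map_smul, hA, hB]

/-- `frameRep` on continuous linear maps. -/
def frameRepL (F : E4 ≃L[ℝ] E4) : (E4 →L[ℝ] E4) →L[ℝ] Mat4 :=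
  LinearMap.toContinuousLinearMap
    ((frameRep F).comp (ContinuousLinearMap.coeLM ℝ : (E4 →L[ℝ] E4) →ₗ[ℝ] (E4 →ₗ[ℝ] E4)))

theorem frameRepL_apply (A : E4 →L[ℝ] E4) : frameRepL F A = frameRep F (A : E4 →ₗ[ℝ] E4) := rfl

theorem frameRep_trans {F' : E4 ≃L[ℝ] E4} {P A B : E4 →ₗ[ℝ] E4} (hF : ∀ u, F' u = P (F u))
    (hB : ∀ u, P (B u) = A (P u)) : frameRep F B = frameRep F' A := by
  have h : ∀ u, F.symm u = F'.symm (P u) := fun u => by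
    rw [F'.eq_symm_apply, hF, F.apply_symm_apply]
  ext a b
  rw [frameRep_apply, frameRep_apply, h, hB, hF]

variable {M : Type*} [TopologicalSpace M] [ChartedSpace E4 M] {g : M → E4 → E4 → ℝ} {U : Set M}

/-- A frame that is orthonormal for a nondegenerate `η` is a basis. -/
theorem exists_frameEquiv {η : Mat4} (hη : η.det ≠ 0) {p : M} {B : E4 →L[ℝ] E4 →L[ℝ] ℝ}
    (hB : ∀ u v, g p u v = B u v) {e : Fin 4 → E4} (he : IsFrame g η p e) :
    ∃ F : E4 ≃L[ℝ] E4, ∀ a, F (basisVec a) = e a := by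
  let F0 : E4 →ₗ[ℝ] E4 := ∑ a, ((coordMap a : E4 →ₗ[ℝ] ℝ).smulRight (e a))
  have h0 : ∀ u, F0 u = ∑ a, u a • e a := fun u => by simp [F0]
  have hinj : Function.Injective F0 := (injective_iff_map_eq_zero F0).2 fun u hu => by
    refine eq_zero_of_bilin hη fun v => ?_
    have h1 : B (F0 u) (F0 v) = bilin η u v := by
      rw [h0, h0, bilin_apply]
      simp only [map_sum, map_smul, ContinuousLinearMap.sum_apply, ContinuousLinearMap.smul_apply,
        smul_eq_mul, Finset.mul_sum, ← hB]
      rw [Finset.sum_comm]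
      refine Finset.sum_congr rfl fun i _ => Finset.sum_congr rfl fun j _ => ?_
      rw [show g p (e i) (e j) = η i j from he i j]
      ring
    rw [← h1, hu]; simp
  refine ⟨(LinearEquiv.ofInjectiveEndo F0 hinj).toContinuousLinearEquiv, fun a => ?_⟩
  change F0 (basisVec a) = e a
  rw [h0]
  simp [basisVec_apply]

theorem mem_matricesInFrame_iff {p : M} {e : Fin 4 → E4} (he : ∀ a, F (basisVec a) = e a)
    {H : Set (E4 →ₗ[ℝ] E4)} {Λ : Mat4} :
    Λ ∈ matricesInFrame (M := M) (p := p) e H ↔ ∃ A ∈ H, frameRep F A = Λ := by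
  simp only [frameRep_eq_iff, he]
  rfl

/-- The parallel transport maps of the loops of a given class. -/
def loopHolonomy (g : M → E4 → E4 → ℝ) (U : Set M) {p : M} (C : Path p p → Prop) :
    Set (E4 →ₗ[ℝ] E4) :=
  {A | ∃ γ, C γ ∧ IsTransport g U γ A}

/-- Classes of loops that are closed under the group operations and contain all null-homotopic
loops. -/
structure IsLoopClass {p : M} (C : Path p p → Prop) : Prop where
  of_homotopic : ∀ γ, γ.Homotopic (Path.refl p) → C γ
  trans : ∀ γ γ', C γ → C γ' → C (γ.trans γ')
  symm : ∀ γ, C γ → C γ.symm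

theorem isLoopClass_true {p : M} : IsLoopClass (fun _ : Path p p => True) :=
  ⟨fun _ _ => trivial, fun _ _ _ _ => trivial, fun _ _ => trivial⟩

theorem isLoopClass_homotopic {p : M} :
    IsLoopClass (fun γ : Path p p => γ.Homotopic (Path.refl p)) := by
  refine ⟨fun _ h => h, fun γ γ' h h' => ?_, fun γ h => ?_⟩
  · exact (h.hcomp h').trans ⟨Path.Homotopy.reflTrans _⟩
  · simpa using h.symm₂

variable [IsManifold 𝓘(ℝ, E4) ∞ M]

theorem isUnitGroup_loopHolonomy (hg : IsMetricOn g U) {p : M} (hp : p ∈ U) {C : Path p p → Prop}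
    (hC : IsLoopClass C) : IsUnitGroup (frameRep F '' loopHolonomy g U C) where
  one_mem := ⟨_, ⟨_, hC.of_homotopic _ (.refl _), IsTransport.refl hp⟩, frameRep_id⟩
  mul_mem := by
    rintro _ _ ⟨A, ⟨γ, hγ, hA⟩, rfl⟩ ⟨B, ⟨γ', hγ', hB⟩, rfl⟩
    exact ⟨_, ⟨_, hC.trans _ _ hγ' hγ, hB.trans hA⟩, frameRep_comp A B⟩
  exists_inv := by
    rintro _ ⟨A, ⟨γ, hγ, hA⟩, rfl⟩
    let A' := LinearEquiv.ofBijective A (hA.bijective hg)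
    have h1 : ∀ v, A (A'.symm v) = v := A'.apply_symm_apply
    refine ⟨_, ⟨_, ⟨_, hC.symm _ hγ, hA.symm hg (B := A'.symm.toLinearMap) h1⟩, rfl⟩, ?_, ?_⟩
    · rw [← frameRep_comp, ← frameRep_id (F := F)]
      congr 1
      ext1 v
      exact h1 v
    · rw [← frameRep_comp, ← frameRep_id (F := F)]
      congr 1
      ext1 v
      exact A'.symm_apply_apply v

/-- A null-homotopic loop at `x` gives an element of the holonomy group at `p`, in the frame
transported from `p` to `x`. -/
theorem frameRep_mem_of_lasso (hg : IsMetricOn g U) {p x : M} {C : Path p p → Prop}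
    (hC : IsLoopClass C) {σ : Path p x} {P : E4 →ₗ[ℝ] E4} (hσ : IsTransport g U σ P)
    {F' : E4 ≃L[ℝ] E4} (hF : ∀ u, F' u = P (F u)) {δ : Path x x} (hδ : δ.Homotopic (Path.refl x))
    {A : E4 →ₗ[ℝ] E4} (hA : IsTransport g U δ A) :
    frameRep F' A ∈ frameRep F '' loopHolonomy g U C := by
  let P' := LinearEquiv.ofBijective P (hσ.bijective hg)
  have h1 : ∀ v, P (P'.symm v) = v := P'.apply_symm_apply
  refine ⟨_, ⟨_, hC.of_homotopic _ ?_, hσ.trans (hA.trans (hσ.symm hg (B := P'.symm.toLinearMap)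
    h1))⟩, frameRep_trans hF fun u => ?_⟩
  · have h2 : (δ.trans σ.symm).Homotopic σ.symm :=
      (hδ.hcomp (.refl _)).trans ⟨Path.Homotopy.reflTrans _⟩
    exact ((Path.Homotopic.refl σ).hcomp h2).trans ⟨(Path.Homotopy.reflTransSymm σ).symm⟩
  · exact h1 _

end Frames

/-! ### Transport along coordinate segments -/

section Balls

variable {M : Type*} [TopologicalSpace M] [ChartedSpace E4 M]

/-- A coordinate ball around `x₀` contained in `U`, with an extension of the Levi-Civita connection
from the ball to all of `ℝ⁴`. -/
structure ConnectionBall (g : M → E4 → E4 → ℝ) (U : Set M) (x₀ : M) where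
  /-- The radius. -/
  r : ℝ
  r_pos : 0 < r
  /-- The extended connection. -/
  Γ : E4 → E4 →L[ℝ] E4 →L[ℝ] E4
  smooth : ContDiff ℝ ∞ Γ
  target : ∀ y ∈ Metric.ball (extChart x₀ x₀) r, y ∈ (extChart x₀).target
  mem : ∀ y ∈ Metric.ball (extChart x₀ x₀) r, (extChart x₀).symm y ∈ U
  eq : ∀ y ∈ Metric.ball (extChart x₀ x₀) r, Γ y = christoffelMap (chartMetric g x₀) y

variable {g : M → E4 → E4 → ℝ} {U : Set M} {x₀ : M}

theorem contDiffAt_smul {E F : Type*} [NormedAddCommGroup E] [NormedSpace ℝ E]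
    [NormedAddCommGroup F] [NormedSpace ℝ F] {n : WithTop ℕ∞} {f : E → ℝ} {h : E → F} {y : E}
    (hf : ContDiffAt ℝ n f y) (hh : ContDiffAt ℝ n h y) : ContDiffAt ℝ n (fun z => f z • h z) y :=
  hf.smul hh

/-- The connection is extended beyond the ball by a smooth cut-off function. -/
theorem nonempty_connectionBall (hg : IsMetricOn g U) (hx : x₀ ∈ U) :
    Nonempty (ConnectionBall g U x₀) := by
  set y₀ := extChart x₀ x₀ with hy₀
  have hc : ContinuousAt (extChart x₀).symm y₀ := continuousAt_extChartAt_symm x₀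
  have hxs := mem_extChartAt_source (I := 𝓘(ℝ, E4)) x₀
  have h1 : ∀ᶠ y in 𝓝 y₀, (extChart x₀).symm y ∈ U :=
    hc.eventually_mem (hg.isOpen.mem_nhds (by rwa [hy₀, (extChart x₀).left_inv hxs]))
  obtain ⟨R, hR, hball⟩ := Metric.eventually_nhds_iff_ball.1
    ((hg.regular x₀ x₀ hx hxs).eventually.and (h1.and (extChartAt_target_mem_nhds x₀)))
  let χ : ContDiffBump y₀ := ⟨R / 3, R / 2, by positivity, by linarith⟩
  refine ⟨⟨R / 3, by positivity, fun y => χ y • christoffelMap (chartMetric g x₀) y, ?_,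
    fun y hy => (hball y (Metric.ball_subset_ball (by linarith) hy)).2.2,
    fun y hy => (hball y (Metric.ball_subset_ball (by linarith) hy)).2.1, fun y hy => ?_⟩⟩
  · rw [contDiff_iff_contDiffAt]
    intro z
    by_cases hz : z ∈ Metric.ball y₀ R
    · exact contDiffAt_smul χ.contDiffAt (hball z hz).1.contDiffAt_christoffelMap
    · have h2 : ∀ᶠ w in 𝓝 z, χ w = 0 := by
        have : (Metric.closedBall y₀ (R / 2))ᶜ ∈ 𝓝 z :=
          Metric.isClosed_closedBall.isOpen_compl.mem_nhds (by
            rw [Metric.mem_ball, not_lt] at hz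
            rw [mem_compl_iff, Metric.mem_closedBall, not_le]
            linarith)
        filter_upwards [this] with w hw
        refine χ.zero_of_le_dist ?_
        rw [mem_compl_iff, Metric.mem_closedBall, not_le] at hw
        exact hw.le
      refine (contDiffAt_const (c := 0)).congr_of_eventuallyEq ?_
      filter_upwards [h2] with w hw
      rw [hw]
      ext1 v
      ext1 u
      exact zero_smul ℝ (christoffelMap (chartMetric g x₀) w v u)
  · rw [χ.one_of_mem_closedBall (Metric.ball_subset_closedBall hy), one_smul]

/-- The straight path between two points of a ball. -/
def ballSegment {c : E4} {r : ℝ} (a b : Metric.ball c r) : Path a b where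
  toFun t := ⟨(a : E4) + (t : ℝ) • ((b : E4) - a), by
    have := (convex_ball c r).add_smul_sub_mem a.2 b.2 t.2
    exact this⟩
  continuous_toFun := by
    refine Continuous.subtype_mk ?_ _
    fun_prop
  source' := by ext1; simp
  target' := by ext1; simp

namespace ConnectionBall

/-- The centre of the ball, in coordinates. -/
abbrev center (_b : ConnectionBall g U x₀) : E4 := extChart x₀ x₀

/-- The parametrisation of a neighbourhood in `M` by the coordinate ball. -/
def param (b : ConnectionBall g U x₀) : C(Metric.ball b.center b.r, M) where
  toFun y := (extChart x₀).symm y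
  continuous_toFun :=
    ((continuousOn_extChartAt_symm x₀).mono fun y hy => b.target y hy).restrict

variable (b : ConnectionBall g U x₀)

theorem param_apply (y : Metric.ball b.center b.r) :
    b.param y = (extChart x₀).symm y := rfl

theorem param_mem (y : Metric.ball b.center b.r) : b.param y ∈ U := b.mem y y.2

theorem param_source (y : Metric.ball b.center b.r) :
    b.param y ∈ (extChart x₀).source :=
  (extChart x₀).map_target (b.target y y.2)

theorem chart_param (y : Metric.ball b.center b.r) : extChart x₀ (b.param y) = y :=
  (extChart x₀).right_inv (b.target y y.2)

theorem center_mem : b.center ∈ Metric.ball b.center b.r := Metric.mem_ball_self b.r_pos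

theorem param_center : b.param ⟨b.center, b.center_mem⟩ = x₀ :=
  (extChart x₀).left_inv (mem_extChartAt_source x₀)

instance : SimplyConnectedSpace (Metric.ball b.center b.r) := by
  have := (convex_ball b.center b.r).contractibleSpace ⟨_, b.center_mem⟩
  infer_instance

variable [IsManifold 𝓘(ℝ, E4) ∞ M]

/-- Parallel transport along a coordinate segment. -/
theorem isTransport_segment (hg : IsMetricOn g U) (a c : Metric.ball b.center b.r) :
    IsTransport g U ((ballSegment a c).map b.param.continuous)
      (fromChart x₀ c ∘L segmentTransport b.Γ a c ∘L toChart x₀ (b.param a) : E4 →L[ℝ] E4) := by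
  set γ := (ballSegment a c).map b.param.continuous
  set A : ℝ → E4 →L[ℝ] E4 := fun t => -b.Γ (a + t • ((c : E4) - a)) ((c : E4) - a)
  have hA : Continuous A := continuous_segmentCoeff b.smooth.continuous _ _
  have hmem : ∀ t ∈ Icc (0 : ℝ) 1, (a : E4) + t • ((c : E4) - a) ∈ Metric.ball b.center b.r :=
    fun t ht => (convex_ball _ _).add_smul_sub_mem a.2 c.2 ht
  have hγ : ∀ t (ht : t ∈ Icc (0 : ℝ) 1), γ.extend t = b.param ⟨_, hmem t ht⟩ := fun t ht =>
    Path.extend_apply _ ht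
  have hγ' : ∀ t ∈ Icc (0 : ℝ) 1, γ.extend t =
      (extChart x₀).symm ((a : E4) + t • ((c : E4) - a)) := hγ
  have hC1 : IsC1On γ.extend 0 1 := by
    have : IsManifold 𝓘(ℝ, E4) 1 M := .of_le (n := ∞) (by simp)
    have h1 : ContMDiff 𝓘(ℝ, ℝ) 𝓘(ℝ, E4) 1 (fun t : ℝ => (a : E4) + t • ((c : E4) - a)) :=
      (by fun_prop : ContDiff ℝ 1 (fun t : ℝ => (a : E4) + t • ((c : E4) - a))).contMDiff
    exact ((contMDiffOn_extChartAt_symm x₀).comp h1.contMDiffOn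
      fun t ht => b.target _ (hmem t ht)).congr hγ'
  refine ⟨fun t => b.param_mem _, .single zero_lt_one hC1, fun v => ?_⟩
  set w := toChart x₀ (b.param a) v with hw
  refine ⟨fun t => fromChart x₀ ((a : E4) + t • ((c : E4) - a)) (pathOrderedExp A t w), ?_, ?_, ?_⟩
  · simp only [zero_smul, add_zero, pathOrderedExp_zero, hw, ContinuousLinearMap.one_apply]
    have := fromChart_toChart (b.param_source a) v
    rwa [b.chart_param] at this
  · simp only [one_smul, add_sub_cancel]
    rfl
  · refine .single zero_lt_one ⟨hC1, (isParallelOn_iff_chart (x₀ := x₀) hg zero_lt_one hC1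
      (fun t ht => ?_) (fun t ht => ?_)).2 fun t ht => ?_⟩
    · rw [hγ t ht]; exact b.param_mem _
    · rw [hγ t ht]; exact b.param_source _
    · have hV : ∀ τ ∈ Icc (0 : ℝ) 1, toChart x₀ (γ.extend τ)
          (fromChart x₀ ((a : E4) + τ • ((c : E4) - a)) (pathOrderedExp A τ w)) =
          pathOrderedExp A τ w := fun τ hτ => by
        rw [hγ' τ hτ]
        exact toChart_fromChart (b.target _ (hmem τ hτ)) _
      have hch : ∀ τ ∈ Icc (0 : ℝ) 1, extChart x₀ (γ.extend τ) =
          (a : E4) + τ • ((c : E4) - a) := fun τ hτ => by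
        rw [hγ τ hτ, b.chart_param]
      have hd : derivWithin (fun τ => extChart x₀ (γ.extend τ)) (Icc 0 1) t =
          (c : E4) - a := by
        rw [derivWithin_congr hch (hch t ht)]
        exact (hasDerivAt_line _ _ t).hasDerivWithinAt.derivWithin
          (uniqueDiffOn_Icc zero_lt_one t ht)
      rw [ParallelAt, hd, hch t ht, hV t ht, ← b.eq _ (hmem t ht)]
      have h2 := (((hasDerivAt_pathOrderedExp hA t).clm_apply
        (hasDerivAt_const t w)).hasDerivWithinAt (s := Icc 0 1)).congr hV (hV t ht)
      refine h2.congr_deriv ?_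
      simp [A]

/-- The loop around a small coordinate parallelogram at the centre. -/
theorem exists_rectangle_loop (hg : IsMetricOn g U) (μ ν : E4) : ∃ δ > 0, ∀ ε ∈ Ico 0 δ,
    ∀ s ∈ Ico 0 δ, ∃ γ : Path x₀ x₀, γ.Homotopic (Path.refl x₀) ∧
      IsTransport g U γ (rectangleTransport b.Γ b.center μ ν ε s : E4 →L[ℝ] E4) := by
  obtain ⟨δ, hδ, hδr⟩ : ∃ δ > 0, δ * (‖μ‖ + ‖ν‖) < b.r := by
    refine ⟨b.r / (‖μ‖ + ‖ν‖ + 1), by have := b.r_pos; positivity, ?_⟩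
    rw [div_mul_eq_mul_div, div_lt_iff₀ (by positivity)]
    have := b.r_pos
    nlinarith
  refine ⟨δ, hδ, fun ε hε s hs => ?_⟩
  have hin : ∀ s' ∈ Ico 0 δ, ∀ ε' ∈ Ico 0 δ,
      b.center + s' • μ + ε' • ν ∈ Metric.ball b.center b.r := fun s' hs' ε' hε' => by
    rw [mem_ball_iff_norm, add_assoc, add_sub_cancel_left]
    refine (norm_add_le _ _).trans_lt (lt_of_le_of_lt ?_ hδr)
    rw [norm_smul, norm_smul, Real.norm_of_nonneg hs'.1, Real.norm_of_nonneg hε'.1]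
    nlinarith [norm_nonneg μ, norm_nonneg ν, hs'.2, hε'.2]
  have h0 : (0 : ℝ) ∈ Ico 0 δ := ⟨le_rfl, hδ⟩
  let y : Metric.ball b.center b.r := ⟨b.center, b.center_mem⟩
  let y1 : Metric.ball b.center b.r :=
    ⟨b.center + s • μ, by simpa using hin s hs 0 h0⟩
  let y2 : Metric.ball b.center b.r := ⟨b.center + s • μ + ε • ν, hin s hs ε hε⟩
  let y3 : Metric.ball b.center b.r := ⟨b.center + ε • ν, by simpa using hin 0 h0 ε hε⟩
  let S := fun u v : Metric.ball b.center b.r => segmentTransport b.Γ u v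
  let T := fun u v : Metric.ball b.center b.r =>
    (fromChart x₀ v ∘L S u v ∘L toChart x₀ (b.param u) : E4 →L[ℝ] E4)
  let T' := fun u v : Metric.ball b.center b.r =>
    (fromChart x₀ u ∘L Ring.inverse (S u v) ∘L toChart x₀ (b.param v) : E4 →L[ℝ] E4)
  have htf : ∀ (u : Metric.ball b.center b.r) w,
      toChart x₀ (b.param u) (fromChart x₀ u w) = w := fun u w =>
    toChart_fromChart (b.target _ u.2) w
  have hft : ∀ (u : Metric.ball b.center b.r) w,
      fromChart x₀ u (toChart x₀ (b.param u) w) = w := fun u w => by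
    have := fromChart_toChart (b.param_source u) w
    rwa [b.chart_param] at this
  have hS : ∀ u v w, S u v (Ring.inverse (S u v) w) = w := fun u v w =>
    congrArg (fun L : E4 →L[ℝ] E4 => L w)
      (Ring.mul_inverse_cancel _ (isUnit_segmentTransport b.smooth.continuous (u : E4) (v : E4)))
  have hT : ∀ u v, IsTransport g U ((ballSegment u v).map b.param.continuous) (T u v) := fun u v =>
    b.isTransport_segment hg u v
  have hT' : ∀ u v, IsTransport g U ((ballSegment u v).map b.param.continuous).symm (T' u v) :=
    fun u v => (hT u v).symm hg fun w => by
      simp only [T, T', ContinuousLinearMap.coe_coe, ContinuousLinearMap.comp_apply, htf, hS, hft]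
  let γ : Path y y := (ballSegment y y1).trans ((ballSegment y1 y2).trans
    ((ballSegment y3 y2).symm.trans (ballSegment y y3).symm))
  have hγ : γ.Homotopic (Path.refl y) := SimplyConnectedSpace.paths_homotopic _ _
  have hall := (hT y y1).trans ((hT y1 y2).trans ((hT' y3 y2).trans (hT' y y3)))
  have hmap : γ.map b.param.continuous = ((ballSegment y y1).map b.param.continuous).trans
      (((ballSegment y1 y2).map b.param.continuous).trans
      (((ballSegment y3 y2).map b.param.continuous).symm.trans
        ((ballSegment y y3).map b.param.continuous).symm)) := by
    simp only [γ, Path.map_trans, Path.map_symm]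
  rw [← hmap] at hall
  have hx₀ : b.param y = x₀ := b.param_center
  have e : ((T' y y3 : E4 →ₗ[ℝ] E4) ∘ₗ (T' y3 y2 : E4 →ₗ[ℝ] E4) ∘ₗ (T y1 y2 : E4 →ₗ[ℝ] E4) ∘ₗ
      (T y y1 : E4 →ₗ[ℝ] E4)) =
      (rectangleTransport b.Γ b.center μ ν ε s : E4 →L[ℝ] E4) := by
    ext1 v
    have h1 : toChart x₀ (b.param y) v = v := by rw [hx₀]; exact toChart_self x₀ v
    have h2 : ∀ w, fromChart x₀ b.center w = w := fun w => by
      have := hft y w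
      rwa [hx₀, toChart_self] at this
    simp only [T, T', S, LinearMap.comp_apply, ContinuousLinearMap.coe_coe,
      ContinuousLinearMap.comp_apply, htf, h1, rectangleTransport, ContinuousLinearMap.mul_apply,
      y, y1, y2, y3, h2, add_right_comm b.center (s • μ)]
  rw [LinearMap.comp_assoc, LinearMap.comp_assoc, e] at hall
  have key : (fun x => ∃ γ : Path x x, γ.Homotopic (Path.refl x) ∧
      IsTransport g U γ (rectangleTransport b.Γ b.center μ ν ε s : E4 →L[ℝ] E4)) (b.param y) :=
    ⟨_, hγ.map b.param, hall⟩
  rw [hx₀] at key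
  exact key

end ConnectionBall

end Balls

section CurvatureHolonomy

variable {M : Type*} [TopologicalSpace M] [ChartedSpace E4 M] [IsManifold 𝓘(ℝ, E4) ∞ M]
  {g : M → E4 → E4 → ℝ} {U : Set M}

/-- The curvature endomorphism `R(u, v)` at `x`, in the preferred chart at `x`. -/
def curvatureAt (g : M → E4 → E4 → ℝ) (x : M) (u v : E4) : E4 →L[ℝ] E4 :=
  gaugeCurvature (christoffelMap (chartMetric g x)) (extChart x x) u v

theorem ConnectionBall.gaugeCurvature_center {x : M} (b : ConnectionBall g U x) (μ ν : E4) :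
    gaugeCurvature b.Γ b.center μ ν = curvatureAt g x μ ν := by
  have h1 : b.Γ =ᶠ[𝓝 b.center] christoffelMap (chartMetric g x) := by
    filter_upwards [Metric.ball_mem_nhds _ b.r_pos] with y hy using b.eq y hy
  rw [gaugeCurvature, h1.fderiv_eq, h1.self_of_nhds, curvatureAt, gaugeCurvature]

theorem mem_tangentSpaceOne_of_rectangles {Γ : E4 → E4 →L[ℝ] E4 →L[ℝ] E4} (hΓ : ContDiff ℝ ∞ Γ)
    (y μ ν : E4) {H : Set Mat4} (hH : IsUnitGroup H) (F : E4 ≃L[ℝ] E4) {δ : ℝ} (hδ : 0 < δ)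
    (h : ∀ ε ∈ Ico 0 δ, ∀ s ∈ Ico 0 δ,
      frameRep F (rectangleTransport Γ y μ ν ε s : E4 →L[ℝ] E4) ∈ H) :
    frameRepL F (gaugeCurvature Γ y μ ν) ∈ tangentSpaceOne hH :=
  gaugeCurvature_mem_tangentSpaceOne hΓ y μ ν hH (frameRepL F) frameRep_id hδ h

/-- The curvature endomorphisms at `x`, carried to `p` by parallel transport, are tangent to the
holonomy group at `p`. -/
theorem curvatureAt_mem_tangentSpaceOne (hg : IsMetricOn g U) {p x : M} (hp : p ∈ U)
    {F : E4 ≃L[ℝ] E4} {C : Path p p → Prop} (hC : IsLoopClass C) {σ : Path p x}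
    {P : E4 →ₗ[ℝ] E4} (hσ : IsTransport g U σ P) {F' : E4 ≃L[ℝ] E4} (hF : ∀ u, F' u = P (F u))
    (μ ν : E4) : frameRepL F' (curvatureAt g x μ ν) ∈
      tangentSpaceOne (isUnitGroup_loopHolonomy (F := F) hg hp hC) := by
  obtain ⟨b⟩ := nonempty_connectionBall hg (x₀ := x) (by simpa using hσ.mem 1)
  obtain ⟨δ, hδ, hloop⟩ := b.exists_rectangle_loop hg μ ν
  rw [← b.gaugeCurvature_center]
  refine mem_tangentSpaceOne_of_rectangles b.smooth _ μ ν _ F' hδ fun ε hε s hs => ?_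
  obtain ⟨γ, hγ, hT⟩ := hloop ε hε s hs
  exact frameRep_mem_of_lasso hg hC hσ hF hγ hT

/-- In a connected region any two points are joined by parallel transport. -/
theorem exists_isTransport (hg : IsMetricOn g U) (hU : IsPreconnected U) {p q : M} (hp : p ∈ U)
    (hq : q ∈ U) : ∃ (σ : Path p q) (P : E4 →ₗ[ℝ] E4), IsTransport g U σ P := by
  refine hU.induction₂ (fun p q => ∃ (σ : Path p q) (P : E4 →ₗ[ℝ] E4), IsTransport g U σ P)
    (fun x hx => ?_) (fun x y z _ _ _ => ?_) (fun x y _ _ => ?_) hp hq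
  · obtain ⟨b⟩ := nonempty_connectionBall hg hx
    have h1 : ∀ᶠ y in 𝓝 x, y ∈ (extChart x).source ∧
        extChart x y ∈ Metric.ball b.center b.r :=
      (show ∀ᶠ y in 𝓝 x, y ∈ (extChart x).source from
        extChartAt_source_mem_nhds_of_mem (mem_extChartAt_source x)).and
        ((continuousAt_extChartAt x).eventually_mem (Metric.ball_mem_nhds _ b.r_pos))
    filter_upwards [mem_nhdsWithin_of_mem_nhds h1] with y hy
    have h2 : (fun x y => ∃ (σ : Path x y) (P : E4 →ₗ[ℝ] E4), IsTransport g U σ P)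
        (b.param ⟨b.center, b.center_mem⟩) (b.param ⟨_, hy.2⟩) :=
      ⟨_, _, b.isTransport_segment hg _ _⟩
    rw [b.param_center, b.param_apply, (extChart x).left_inv hy.1] at h2
    exact h2
  · rintro ⟨σ, P, h⟩ ⟨σ', P', h'⟩
    exact ⟨_, _, h.trans h'⟩
  · rintro ⟨σ, P, h⟩
    exact ⟨_, _, h.symm hg (B := (LinearEquiv.ofBijective P (h.bijective hg)).symm.toLinearMap)
      (LinearEquiv.ofBijective P (h.bijective hg)).apply_symm_apply⟩

/-- The frame at `x` obtained by parallel transport. -/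
theorem exists_transported_frame (hg : IsMetricOn g U) {p x : M} {σ : Path p x}
    {P : E4 →ₗ[ℝ] E4} (hσ : IsTransport g U σ P) (F : E4 ≃L[ℝ] E4) :
    ∃ F' : E4 ≃L[ℝ] E4, ∀ u, F' u = P (F u) :=
  ⟨F.trans (LinearEquiv.ofBijective P (hσ.bijective hg)).toContinuousLinearEquiv, fun _ => rfl⟩

end CurvatureHolonomy

/-! ### Loops as curves and as paths -/

section Loops

variable {M : Type*} [TopologicalSpace M] [ChartedSpace E4 M] {g : M → E4 → E4 → ℝ} {U : Set M}

theorem isParallelOn_congr [IsManifold 𝓘(ℝ, E4) ∞ M] {γ γ' : ℝ → M} {V : ℝ → E4} {a b : ℝ}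
    (hab : a < b) (h : EqOn γ' γ (Icc a b)) (hV : IsC1On γ a b ∧ IsParallelOn g γ V (Icc a b)) :
    IsC1On γ' a b ∧ IsParallelOn g γ' V (Icc a b) :=
  isParallelOn_reparam (σ := 1) (β := 0) hab hab (fun τ hτ => by simpa using hτ)
    (fun τ hτ => by simpa using h hτ) (fun τ _ => by simp) hV

theorem holonomyGroup_eq [IsManifold 𝓘(ℝ, E4) ∞ M] (p : M) :
    holonomyGroup g U p = loopHolonomy g U (fun _ : Path p p => True) := by
  ext A
  constructor
  · rintro ⟨γ, ⟨h0, h1, hU, hp⟩, hA⟩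
    have hc : ContinuousOn γ (Icc 0 1) := hp.continuousOn fun c d h => ContMDiffOn.continuousOn h
    let γ' : Path p p :=
      { toFun := fun t => γ t
        continuous_toFun := hc.restrict
        source' := h0
        target' := h1 }
    have e : EqOn γ'.extend γ (Icc 0 1) := fun t ht => Path.extend_apply γ' ht
    refine ⟨γ', trivial, fun t => hU t.2, ?_, fun v => ?_⟩
    · exact hp.with_subset.mono fun c d hcd h => ContMDiffOn.congr h.1 fun t ht => e (h.2 ht)
    · obtain ⟨V, hV0, hV1, hV⟩ := hA v
      exact ⟨V, hV0, hV1, (OnPieces.with_subset hV).mono fun c d hcd h =>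
        isParallelOn_congr hcd (fun t ht => e (h.2 ht)) h.1⟩
  · rintro ⟨γ, -, hγ⟩
    exact ⟨γ.extend, ⟨γ.extend_zero, γ.extend_one, fun t _ => hγ.extend_mem t, hγ.piecewise⟩,
      hγ.transport⟩

theorem restrictedHolonomyGroup_eq [IsManifold 𝓘(ℝ, E4) ∞ M] (p : M) :
    restrictedHolonomyGroup g univ p =
      loopHolonomy g univ (fun γ : Path p p => γ.Homotopic (Path.refl p)) := by
  ext A
  constructor
  · rintro ⟨γ, ⟨h0, h1, hU, hp⟩, ⟨H, hH, -, hH1, hH2⟩, hA⟩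
    have hc : ContinuousOn γ (Icc 0 1) := hp.continuousOn fun c d h => ContMDiffOn.continuousOn h
    let γ' : Path p p :=
      { toFun := fun t => γ t
        continuous_toFun := hc.restrict
        source' := h0
        target' := h1 }
    have e : EqOn γ'.extend γ (Icc 0 1) := fun t ht => Path.extend_apply γ' ht
    refine ⟨γ', ⟨⟨⟨⟨fun q => H (q.1, q.2), ?_⟩, fun t => ?_, fun t => ?_⟩, ?_⟩⟩, fun t => hU t.2,
      ?_, fun v => ?_⟩
    · exact hH.comp_continuous (f := fun q : unitInterval × unitInterval => ((q.1 : ℝ), (q.2 : ℝ)))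
        (by fun_prop) fun q => ⟨q.1.2, q.2.2⟩
    · exact (hH1 t t.2).1
    · exact (hH1 t t.2).2
    · rintro s t (rfl | rfl)
      · exact ((hH2 s s.2).1).trans γ'.source.symm
      · exact ((hH2 s s.2).2).trans γ'.target.symm
    · exact hp.with_subset.mono fun c d hcd h => ContMDiffOn.congr h.1 fun t ht => e (h.2 ht)
    · obtain ⟨V, hV0, hV1, hV⟩ := hA v
      exact ⟨V, hV0, hV1, (OnPieces.with_subset hV).mono fun c d hcd h =>
        isParallelOn_congr hcd (fun t ht => e (h.2 ht)) h.1⟩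
  · rintro ⟨γ, ⟨H⟩, hγ⟩
    refine ⟨γ.extend, ⟨γ.extend_zero, γ.extend_one, fun t _ => hγ.extend_mem t, hγ.piecewise⟩,
      ⟨fun q => H (projIcc 0 1 zero_le_one q.1, projIcc 0 1 zero_le_one q.2), ?_,
        fun _ _ => mem_univ _, fun t ht => ?_, fun s _ => ?_⟩, hγ.transport⟩
    · have h1 : Continuous (projIcc (0 : ℝ) 1 zero_le_one) := continuous_projIcc
      exact Continuous.continuousOn (H.continuous.comp (by fun_prop))
    · constructor
      · simp only [projIcc_left]
        exact (H.apply_zero _)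
      · simp only [projIcc_right]
        exact (H.apply_one _)
    · constructor
      · simp only [projIcc_left]
        exact H.source _
      · simp only [projIcc_right]
        exact H.target _

end Loops

end

/-! ### Fields that are parallel along the rays from a point -/

section Radial

variable {E 𝔸 : Type*} [NormedAddCommGroup E] [NormedSpace ℝ E] [NormedRing 𝔸] [NormedAlgebra ℝ 𝔸]
  [CompleteSpace 𝔸] {Γ : E → E →L[ℝ] 𝔸}

theorem pathOrderedExp_segment (hΓ : Continuous Γ) (a v : E) (t : ℝ) :
    pathOrderedExp (fun t => -Γ (a + t • v) v) t = segmentTransport Γ a (a + t • v) := by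
  set A : ℝ → 𝔸 := fun t => -Γ (a + t • v) v
  set A' : ℝ → 𝔸 := fun u => -Γ (a + u • t • v) (t • v)
  have hA : Continuous A := continuous_segmentCoeff hΓ a v
  have hA' : Continuous A' := continuous_segmentCoeff hΓ a (t • v)
  have e : ∀ u, A' u = t • A (u * t) := fun u => by simp [A, A', smul_smul]
  have h1 : ∀ u, HasDerivAt (fun u => pathOrderedExp A (u * t))
      (A' u * pathOrderedExp A (u * t)) u := fun u => by
    have h2 := (hasDerivAt_pathOrderedExp hA (u * t)).scomp u
      (((hasDerivAt_id u).mul_const t))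
    refine h2.congr_deriv ?_
    rw [e]
    simp
  have h3 := linearODE_unique (B := fun u => ContinuousLinearMap.mul ℝ 𝔸 (A' u)) (a := 0) (b := 1)
    (f := fun u => pathOrderedExp A (u * t)) (g := pathOrderedExp A') (by fun_prop)
    (fun u _ => (h1 u).continuousAt.continuousWithinAt)
    (fun u _ => (hasDerivAt_pathOrderedExp hA' u).continuousAt.continuousWithinAt)
    (fun u _ => (h1 u).hasDerivWithinAt)
    (fun u _ => (hasDerivAt_pathOrderedExp hA' u).hasDerivWithinAt)
    (by simp [pathOrderedExp_zero]) (right_mem_Icc.2 zero_le_one)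
  simp only [one_mul] at h3
  rw [h3, segmentTransport, add_sub_cancel_left]

/-- If the curvature in radial directions commutes with a field that is parallel along the rays
from `a`, then the field is parallel in all directions: the commutator of the field with the
defect of parallelism along the ray has derivative zero. -/
theorem exists_hasFDerivAt_radial [LocallyCompactSpace E] (hΓ : ContDiff ℝ ∞ Γ) (a y : E) (X : 𝔸)
    (hc : ∀ u ∈ Icc (0 : ℝ) 1, ∀ h, Commute (gaugeCurvature Γ (a + u • (y - a)) (y - a) h)
      (segmentTransport Γ a (a + u • (y - a)) * X *
        Ring.inverse (segmentTransport Γ a (a + u • (y - a))))) :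
    ∃ D : E →L[ℝ] 𝔸, HasFDerivAt
      (fun y => segmentTransport Γ a y * X * Ring.inverse (segmentTransport Γ a y)) D y ∧
      ∀ h, D h =
        segmentTransport Γ a y * X * Ring.inverse (segmentTransport Γ a y) * Γ y h -
          Γ y h * (segmentTransport Γ a y * X * Ring.inverse (segmentTransport Γ a y)) := by
  have hΓc := hΓ.continuous
  set A : E → ℝ → 𝔸 := fun y t => -Γ (a + t • (y - a)) (y - a)
  have hA : ContDiff ℝ ∞ A.uncurry := by
    refine ContDiff.neg (ContDiff.clm_apply (hΓ.comp ?_) ?_) <;> fun_prop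
  have hAy : Continuous (A y) := continuous_segmentCoeff hΓc a (y - a)
  have hS : ∀ y, segmentTransport Γ a y = pathOrderedExp (A y) 1 := fun y => rfl
  set S := segmentTransport Γ a with hSdef
  have hSu : ∀ y, IsUnit (S y) := fun y => isUnit_segmentTransport hΓc a y
  set L : ℝ → 𝔸 := pathOrderedExp (A y)
  set N : ℝ → 𝔸 := fun u => Ring.inverse (L u)
  have hL : ∀ u, HasDerivAt L (A y u * L u) u := hasDerivAt_pathOrderedExp hAy
  have hN : ∀ u, HasDerivAt N (-(N u * A y u)) u := hasDerivAt_inverse_pathOrderedExp hAy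
  have hLu : ∀ u, IsUnit (L u) := isUnit_pathOrderedExp hAy
  have hLN : ∀ u, L u * N u = 1 := fun u => Ring.mul_inverse_cancel _ (hLu u)
  have hNL : ∀ u, N u * L u = 1 := fun u => Ring.inverse_mul_cancel _ (hLu u)
  have hdiff : DifferentiableAt ℝ S y := by
    obtain ⟨K, hK, -⟩ := hasStrictFDerivAt_pathOrderedExp_of_contDiff hA y 0 (fun _ _ => rfl)
    exact hK.hasFDerivAt.differentiableAt
  have hf : DifferentiableAt ℝ (fun y => S y * X * Ring.inverse (S y)) y :=
    (hdiff.mul_const X).mul ((differentiableAt_inverse (𝕜 := ℝ) (hSu y)).comp y hdiff)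
  refine ⟨_, hf.hasFDerivAt, fun h => ?_⟩
  have hz : ∀ u : ℝ, HasDerivAt (fun u : ℝ => a + u • (y - a)) (y - a) u :=
      hasDerivAt_line a (y - a)
  have hDΓ : Continuous (fderiv ℝ Γ) := hΓ.continuous_fderiv (by simp)
  have hΓd : ∀ z, HasFDerivAt Γ (fderiv ℝ Γ z) z := fun z =>
    (hΓ.differentiable (by simp) z).hasFDerivAt
  let B : ℝ → 𝔸 := fun u => -(u • fderiv ℝ Γ (a + u • (y - a)) h (y - a) + Γ (a + u • (y - a)) h)
  have hB : ∀ u, HasFDerivAt (fun y => A y u) (fderiv ℝ (fun y => A y u) y) y →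
      fderiv ℝ (fun y => A y u) y h = B u := by
    intro u hu
    have h0 : HasFDerivAt (fun y : E => a + u • (y - a)) (u • ContinuousLinearMap.id ℝ E) y :=
      (((hasFDerivAt_id y).sub_const a).const_smul u).const_add a
    have h1 : HasFDerivAt (fun y : E => Γ (a + u • (y - a)))
        (fderiv ℝ Γ (a + u • (y - a)) ∘L (u • ContinuousLinearMap.id ℝ E)) y :=
      HasFDerivAt.comp (g := Γ) y (hΓd _) h0
    have h2 := (h1.clm_apply ((hasFDerivAt_id y).sub_const a)).neg
    rw [hu.unique h2]
    simp [B]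
    abel
  obtain ⟨K, hK, hKh⟩ := hasStrictFDerivAt_pathOrderedExp_of_contDiff hA y h hB
  have hBc : Continuous B := by fun_prop
  have hLc : Continuous L := continuous_iff_continuousAt.2 fun u => (hL u).continuousAt
  have hNc : Continuous N := continuous_iff_continuousAt.2 fun u => (hN u).continuousAt
  let Φ : ℝ → 𝔸 := fun u => N u * B u * L u
  have hΦ : Continuous Φ := (hNc.mul hBc).mul hLc
  have hK1 : K h = L 1 * ∫ u in (0 : ℝ)..1, Φ u := by
    rw [hKh]
    change _ = ContinuousLinearMap.mul ℝ 𝔸 (L 1) _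
    rw [← ContinuousLinearMap.intervalIntegral_comp_comm _ (hΦ.intervalIntegrable _ _)]
    refine intervalIntegral.integral_congr fun u _ => ?_
    simp [Φ, N, L, mul_assoc]
  let C : ℝ → 𝔸 := fun u => N u * gaugeCurvature Γ (a + u • (y - a)) (y - a) h * L u
  have hC : ∀ u ∈ Icc (0 : ℝ) 1, C u * X = X * C u := by
    intro u hu
    have h1 := (hc u hu h).eq
    have h2 : S (a + u • (y - a)) = L u := (pathOrderedExp_segment hΓc a (y - a) u).symm
    rw [h2] at h1
    set R := gaugeCurvature Γ (a + u • (y - a)) (y - a) h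
    calc C u * X = N u * (R * (L u * X * N u)) * L u := by
          simp only [C, mul_assoc, hNL, mul_one]; rfl
      _ = N u * ((L u * X * N u) * R) * L u := by rw [← h1]
      _ = X * C u := by simp only [C, ← mul_assoc, hNL, one_mul]; rfl
  let W : ℝ → 𝔸 := fun u => -(u • (N u * Γ (a + u • (y - a)) h * L u))
  have hW : ∀ u, HasDerivAt W (Φ u - u • C u) u := by
    intro u
    have h1 : HasDerivAt (fun u : ℝ => Γ (a + u • (y - a)))
        (fderiv ℝ Γ (a + u • (y - a)) (y - a)) u := (hΓd _).comp_hasDerivAt u (hz u)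
    have h2 : HasDerivAt (fun u : ℝ => Γ (a + u • (y - a)) h)
        (fderiv ℝ Γ (a + u • (y - a)) (y - a) h) u := by
      simpa using h1.clm_apply (hasDerivAt_const u h)
    have h3 := ((hasDerivAt_id u).smul (((hN u).mul h2).mul (hL u))).neg
    refine h3.congr_deriv ?_
    simp only [Φ, C, B, A, gaugeCurvature, id_eq, one_smul, Pi.mul_apply, mul_neg, neg_mul,
      neg_neg, mul_add, add_mul, mul_sub, sub_mul, smul_add, smul_sub, smul_neg, mul_smul_comm,
      smul_mul_assoc, mul_assoc]
    abel
  let T : 𝔸 →L[ℝ] 𝔸 := (ContinuousLinearMap.mul ℝ 𝔸).flip X - ContinuousLinearMap.mul ℝ 𝔸 X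
  have hT : ∀ Z, T Z = Z * X - X * Z := fun Z => by simp [T]
  have hint : T (∫ u in (0 : ℝ)..1, Φ u) = T (W 1) := by
    rw [← ContinuousLinearMap.intervalIntegral_comp_comm _ (hΦ.intervalIntegrable _ _)]
    have h1 : ∀ u ∈ uIcc (0 : ℝ) 1, HasDerivAt (fun u => T (W u)) (T (Φ u)) u := by
      intro u hu
      rw [uIcc_of_le zero_le_one] at hu
      refine (T.hasFDerivAt.comp_hasDerivAt u (hW u)).congr_deriv ?_
      rw [map_sub, map_smul, hT (C u), hC u hu, sub_self, smul_zero, sub_zero]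
    rw [intervalIntegral.integral_eq_sub_of_hasDerivAt h1
      ((T.continuous.comp hΦ).intervalIntegrable _ _)]
    simp [W]
  -- the derivative along the line in the direction `h`
  have hline : HasStrictDerivAt (fun s : ℝ => S (y + s • h)) (K h) 0 := by
    have h1 : HasStrictFDerivAt S K (y + (0 : ℝ) • h) := by
      rw [zero_smul, add_zero]; exact hK
    have h2 : HasStrictDerivAt (fun s : ℝ => y + s • h) h 0 := by
      simpa using ((hasStrictDerivAt_id (0 : ℝ)).smul_const h).const_add y
    exact h1.comp_hasStrictDerivAt 0 h2
  have h1 := (hline.mul_const X).mul (hasStrictDerivAt_inverse hline (hSu _))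
  have h2 : HasDerivAt (fun s : ℝ => S (y + s • h) * X * Ring.inverse (S (y + s • h)))
      (fderiv ℝ (fun y => S y * X * Ring.inverse (S y)) y h) 0 := by
    have h3 : HasFDerivAt (fun y => S y * X * Ring.inverse (S y))
        (fderiv ℝ (fun y => S y * X * Ring.inverse (S y)) y) (y + (0 : ℝ) • h) := by
      simpa using hf.hasFDerivAt
    exact h3.comp_hasDerivAt (0 : ℝ) (hasDerivAt_line y h 0)
  rw [h2.unique h1.hasDerivAt]
  simp only [zero_smul, add_zero]
  have hS1 : S y = L 1 := rfl
  have hW1 : W 1 = -(N 1 * Γ y h * L 1) := by simp [W]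
  rw [hT, hT, hW1] at hint
  set J := ∫ u in (0 : ℝ)..1, Φ u
  rw [hK1, hS1]
  change L 1 * J * X * N 1 + L 1 * X * -(N 1 * (L 1 * J) * N 1) =
    L 1 * X * N 1 * Γ y h - Γ y h * (L 1 * X * N 1)
  calc L 1 * J * X * N 1 + L 1 * X * -(N 1 * (L 1 * J) * N 1)
      = L 1 * (J * X - X * J) * N 1 := by
        rw [← mul_assoc (N 1), hNL]
        noncomm_ring
    _ = L 1 * X * N 1 * Γ y h * (L 1 * N 1) - (L 1 * N 1) * Γ y h * (L 1 * X * N 1) := by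
        rw [hint]
        noncomm_ring
    _ = _ := by rw [hLN]; noncomm_ring

end Radial

section ParallelFields

variable {M : Type*} [TopologicalSpace M] [ChartedSpace E4 M]
  {g : M → E4 → E4 → ℝ} {U N N' : Set M}

/-- The field `s` of endomorphisms of the tangent spaces is parallel at the points of `N`: it maps
parallel vector fields along curves to parallel vector fields. -/
def IsParallelField (g : M → E4 → E4 → ℝ) (N : Set M) (s : M → E4 →L[ℝ] E4) : Prop :=
  ∀ (γ : ℝ → M) (V : ℝ → E4) (S : Set ℝ) (t : ℝ), γ t ∈ N →
    ContMDiffWithinAt 𝓘(ℝ, ℝ) 𝓘(ℝ, E4) 1 γ S t → UniqueDiffWithinAt ℝ S t →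
    ParallelAt g (γ t) γ V S t → ParallelAt g (γ t) γ (fun τ => s (γ τ) (V τ)) S t

theorem ParallelAt.congr {x₀ : M} {γ : ℝ → M} {V W : ℝ → E4} {S : Set ℝ} {t : ℝ} (ht : t ∈ S)
    (h : ParallelAt g x₀ γ V S t) (hW : ∀ᶠ τ in 𝓝[S] t, W τ = V τ) : ParallelAt g x₀ γ W S t := by
  have h0 : W t = V t := hW.self_of_nhdsWithin ht
  rw [ParallelAt, h0]
  refine HasDerivWithinAt.congr_of_eventuallyEq h ?_ (by simp only [h0])
  filter_upwards [hW] with τ hτ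
  rw [hτ]

theorem IsMetricOn.mono (hg : IsMetricOn g U) (hN : IsOpen N) (h : N ⊆ U) : IsMetricOn g N :=
  ⟨hN, fun x hx => hg.bilinear x (h hx), fun x₀ x hx => hg.regular x₀ x (h hx)⟩

/-- Endomorphisms `Y t` along a path that come locally from parallel fields commute with parallel
transport along the path. -/
theorem IsTransport.comp_of_local [IsManifold 𝓘(ℝ, E4) ∞ M] (hg : IsMetricOn g U) {p q : M}
    {γ : Path p q} {P : E4 →ₗ[ℝ] E4} (hγ : IsTransport g U γ P) {Y : ℝ → E4 →L[ℝ] E4}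
    (hY : ∀ t ∈ Icc (0 : ℝ) 1, ∃ N s, γ.extend t ∈ N ∧ IsParallelField g N s ∧
      ∀ᶠ τ in 𝓝[Icc 0 1] t, Y τ = s (γ.extend τ)) (v : E4) :
    Y 1 (P v) = P (Y 0 v) := by
  obtain ⟨V, hV0, hV1, hV⟩ := hγ.transport v
  have hW : IsParallelAlong g γ.extend (fun t => Y t (V t)) := by
    refine (OnPieces.with_subset hV).mono fun c d hcd h => ⟨h.1.1, ?_⟩
    rw [isParallelOn_iff]
    intro t ht
    obtain ⟨N, s, hN, hs, he⟩ := hY t (h.2 ht)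
    refine ParallelAt.congr ht (hs γ.extend V (Icc c d) t hN (h.1.1 t ht)
      (uniqueDiffOn_Icc hcd t ht) (isParallelOn_iff.1 h.1.2 t ht)) ?_
    filter_upwards [nhdsWithin_mono t h.2 he] with τ hτ
    rw [hτ]
  have := hγ.eq_of_parallel hg hW
  rwa [hV0, hV1] at this

theorem IsParallelField.comp_transport [IsManifold 𝓘(ℝ, E4) ∞ M] (hg : IsMetricOn g U)
    {s : M → E4 →L[ℝ] E4} (hs : IsParallelField g U s) {p q : M} {γ : Path p q}
    {P : E4 →ₗ[ℝ] E4} (hγ : IsTransport g U γ P) (v : E4) : s q (P v) = P (s p v) := by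
  have := hγ.comp_of_local hg (Y := fun t => s (γ.extend t))
    (fun t _ => ⟨U, s, hγ.extend_mem t, hs, .of_forall fun _ => rfl⟩) v
  simpa using this

theorem IsParallelField.mono {s : M → E4 →L[ℝ] E4} (hs : IsParallelField g N s) (h : N' ⊆ N) :
    IsParallelField g N' s := fun γ V S t ht => hs γ V S t (h ht)

/-- The points near `x₀` are joined to `x₀` by the transport along coordinate segments. -/
theorem ConnectionBall.exists_transport [IsManifold 𝓘(ℝ, E4) ∞ M] (hg : IsMetricOn g U) {x₀ : M}
    (b : ConnectionBall g U x₀) {z : M} (hz : z ∈ (extChart x₀).source)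
    (hz' : extChart x₀ z ∈ Metric.ball b.center b.r) :
    ∃ σ : Path x₀ z, IsTransport g U σ (fromChart x₀ (extChart x₀ z) ∘L
      segmentTransport b.Γ b.center (extChart x₀ z) : E4 →L[ℝ] E4) := by
  have h1 := b.isTransport_segment hg ⟨b.center, b.center_mem⟩ ⟨_, hz'⟩
  have h2 : (fun x y => ∃ σ : Path x y, IsTransport g U σ
      (fromChart x₀ (extChart x₀ z) ∘L
      segmentTransport b.Γ b.center (extChart x₀ z) ∘L toChart x₀ x : E4 →L[ℝ] E4))
      (b.param ⟨b.center, b.center_mem⟩) (b.param ⟨_, hz'⟩) := ⟨_, h1⟩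
  rw [b.param_center, b.param_apply, (extChart x₀).left_inv hz] at h2
  have h3 : toChart x₀ x₀ = ContinuousLinearMap.id ℝ E4 := by
    ext1 v; exact toChart_self x₀ v
  simp only [h3, ContinuousLinearMap.comp_id] at h2
  exact h2

theorem ConnectionBall.eventually_mem {x₀ : M} (b : ConnectionBall g U x₀) :
    ∀ᶠ z in 𝓝 x₀, z ∈ (extChart x₀).source ∧
      extChart x₀ z ∈ Metric.ball b.center b.r :=
  (show ∀ᶠ y in 𝓝 x₀, y ∈ (extChart x₀).source from
    extChartAt_source_mem_nhds_of_mem (mem_extChartAt_source x₀)).and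
    ((continuousAt_extChartAt x₀).eventually_mem (Metric.ball_mem_nhds _ b.r_pos))

/-- A parallel field is determined near a point by its value at the point. -/
theorem IsParallelField.eventually_eq_iff [IsManifold 𝓘(ℝ, E4) ∞ M] (hg : IsMetricOn g U)
    {s s' : M → E4 →L[ℝ] E4} (hN : IsOpen N) (hN' : IsOpen N') (hNU : N ⊆ U)
    (hs : IsParallelField g N s) (hs' : IsParallelField g N' s') {x : M} (hx : x ∈ N)
    (hx' : x ∈ N') : ∀ᶠ z in 𝓝 x, (s x = s' x ↔ s z = s' z) := by
  have hg' : IsMetricOn g (N ∩ N') := hg.mono (hN.inter hN') (inter_subset_left.trans hNU)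
  obtain ⟨b⟩ := nonempty_connectionBall hg' (x₀ := x) ⟨hx, hx'⟩
  filter_upwards [b.eventually_mem] with z hz
  obtain ⟨σ, hσ⟩ := b.exists_transport hg' hz.1 hz.2
  have h1 := (hs.mono (N' := N ∩ N') inter_subset_left).comp_transport hg' hσ
  have h2 := (hs'.mono (N' := N ∩ N') inter_subset_right).comp_transport hg' hσ
  constructor
  · intro h
    ext1 w
    obtain ⟨v, rfl⟩ := (hσ.bijective hg').2 w
    rw [h1, h2, h]
  · intro h
    ext1 v
    exact (hσ.bijective hg').1 (by rw [← h1, ← h2, h])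

/-- A family of sets of endomorphisms of the tangent spaces that is preserved by parallel transport
and whose members commute with the curvature. -/
structure IsCurvatureInvariant (g : M → E4 → E4 → ℝ) (𝓢 : M → Set (E4 →L[ℝ] E4)) : Prop where
  transport : ∀ {p q : M} {σ : Path p q} {P : E4 →ₗ[ℝ] E4}, IsTransport g univ σ P →
    ∀ f ∈ 𝓢 p, ∀ f' : E4 →L[ℝ] E4, (∀ v, f' (P v) = P (f v)) → f' ∈ 𝓢 q
  commute : ∀ x, ∀ f ∈ 𝓢 x, ∀ u v w, curvatureAt g x u v (f w) = f (curvatureAt g x u v w)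

variable {𝓢 : M → Set (E4 →L[ℝ] E4)} [IsManifold 𝓘(ℝ, E4) ∞ M]

/-- The field obtained from an endomorphism at `x₀` by transport along coordinate segments. -/
def ConnectionBall.radialField {x₀ : M} (b : ConnectionBall g U x₀) (f : E4 →L[ℝ] E4) (z : M) :
    E4 →L[ℝ] E4 :=
  fromChart x₀ (extChart x₀ z) ∘L
    (segmentTransport b.Γ b.center (extChart x₀ z) * f *
      Ring.inverse (segmentTransport b.Γ b.center (extChart x₀ z))) ∘L toChart x₀ z

theorem ConnectionBall.radialField_apply {x₀ : M} (b : ConnectionBall g U x₀) (f : E4 →L[ℝ] E4)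
    {z : M} (hz : z ∈ (extChart x₀).source) (v : E4) :
    b.radialField f z ((fromChart x₀ (extChart x₀ z) ∘L
      segmentTransport b.Γ b.center (extChart x₀ z)) v) =
    (fromChart x₀ (extChart x₀ z) ∘L
      segmentTransport b.Γ b.center (extChart x₀ z)) (f v) := by
  have h1 := toChart_fromChart ((extChart x₀).map_source hz)
    (segmentTransport b.Γ b.center (extChart x₀ z) v)
  rw [(extChart x₀).left_inv hz] at h1
  have h2 := congrArg (fun L : E4 →L[ℝ] E4 => L v) (Ring.inverse_mul_cancel _
    (isUnit_segmentTransport b.smooth.continuous b.center (extChart x₀ z)))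
  simp only [ContinuousLinearMap.mul_apply, ContinuousLinearMap.one_apply] at h2
  simp only [radialField, ContinuousLinearMap.comp_apply, ContinuousLinearMap.mul_apply, h1, h2]

/-- The curvature at `x` read in another chart. -/
theorem curvatureAt_eq_of_chart (hg : IsMetricOn g U) {x x₀ : M} (hx : x ∈ U)
    (h₀ : x ∈ (extChart x₀).source) (u v w : E4) :
    gaugeCurvature (christoffelMap (chartMetric g x₀)) (extChart x₀ x)
      (toChart x₀ x u) (toChart x₀ x v) (toChart x₀ x w) =
    toChart x₀ x (curvatureAt g x u v w) := by
  have h₁ := mem_extChartAt_source (I := 𝓘(ℝ, E4)) x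
  have hiso := eventually_isometry hg hx h₁ h₀
  have h2 := gaugeCurvature_transform (hg.regular x x hx h₁)
    (by rw [coordChange_extChartAt h₁]; exact hg.regular x₀ x hx h₀)
    (hiso.mono fun _ h => h.1) (hiso.mono fun _ h => h.2) u v w
  have h3 : ∀ u, fderiv ℝ (coordChange x x₀) (extChart x x) u = toChart x₀ x u :=
    fun u => by rw [toChart_eq h₁ h₀, toChart_self]
  rw [h3, h3, h3, h3, coordChange_extChartAt h₁] at h2
  exact h2.symm

theorem ConnectionBall.gaugeCurvature_eq {x₀ : M} (b : ConnectionBall g U x₀) {z : M}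
    (hz' : extChart x₀ z ∈ Metric.ball b.center b.r) (u v : E4) :
    gaugeCurvature b.Γ (extChart x₀ z) u v =
      gaugeCurvature (christoffelMap (chartMetric g x₀)) (extChart x₀ z) u v := by
  have h1 : b.Γ =ᶠ[𝓝 (extChart x₀ z)] christoffelMap (chartMetric g x₀) := by
    filter_upwards [Metric.isOpen_ball.mem_nhds hz'] with y hy using b.eq y hy
  rw [gaugeCurvature, h1.fderiv_eq, h1.self_of_nhds]
  rfl

theorem IsCurvatureInvariant.radialField_mem (h𝓢 : IsCurvatureInvariant g 𝓢)
    (hg : IsMetricOn g univ) {x₀ : M} (b : ConnectionBall g univ x₀) {f : E4 →L[ℝ] E4}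
    (hf : f ∈ 𝓢 x₀) {z : M} (hz : z ∈ (extChart x₀).source)
    (hz' : extChart x₀ z ∈ Metric.ball b.center b.r) : b.radialField f z ∈ 𝓢 z := by
  obtain ⟨σ, hσ⟩ := b.exists_transport hg hz hz'
  exact h𝓢.transport hσ f hf _ fun v => b.radialField_apply f hz v

theorem commute_of_apply {R Z : E4 →L[ℝ] E4} (h : ∀ w, R (Z w) = Z (R w)) : Commute R Z :=
  ContinuousLinearMap.ext h

theorem commute_of_conj {K : E4 → E4} (hK : Function.Surjective K) {R Z R' s : E4 →L[ℝ] E4}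
    (hR : ∀ w, R (K w) = K (R' w)) (hs : ∀ w, K (s w) = Z (K w))
    (hc : ∀ w, R' (s w) = s (R' w)) : Commute R Z := by
  refine commute_of_apply fun w => ?_
  obtain ⟨w, rfl⟩ := hK w
  rw [hR, ← hs, ← hs, hR, hc]

/-- The field in coordinates commutes with the curvature. -/
theorem IsCurvatureInvariant.commute_gaugeCurvature (h𝓢 : IsCurvatureInvariant g 𝓢)
    (hg : IsMetricOn g univ) {x₀ : M} (b : ConnectionBall g univ x₀) {f : E4 →L[ℝ] E4}
    (hf : f ∈ 𝓢 x₀) {y : E4} (hy : y ∈ Metric.ball b.center b.r) (u v : E4) :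
    Commute (gaugeCurvature b.Γ y u v) (segmentTransport b.Γ b.center y * f *
      Ring.inverse (segmentTransport b.Γ b.center y)) := by
  obtain ⟨z, hz, rfl⟩ : ∃ z ∈ (extChart x₀).source, extChart x₀ z = y :=
    ⟨_, (extChart x₀).map_target (b.target y hy),
      (extChart x₀).right_inv (b.target y hy)⟩
  have hmem := h𝓢.radialField_mem hg b hf hz hy
  have hK : ∀ w, toChart x₀ z (fromChart x₀ (extChart x₀ z) w) = w := fun w => by
    have := toChart_fromChart ((extChart x₀).map_source hz) w
    rwa [(extChart x₀).left_inv hz] at this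
  obtain ⟨u, rfl⟩ : ∃ u', toChart x₀ z u' = u := ⟨_, hK u⟩
  obtain ⟨v, rfl⟩ : ∃ v', toChart x₀ z v' = v := ⟨_, hK v⟩
  rw [b.gaugeCurvature_eq hy]
  exact commute_of_conj (K := toChart x₀ z) (fun w => ⟨_, hK w⟩)
    (curvatureAt_eq_of_chart hg (mem_univ z) hz u v) (fun w => hK _) (h𝓢.commute z _ hmem u v)

theorem IsCurvatureInvariant.isParallelField_radialField (h𝓢 : IsCurvatureInvariant g 𝓢)
    (hg : IsMetricOn g univ) {x₀ : M} (b : ConnectionBall g univ x₀) {f : E4 →L[ℝ] E4}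
    (hf : f ∈ 𝓢 x₀) : IsParallelField g {z | z ∈ (extChart x₀).source ∧
      extChart x₀ z ∈ Metric.ball b.center b.r} (b.radialField f) := by
  rintro γ V S t ⟨hz, hy⟩ hγ hS hV
  refine ParallelAt.change hg hγ hS (mem_univ _) hz (mem_extChartAt_source _) ?_
  have hV' := ParallelAt.change (x₁ := x₀) hg hγ hS (mem_univ _) (mem_extChartAt_source _) hz hV
  have hc := (differentiableWithinAt_chart hγ hz).hasDerivWithinAt
  set c := fun τ => extChart x₀ (γ τ)
  set c' := derivWithin c S t
  obtain ⟨D, hD, hDh⟩ := exists_hasFDerivAt_radial b.smooth b.center (c t) f fun u hu h =>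
    h𝓢.commute_gaugeCurvature hg b hf
      ((convex_ball b.center b.r).add_smul_sub_mem b.center_mem hy hu) _ h
  set Z : E4 → E4 →L[ℝ] E4 := fun y => segmentTransport b.Γ b.center y * f *
    Ring.inverse (segmentTransport b.Γ b.center y)
  have h1 : HasDerivWithinAt (fun τ => Z (c τ)) (D c') S t :=
    HasFDerivAt.comp_hasDerivWithinAt (f := c) t hD hc
  have h2 : HasDerivWithinAt (fun τ => Z (c τ) (toChart x₀ (γ τ) (V τ)))
      (D c' (toChart x₀ (γ t) (V t)) + Z (c t) (-(christoffelMap (chartMetric g x₀) (c t) c'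
        (toChart x₀ (γ t) (V t))))) S t := h1.clm_apply hV'
  have hev : ∀ᶠ τ in 𝓝[S] t, γ τ ∈ (extChart x₀).source :=
    hγ.continuousWithinAt.eventually_mem (extChartAt_source_mem_nhds_of_mem hz)
  have hfield : ∀ τ, γ τ ∈ (extChart x₀).source →
      toChart x₀ (γ τ) (b.radialField f (γ τ) (V τ)) = Z (c τ) (toChart x₀ (γ τ) (V τ)) := by
    intro τ hτ
    have := toChart_fromChart ((extChart x₀).map_source hτ)
      (Z (c τ) (toChart x₀ (γ τ) (V τ)))
    rw [(extChart x₀).left_inv hτ] at this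
    exact this
  have h3 := h2.congr_of_eventuallyEq (hev.mono fun τ hτ => hfield τ hτ) (hfield t hz)
  rw [ParallelAt, hfield t hz]
  refine h3.congr_deriv ?_
  rw [hDh, b.eq _ hy]
  simp only [ContinuousLinearMap.sub_apply, ContinuousLinearMap.mul_apply, map_neg]
  change Z (c t) _ - _ + -(Z (c t) _) = _
  abel

/-- Local existence of parallel fields with prescribed value at any point of a neighbourhood. -/
theorem IsCurvatureInvariant.exists_local (h𝓢 : IsCurvatureInvariant g 𝓢)
    (hg : IsMetricOn g univ) (x₀ : M) : ∃ N : Set M, IsOpen N ∧ x₀ ∈ N ∧ ∀ x ∈ N, ∀ f ∈ 𝓢 x,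
      ∃ s, IsParallelField g N s ∧ s x = f ∧ ∀ z ∈ N, s z ∈ 𝓢 z := by
  obtain ⟨b⟩ := nonempty_connectionBall hg (mem_univ x₀)
  refine ⟨{z | z ∈ (extChart x₀).source ∧
    extChart x₀ z ∈ Metric.ball b.center b.r},
    (continuousOn_extChartAt x₀).isOpen_inter_preimage (isOpen_extChartAt_source x₀)
      Metric.isOpen_ball, ⟨mem_extChartAt_source x₀, b.center_mem⟩, ?_⟩
  rintro x ⟨hx, hx'⟩ f hf
  obtain ⟨σ, hσ⟩ := b.exists_transport hg hx hx'
  set P := fromChart x₀ (extChart x₀ x) ∘L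
      segmentTransport b.Γ b.center (extChart x₀ x)
  let e := (LinearEquiv.ofBijective (P : E4 →ₗ[ℝ] E4) (hσ.bijective hg))
  have he : ∀ v, P (e.symm v) = v := e.apply_symm_apply
  have he' : ∀ v, e.symm (P v) = v := e.symm_apply_apply
  let f₀ : E4 →L[ℝ] E4 := LinearMap.toContinuousLinearMap
    (e.symm.toLinearMap ∘ₗ (f : E4 →ₗ[ℝ] E4) ∘ₗ (P : E4 →ₗ[ℝ] E4))
  have hf₀ : ∀ v, P (f₀ v) = f (P v) := fun v => he _
  have hmem : f₀ ∈ 𝓢 x₀ := by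
    refine h𝓢.transport (hσ.symm hg (B := e.symm.toLinearMap) he) f hf f₀ fun v => ?_
    change e.symm (f (P (e.symm v))) = e.symm (f v)
    rw [he]
  refine ⟨b.radialField f₀, h𝓢.isParallelField_radialField hg b hmem, ?_,
    fun z hz => h𝓢.radialField_mem hg b hmem hz.1 hz.2⟩
  ext1 w
  obtain ⟨v, rfl⟩ : ∃ v, P v = w := ⟨_, he w⟩
  rw [← hf₀]
  exact b.radialField_apply f₀ hx v

end ParallelFields

section Homotopy

variable {M : Type*} [TopologicalSpace M] [ChartedSpace E4 M]
  {g : M → E4 → E4 → ℝ} {𝓢 : M → Set (E4 →L[ℝ] E4)} {Z : Type*} [TopologicalSpace Z]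
  {G : Z → M} {C C' : Set Z} {Y Y' : Z → E4 →L[ℝ] E4}

/-- `Y` is a parallel section of `𝓢` along the map `G`, over the set `C`: it is locally the
composition of `G` with a parallel field. -/
def IsParallelSection (g : M → E4 → E4 → ℝ) (G : Z → M) (C : Set Z) (Y : Z → E4 →L[ℝ] E4) : Prop :=
  ∀ z ∈ C, ∃ (N : Set M) (s : M → E4 →L[ℝ] E4), IsOpen N ∧ G z ∈ N ∧ IsParallelField g N s ∧
    ∀ᶠ w in 𝓝[C] z, Y w = s (G w)

theorem IsParallelSection.mono (h : IsParallelSection g G C Y) (hC : C' ⊆ C) :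
    IsParallelSection g G C' Y := fun z hz => by
  obtain ⟨N, s, hN, hz', hs, he⟩ := h z (hC hz)
  exact ⟨N, s, hN, hz', hs, nhdsWithin_mono z hC he⟩

theorem IsParallelSection.eq_of_const (h : IsParallelSection g G C Y) (hC : IsPreconnected C)
    {p : M} (hG : ∀ z ∈ C, G z = p) {z w : Z} (hz : z ∈ C) (hw : w ∈ C) : Y z = Y w := by
  refine hC.induction₂ (fun z w => Y z = Y w) (fun z hz => ?_) (fun _ _ _ _ _ _ => Eq.trans)
    (fun _ _ _ _ => Eq.symm) hz hw
  obtain ⟨N, s, hN, hz', hs, he⟩ := h z hz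
  filter_upwards [he, self_mem_nhdsWithin] with w hw hwC
  rw [hw, he.self_of_nhdsWithin hz, hG w hwC, hG z hz]

variable [IsManifold 𝓘(ℝ, E4) ∞ M]

theorem IsParallelSection.eqOn (hg : IsMetricOn g univ) (hG : Continuous G)
    (h : IsParallelSection g G C Y) (h' : IsParallelSection g G C Y') (hC : IsPreconnected C)
    {z w : Z} (hz : z ∈ C) (hw : w ∈ C) (he : Y z = Y' z) : Y w = Y' w := by
  refine (hC.induction₂ (fun z w => Y z = Y' z ↔ Y w = Y' w) (fun z hz => ?_)
    (fun _ _ _ _ _ _ => Iff.trans) (fun _ _ _ _ => Iff.symm) hz hw).1 he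
  obtain ⟨N, s, hN, hzN, hs, he⟩ := h z hz
  obtain ⟨N', s', hN', hzN', hs', he'⟩ := h' z hz
  have h1 := hG.continuousAt.eventually
    (hs.eventually_eq_iff hg hN hN' (subset_univ _) hs' hzN hzN')
  filter_upwards [he, he', mem_nhdsWithin_of_mem_nhds h1] with w hw hw' hw1
  rw [hw, hw', he.self_of_nhdsWithin hz, he'.self_of_nhdsWithin hz]
  exact hw1

/-- Every value of `𝓢` at a point of `C` extends to a parallel section over `C`. -/
def HasParallelSections (g : M → E4 → E4 → ℝ) (𝓢 : M → Set (E4 →L[ℝ] E4)) (G : Z → M)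
    (C : Set Z) : Prop :=
  ∀ z ∈ C, ∀ f ∈ 𝓢 (G z), ∃ Y, IsParallelSection g G C Y ∧ Y z = f ∧ ∀ w ∈ C, Y w ∈ 𝓢 (G w)

/-- Parallel sections over closed sets with connected overlaps and a common point can be glued. -/
theorem HasParallelSections.iUnion (hg : IsMetricOn g univ) (hG : Continuous G) {κ : Type*}
    [Finite κ] {D : κ → Set Z} (hclosed : ∀ k, IsClosed (D k))
    (hconn : ∀ k l, IsPreconnected (D k ∩ D l)) {c : Z} (hc : ∀ k, c ∈ D k)
    (h : ∀ k, HasParallelSections g 𝓢 G (D k)) : HasParallelSections g 𝓢 G (⋃ k, D k) := by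
  classical
  intro z₀ hz₀ f hf
  obtain ⟨k₀, hk₀⟩ := mem_iUnion.1 hz₀
  obtain ⟨Y₀, hY₀, hY₀f, hY₀m⟩ := h k₀ z₀ hk₀ f hf
  choose Yk hYk hYkc hYkm using fun k => h k c (hc k) (Y₀ c) (hY₀m c (hc k₀))
  let Y : Z → E4 →L[ℝ] E4 := fun z => if hz : ∃ k, z ∈ D k then Yk hz.choose z else 0
  have hY : ∀ k, ∀ z ∈ D k, Y z = Yk k z := fun k z hz => by
    have hex : ∃ k, z ∈ D k := ⟨k, hz⟩
    simp only [Y, dif_pos hex]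
    exact ((hYk _).mono inter_subset_left).eqOn hg hG ((hYk k).mono inter_subset_right)
      (hconn hex.choose k) ⟨hc _, hc k⟩ ⟨hex.choose_spec, hz⟩ (by rw [hYkc, hYkc])
  refine ⟨Y, fun z hz => ?_, ?_, fun w hw => ?_⟩
  · obtain ⟨k, hk⟩ := mem_iUnion.1 hz
    obtain ⟨N, s, hN, hzN, hs, he⟩ := hYk k z hk
    refine ⟨N, s, hN, hzN, hs, ?_⟩
    have key : ∀ l, ∀ᶠ w in 𝓝 z, w ∈ D l → Y w = s (G w) := fun l => by
      by_cases hzl : z ∈ D l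
      · obtain ⟨N', s', hN', hzN', hs', he'⟩ := hYk l z hzl
        have h1 := hG.continuousAt.eventually
          (hs.eventually_eq_iff hg hN hN' (subset_univ _) hs' hzN hzN')
        filter_upwards [eventually_nhdsWithin_iff.1 he', h1] with w hw hw1 hwl
        rw [hY l w hwl, hw hwl]
        refine (hw1.1 ?_).symm
        rw [← he.self_of_nhdsWithin hk, ← he'.self_of_nhdsWithin hzl, ← hY k z hk, ← hY l z hzl]
      · filter_upwards [(hclosed l).isOpen_compl.mem_nhds hzl] with w hw hwl
        exact absurd hwl hw
    rw [eventually_nhdsWithin_iff]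
    filter_upwards [eventually_all.2 key] with w hw hwU
    obtain ⟨l, hl⟩ := mem_iUnion.1 hwU
    exact hw l hl
  · rw [hY k₀ z₀ hk₀, ← hY₀f]
    exact (hYk k₀).eqOn hg hG hY₀ (by simpa using hconn k₀ k₀) (hc k₀) hk₀ (hYkc k₀)
  · obtain ⟨l, hl⟩ := mem_iUnion.1 hw
    rw [hY l w hl]
    exact hYkm l w hl

theorem iUnion_Icc_splitCenterBox {ι : Type*} (J : BoxIntegral.Box ι) :
    ⋃ s, BoxIntegral.Box.Icc (J.splitCenterBox s) = BoxIntegral.Box.Icc J := by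
  classical
  refine Subset.antisymm
    (iUnion_subset fun s => BoxIntegral.Box.le_iff_Icc.1 (J.splitCenterBox_le s)) fun x hx => ?_
  rw [mem_iUnion]
  refine ⟨{i | (J.lower i + J.upper i) / 2 ≤ x i}, fun i => ?_, fun i => ?_⟩
  · simp only [BoxIntegral.Box.splitCenterBox, Set.piecewise, mem_setOf_eq]
    split_ifs with h
    · exact h
    · exact hx.1 i
  · simp only [BoxIntegral.Box.splitCenterBox, Set.piecewise, mem_setOf_eq]
    split_ifs with h
    · exact hx.2 i
    · exact (not_le.1 h).le

theorem center_mem_splitCenterBox {ι : Type*} (J : BoxIntegral.Box ι) (s : Set ι) :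
    (fun i => (J.lower i + J.upper i) / 2) ∈ BoxIntegral.Box.Icc (J.splitCenterBox s) := by
  classical
  refine ⟨fun i => ?_, fun i => ?_⟩
  · have := J.lower_lt_upper i
    simp only [BoxIntegral.Box.splitCenterBox, Set.piecewise]
    split_ifs <;> linarith
  · have := J.lower_lt_upper i
    simp only [BoxIntegral.Box.splitCenterBox, Set.piecewise]
    split_ifs <;> linarith

/-- Parallel sections exist over every box. -/
theorem IsCurvatureInvariant.hasParallelSections_box (h𝓢 : IsCurvatureInvariant g 𝓢)
    (hg : IsMetricOn g univ) {ι : Type*} [Fintype ι] {G : (ι → ℝ) → M} (hG : Continuous G)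
    (I : BoxIntegral.Box ι) : HasParallelSections g 𝓢 G (BoxIntegral.Box.Icc I) := by
  refine BoxIntegral.Box.subbox_induction_on' (p := fun J =>
    HasParallelSections g 𝓢 G (BoxIntegral.Box.Icc J)) I (fun J _ hJ => ?_) fun z _ => ?_
  · rw [← iUnion_Icc_splitCenterBox J]
    exact HasParallelSections.iUnion hg hG (fun s => (J.splitCenterBox s).isCompact_Icc.isClosed)
      (fun s t => ((convex_Icc _ _).inter (convex_Icc _ _)).isPreconnected)
      (center_mem_splitCenterBox J) hJ
  · obtain ⟨N, hN, hz, hloc⟩ := h𝓢.exists_local hg (G z)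
    refine ⟨G ⁻¹' N, mem_nhdsWithin_of_mem_nhds ((hN.preimage hG).mem_nhds hz),
      fun J _ _ _ hJ _ z₀ hz₀ f hf => ?_⟩
    obtain ⟨s, hs, hsf, hsm⟩ := hloc (G z₀) (hJ hz₀) f hf
    exact ⟨fun w => s (G w), fun w hw => ⟨N, s, hN, hJ hw, hs, .of_forall fun _ => rfl⟩, hsf,
      fun w hw => hsm _ (hJ hw)⟩

/-- The holonomy of a contractible loop commutes with every curvature invariant family. -/
theorem IsCurvatureInvariant.commute_of_homotopic (h𝓢 : IsCurvatureInvariant g 𝓢)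
    (hg : IsMetricOn g univ) {p : M} {γ : Path p p} (hγ : γ.Homotopic (Path.refl p))
    {A : E4 →ₗ[ℝ] E4} (hA : IsTransport g univ γ A) {f : E4 →L[ℝ] E4} (hf : f ∈ 𝓢 p) (v : E4) :
    f (A v) = A (f v) := by
  obtain ⟨H⟩ := hγ
  let π : ℝ → unitInterval := projIcc 0 1 zero_le_one
  have hπ : Continuous π := continuous_projIcc
  have hπ0 : π 0 = 0 := projIcc_left _
  have hπ1 : π 1 = 1 := projIcc_right _
  let G : (Fin 2 → ℝ) → M := fun z => H (π (z 0), π (z 1))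
  have hG : Continuous G := H.continuous.comp (by fun_prop)
  let I : BoxIntegral.Box (Fin 2) := ⟨fun _ => 0, fun _ => 1, fun _ => zero_lt_one⟩
  have hI : ∀ a ∈ Icc (0 : ℝ) 1, ∀ b ∈ Icc (0 : ℝ) 1, ![a, b] ∈ BoxIntegral.Box.Icc I :=
    fun a ha b hb => ⟨fun i => by fin_cases i <;> [exact ha.1; exact hb.1],
      fun i => by fin_cases i <;> [exact ha.2; exact hb.2]⟩
  have h0 : (0 : ℝ) ∈ Icc (0 : ℝ) 1 := left_mem_Icc.2 zero_le_one
  have h1 : (1 : ℝ) ∈ Icc (0 : ℝ) 1 := right_mem_Icc.2 zero_le_one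
  have hleft : ∀ t, G ![0, t] = γ.extend t := fun t => by
    change H (π 0, π t) = _
    rw [hπ0]
    exact H.apply_zero _
  obtain ⟨Y, hY, hY0, -⟩ := h𝓢.hasParallelSections_box hg hG I ![0, 0] (hI 0 h0 0 h0) f (by
    rw [hleft, Path.extend_zero]; exact hf)
  have hedge : ∀ (i : Fin 2) (c : ℝ), (∀ z : Fin 2 → ℝ, z i = c → G z = p) →
      ∀ z ∈ BoxIntegral.Box.Icc I, ∀ w ∈ BoxIntegral.Box.Icc I, z i = c → w i = c → Y z = Y w :=
    fun i c hc z hz w hw hzc hwc =>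
      (hY.mono inter_subset_left).eq_of_const
        (C := BoxIntegral.Box.Icc I ∩ (LinearMap.proj i : (Fin 2 → ℝ) →ₗ[ℝ] ℝ) ⁻¹' {c})
        ((convex_Icc _ _).inter ((convex_singleton c).linear_preimage _)).isPreconnected
        (fun z hz => hc z hz.2) ⟨hz, hzc⟩ ⟨hw, hwc⟩
  have e1 : Y ![0, 0] = Y ![1, 0] := hedge 1 0 (fun z hz => by
    change H (π (z 0), π (z 1)) = p
    rw [hz, hπ0]; exact H.source _) _ (hI 0 h0 0 h0) _ (hI 1 h1 0 h0) rfl rfl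
  have e2 : Y ![1, 0] = Y ![1, 1] := hedge 0 1 (fun z hz => by
    change H (π (z 0), π (z 1)) = p
    rw [hz, hπ1]; exact H.apply_one _) _ (hI 1 h1 0 h0) _ (hI 1 h1 1 h1) rfl rfl
  have e3 : Y ![1, 1] = Y ![0, 1] := hedge 1 1 (fun z hz => by
    change H (π (z 0), π (z 1)) = p
    rw [hz, hπ1]; exact H.target _) _ (hI 1 h1 1 h1) _ (hI 0 h0 1 h1) rfl rfl
  have key := hA.comp_of_local hg (Y := fun t => Y ![0, t]) (fun t ht => by
    obtain ⟨N, s, -, hz, hs, he⟩ := hY _ (hI 0 h0 t ht)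
    refine ⟨N, s, by rwa [hleft] at hz, hs, ?_⟩
    have hcont : ContinuousWithinAt (fun t : ℝ => ![0, t]) (Icc 0 1) t := by
      refine Continuous.continuousWithinAt ?_
      fun_prop
    have hm : Tendsto (fun t : ℝ => ![0, t]) (𝓝[Icc 0 1] t) (𝓝[BoxIntegral.Box.Icc I] ![0, t]) :=
      hcont.tendsto_nhdsWithin fun τ hτ => hI 0 h0 τ hτ
    filter_upwards [hm.eventually he] with τ hτ
    rw [hτ, hleft]) v
  simp only [← e3, ← e2, ← e1, hY0] at key
  exact key

end Homotopy

/-! ### Self-duality in orthonormal frames -/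

section FrameDuality

theorem sum_leviCivita_mul (N : Mat4) : ∑ a, ∑ b, ∑ c, ∑ d,
    leviCivita a b c d * (N 0 a * N 1 b * N 2 c * N 3 d) = N.det := by
  simp only [leviCivita_eq, Fin.sum_univ_four]
  simp [permSign, Matrix.det_succ_row_zero, Fin.sum_univ_succ]
  have h1 : Fin.succAbove (1 : Fin 4) (2 : Fin 3) = 3 := rfl
  have h2 : Fin.succAbove (2 : Fin 4) (2 : Fin 3) = 3 := rfl
  have h3 : Fin.succAbove (3 : Fin 4) (2 : Fin 3) = 2 := rfl
  rw [h1, h2, h3]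
  ring

theorem sum_leviCivita_mul_frame (E : Mat4) (a b c d : Fin 4) : ∑ ρ, ∑ σ, ∑ κ, ∑ l,
    leviCivita ρ σ κ l * (E ρ a * E σ b * E κ c * E l d) = E.det * leviCivita a b c d := by
  have h := sum_leviCivita_mul (Matrix.of fun i j : Fin 4 => E j (![a, b, c, d] i))
  have e : (Matrix.of fun i j : Fin 4 => E j (![a, b, c, d] i)) =
      (Matrix.of fun i j : Fin 4 => if ![a, b, c, d] i = j then (1 : ℝ) else 0) * Eᵀ := by
    ext i j
    simp [Matrix.mul_apply]
  rw [e, Matrix.det_mul, Matrix.det_transpose, mul_comm] at h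
  rw [leviCivita, ← h, ← e]
  rfl

theorem sum_comm_six (f : Fin 4 → Fin 4 → Fin 4 → Fin 4 → Fin 4 → Fin 4 → ℝ) :
    ∑ σ, ∑ ρ, ∑ κ, ∑ l, ∑ d, ∑ c, f ρ σ κ l c d = ∑ c, ∑ d, ∑ ρ, ∑ σ, ∑ κ, ∑ l, f ρ σ κ l c d := by
  trans ∑ p : Fin 4 × Fin 4 × Fin 4 × Fin 4 × Fin 4 × Fin 4,
    f p.2.1 p.1 p.2.2.1 p.2.2.2.1 p.2.2.2.2.2 p.2.2.2.2.1
  · simp only [Fintype.sum_prod_type]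
  trans ∑ p : Fin 4 × Fin 4 × Fin 4 × Fin 4 × Fin 4 × Fin 4,
    f p.2.2.1 p.2.2.2.1 p.2.2.2.2.1 p.2.2.2.2.2 p.1 p.2.1
  · let e : Fin 4 × Fin 4 × Fin 4 × Fin 4 × Fin 4 × Fin 4 ≃
        Fin 4 × Fin 4 × Fin 4 × Fin 4 × Fin 4 × Fin 4 :=
      { toFun := fun p => (p.2.2.2.2.2, p.2.2.2.2.1, p.2.1, p.1, p.2.2.1, p.2.2.2.1)
        invFun := fun q => (q.2.2.2.1, q.2.2.1, q.2.2.2.2.1, q.2.2.2.2.2, q.2.1, q.1)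
        left_inv := fun _ => rfl
        right_inv := fun _ => rfl }
    exact Fintype.sum_equiv e _ _ fun _ => rfl
  · simp only [Fintype.sum_prod_type]

/-- The Hodge dual in an oriented orthonormal frame is the standard one. -/
theorem hodgeDual_frame {G E : Mat4} (hE : Eᵀ * G * E = 1) (hdet : 0 < E.det) (X : Mat4) :
    Eᵀ * hodgeDual G X * E = hodgeDual 1 (Eᵀ * X * E) := by
  have h1 : E * (Eᵀ * G) = 1 := mul_eq_one_comm.1 hE
  have hG : G⁻¹ = E * Eᵀ := Matrix.inv_eq_left_inv (by rw [mul_assoc]; exact h1)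
  have hd : Real.sqrt G.det * E.det = 1 := by
    have h2 : E.det ^ 2 * G.det = 1 := by
      have := congrArg Matrix.det hE
      rw [Matrix.det_mul, Matrix.det_mul, Matrix.det_transpose, Matrix.det_one] at this
      linarith
    have h3 : G.det = (E.det⁻¹) ^ 2 := by
      field_simp
      linarith
    rw [h3, Real.sqrt_sq (by positivity), inv_mul_cancel₀ hdet.ne']
  obtain ⟨Y, hY⟩ : ∃ Y, Y = Eᵀ * X * E := ⟨_, rfl⟩
  rw [← hY]
  have h4 : G⁻¹ * X * (G⁻¹)ᵀ = E * Y * Eᵀ := by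
    rw [hG, Matrix.transpose_mul, Matrix.transpose_transpose, hY]
    simp only [mul_assoc]
  ext a b
  have h5 : (Eᵀ * hodgeDual G X * E) a b = (1 / 2) * Real.sqrt G.det *
      ∑ σ, ∑ ρ, ∑ κ, ∑ l, ∑ d, ∑ c,
        leviCivita ρ σ κ l * (E ρ a * E σ b * E κ c * E l d) * Y c d := by
    rw [hodgeDual, h4]
    simp only [Matrix.mul_apply, Matrix.transpose_apply, Matrix.of_apply,
      Finset.mul_sum, Finset.sum_mul]
    refine Finset.sum_congr rfl fun σ _ => Finset.sum_congr rfl fun ρ _ =>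
      Finset.sum_congr rfl fun κ _ => Finset.sum_congr rfl fun l _ =>
      Finset.sum_congr rfl fun d _ => Finset.sum_congr rfl fun c _ => ?_
    ring
  rw [h5, sum_comm_six (fun ρ σ κ l c d =>
    leviCivita ρ σ κ l * (E ρ a * E σ b * E κ c * E l d) * Y c d)]
  simp only [← Finset.sum_mul, sum_leviCivita_mul_frame]
  simp only [hodgeDual, Matrix.of_apply, Matrix.det_one, Real.sqrt_one, mul_one, inv_one, one_mul,
    Matrix.transpose_one]
  rw [mul_assoc (1 / 2 : ℝ), Finset.mul_sum]
  congr 1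
  refine Finset.sum_congr rfl fun c _ => ?_
  rw [Finset.mul_sum]
  refine Finset.sum_congr rfl fun d _ => ?_
  rw [mul_assoc, ← mul_assoc, hd, one_mul]

theorem mem_selfDualAlgebra_of_frame {G E X : Mat4} (hE : Eᵀ * G * E = 1) (hdet : 0 < E.det)
    (hX : antiSelfDualPart G X = 0) : Eᵀ * X * E ∈ selfDualAlgebra := by
  change antiSelfDualPart 1 (Eᵀ * X * E) = 0
  rw [antiSelfDualPart, sub_eq_zero] at hX
  rw [antiSelfDualPart, ← hodgeDual_frame hE hdet, ← hX, sub_self]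

/-- The matrix of a linear map in the standard basis. -/
def stdMatrix (A : E4 → E4) : Mat4 := Matrix.of fun i j => A (basisVec j) i

theorem stdMatrix_apply (A : E4 → E4) (i j : Fin 4) : stdMatrix A i j = A (basisVec j) i := rfl

theorem apply_eq_sum_stdMatrix (A : E4 →ₗ[ℝ] E4) (u : E4) (i : Fin 4) :
    A u i = ∑ j, stdMatrix A i j * u j := by
  conv_lhs => rw [← sum_smul_basisVec u]
  simp [stdMatrix_apply, mul_comm]

theorem stdMatrix_comp (A : E4 →ₗ[ℝ] E4) (V : Fin 4 → E4) :
    (Matrix.of fun i a => A (V a) i) = stdMatrix A * Matrix.of fun i a => V a i := by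
  ext i a
  simp only [Matrix.of_apply, Matrix.mul_apply]
  exact apply_eq_sum_stdMatrix A (V a) i

theorem det_stdMatrix (A : E4 →L[ℝ] E4) : (stdMatrix A).det = A.det := by
  have : stdMatrix A = LinearMap.toMatrix (EuclideanSpace.basisFun (Fin 4) ℝ).toBasis
      (EuclideanSpace.basisFun (Fin 4) ℝ).toBasis (A : E4 →ₗ[ℝ] E4) := by
    ext i j
    simp [stdMatrix_apply, LinearMap.toMatrix_apply, basisVec]
  rw [this, LinearMap.det_toMatrix]

theorem stdMatrix_mul_frame (F : E4 ≃L[ℝ] E4) (A : E4 →ₗ[ℝ] E4) :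
    stdMatrix A * stdMatrix F = stdMatrix F * frameRep F A := by
  rw [← show (Matrix.of fun i a => A (F (basisVec a)) i) = stdMatrix A * stdMatrix F from
    stdMatrix_comp A fun a => F (basisVec a)]
  have h := frameRep_eq_iff.1 (rfl : frameRep F A = _)
  ext i a
  simp only [Matrix.of_apply, Matrix.mul_apply, h, stdMatrix_apply]
  simp [mul_comm]

theorem stdMatrix_frame (F : E4 ≃L[ℝ] E4) (G : Mat4) (A : E4 →ₗ[ℝ] E4)
    (hF : (stdMatrix F)ᵀ * G * stdMatrix F = 1) :
    frameRep F A = (stdMatrix F)ᵀ * (G * stdMatrix A) * stdMatrix F := by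
  rw [mul_assoc, mul_assoc, stdMatrix_mul_frame, ← mul_assoc, ← mul_assoc, hF, one_mul]

theorem frameRep_surjective (F : E4 ≃L[ℝ] E4) (Λ : Mat4) :
    ∃ f : E4 →L[ℝ] E4, frameRep F (f : E4 →ₗ[ℝ] E4) = Λ := by
  refine ⟨∑ a, ∑ b, Λ a b • ((coordMap b) ∘L (F.symm : E4 →L[ℝ] E4)).smulRight (F (basisVec a)), ?_⟩
  rw [frameRep_eq_iff]
  intro b
  simp [basisVec_apply]

/-- The curvature of a connection as a bilinear map. -/
def gaugeCurvatureBilin {E 𝔸 : Type*} [NormedAddCommGroup E] [NormedSpace ℝ E] [NormedRing 𝔸]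
    [NormedAlgebra ℝ 𝔸] (Γ : E → E →L[ℝ] 𝔸) (y : E) : E →ₗ[ℝ] E →ₗ[ℝ] 𝔸 :=
  LinearMap.mk₂ ℝ (gaugeCurvature Γ y)
    (fun u u' v => by
      simp only [gaugeCurvature, map_add, ContinuousLinearMap.add_apply, add_mul, mul_add]
      abel)
    (fun c u v => by
      simp only [gaugeCurvature, map_smul, ContinuousLinearMap.smul_apply, smul_mul_assoc,
        mul_smul_comm, smul_add, smul_sub])
    (fun u v v' => by
      simp only [gaugeCurvature, map_add, ContinuousLinearMap.add_apply, add_mul, mul_add]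
      abel)
    (fun c u v => by
      simp only [gaugeCurvature, map_smul, ContinuousLinearMap.smul_apply, smul_mul_assoc,
        mul_smul_comm, smul_add, smul_sub])

/-- The curvature at `x` as a bilinear map. -/
def curvatureBilin {M : Type*} [TopologicalSpace M] [ChartedSpace E4 M] (g : M → E4 → E4 → ℝ)
    (x : M) : E4 →ₗ[ℝ] E4 →ₗ[ℝ] E4 →L[ℝ] E4 :=
  gaugeCurvatureBilin (christoffelMap (chartMetric g x)) (extChart x x)

theorem curvatureBilin_apply {M : Type*} [TopologicalSpace M] [ChartedSpace E4 M]
    (g : M → E4 → E4 → ℝ) (x : M) (u v : E4) : curvatureBilin g x u v = curvatureAt g x u v := rfl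

end FrameDuality

section SelfDualManifold

variable {M : Type*} [TopologicalSpace M] [ChartedSpace E4 M] {g : M → E4 → E4 → ℝ}

/-- The basis `F e₀, …, F e₃` of the tangent space at `x` is orthonormal and positively oriented. -/
structure IsOrientedFrame (g : M → E4 → E4 → ℝ) (x : M) (F : E4 ≃L[ℝ] E4) : Prop where
  orthonormal : IsFrame g 1 x fun a => F (basisVec a)
  positive : 0 < (stdMatrix F).det

/-- The endomorphisms at `x` that have the matrix `Y` in some oriented orthonormal frame. -/
def endosWithMatrix (g : M → E4 → E4 → ℝ) (Y : Mat4) (x : M) : Set (E4 →L[ℝ] E4) :=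
  {f | ∃ F, IsOrientedFrame g x F ∧ frameRep F (f : E4 →ₗ[ℝ] E4) = Y}

variable [IsManifold 𝓘(ℝ, E4) ∞ M]

theorem det_toChart_pos (hor : IsOrientedAtlas M) {x x₁ : M}
    (h₁ : x ∈ (extChart x₁).source) : 0 < (stdMatrix (toChart x₁ x)).det := by
  have h2 : toChart x₁ x = fderiv ℝ (coordChange x x₁) (extChart x x) := by
    ext1 u
    rw [toChart_eq (mem_extChartAt_source x) h₁, toChart_self]
  rw [det_stdMatrix, h2]
  exact hor _ (chart_mem_atlas E4 x) _ (chart_mem_atlas E4 x₁) x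
    ⟨mem_chart_source E4 x, by simpa using h₁⟩

theorem frame_matrix_eq_one {U : Set M} (hg : IsMetricOn g U) {x : M} (hx : x ∈ U) {η : Mat4}
    {V : Fin 4 → E4} (hV : IsFrame g η x V) :
    (Matrix.of fun i a => V a i)ᵀ * chartMetric g x (extChart x x) *
      (Matrix.of fun i a => V a i) = η := by
  ext a b
  have h1 := metric_eq hg hx (mem_extChartAt_source (I := 𝓘(ℝ, E4)) x) (V a) (V b)
  rw [toChart_self, toChart_self, bilin_eq_dotProduct] at h1
  rw [← hV a b]
  refine Eq.trans ?_ h1.symm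
  rw [mul_assoc, Matrix.mul_apply]
  simp only [dotProduct, Matrix.mulVec, Matrix.mul_apply, Matrix.transpose_apply, Matrix.of_apply]

theorem IsOrientedFrame.matrix_eq_one {U : Set M} (hg : IsMetricOn g U) {x : M} (hx : x ∈ U)
    {F : E4 ≃L[ℝ] E4} (hF : IsOrientedFrame g x F) :
    (stdMatrix F)ᵀ * chartMetric g x (extChart x x) * stdMatrix F = 1 :=
  frame_matrix_eq_one hg hx hF.orthonormal

/-- On an oriented manifold parallel transport preserves the orientation. -/
theorem IsOrientedFrame.transport {U : Set M} (hg : IsMetricOn g U) (hor : IsOrientedAtlas M)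
    {p q : M} {σ : Path p q} {P : E4 →ₗ[ℝ] E4} (hσ : IsTransport g U σ P) {F F' : E4 ≃L[ℝ] E4}
    (hF : IsOrientedFrame g p F) (hF' : ∀ u, F' u = P (F u)) : IsOrientedFrame g q F' := by
  choose V hV0 hV1 hV using fun a => hσ.transport (F (basisVec a))
  have horth : ∀ t ∈ Icc (0 : ℝ) 1, IsFrame g 1 (σ.extend t) fun a => V a t := fun t ht a b => by
    rw [((hV a).metric_eq hg (fun t _ => hσ.extend_mem t) (hV b)).2 t ht, hV0, hV0,
      Path.extend_zero]
    exact hF.orthonormal a b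
  have hF'V : ∀ a, F' (basisVec a) = V a 1 := fun a => by rw [hF', hV1]
  refine ⟨?_, ?_⟩
  · intro a b
    have h1 : g (σ.extend 1) (V a 1) (V b 1) = (1 : Mat4) a b :=
      horth 1 (right_mem_Icc.2 zero_le_one) a b
    rw [Path.extend_one] at h1
    simpa only [hF'V] using h1
  let D : ℝ → Mat4 := fun t => Matrix.of fun i a => V a t i
  have hD : ∀ t ∈ Icc (0 : ℝ) 1, (D t).det ≠ 0 := fun t ht h0 => by
    have := congrArg Matrix.det (frame_matrix_eq_one hg (hσ.extend_mem t) (horth t ht))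
    rw [Matrix.det_mul] at this
    change _ * (D t).det = _ at this
    rw [h0] at this
    simp at this
  have hγ : ContinuousOn σ.extend (Icc 0 1) := σ.continuous_extend.continuousOn
  have key : (0 < (D 0).det ↔ 0 < (D 1).det) := by
    refine isPreconnected_Icc.induction₂ (fun s t => 0 < (D s).det ↔ 0 < (D t).det)
      (fun t ht => ?_) (fun _ _ _ _ _ _ => Iff.trans) (fun _ _ _ _ => Iff.symm)
      (left_mem_Icc.2 zero_le_one) (right_mem_Icc.2 (zero_le_one (α := ℝ)))
    let D' : ℝ → Mat4 := fun τ => stdMatrix (toChart (σ.extend t) (σ.extend τ)) * D τ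
    have hD' : ContinuousWithinAt (fun τ => (D' τ).det) (Icc 0 1) t := by
      have h1 : ∀ a, ContinuousWithinAt
          (fun τ => toChart (σ.extend t) (σ.extend τ) (V a τ)) (Icc 0 1) t := fun a =>
        OnPieces.continuousWithinAt (f := fun t τ => toChart (σ.extend t) (σ.extend τ) (V a τ))
          (hV a) (fun c d h t ht => (isParallelOn_iff.1 h.2 t ht).continuousWithinAt) t ht
      have h2 : D' = fun τ => Matrix.of fun i a =>
          toChart (σ.extend t) (σ.extend τ) (V a τ) i := by
        ext1 τ
        exact (stdMatrix_comp (toChart (σ.extend t) (σ.extend τ) : E4 →ₗ[ℝ] E4)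
          fun a => V a τ).symm
      rw [h2]
      refine (Continuous.matrix_det continuous_id).continuousAt.comp_continuousWithinAt
        (f := fun τ => (Matrix.of fun i a => toChart (σ.extend t) (σ.extend τ) (V a τ) i : Mat4)) ?_
      refine continuousWithinAt_pi.2 fun i => continuousWithinAt_pi.2 fun a => ?_
      exact (coordMap i).continuous.continuousAt.comp_continuousWithinAt (h1 a)
    have hD't : D' t = D t := by
      have h1 : stdMatrix (toChart (σ.extend t) (σ.extend t)) = 1 := by
        ext i j
        rw [stdMatrix_apply, toChart_self, basisVec_apply, Matrix.one_apply]
      rw [show D' t = stdMatrix (toChart (σ.extend t) (σ.extend t)) * D t from rfl, h1, one_mul]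
    have hsign : ∀ᶠ τ in 𝓝[Icc 0 1] t, (0 < (D' t).det ↔ 0 < (D' τ).det) := by
      rcases lt_or_gt_of_ne (hD t ht) with h | h
      · rw [hD't]
        have := hD'.eventually_lt (continuousWithinAt_const (b := (0 : ℝ)))
          (by change (D' t).det < 0; rwa [hD't])
        filter_upwards [this] with τ hτ
        exact iff_of_false h.not_gt hτ.not_gt
      · rw [hD't]
        have := (continuousWithinAt_const (b := (0 : ℝ))).eventually_lt hD'
          (by change 0 < (D' t).det; rwa [hD't])
        filter_upwards [this] with τ hτ
        exact iff_of_true h hτ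
    filter_upwards [hsign, (hγ t ht).eventually_mem
      (extChartAt_source_mem_nhds_of_mem (mem_extChartAt_source (σ.extend t)))] with τ hτ hs
    rw [← hD't, hτ, show D' τ = stdMatrix (toChart (σ.extend t) (σ.extend τ)) * D τ from rfl,
      Matrix.det_mul, mul_pos_iff_of_pos_left (det_toChart_pos hor hs)]
  have h0 : D 0 = stdMatrix F := by ext i a; simp [D, hV0, stdMatrix_apply]
  have h1 : D 1 = stdMatrix F' := by ext i a; simp [D, ← hF'V, stdMatrix_apply]
  rw [← h1]
  exact key.1 (by rw [h0]; exact hF.positive)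

/-- In an oriented orthonormal frame the curvature of a self-dual metric is self-dual. -/
theorem frameRep_curvatureAt_mem {U : Set M} (hg : IsMetricOn g U)
    (hsd : HasSelfDualCurvature g) {x : M} (hx : x ∈ U) {F : E4 ≃L[ℝ] E4}
    (hF : IsOrientedFrame g x F) (u v : E4) :
    frameRepL F (curvatureAt g x u v) ∈ selfDualAlgebra := by
  have hbasis : ∀ μ ν, frameRepL F (curvatureAt g x (basisVec μ) (basisVec ν)) ∈
      selfDualAlgebra := by
    intro μ ν
    have hM := hF.matrix_eq_one hg hx
    have h1 : curvatureForm g x μ ν = chartMetric g x (extChart x x) *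
        stdMatrix (curvatureAt g x (basisVec μ) (basisVec ν)) := by
      ext ρ σ
      simp only [curvatureForm, Matrix.of_apply, Matrix.mul_apply, riemannAt, stdMatrix_apply,
        (hg.regular x x hx (mem_extChartAt_source x)).riemann_eq]
      rfl
    have h2 := mem_selfDualAlgebra_of_frame hM hF.positive (hsd x μ ν)
    rw [h1] at h2
    rw [frameRepL_apply, stdMatrix_frame F _ _ hM]
    exact h2
  rw [← curvatureBilin_apply, ← sum_smul_basisVec u, ← sum_smul_basisVec v]
  simp only [map_sum, map_smul, LinearMap.sum_apply, LinearMap.smul_apply]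
  exact Submodule.sum_mem _ fun i _ => Submodule.smul_mem _ _ <|
    Submodule.sum_mem _ fun j _ => Submodule.smul_mem _ _ (hbasis _ _)

theorem commute_of_frameRep {F : E4 ≃L[ℝ] E4} {R f : E4 →L[ℝ] E4} {Y : Mat4}
    (hfY : frameRep F (f : E4 →ₗ[ℝ] E4) = Y) (h : frameRepL F R * Y = Y * frameRepL F R) (w : E4) :
    R (f w) = f (R w) := by
  rw [frameRepL_apply, ← hfY, ← frameRep_comp, ← frameRep_comp] at h
  exact LinearMap.congr_fun (frameRep_injective h) w

/-- On a self-dual manifold the endomorphisms with a given anti-self-dual matrix form a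
curvature invariant family. -/
theorem isCurvatureInvariant_endosWithMatrix (hg : IsMetricOn g univ) (hor : IsOrientedAtlas M)
    (hsd : HasSelfDualCurvature g) {Y : Mat4} (hY : ∀ X ∈ selfDualAlgebra, X * Y = Y * X) :
    IsCurvatureInvariant g (endosWithMatrix g Y) where
  transport := by
    rintro p q σ P hσ f ⟨F, hF, hfY⟩ f' hf'
    obtain ⟨F', hF'⟩ := exists_transported_frame hg hσ F
    refine ⟨F', hF.transport hg hor hσ hF', ?_⟩
    have h := frameRep_trans (F := F) (F' := F') (P := P) (A := (f' : E4 →ₗ[ℝ] E4))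
      (B := (f : E4 →ₗ[ℝ] E4)) hF' fun u => (hf' u).symm
    exact h.symm.trans hfY
  commute := by
    rintro x f ⟨F, hF, hfY⟩ u v w
    exact commute_of_frameRep hfY
      (hY _ (frameRep_curvatureAt_mem hg hsd (mem_univ x) hF u v)) w

/-- The restricted holonomy group of a self-dual manifold commutes with the anti-self-dual
endomorphisms, which are parallel. -/
theorem image_loopHolonomy_subset (hg : IsMetricOn g univ) (hor : IsOrientedAtlas M)
    (hsd : HasSelfDualCurvature g) {p : M} {F : E4 ≃L[ℝ] E4} (hF : IsOrientedFrame g p F) :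
    frameRep F '' loopHolonomy g univ (fun γ : Path p p => γ.Homotopic (Path.refl p)) ⊆
      selfDualSU2 := by
  rintro _ ⟨A, ⟨γ, hγ, hA⟩, rfl⟩
  have hcomm : ∀ Y : Mat4, (∀ X ∈ selfDualAlgebra, X * Y = Y * X) →
      frameRep F A * Y = Y * frameRep F A := by
    intro Y hY
    obtain ⟨f, hf⟩ := frameRep_surjective F Y
    have h1 := (isCurvatureInvariant_endosWithMatrix hg hor hsd hY).commute_of_homotopic hg hγ hA
      (f := f) ⟨F, hF, hf⟩
    rw [← hf, ← frameRep_comp, ← frameRep_comp]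
    exact congrArg _ (LinearMap.ext fun v => (h1 v).symm)
  refine mem_selfDualSU2_of_commute ?_ (hcomm antiSelfDualI fun X hX => commute_antiSelfDualI hX)
    (hcomm antiSelfDualJ fun X hX => commute_antiSelfDualJ hX)
  have hM := hF.matrix_eq_one hg (mem_univ p)
  have hAF : (Matrix.of fun i a => A (F (basisVec a)) i : Mat4) =
      stdMatrix F * frameRep F A := by
    ext i a
    rw [Matrix.of_apply, frameRep_eq_iff.1 (rfl : frameRep F A = _)]
    simp [Matrix.mul_apply, stdMatrix_apply, mul_comm]
  have h2 := frame_matrix_eq_one hg (mem_univ p) (η := 1) (V := fun a => A (F (basisVec a)))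
    fun a b => by rw [hA.metric_eq hg]; exact hF.orthonormal a b
  rw [hAF, Matrix.transpose_mul] at h2
  calc (frameRep F A)ᵀ * frameRep F A
      = (frameRep F A)ᵀ * ((stdMatrix F)ᵀ * chartMetric g p (extChart p p) *
          stdMatrix F) * frameRep F A := by rw [hM, mul_one]
    _ = 1 := by rw [← h2]; simp only [mul_assoc]

/-- A curvature tensor that is not zero has at least two independent components in the
self-dual algebra, by the first Bianchi identity. -/
theorem exists_linearIndependent_curvature {U : Set M} (hg : IsMetricOn g U)
    (hsd : HasSelfDualCurvature g) {x : M} (hx : x ∈ U) {F : E4 ≃L[ℝ] E4}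
    (hF : IsOrientedFrame g x F) {ρ σ μ ν : Fin 4} (hR : riemannAt g x ρ σ μ ν ≠ 0) :
    ∃ u v u' v', LinearIndependent ℝ
      ![frameRepL F (curvatureAt g x u v), frameRepL F (curvatureAt g x u' v')] := by
  by_contra! hno
  have hreg := hg.regular x x hx (mem_extChartAt_source x)
  have hB := hreg.bianchi
  set X := frameRepL F (curvatureAt g x (basisVec μ) (basisVec ν)) with hX
  have hinj : Function.Injective (frameRepL F) := fun A B h =>
    ContinuousLinearMap.coe_injective (frameRep_injective h)
  have hR0 : curvatureAt g x (basisVec μ) (basisVec ν) ≠ 0 := by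
    intro h0
    apply hR
    change riemann (chartMetric g x) (extChart x x) ρ σ μ ν = 0
    rw [hreg.riemann_eq]
    exact congrArg (fun L : E4 →L[ℝ] E4 => L (basisVec σ) ρ) h0
  have hX0 : X ≠ 0 := fun h0 => hR0 (hinj (by rw [map_zero]; exact h0))
  have hc : ∀ u v, ∃ c : ℝ, curvatureAt g x u v =
      c • curvatureAt g x (basisVec μ) (basisVec ν) := by
    intro u v
    have := hno (basisVec μ) (basisVec ν) u v
    rw [LinearIndependent.pair_iff' hX0] at this
    push Not at this
    obtain ⟨c, hc⟩ := this
    exact ⟨c, hinj (by rw [map_smul, hc])⟩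
  choose c hc using hc
  have hμν : μ ≠ ν := by
    rintro rfl
    apply hR0
    rw [curvatureAt, gaugeCurvature]
    simp
  obtain ⟨w, hwμ, hwν⟩ : ∃ w : Fin 4, w ≠ μ ∧ w ≠ ν :=
    (by decide : ∀ μ ν : Fin 4, ∃ w, w ≠ μ ∧ w ≠ ν) μ ν
  have hinjR : Function.Injective (curvatureAt g x (basisVec μ) (basisVec ν)) := by
    obtain ⟨q, hq, hqX⟩ := mem_selfDualAlgebra_iff.1
      (frameRep_curvatureAt_mem hg hsd hx hF (basisVec μ) (basisVec ν))
    have hq0 : q ≠ 0 := by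
      rintro rfl
      rw [map_zero] at hqX
      exact hX0 hqX.symm
    obtain ⟨f, hf⟩ := frameRep_surjective F (quatMat q⁻¹)
    have h1 : (f : E4 →ₗ[ℝ] E4) ∘ₗ
        (curvatureAt g x (basisVec μ) (basisVec ν) : E4 →ₗ[ℝ] E4) = LinearMap.id := by
      refine frameRep_injective (F := F) ?_
      rw [frameRep_comp, hf, frameRep_id, ← frameRepL_apply, ← hqX, ← map_mul,
        inv_mul_cancel₀ hq0, map_one]
    exact Function.LeftInverse.injective (g := f) fun v =>
      congrArg (fun L : E4 →ₗ[ℝ] E4 => L v) h1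
  have h1 := hB (basisVec μ) (basisVec ν) (basisVec w)
  change curvatureAt g x (basisVec μ) (basisVec ν) (basisVec w) +
    curvatureAt g x (basisVec ν) (basisVec w) (basisVec μ) +
    curvatureAt g x (basisVec w) (basisVec μ) (basisVec ν) = 0 at h1
  rw [hc (basisVec ν) (basisVec w), hc (basisVec w) (basisVec μ),
    ContinuousLinearMap.smul_apply, ContinuousLinearMap.smul_apply, ← map_smul, ← map_smul,
    ← map_add, ← map_add, ← map_zero (curvatureAt g x (basisVec μ) (basisVec ν))] at h1
  have h2 := congrArg (fun v : E4 => v w) (hinjR h1)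
  simp [basisVec_apply, hwμ, hwν] at h2

/-- The holonomy group of a self-dual manifold that is not flat. -/
theorem image_loopHolonomy_eq (hg : IsMetricOn g univ) [ConnectedSpace M] (hor : IsOrientedAtlas M)
    (hsd : HasSelfDualCurvature g) {p : M} {F : E4 ≃L[ℝ] E4} (hF : IsOrientedFrame g p F)
    (hR : ∃ x ρ σ μ ν, riemannAt g x ρ σ μ ν ≠ 0) :
    frameRep F '' loopHolonomy g univ (fun γ : Path p p => γ.Homotopic (Path.refl p)) =
      selfDualSU2 := by
  obtain ⟨x, ρ, σ, μ, ν, hR⟩ := hR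
  obtain ⟨τ, P, hτ⟩ := exists_isTransport hg isPreconnected_univ (mem_univ p) (mem_univ x)
  obtain ⟨F', hF'⟩ := exists_transported_frame hg hτ F
  have hF'or := hF.transport hg hor hτ hF'
  obtain ⟨u, v, u', v', hli⟩ := exists_linearIndependent_curvature hg hsd (mem_univ x) hF'or hR
  refine selfDualSU2_eq_of_tangent (isUnitGroup_loopHolonomy hg (mem_univ p) isLoopClass_homotopic)
    (image_loopHolonomy_subset hg hor hsd hF) ?_
  exact selfDualAlgebra_le_of_linearIndependent _
    (frameRep_curvatureAt_mem hg hsd (mem_univ x) hF'or u v)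
    (frameRep_curvatureAt_mem hg hsd (mem_univ x) hF'or u' v') hli
    (curvatureAt_mem_tangentSpaceOne hg (mem_univ p) isLoopClass_homotopic hτ hF' u v)
    (curvatureAt_mem_tangentSpaceOne hg (mem_univ p) isLoopClass_homotopic hτ hF' u' v')

end SelfDualManifold

section Riemannian

variable {M : Type*} [TopologicalSpace M] [ChartedSpace E4 M] [IsManifold 𝓘(ℝ, E4) ∞ M]

/-- The coordinate vector fields of a chart are smooth. -/
theorem contMDiffAt_fromChart (x₀ : M) {y : E4} (hy : y ∈ (extChart x₀).target)
    (u : E4) : ContMDiffAt 𝓘(ℝ, E4) (𝓘(ℝ, E4).prod 𝓘(ℝ, E4)) ∞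
      (fun z => (Bundle.TotalSpace.mk' E4 ((extChart x₀).symm z) (fromChart x₀ z u) :
        TangentBundle 𝓘(ℝ, E4) M)) y := by
  have hsource := (extChart x₀).map_target hy
  rw [(trivializationAt E4 (TangentSpace 𝓘(ℝ, E4)) x₀).contMDiffAt_iff (by
    rw [(trivializationAt E4 (TangentSpace 𝓘(ℝ, E4)) x₀).mem_source]
    simpa using hsource)]
  have htarget := (isOpen_extChartAt_target (I := 𝓘(ℝ, E4)) x₀).mem_nhds hy
  refine ⟨((contMDiffOn_extChartAt_symm x₀).contMDiffAt htarget), ?_⟩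
  refine (contMDiffAt_const (c := u)).congr_of_eventuallyEq ?_
  filter_upwards [htarget] with z hz
  have hz' := (extChart x₀).map_target hz
  have h1 := TangentBundle.continuousLinearMapAt_trivializationAt (I := 𝓘(ℝ, E4)) (x₀ := x₀)
    (x := (extChart x₀).symm z) (by simpa using hz')
  have h2 := toChart_fromChart hz u
  rw [toChart, ← h1] at h2
  refine Eq.trans ?_ h2
  exact (congrFun (Bundle.Trivialization.coe_linearMapAt_of_mem (R := ℝ)
    (trivializationAt E4 (TangentSpace 𝓘(ℝ, E4)) x₀) (by simpa using hz')) _).symm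

open scoped Bundle

variable (g : Bundle.ContMDiffRiemannianMetric 𝓘(ℝ, E4) ∞ E4
  (fun x : M => TangentSpace 𝓘(ℝ, E4) x))

/-- A smooth Riemannian metric, as a field of bilinear forms. -/
def riemannianForm (x : M) (u v : E4) : ℝ := g.inner x u v

theorem isMetricOn_riemannianForm : IsMetricOn (riemannianForm g) univ := by
  refine ⟨isOpen_univ, fun x _ => ⟨g.inner x, fun u v => rfl⟩, fun x₀ x _ hx => ?_⟩
  have hy := (extChart x₀).map_source hx
  refine ⟨?_, ?_, ?_⟩
  · filter_upwards [extChartAt_target_mem_nhds' hy] with z hz i j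
    have h1 := g.contMDiff.contMDiffAt.comp z ((contMDiffOn_extChartAt_symm x₀).contMDiffAt
      (extChartAt_target_mem_nhds' hz))
    have h2 := ContMDiffAt.clm_bundle_apply₂ (F₁ := E4) (F₂ := E4) (F₃ := ℝ)
      (E₃ := Bundle.Trivial M ℝ) h1
      (contMDiffAt_fromChart x₀ hz (basisVec i)) (contMDiffAt_fromChart x₀ hz (basisVec j))
    have h3 := (Bundle.contMDiffAt_totalSpace.1 h2).2
    exact h3.contDiffAt
  · exact .of_forall fun z i j => g.symm _ _ _
  · intro h0
    generalize extChart x₀ x = y at *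
    obtain ⟨v, hv0, hv⟩ := Matrix.exists_mulVec_eq_zero_iff.2 h0
    have h1 : riemannianForm g ((extChart x₀).symm y)
        (fromChart x₀ y (WithLp.toLp 2 v))
        (fromChart x₀ y (WithLp.toLp 2 v)) =
        v ⬝ᵥ (chartMetric (riemannianForm g) x₀ y *ᵥ v) := by
      obtain ⟨B, hB⟩ : ∃ B : E4 →L[ℝ] E4 →L[ℝ] ℝ, ∀ u w, riemannianForm g
          ((extChart x₀).symm y) u w = B u w :=
        ⟨g.inner _, fun _ _ => rfl⟩
      have hG : ∀ i j, chartMetric (riemannianForm g) x₀ y i j =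
          B (fromChart x₀ y (basisVec i))
            (fromChart x₀ y (basisVec j)) := fun i j => hB _ _
      rw [hB, ← sum_smul_basisVec (WithLp.toLp 2 v)]
      simp only [map_sum, map_smul, ContinuousLinearMap.sum_apply, ContinuousLinearMap.smul_apply,
        smul_eq_mul, dotProduct, Matrix.mulVec, Finset.mul_sum, hG]
      rw [Finset.sum_comm]
      refine Finset.sum_congr rfl fun i _ => Finset.sum_congr rfl fun j _ => ?_
      ring
    rw [hv, dotProduct_zero] at h1
    have h2 : fromChart x₀ y (WithLp.toLp 2 v) = 0 := by
      by_contra hne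
      exact (g.pos _ _ hne).ne' h1
    have h3 := toChart_fromChart hy (WithLp.toLp 2 v)
    rw [h2, map_zero] at h3
    exact hv0 ((WithLp.toLp_injective 2) h3.symm)

theorem exists_orientedFrame (p : M) : ∃ e : Fin 4 → TangentSpace 𝓘(ℝ, E4) p,
    IsFrame (fun x u v => g.inner x u v) 1 p e ∧ IsPositiveFrame p e := by
  let _ : Bundle.RiemannianBundle (fun x : M => TangentSpace 𝓘(ℝ, E4) x) := ⟨g.toRiemannianMetric⟩
  have hfin : Module.finrank ℝ (TangentSpace 𝓘(ℝ, E4) p) = 4 := by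
    change Module.finrank ℝ E4 = 4
    simp
  have : FiniteDimensional ℝ (TangentSpace 𝓘(ℝ, E4) p) := by
    change FiniteDimensional ℝ E4
    infer_instance
  let b := (stdOrthonormalBasis ℝ (TangentSpace 𝓘(ℝ, E4) p)).reindex (finCongr hfin)
  have hb : ∀ i j, g.inner p (b i) (b j) = if i = j then 1 else 0 := fun i j =>
    orthonormal_iff_ite.1 b.orthonormal i j
  have horth : ∀ s : Fin 4 → ℝ, (∀ i, s i * s i = 1) →
      IsFrame (riemannianForm g) 1 p fun i => s i • coords (b i) := by
    intro s hs i j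
    have h1 : riemannianForm g p (s i • coords (b i)) (s j • coords (b j)) =
        s i * s j * g.inner p (b i) (b j) := by
      change g.inner p (s i • b i) (s j • b j) = _
      simp only [map_smul, ContinuousLinearMap.smul_apply, smul_eq_mul]
      ring
    rw [h1, hb, Matrix.one_apply]
    split_ifs with h
    · rw [h, hs]; simp
    · simp
  have hdet : ∀ s : Fin 4 → ℝ, (Matrix.of fun i a : Fin 4 => (s a • coords (b a)) i).det =
      (Matrix.of fun i a : Fin 4 => coords (b a) i).det * ∏ i, s i := by
    intro s
    rw [← Matrix.det_diagonal, ← Matrix.det_mul]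
    congr 1
    ext i a
    simp [Matrix.mul_diagonal, mul_comm]
  have h0 : (Matrix.of fun i a : Fin 4 => coords (b a) i).det ≠ 0 := by
    intro h0
    have h1 := frame_matrix_eq_one (isMetricOn_riemannianForm g) (mem_univ p)
      (horth (fun _ => 1) (by simp))
    have h2 := congrArg Matrix.det h1
    simp only [one_smul] at h2
    rw [Matrix.det_mul, h0] at h2
    simp at h2
  rcases lt_or_gt_of_ne h0 with h | h
  · refine ⟨fun i => (![-1, 1, 1, 1] : Fin 4 → ℝ) i • coords (b i), horth _ ?_, ?_⟩
    · intro i; fin_cases i <;> simp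
    · refine lt_of_lt_of_eq ?_ (hdet ![-1, 1, 1, 1]).symm
      simp [Fin.prod_univ_four, h]
  · refine ⟨fun i => (1 : ℝ) • coords (b i), horth (fun _ => 1) (by simp), ?_⟩
    refine lt_of_lt_of_eq ?_ (hdet fun _ => 1).symm
    simpa using h

end Riemannian

/-- The holonomy of self-dual Riemannian four-manifolds. -/
theorem holonomy_selfDual (M : Type*) [TopologicalSpace M] [ConnectedSpace M]
    [ChartedSpace E4 M] [IsManifold 𝓘(ℝ, E4) ∞ M]
    (g : Bundle.ContMDiffRiemannianMetric 𝓘(ℝ, E4) ∞ E4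
      (fun x : M => TangentSpace 𝓘(ℝ, E4) x))
    (hor : IsOrientedAtlas M) (hsd : HasSelfDualCurvature (riemannianForm g)) (p : M) :
    (∃ e : Fin 4 → TangentSpace 𝓘(ℝ, E4) p,
      IsFrame (riemannianForm g) 1 p e ∧ IsPositiveFrame p e) ∧
    ∀ e : Fin 4 → TangentSpace 𝓘(ℝ, E4) p,
      IsFrame (riemannianForm g) 1 p e → IsPositiveFrame p e →
      matricesInFrame e
        (restrictedHolonomyGroup (riemannianForm g) Set.univ p) ⊆ selfDualSU2 ∧
      ((∃ x ρ σ μ ν, riemannAt (M := M) (riemannianForm g) x ρ σ μ ν ≠ 0) →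
        matricesInFrame e
          (restrictedHolonomyGroup (riemannianForm g) Set.univ p) = selfDualSU2 ∧
        (SimplyConnectedSpace M → matricesInFrame e
          (holonomyGroup (riemannianForm g) Set.univ p) = selfDualSU2)) := by
  refine ⟨exists_orientedFrame g p, fun e he hpos => ?_⟩
  have hg := isMetricOn_riemannianForm g
  obtain ⟨F, hFe⟩ := exists_frameEquiv (g := riemannianForm g) (η := 1) (by simp)
    (B := g.inner p) (fun u v => rfl) he
  have hF : IsOrientedFrame (riemannianForm g) p F := by
    refine ⟨fun a b => by simp only [hFe]; exact he a b, ?_⟩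
    have h1 : stdMatrix F = Matrix.of fun i a : Fin 4 => coords (e a) i := by
      ext i a
      rw [stdMatrix_apply, hFe]
      rfl
    rw [h1]
    exact hpos
  have hmat : ∀ H : Set (E4 →ₗ[ℝ] E4), matricesInFrame (M := M) (p := p) e H = frameRep F '' H :=
    fun H => by
      ext Λ
      exact mem_matricesInFrame_iff hFe
  have hres : matricesInFrame e
      (restrictedHolonomyGroup (riemannianForm g) Set.univ p) = frameRep F ''
        loopHolonomy (riemannianForm g) univ (fun γ : Path p p => γ.Homotopic (Path.refl p)) := by
    rw [← restrictedHolonomyGroup_eq]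
    exact hmat _
  refine ⟨?_, fun hR => ⟨?_, fun hsc => ?_⟩⟩
  · rw [hres]
    exact image_loopHolonomy_subset hg hor hsd hF
  · rw [hres]
    exact image_loopHolonomy_eq hg hor hsd hF hR
  · have h1 : matricesInFrame e (holonomyGroup (riemannianForm g) Set.univ p) =
        frameRep F '' loopHolonomy (riemannianForm g) univ (fun _ : Path p p => True) := by
      rw [← holonomyGroup_eq]
      exact hmat _
    rw [h1, ← image_loopHolonomy_eq hg hor hsd hF hR]
    have h2 : (fun _ : Path p p => True) = fun γ : Path p p => γ.Homotopic (Path.refl p) := by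
      ext γ
      exact iff_of_true trivial (SimplyConnectedSpace.paths_homotopic γ _)
    rw [h2]

/-! ### The curvature in terms of second derivatives of the metric -/

section Jet

variable {G : E4 → Mat4} {y : E4}

theorem bilin_sub_add_left (X : Mat4) (a b c d v : E4) :
    bilin X (a - b + (c - d)) v = bilin X a v - bilin X b v + (bilin X c v - bilin X d v) := by
  simp

theorem gaugeCurvature_apply (Γ : E4 → E4 →L[ℝ] E4 →L[ℝ] E4) (y u v w : E4) :
    gaugeCurvature Γ y u v w =
      fderiv ℝ Γ y u v w - fderiv ℝ Γ y v u w + (Γ y u (Γ y v w) - Γ y v (Γ y u w)) := rfl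

/-- The Christoffel symbols of the first kind, in terms of the first derivatives
`D k i j = ∂_k G_{ij}` of the metric. -/
def christoffelLower (D : Fin 4 → Mat4) (i j l : Fin 4) : ℝ :=
  (1 / 2) * (D i j l + D j i l - D l i j)

theorem bilin_eq_sum_inv {X Y : Mat4} (h : X * Y = 1) (hX : ∀ i j, X i j = X j i) (u v : E4) :
    bilin X u v = ∑ a, ∑ b, Y a b * (bilin X u (basisVec a) * bilin X v (basisVec b)) := by
  have h1 : ∀ (u : E4) a, bilin X u (basisVec a) = (X *ᵥ (u : Fin 4 → ℝ)) a := fun u a => by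
    rw [bilin_symm hX, bilin_apply]
    simp [basisVec_apply, Matrix.mulVec, dotProduct]
  have h2 : (v : Fin 4 → ℝ) = Y *ᵥ (X *ᵥ (v : Fin 4 → ℝ)) := by
    rw [Matrix.mulVec_mulVec, mul_eq_one_comm.1 h, Matrix.one_mulVec]
  rw [bilin_symm hX, bilin_eq_dotProduct, dotProduct_comm]
  conv_lhs => rw [h2]
  simp only [h1, dotProduct]
  refine Finset.sum_congr rfl fun a _ => ?_
  rw [show (Y *ᵥ (X *ᵥ (v : Fin 4 → ℝ))) a = ∑ b, Y a b * (X *ᵥ (v : Fin 4 → ℝ)) b from rfl,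
    Finset.mul_sum]
  refine Finset.sum_congr rfl fun b _ => ?_
  simp only [Matrix.mulVec, dotProduct]
  ring

/-- The derivative of the lowered Christoffel symbols. -/
theorem RegularAt.bilin_fderiv_christoffelMap (h : RegularAt G y) (μ ν w v : Fin 4) :
    bilin (G y) (fderiv ℝ (christoffelMap G) y (basisVec μ) (basisVec ν) (basisVec w))
        (basisVec v)
      + bilin (G y) (christoffelMap G y (basisVec μ)
          (christoffelMap G y (basisVec ν) (basisVec w))) (basisVec v)
      + bilin (G y) (christoffelMap G y (basisVec ν) (basisVec w))
          (christoffelMap G y (basisVec μ) (basisVec v))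
    = (1 / 2) * (fderiv ℝ (fun z => fderiv ℝ (fun z => G z w v) z (basisVec ν)) y (basisVec μ)
      + fderiv ℝ (fun z => fderiv ℝ (fun z => G z ν v) z (basisVec w)) y (basisVec μ)
      - fderiv ℝ (fun z => fderiv ℝ (fun z => G z ν w) z (basisVec v)) y (basisVec μ)) := by
  have hB := (h.contDiffAt_bilin.differentiableAt (by simp)).hasFDerivAt
  have hΓ := (h.contDiffAt_christoffelMap.differentiableAt (by simp)).hasFDerivAt
  have h1 := (hB.clm_apply ((hΓ.clm_apply (hasFDerivAt_const (basisVec ν) y)).clm_apply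
    (hasFDerivAt_const (basisVec w) y))).clm_apply (hasFDerivAt_const (basisVec v) y)
  have hd : ∀ a b c, HasFDerivAt (fun z => fderiv ℝ (fun z => G z a b) z (basisVec c))
      (fderiv ℝ (fun z => fderiv ℝ (fun z => G z a b) z (basisVec c)) y) y := fun a b c =>
    ((((h.contDiffAt a b).fderiv_right (m := ∞) (by simp)).clm_apply
      contDiffAt_const).differentiableAt (by simp)).hasFDerivAt
  have h2 := (((hd w v ν).add (hd ν v w)).sub (hd ν w v)).const_mul (1 / 2)
  have h3 := h1.unique (h2.congr_of_eventuallyEq (by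
    filter_upwards [h.eventually] with z hz
    rw [hz.bilin_christoffelMap, hz.fderiv_bilin, hz.fderiv_bilin, hz.fderiv_bilin]
    rfl))
  have h4 := congrArg (fun L => L (basisVec μ)) h3
  simp at h4
  rw [h.fderiv_bilin_eq] at h4
  simp only [one_div]
  rw [← h4]
  ring

theorem RegularAt.bilin_gaugeCurvature (h : RegularAt G y) {D : Fin 4 → Mat4}
    {D2 : Fin 4 → Fin 4 → Mat4} {Gi : Mat4} (hGi : G y * Gi = 1)
    (hD : ∀ k i j, fderiv ℝ (fun z => G z i j) y (basisVec k) = D k i j)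
    (hD2 : ∀ l k i j, fderiv ℝ (fun z => fderiv ℝ (fun z => G z i j) z (basisVec k)) y
      (basisVec l) = D2 l k i j) (μ ν w v : Fin 4) :
    bilin (G y) (gaugeCurvature (christoffelMap G) y (basisVec μ) (basisVec ν) (basisVec w))
      (basisVec v) =
      (1 / 2) * (D2 μ ν w v + D2 μ w ν v - D2 μ v ν w)
        - (1 / 2) * (D2 ν μ w v + D2 ν w μ v - D2 ν v μ w)
        + ∑ a, ∑ b, Gi a b * (christoffelLower D μ w a * christoffelLower D ν v b
          - christoffelLower D ν w a * christoffelLower D μ v b) := by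
  have h1 := h.bilin_fderiv_christoffelMap μ ν w v
  have h2 := h.bilin_fderiv_christoffelMap ν μ w v
  have hs := h.symm.self_of_nhds
  have hK : ∀ i j l, bilin (G y) (christoffelMap G y (basisVec i) (basisVec j)) (basisVec l) =
      christoffelLower D i j l := fun i j l => by
    rw [h.bilin_christoffelMap, h.fderiv_bilin, h.fderiv_bilin, h.fderiv_bilin]
    simp only [hD, christoffelLower]
  have h3 := fun i j k l => bilin_eq_sum_inv hGi hs
    (christoffelMap G y (basisVec i) (basisVec j)) (christoffelMap G y (basisVec k) (basisVec l))
  simp only [hK] at h3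
  rw [h3] at h1 h2
  simp only [hD2] at h1 h2
  rw [gaugeCurvature_apply, bilin_sub_add_left]
  simp only [mul_sub, Finset.sum_sub_distrib]
  linarith

/-- A metric depending on the coordinates `z₁` and `z₂` only, through products of functions
of one variable. -/
theorem fderiv_separated {ι : Type*} [Fintype ι] {f p : ι → ℝ → ℝ} {c : ι → ℝ} {z : E4}
    (hf : ∀ t, DifferentiableAt ℝ (f t) (z 1)) (hp : ∀ t, DifferentiableAt ℝ (p t) (z 2))
    (k : Fin 4) :
    fderiv ℝ (fun z : E4 => ∑ t, f t (z 1) * p t (z 2) * c t) z (basisVec k) =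
      ∑ t, (basisVec k 1 * (deriv (f t) (z 1) * p t (z 2))
        + basisVec k 2 * (f t (z 1) * deriv (p t) (z 2))) * c t := by
  have h : ∀ t, HasFDerivAt (fun z : E4 => f t (z 1) * p t (z 2) * c t)
      (c t • (f t (z 1) • (deriv (p t) (z 2) • coordMap 2)
        + p t (z 2) • (deriv (f t) (z 1) • coordMap 1))) z := fun t =>
    (((hf t).hasDerivAt.comp_hasFDerivAt z (coordMap 1).hasFDerivAt).mul
      ((hp t).hasDerivAt.comp_hasFDerivAt z (coordMap 2).hasFDerivAt)).mul_const (c t)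
  rw [(HasFDerivAt.fun_sum fun t _ => h t).fderiv, ContinuousLinearMap.sum_apply]
  refine Finset.sum_congr rfl fun t _ => ?_
  simp
  ring

theorem fderiv_fderiv_separated {ι : Type*} [Fintype ι] {f p : ι → ℝ → ℝ} {c : ι → ℝ} {y : E4}
    (hf : ∀ t, ContDiffAt ℝ ∞ (f t) (y 1)) (hp : ∀ t, ContDiffAt ℝ ∞ (p t) (y 2))
    (l k : Fin 4) :
    fderiv ℝ (fun z => fderiv ℝ (fun z : E4 => ∑ t, f t (z 1) * p t (z 2) * c t) z (basisVec k)) y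
        (basisVec l) =
      ∑ t, (basisVec k 1 * (basisVec l 1 * (deriv (deriv (f t)) (y 1) * p t (y 2))
          + basisVec l 2 * (deriv (f t) (y 1) * deriv (p t) (y 2)))
        + basisVec k 2 * (basisVec l 1 * (deriv (f t) (y 1) * deriv (p t) (y 2))
          + basisVec l 2 * (f t (y 1) * deriv (deriv (p t)) (y 2)))) * c t := by
  have hc : ∀ i : Fin 4, Tendsto (fun z : E4 => z i) (𝓝 y) (𝓝 (y i)) := fun i =>
    (coordMap i).continuous.continuousAt
  have hev : ∀ {f : ℝ → ℝ} {x : ℝ}, ContDiffAt ℝ ∞ f x → ∀ᶠ x' in 𝓝 x, DifferentiableAt ℝ f x' :=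
    fun hf => by
      filter_upwards [(hf.of_le (m := 1) (by simp)).eventually (by simp)] with x' h
        using h.differentiableAt (by simp)
  have h1 : (fun z => fderiv ℝ (fun z : E4 => ∑ t, f t (z 1) * p t (z 2) * c t) z (basisVec k))
      =ᶠ[𝓝 y] fun z => ∑ t, deriv (f t) (z 1) * p t (z 2) * (basisVec k 1 * c t)
        + ∑ t, f t (z 1) * deriv (p t) (z 2) * (basisVec k 2 * c t) := by
    filter_upwards [(hc 1).eventually (eventually_all.2 fun t => hev (hf t)),
      (hc 2).eventually (eventually_all.2 fun t => hev (hp t))] with z h1 h2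
    rw [fderiv_separated h1 h2, ← Finset.sum_add_distrib]
    exact Finset.sum_congr rfl fun t _ => by ring
  have hd : ∀ {f : ℝ → ℝ} {x : ℝ}, ContDiffAt ℝ ∞ f x → DifferentiableAt ℝ (deriv f) x :=
    fun {f x} hf => by
      have h := ((hf.fderiv_right (m := ∞) (by simp)).clm_apply
        (contDiffAt_const (c := (1 : ℝ)))).differentiableAt (by simp)
      simpa only [fderiv_apply_one_eq_deriv] using h
  have hd0 : ∀ {f : ℝ → ℝ} {x : ℝ}, ContDiffAt ℝ ∞ f x → DifferentiableAt ℝ f x :=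
    fun hf => hf.differentiableAt (by simp)
  have hdiff : ∀ {f p : ι → ℝ → ℝ} {c : ι → ℝ}, (∀ t, DifferentiableAt ℝ (f t) (y 1)) →
      (∀ t, DifferentiableAt ℝ (p t) (y 2)) →
      DifferentiableAt ℝ (fun z : E4 => ∑ t, f t (z 1) * p t (z 2) * c t) y := fun hf hp =>
    DifferentiableAt.fun_sum fun t _ =>
      (((hf t).comp y (coordMap 1).differentiableAt).mul
        ((hp t).comp y (coordMap 2).differentiableAt)).mul_const _
  rw [h1.fderiv_eq, fderiv_fun_add (hdiff (fun t => hd (hf t)) fun t => hd0 (hp t))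
    (hdiff (fun t => hd0 (hf t)) fun t => hd (hp t)), ContinuousLinearMap.add_apply,
    fderiv_separated (fun t => hd (hf t)) (fun t => hd0 (hp t)),
    fderiv_separated (fun t => hd0 (hf t)) (fun t => hd (hp t)), ← Finset.sum_add_distrib]
  exact Finset.sum_congr rfl fun t _ => by ring

end Jet

/-! ### A stationary metric in retarded polar coordinates and its curvature -/

section NutModel

/-- The elementary skew matrices. -/
def skewUnit (i j : Fin 4) : Mat4 := Matrix.single i j 1 - Matrix.single j i 1

theorem skew_eq_sum {X : Mat4} (hX : Xᵀ = -X) :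
    X = X 0 1 • skewUnit 0 1 + X 0 2 • skewUnit 0 2 + X 0 3 • skewUnit 0 3
      + X 1 2 • skewUnit 1 2 + X 1 3 • skewUnit 1 3 + X 2 3 • skewUnit 2 3 := by
  have e : ∀ i j, X j i = -X i j := fun i j => congrFun (congrFun hX i) j
  have d : ∀ i, X i i = 0 := fun i => by linarith [e i i]
  ext i j
  fin_cases i <;> fin_cases j <;>
    simp [skewUnit, d, e 0 1, e 0 2, e 0 3, e 1 2, e 1 3, e 2 3]

/-- The inverse of the matrix `nutModel` on the equator. -/
def nutModelInv (a s : ℝ) : Mat4 :=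
  !![0, 1, 0, 0; 1, a, 0, 0; 0, 0, s⁻¹, 0; 0, 0, 0, s⁻¹]

theorem skewUnit_mul_mul (K : Mat4) (i j k l : Fin 4) :
    skewUnit i j * K * skewUnit k l = Matrix.single i l (K j k) - Matrix.single i k (K j l)
      - Matrix.single j l (K i k) + Matrix.single j k (K i l) := by
  simp only [skewUnit, sub_mul, mul_sub, Matrix.single_mul_mul_single, one_mul, mul_one]
  abel

theorem lie_mul_skewUnit (K : Mat4) (hK : ∀ i j, K i j = K j i) (i j k l : Fin 4) :
    K * skewUnit i j * (K * skewUnit k l) - K * skewUnit k l * (K * skewUnit i j) =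
      K * (K j k • skewUnit i l - K j l • skewUnit i k - K i k • skewUnit j l
        + K i l • skewUnit j k) := by
  have h : ∀ (i j : Fin 4) (c : ℝ), Matrix.single i j c = c • Matrix.single i j (1 : ℝ) :=
    fun i j c => by simp
  calc K * skewUnit i j * (K * skewUnit k l) - K * skewUnit k l * (K * skewUnit i j)
      = K * (skewUnit i j * K * skewUnit k l - skewUnit k l * K * skewUnit i j) := by
        simp only [mul_sub, mul_assoc]
    _ = _ := by
        rw [skewUnit_mul_mul, skewUnit_mul_mul, hK l i, hK l j, hK k i, hK k j,
          h i l, h i k, h j l, h j k, h k j, h k i, h l j, h l i]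
        simp only [skewUnit]
        congr 1
        module

theorem nutModelInv_symm (a s : ℝ) (i j : Fin 4) : nutModelInv a s i j = nutModelInv a s j i := by
  fin_cases i <;> fin_cases j <;> rfl

/-- Commutators of these four elements give the other two. -/
theorem nutModelInv_mul_mem {a s : ℝ} (hs : s ≠ 0) {T : Submodule ℝ Mat4}
    (hT : ∀ X ∈ T, ∀ Y ∈ T, X * Y - Y * X ∈ T)
    (h02 : nutModelInv a s * skewUnit 0 2 ∈ T) (h03 : nutModelInv a s * skewUnit 0 3 ∈ T)
    (h12 : nutModelInv a s * skewUnit 1 2 ∈ T) (h13 : nutModelInv a s * skewUnit 1 3 ∈ T)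
    {X : Mat4} (hX : Xᵀ = -X) : nutModelInv a s * X ∈ T := by
  have k00 : nutModelInv a s 0 0 = 0 := rfl
  have k01 : nutModelInv a s 0 1 = 1 := rfl
  have k02 : nutModelInv a s 0 2 = 0 := rfl
  have k03 : nutModelInv a s 0 3 = 0 := rfl
  have k21 : nutModelInv a s 2 1 = 0 := rfl
  have k22 : nutModelInv a s 2 2 = s⁻¹ := rfl
  have k23 : nutModelInv a s 2 3 = 0 := rfl
  have h01 : nutModelInv a s * skewUnit 0 1 ∈ T := by
    have h := hT _ h02 _ h12
    rw [lie_mul_skewUnit _ (nutModelInv_symm a s), k21, k22, k01, k02] at h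
    have e : (0 : ℝ) • skewUnit 0 2 - s⁻¹ • skewUnit 0 1 - (1 : ℝ) • skewUnit 2 2
        + (0 : ℝ) • skewUnit 2 1 = (-s⁻¹) • skewUnit 0 1 := by
      rw [show skewUnit 2 2 = 0 by simp [skewUnit]]
      module
    have h' := T.smul_mem (-s) h
    rwa [e, Matrix.mul_smul, smul_smul, neg_mul_neg, mul_inv_cancel₀ hs, one_smul] at h'
  have h23 : nutModelInv a s * skewUnit 2 3 ∈ T := by
    have h := T.neg_mem (hT _ h02 _ h13)
    rw [lie_mul_skewUnit _ (nutModelInv_symm a s), k21, k23, k01, k03] at h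
    have e : (0 : ℝ) • skewUnit 0 3 - (0 : ℝ) • skewUnit 0 1 - (1 : ℝ) • skewUnit 2 3
        + (0 : ℝ) • skewUnit 2 1 = (-1 : ℝ) • skewUnit 2 3 := by
      module
    have h' := T.neg_mem (T.neg_mem h)
    rwa [e, Matrix.mul_smul, neg_one_smul, neg_neg, ← neg_one_smul ℝ, neg_one_smul, neg_neg] at h'
  rw [skew_eq_sum hX]
  simp only [mul_add, mul_smul_comm]
  exact T.add_mem (T.add_mem (T.add_mem (T.add_mem (T.add_mem (T.smul_mem _ h01)
    (T.smul_mem _ h02)) (T.smul_mem _ h03)) (T.smul_mem _ h12)) (T.smul_mem _ h13))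
    (T.smul_mem _ h23)

/-- The metric `-A τ² + 2 τ dr + (r² + N²) (dψ² + cos² ψ dφ²)`, `τ = dv + 2 N sin ψ dφ`, in the
coordinates `(v, r, ψ, φ)`; `ψ` is the latitude. -/
def nutModel (A : ℝ → ℝ) (N : ℝ) (z : E4) : Mat4 :=
  !![-A (z 1), 1, 0, -2 * N * A (z 1) * Real.sin (z 2);
    1, 0, 0, 2 * N * Real.sin (z 2);
    0, 0, z 1 ^ 2 + N ^ 2, 0;
    -2 * N * A (z 1) * Real.sin (z 2), 2 * N * Real.sin (z 2), 0,
      (z 1 ^ 2 + N ^ 2) * Real.cos (z 2) ^ 2 - 4 * N ^ 2 * A (z 1) * Real.sin (z 2) ^ 2]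

theorem bilin_nutModel (A : ℝ → ℝ) (N : ℝ) (z u v : E4) :
    bilin (nutModel A N z) u v =
      -A (z 1) * ((u 0 + 2 * N * Real.sin (z 2) * u 3) * (v 0 + 2 * N * Real.sin (z 2) * v 3))
        + ((u 0 + 2 * N * Real.sin (z 2) * u 3) * v 1
          + u 1 * (v 0 + 2 * N * Real.sin (z 2) * v 3))
        + (z 1 ^ 2 + N ^ 2) * (u 2 * v 2 + Real.cos (z 2) ^ 2 * (u 3 * v 3)) := by
  simp [bilin_apply, nutModel, Fin.sum_univ_four]
  ring

theorem nutModel_symm (A : ℝ → ℝ) (N : ℝ) (z : E4) (i j : Fin 4) :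
    nutModel A N z i j = nutModel A N z j i := by
  fin_cases i <;> fin_cases j <;> rfl

/-- The terms of the metric `nutModel`: functions of `r`, functions of `ψ` and coefficients. -/
def nutTermR (A : ℝ → ℝ) (N : ℝ) : Fin 7 → ℝ → ℝ :=
  ![fun _ => 1, A, A, fun _ => 1, fun r => r ^ 2 + N ^ 2, A, fun r => r ^ 2 + N ^ 2]

/-- See `nutTermR`. -/
def nutTermPsi : Fin 7 → ℝ → ℝ :=
  ![fun _ => 1, fun _ => 1, Real.sin, Real.sin, fun _ => 1, fun x => Real.sin x ^ 2,
    fun x => Real.cos x ^ 2]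

/-- See `nutTermR`. -/
def nutTermCoeff (N : ℝ) : Fin 7 → Mat4 :=
  ![!![0, 1, 0, 0; 1, 0, 0, 0; 0, 0, 0, 0; 0, 0, 0, 0],
    !![-1, 0, 0, 0; 0, 0, 0, 0; 0, 0, 0, 0; 0, 0, 0, 0],
    !![0, 0, 0, -2 * N; 0, 0, 0, 0; 0, 0, 0, 0; -2 * N, 0, 0, 0],
    !![0, 0, 0, 0; 0, 0, 0, 2 * N; 0, 0, 0, 0; 0, 2 * N, 0, 0],
    !![0, 0, 0, 0; 0, 0, 0, 0; 0, 0, 1, 0; 0, 0, 0, 0],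
    !![0, 0, 0, 0; 0, 0, 0, 0; 0, 0, 0, 0; 0, 0, 0, -4 * N ^ 2],
    !![0, 0, 0, 0; 0, 0, 0, 0; 0, 0, 0, 0; 0, 0, 0, 1]]

theorem nutModel_eq_sum (A : ℝ → ℝ) (N : ℝ) (i j : Fin 4) :
    (fun z : E4 => nutModel A N z i j) = fun z : E4 =>
      ∑ t, nutTermR A N t (z 1) * nutTermPsi t (z 2) * nutTermCoeff N t i j := by
  ext z
  fin_cases i <;> fin_cases j <;>
    simp [nutModel, nutTermR, nutTermPsi, nutTermCoeff, Fin.sum_univ_succ] <;> ring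

theorem contDiff_nutTermPsi (t : Fin 7) {x : ℝ} : ContDiffAt ℝ ∞ (nutTermPsi t) x := by
  fin_cases t
  · exact contDiffAt_const
  · exact contDiffAt_const
  · exact Real.contDiff_sin.contDiffAt
  · exact Real.contDiff_sin.contDiffAt
  · exact contDiffAt_const
  · exact (Real.contDiff_sin.pow 2).contDiffAt
  · exact (Real.contDiff_cos.pow 2).contDiffAt

theorem contDiffAt_nutTermR {A : ℝ → ℝ} {N x : ℝ} (hA : ContDiffAt ℝ ∞ A x) (t : Fin 7) :
    ContDiffAt ℝ ∞ (nutTermR A N t) x := by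
  have h : ContDiffAt ℝ ∞ (fun r : ℝ => r ^ 2 + N ^ 2) x :=
    (contDiffAt_id.pow 2).add contDiffAt_const
  fin_cases t
  · exact contDiffAt_const
  · exact hA
  · exact hA
  · exact contDiffAt_const
  · exact h
  · exact hA
  · exact h

theorem nutModel_mul_inv {A : ℝ → ℝ} {N : ℝ} {y : E4} (hs : y 1 ^ 2 + N ^ 2 ≠ 0) (h2 : y 2 = 0) :
    nutModel A N y * nutModelInv (A (y 1)) (y 1 ^ 2 + N ^ 2) = 1 := by
  ext i j
  fin_cases i <;> fin_cases j <;>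
    simp [nutModel, nutModelInv, Matrix.mul_apply, Fin.sum_univ_four, h2, hs]

theorem regularAt_nutModel {A : ℝ → ℝ} {N : ℝ} {y : E4} (hA : ∀ᶠ r in 𝓝 (y 1), ContDiffAt ℝ ∞ A r)
    (hs : y 1 ^ 2 + N ^ 2 ≠ 0) (h2 : y 2 = 0) : RegularAt (nutModel A N) y where
  smooth := by
    filter_upwards [(coordMap 1).continuous.continuousAt.eventually hA] with z hz i j
    rw [nutModel_eq_sum]
    exact ContDiffAt.sum fun t _ => (((contDiffAt_nutTermR hz t).comp z
      (coordMap 1).contDiff.contDiffAt).mul ((contDiff_nutTermPsi t).comp z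
        (coordMap 2).contDiff.contDiffAt)).mul contDiffAt_const
  symm := .of_forall fun z i j => nutModel_symm A N z i j
  det h := by
    have := congrArg Matrix.det (nutModel_mul_inv (A := A) hs h2)
    rw [Matrix.det_mul, h] at this
    simp at this

theorem nutTermPsi_zero : (fun t => nutTermPsi t 0) = ![1, 1, 0, 0, 1, 0, 1] := by
  ext t
  fin_cases t <;> simp [nutTermPsi]

theorem deriv_sin_sq : deriv (fun x : ℝ => Real.sin x ^ 2) = fun x => Real.sin (2 * x) := by
  ext x
  rw [Real.sin_two_mul]
  simpa using ((Real.hasDerivAt_sin x).pow 2).deriv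

theorem deriv_cos_sq : deriv (fun x : ℝ => Real.cos x ^ 2) = fun x => -Real.sin (2 * x) := by
  ext x
  rw [Real.sin_two_mul]
  have h : HasDerivAt (fun x : ℝ => Real.cos x ^ 2) _ x := (Real.hasDerivAt_cos x).pow 2
  rw [h.deriv]
  simp
  ring

theorem deriv_sin_two_mul : deriv (fun x : ℝ => Real.sin (2 * x)) 0 = 2 := by
  have h := (((hasDerivAt_id (0 : ℝ)).const_mul 2)).sin
  simpa using h.deriv

theorem deriv_sq_add (N : ℝ) : deriv (fun r : ℝ => r ^ 2 + N ^ 2) = fun r => 2 * r := by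
  ext x
  simp

theorem deriv_nutTermPsi : (fun t => deriv (nutTermPsi t) 0) = ![0, 0, 1, 1, 0, 0, 0] := by
  ext t
  fin_cases t <;> simp [nutTermPsi, deriv_sin_sq, deriv_cos_sq]

theorem deriv_deriv_nutTermPsi :
    (fun t => deriv (deriv (nutTermPsi t)) 0) = ![0, 0, 0, 0, 0, 2, -2] := by
  ext t
  fin_cases t <;> simp [nutTermPsi, deriv_sin_sq, deriv_cos_sq, deriv_sin_two_mul]

theorem nutTermR_apply (A : ℝ → ℝ) (N r : ℝ) : (fun t => nutTermR A N t r) =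
    ![1, A r, A r, 1, r ^ 2 + N ^ 2, A r, r ^ 2 + N ^ 2] := by
  ext t
  fin_cases t <;> rfl

theorem deriv_nutTermR (A : ℝ → ℝ) (N r : ℝ) : (fun t => deriv (nutTermR A N t) r) =
    ![0, deriv A r, deriv A r, 0, 2 * r, deriv A r, 2 * r] := by
  ext t
  fin_cases t <;> simp [nutTermR]

theorem deriv_deriv_nutTermR (A : ℝ → ℝ) (N r : ℝ) : (fun t => deriv (deriv (nutTermR A N t)) r) =
    ![0, deriv (deriv A) r, deriv (deriv A) r, 0, 2, deriv (deriv A) r, 2] := by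
  have hd : deriv (fun x : ℝ => 2 * x) r = 2 := by
    simpa using ((hasDerivAt_id r).const_mul 2).deriv
  ext t
  fin_cases t <;> simp only [nutTermR] <;> simp [-deriv_add_const', deriv_sq_add, hd]

/-- The matrix of the form of `nutModel` with the given coefficients of its terms. -/
def nutMatrix (N : ℝ) (x : Fin 7 → ℝ) : Mat4 :=
  !![-x 1, x 0, 0, -2 * N * x 2; x 0, 0, 0, 2 * N * x 3; 0, 0, x 4, 0;
    -2 * N * x 2, 2 * N * x 3, 0, x 6 - 4 * N ^ 2 * x 5]

theorem sum_nutTermCoeff (N : ℝ) (x : Fin 7 → ℝ) (i j : Fin 4) :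
    ∑ t, x t * nutTermCoeff N t i j = nutMatrix N x i j := by
  simp only [Fin.sum_univ_succ, nutTermCoeff, nutMatrix]
  fin_cases i <;> fin_cases j <;> simp <;> ring

/-- The first derivatives of `nutModel` on the equator, as coefficients of its terms. -/
def nutD1 (a a1 r : ℝ) : Fin 4 → Fin 7 → ℝ :=
  ![0, ![0, a1, 0, 0, 2 * r, 0, 2 * r], ![0, 0, a, 1, 0, 0, 0], 0]

/-- The second derivatives of `nutModel` on the equator, as coefficients of its terms. -/
def nutD2 (N a a1 a2 r : ℝ) : Fin 4 → Fin 4 → Fin 7 → ℝ :=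
  ![0,
    ![0, ![0, a2, 0, 0, 2, 0, 2], ![0, 0, a1, 0, 0, 0, 0], 0],
    ![0, ![0, 0, a1, 0, 0, 0, 0], ![0, 0, 0, 0, 0, 2 * a, -2 * (r ^ 2 + N ^ 2)], 0],
    0]

theorem fderiv_nutModel {A : ℝ → ℝ} {N : ℝ} {y : E4} (hA : ContDiffAt ℝ ∞ A (y 1)) (h2 : y 2 = 0)
    (k i j : Fin 4) : fderiv ℝ (fun z => nutModel A N z i j) y (basisVec k) =
      nutMatrix N (nutD1 (A (y 1)) (deriv A (y 1)) (y 1) k) i j := by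
  have hR := congrFun (nutTermR_apply A N (y 1))
  have hR1 := congrFun (deriv_nutTermR A N (y 1))
  have hP := congrFun nutTermPsi_zero
  have hP1 := congrFun deriv_nutTermPsi
  simp only at hR hR1 hP hP1
  rw [nutModel_eq_sum, fderiv_separated
    (fun t => (contDiffAt_nutTermR hA t).differentiableAt (by simp))
    (fun t => (contDiff_nutTermPsi t).differentiableAt (by simp)), h2, sum_nutTermCoeff]
  congr 2
  ext t
  simp only [hR, hR1, hP, hP1]
  clear hR hR1 hP hP1
  fin_cases k <;> simp [basisVec_apply, nutD1] <;> fin_cases t <;> simp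

theorem fderiv_fderiv_nutModel {A : ℝ → ℝ} {N : ℝ} {y : E4} (hA : ContDiffAt ℝ ∞ A (y 1))
    (h2 : y 2 = 0) (l k i j : Fin 4) :
    fderiv ℝ (fun z => fderiv ℝ (fun z => nutModel A N z i j) z (basisVec k)) y (basisVec l) =
      nutMatrix N (nutD2 N (A (y 1)) (deriv A (y 1)) (deriv (deriv A) (y 1)) (y 1) l k) i j := by
  have hR := congrFun (nutTermR_apply A N (y 1))
  have hR1 := congrFun (deriv_nutTermR A N (y 1))
  have hR2 := congrFun (deriv_deriv_nutTermR A N (y 1))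
  have hP := congrFun nutTermPsi_zero
  have hP1 := congrFun deriv_nutTermPsi
  have hP2 := congrFun deriv_deriv_nutTermPsi
  simp only at hR hR1 hR2 hP hP1 hP2
  rw [nutModel_eq_sum, fderiv_fderiv_separated (contDiffAt_nutTermR hA)
    (fun t => contDiff_nutTermPsi t), h2, sum_nutTermCoeff]
  congr 2
  ext t
  simp only [hR, hR1, hR2, hP, hP1, hP2]
  clear hR hR1 hR2 hP hP1 hP2
  fin_cases l <;> fin_cases k <;> simp [basisVec_apply, nutD2] <;> fin_cases t <;> simp <;> ring

end NutModel

section NutCurvature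

/-- The Christoffel symbols of the first kind of `nutModel` on the equator: the matrix
`Γ_{l,ij}` (indices `j l`) for fixed `i`. -/
def nutChristoffel (N a a1 r : ℝ) : Fin 4 → Mat4 :=
  ![!![0, a1 / 2, 0, 0; -a1 / 2, 0, 0, 0; 0, 0, 0, -N * a; 0, 0, N * a, 0],
    !![-a1 / 2, 0, 0, 0; 0, 0, 0, 0; 0, 0, r, N; 0, 0, -N, r],
    !![0, 0, 0, -N * a; 0, 0, r, N; 0, -r, 0, 0; -N * a, N, 0, 0],
    !![0, 0, N * a, 0; 0, 0, -N, r; -N * a, N, 0, 0; 0, -r, 0, 0]]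

theorem christoffelLower_nut (N a a1 r : ℝ) (i j l : Fin 4) :
    christoffelLower (fun k => nutMatrix N (nutD1 a a1 r k)) i j l =
      nutChristoffel N a a1 r i j l := by
  simp only [christoffelLower, nutMatrix]
  fin_cases i <;> fin_cases j <;> fin_cases l <;> simp [nutD1, nutChristoffel] <;> ring

theorem sum_nutModelInv (a s : ℝ) (f : Fin 4 → Fin 4 → ℝ) :
    ∑ i, ∑ j, nutModelInv a s i j * f i j =
      f 0 1 + f 1 0 + a * f 1 1 + s⁻¹ * f 2 2 + s⁻¹ * f 3 3 := by
  simp [Fin.sum_univ_four, nutModelInv]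
  ring

/-- The curvature two-forms `R(∂_μ, ∂_ν)` of `nutModel` on the equator. -/
def nutCurvature (a c d : ℝ) (ν : Fin 2) (μ : Fin 2) : Mat4 :=
  ![![(-(a * c)) • skewUnit 0 2 + c • skewUnit 1 2 + d • skewUnit 1 3,
      (-(a * c)) • skewUnit 0 3 - d • skewUnit 1 2 + c • skewUnit 1 3],
    ![c • skewUnit 0 2 - d • skewUnit 0 3, d • skewUnit 0 2 + c • skewUnit 0 3]] μ ν

theorem skewUnit_transpose (i j : Fin 4) : (skewUnit i j)ᵀ = -skewUnit i j := by
  simp [skewUnit]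

theorem nutCurvature_transpose (a c d : ℝ) (ν μ : Fin 2) :
    (nutCurvature a c d ν μ)ᵀ = -nutCurvature a c d ν μ := by
  fin_cases ν <;> fin_cases μ <;>
    simp only [nutCurvature, Fin.zero_eta, Fin.mk_one, Matrix.cons_val_zero, Matrix.cons_val_one,
      Matrix.cons_val_fin_one, Matrix.transpose_add, Matrix.transpose_sub, Matrix.transpose_smul,
      skewUnit_transpose] <;> module

set_option maxHeartbeats 1000000 in
theorem bilin_curvature_nutModel {A : ℝ → ℝ} {N : ℝ} {y : E4}
    (hA : ∀ᶠ r in 𝓝 (y 1), ContDiffAt ℝ ∞ A r) (hs : y 1 ^ 2 + N ^ 2 ≠ 0) (h2 : y 2 = 0)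
    (μ ν : Fin 2) (w v : Fin 4) :
    bilin (nutModel A N y) (gaugeCurvature (christoffelMap (nutModel A N)) y
      (basisVec (Fin.castLE (by norm_num) μ)) (basisVec (Fin.natAdd 2 ν)) (basisVec w))
        (basisVec v) =
      nutCurvature (A (y 1))
        (y 1 * deriv A (y 1) / 2 + N ^ 2 * A (y 1) / (y 1 ^ 2 + N ^ 2))
        (N * deriv A (y 1) / 2 - N * A (y 1) * y 1 / (y 1 ^ 2 + N ^ 2)) ν μ w v := by
  have hA0 := hA.self_of_nhds
  rw [(regularAt_nutModel hA hs h2).bilin_gaugeCurvature (nutModel_mul_inv hs h2)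
    (D := fun k => nutMatrix N (nutD1 (A (y 1)) (deriv A (y 1)) (y 1) k))
    (D2 := fun l k =>
      nutMatrix N (nutD2 N (A (y 1)) (deriv A (y 1)) (deriv (deriv A) (y 1)) (y 1) l k))
    (fun k i j => fderiv_nutModel hA0 h2 k i j)
    (fun l k i j => fderiv_fderiv_nutModel hA0 h2 l k i j)]
  rw [sum_nutModelInv]
  simp only [christoffelLower_nut]
  generalize deriv (deriv A) (y 1) = a2
  generalize deriv A (y 1) = a1
  generalize A (y 1) = a
  generalize y 1 = r at *
  clear hA hA0 h2
  simp only [nutMatrix, div_eq_mul_inv]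
  have hs' : (r ^ 2 + N ^ 2) * (r ^ 2 + N ^ 2)⁻¹ = 1 := mul_inv_cancel₀ hs
  generalize (r ^ 2 + N ^ 2)⁻¹ = t at *
  fin_cases μ <;> fin_cases ν
  all_goals
    fin_cases w <;> fin_cases v <;>
      simp [nutD2, nutChristoffel, nutCurvature, skewUnit] <;> grind

/-- The curvature operators `R(∂_μ, ∂_ν)` of the metric `nutModel` generate the algebra of all
skew endomorphisms. -/
theorem mem_of_nutCurvature_mem {a c d s : ℝ} (hs : s ≠ 0) (hc : c ≠ 0) {T : Submodule ℝ Mat4}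
    (hT : ∀ X ∈ T, ∀ Y ∈ T, X * Y - Y * X ∈ T)
    (h : ∀ μ ν, nutModelInv a s * nutCurvature a c d ν μ ∈ T) {X : Mat4} (hX : Xᵀ = -X) :
    nutModelInv a s * X ∈ T := by
  have hcd : c ^ 2 + d ^ 2 ≠ 0 := by positivity
  let T' : Submodule ℝ Mat4 := T.comap (LinearMap.mulLeft ℝ (nutModelInv a s))
  have h00 : (-(a * c)) • skewUnit 0 2 + c • skewUnit 1 2 + d • skewUnit 1 3 ∈ T' := h 0 0
  have h01 : (-(a * c)) • skewUnit 0 3 - d • skewUnit 1 2 + c • skewUnit 1 3 ∈ T' := h 0 1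
  have h10 : c • skewUnit 0 2 - d • skewUnit 0 3 ∈ T' := h 1 0
  have h11 : d • skewUnit 0 2 + c • skewUnit 0 3 ∈ T' := h 1 1
  have e02 : skewUnit 0 2 ∈ T' := (T'.smul_mem_iff hcd).1 (by
    convert T'.add_mem (T'.smul_mem c h10) (T'.smul_mem d h11) using 1
    module)
  have e03 : skewUnit 0 3 ∈ T' := (T'.smul_mem_iff hcd).1 (by
    convert T'.sub_mem (T'.smul_mem c h11) (T'.smul_mem d h10) using 1
    module)
  have h00' := T'.add_mem h00 (T'.smul_mem (a * c) e02)
  have h01' := T'.add_mem h01 (T'.smul_mem (a * c) e03)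
  have e12 : skewUnit 1 2 ∈ T' := (T'.smul_mem_iff hcd).1 (by
    convert T'.sub_mem (T'.smul_mem c h00') (T'.smul_mem d h01') using 1
    module)
  have e13 : skewUnit 1 3 ∈ T' := (T'.smul_mem_iff hcd).1 (by
    convert T'.add_mem (T'.smul_mem d h00') (T'.smul_mem c h01') using 1
    module)
  exact nutModelInv_mul_mem hs hT e02 e03 e12 e13 hX

end NutCurvature

/-! ### Lorentz metrics on domains of `ℝ⁴` with full holonomy group -/

section Domain

variable {g : E4 → E4 → E4 → ℝ} {U : Set E4}

/-- The matrix of components of a field of forms on `ℝ⁴`. -/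
def componentMatrix (g : E4 → E4 → E4 → ℝ) (x : E4) : Mat4 :=
  Matrix.of fun i j => g x (basisVec i) (basisVec j)

theorem toChart_model (x₀ x u : E4) : toChart x₀ x u = u := by
  have h : (extChart x₀ : E4 → E4) = id := rfl
  change mfderiv 𝓘(ℝ, E4) 𝓘(ℝ, E4) (extChart x₀ : E4 → E4) x u = u
  rw [h]
  simp
  rfl

theorem chartMetric_model (g : E4 → E4 → E4 → ℝ) (x₀ : E4) :
    chartMetric (M := E4) g x₀ = componentMatrix g := by
  have h : ((extChart x₀).symm : E4 → E4) = id := rfl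
  ext y i j
  have h2 : ∀ u : E4, mfderiv 𝓘(ℝ, E4) 𝓘(ℝ, E4) ((extChart x₀).symm : E4 → E4) y u
      = u := fun u => by
    rw [h]
    simp
    rfl
  change g y (mfderiv 𝓘(ℝ, E4) 𝓘(ℝ, E4) ((extChart x₀).symm : E4 → E4) y (basisVec i))
    (mfderiv 𝓘(ℝ, E4) 𝓘(ℝ, E4) ((extChart x₀).symm : E4 → E4) y (basisVec j)) = _
  rw [h2, h2]
  rfl

theorem bilin_componentMatrix {x : E4} {B : E4 →L[ℝ] E4 →L[ℝ] ℝ} (hB : ∀ u v, g x u v = B u v)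
    (u v : E4) : bilin (componentMatrix g x) u v = g x u v := by
  rw [hB, bilin_apply]
  conv_rhs => rw [← sum_smul_basisVec u, ← sum_smul_basisVec v]
  simp only [map_sum, map_smul, ContinuousLinearMap.sum_apply, ContinuousLinearMap.smul_apply,
    componentMatrix, Matrix.of_apply, hB, smul_eq_mul, Finset.mul_sum]
  rw [Finset.sum_comm]
  refine Finset.sum_congr rfl fun i _ => Finset.sum_congr rfl fun j _ => ?_
  ring

theorem frame_matrix_eq {x : E4} {B : E4 →L[ℝ] E4 →L[ℝ] ℝ} (hB : ∀ u v, g x u v = B u v)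
    {η : Mat4} {e : Fin 4 → E4} (he : IsFrame (M := E4) g η x e) :
    (Matrix.of fun i a => e a i)ᵀ * componentMatrix g x * (Matrix.of fun i a => e a i) = η := by
  ext a b
  have h1 := bilin_componentMatrix hB (e a) (e b)
  rw [bilin_eq_dotProduct] at h1
  rw [← he a b]
  refine Eq.trans ?_ h1
  rw [mul_assoc, Matrix.mul_apply]
  simp only [dotProduct, Matrix.mulVec, Matrix.mul_apply, Matrix.transpose_apply, Matrix.of_apply]

theorem det_minkowski : minkowski.det = -1 := by simp [minkowski, Fin.prod_univ_four]

theorem minkowski_transpose : minkowskiᵀ = minkowski := by simp [minkowski]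

/-- A smooth Lorentz metric on an open set, given by its components. -/
theorem isMetricOn_model (hU : IsOpen U)
    (hbil : ∀ x ∈ U, ∃ B : E4 →L[ℝ] E4 →L[ℝ] ℝ, ∀ u v, g x u v = B u v)
    (hsymm : ∀ x u v, g x u v = g x v u)
    (hsm : ∀ x ∈ U, ∀ u v, ContDiffAt ℝ ∞ (fun z => g z u v) x)
    (hfr : ∀ x ∈ U, ∃ e : Fin 4 → E4, IsFrame (M := E4) g minkowski x e) :
    IsMetricOn (M := E4) g U where
  isOpen := hU
  bilinear := hbil
  regular := by
    intro x₀ x hx _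
    rw [chartMetric_model]
    have h : extChart x₀ x = x := rfl
    rw [h]
    refine ⟨?_, .of_forall fun z i j => hsymm _ _ _, fun h0 => ?_⟩
    · filter_upwards [hU.mem_nhds hx] with z hz i j using hsm z hz _ _
    · obtain ⟨B, hB⟩ := hbil x hx
      obtain ⟨e, he⟩ := hfr x hx
      have h1 := congrArg Matrix.det (frame_matrix_eq hB he)
      rw [Matrix.det_mul, Matrix.det_mul, h0, det_minkowski] at h1
      simp at h1

theorem minkowski_frame_inv {E G : Mat4} (h : Eᵀ * G * E = minkowski) :
    E * minkowski * Eᵀ * G = 1 := by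
  have h1 : minkowski * Eᵀ * G * E = 1 := by
    rw [mul_assoc minkowski, mul_assoc minkowski, h, minkowski_mul_self]
  have h2 := mul_eq_one_comm.1 h1
  simpa only [mul_assoc] using h2

/-- If there is a continuous field of orthonormal frames, parallel transport around a loop is
given by an element of the identity component of the Lorentz group. -/
theorem frameRep_mem_lorentzGroup (hg : IsMetricOn (M := E4) g U) {e : E4 → Fin 4 → E4}
    (he : ∀ x ∈ U, IsFrame (M := E4) g minkowski x (e x))
    (hc : ∀ a, ContinuousOn (fun x => e x a) U)
    {p : E4} {γ : Path p p} {A : E4 →ₗ[ℝ] E4} (hA : IsTransport (M := E4) g U γ A)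
    {F : E4 ≃L[ℝ] E4} (hF : IsFrame (M := E4) g minkowski p fun a => F (basisVec a)) :
    frameRep F A ∈ lorentzGroup := by
  choose V hV0 hV1 hV using fun a => hA.transport (F (basisVec a))
  have hp : p ∈ U := by simpa using hA.mem 0
  have hγU : ∀ t, γ.extend t ∈ U := fun t => hA.extend_mem t
  let γ' : ℝ → E4 := fun t => γ.extend t
  have hγc : Continuous γ' := γ.continuous_extend
  have hVc : ∀ a, ContinuousOn (V a) (Icc 0 1) := fun a t ht => by
    have := OnPieces.continuousWithinAt (f := fun t τ => toChart (γ' t) (γ' τ) (V a τ)) (hV a)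
      (fun c d h t ht => (isParallelOn_iff.1 h.2 t ht).continuousWithinAt) t ht
    simpa only [toChart_model] using this
  have hfr : ∀ t ∈ Icc (0 : ℝ) 1, IsFrame (M := E4) g minkowski (γ' t) fun a => V a t :=
    fun t ht a b => by
      have h := ((hV a).metric_eq hg (fun t _ => hγU t) (hV b)).2 t ht
      refine h.trans ?_
      simp only [hV0]
      rw [show γ.extend 0 = p from γ.extend_zero]
      exact hF a b
  have hmat : ∀ x ∈ U, ∀ {f : Fin 4 → E4}, IsFrame (M := E4) g minkowski x f →
      (Matrix.of fun i a => f a i)ᵀ * componentMatrix g x * (Matrix.of fun i a => f a i) =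
        minkowski := fun x hx f hf => by
    obtain ⟨B, hB⟩ := hg.bilinear x hx
    exact frame_matrix_eq hB hf
  -- the matrix of the frame field, of the metric, and of the transported frame
  set X : E4 → Mat4 := fun x => Matrix.of fun i a => e x a i
  set Vm : ℝ → Mat4 := fun t => Matrix.of fun i a => V a t i
  set G : ℝ → Mat4 := fun t => componentMatrix g (γ' t)
  have hX : ∀ x ∈ U, (X x)ᵀ * componentMatrix g x * X x = minkowski :=
      fun x hx => hmat x hx (he x hx)
  have hVm : ∀ t ∈ Icc (0 : ℝ) 1, (Vm t)ᵀ * G t * Vm t = minkowski := fun t ht =>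
    hmat _ (hγU t) (hfr t ht)
  have hGT : ∀ t, (G t)ᵀ = G t := fun t => by
    ext i j
    have := (hg.regular (γ' t) _ (hγU t) (mem_extChartAt_source _)).symm.self_of_nhds j i
    rw [chartMetric_model] at this
    exact this
  -- a constant Lorentz transformation adapts the frame field to the given frame at `p`
  set Λ : Mat4 := minkowski * (X p)ᵀ * componentMatrix g p * Vm 0
  have hγ0 : γ' 0 = p := γ.extend_zero
  have hγ1 : γ' 1 = p := γ.extend_one
  have hV0' : (Vm 0)ᵀ * componentMatrix g p * Vm 0 = minkowski := by
    have := hVm 0 (left_mem_Icc.2 zero_le_one)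
    simpa only [G, hγ0] using this
  have hG0T : (componentMatrix g p)ᵀ = componentMatrix g p := by
    have := hGT 0
    simpa only [G, hγ0] using this
  have hW : ∀ {G X V : Mat4}, Gᵀ = G → Xᵀ * G * X = minkowski → Vᵀ * G * V = minkowski →
      (minkowski * Xᵀ * G * V)ᵀ * minkowski * (minkowski * Xᵀ * G * V) = minkowski :=
    fun {G X V} hG hX hV => by
      simp only [Matrix.transpose_mul, Matrix.transpose_transpose, hG, minkowski_transpose]
      calc Vᵀ * (G * (X * minkowski)) * minkowski * (minkowski * Xᵀ * G * V)
          = Vᵀ * G * (X * (minkowski * minkowski) * minkowski * Xᵀ * G) * V := by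
            simp only [mul_assoc]
        _ = minkowski := by
            rw [minkowski_mul_self, mul_one, minkowski_frame_inv hX, mul_one, hV]
  have hΛ : Λᵀ * minkowski * Λ = minkowski := hW hG0T (hX p hp) hV0'
  have hXΛ : ∀ t, (X (γ' t) * Λ)ᵀ * G t * (X (γ' t) * Λ) = minkowski := fun t => by
    calc (X (γ' t) * Λ)ᵀ * G t * (X (γ' t) * Λ)
        = Λᵀ * ((X (γ' t))ᵀ * G t * X (γ' t)) * Λ := by
          simp only [Matrix.transpose_mul, mul_assoc]
      _ = minkowski := by rw [hX _ (hγU t), hΛ]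
  have hXp : X p * Λ = Vm 0 := by
    calc X p * Λ = X p * minkowski * (X p)ᵀ * componentMatrix g p * Vm 0 := by
          simp only [Λ, mul_assoc]
      _ = Vm 0 := by rw [minkowski_frame_inv (hX p hp), one_mul]
  have key := mem_lorentzGroup_of_path (W := fun t => minkowski * (X (γ' t) * Λ)ᵀ * G t * Vm t)
    zero_le_one ?_ ?_ fun t ht => hW (hGT t) (hXΛ t) (hVm t ht)
  · convert key using 1
    have e1 : Vm 1 = Vm 0 * frameRep F A := by
      have := frameRep_eq_iff.1 (rfl : frameRep F A = _)
      ext i a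
      simp only [Vm, Matrix.of_apply, Matrix.mul_apply, hV0, hV1, this]
      simp [mul_comm]
    simp only [hγ1, hXp, e1, G]
    rw [← mul_assoc, mul_assoc minkowski, mul_assoc minkowski, hV0', minkowski_mul_self, one_mul]
  · have hE : ∀ {Y : ℝ → Mat4}, (∀ i j, ContinuousOn (fun t => Y t i j) (Icc 0 1)) →
        ContinuousOn Y (Icc 0 1) := fun h =>
      continuousOn_pi.2 fun i => continuousOn_pi.2 fun j => h i j
    have h1 : ContinuousOn (fun t => X (γ' t)) (Icc 0 1) := hE fun i a => by
      have := (coordMap i).continuous.comp_continuousOn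
        ((hc a).comp hγc.continuousOn (s := Icc 0 1) fun t _ => hγU t)
      exact this
    have h2 : ContinuousOn G (Icc 0 1) := hE fun i j t _ => by
      have h := (hg.regular (γ' t) _ (hγU t) (mem_extChartAt_source _)).contDiffAt i j
      rw [chartMetric_model] at h
      have h3 : extChart (γ' t) (γ' t) = γ' t := rfl
      rw [h3] at h
      exact (h.continuousAt.comp (f := γ') hγc.continuousAt).continuousWithinAt
    have h3 : ContinuousOn Vm (Icc 0 1) := hE fun i a =>
      (coordMap i).continuous.comp_continuousOn (hVc a)
    have h4 : ContinuousOn (fun t => (X (γ' t) * Λ)ᵀ) (Icc 0 1) :=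
      (continuous_id.matrix_transpose).comp_continuousOn (h1.mul continuousOn_const)
    exact ((continuousOn_const.mul h4).mul h2).mul h3
  · change minkowski * (X (γ' 0) * Λ)ᵀ * G 0 * Vm 0 = 1
    simp only [hγ0, hXp, G]
    rw [mul_assoc minkowski, mul_assoc minkowski, hV0', minkowski_mul_self]

end Domain

section

attribute [local instance] Matrix.linftyOpNormedRing Matrix.linftyOpNormedAlgebra

section FullHolonomy


variable {g : E4 → E4 → E4 → ℝ} {U : Set E4}

theorem curvatureAt_model (g : E4 → E4 → E4 → ℝ) (x u v : E4) :
    curvatureAt (M := E4) g x u v =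
      gaugeCurvature (christoffelMap (componentMatrix g)) x u v := by
  rw [curvatureAt, chartMetric_model]
  rfl

theorem regularAt_componentMatrix (hg : IsMetricOn (M := E4) g U) {x : E4} (hx : x ∈ U) :
    RegularAt (componentMatrix g) x := by
  have h := hg.regular x x hx (mem_extChartAt_source _)
  rw [chartMetric_model] at h
  exact h

theorem frameRepL_trans {F F' : E4 ≃L[ℝ] E4} {J Q Q' : E4 →L[ℝ] E4} (hF : ∀ u, F u = J (F' u))
    (hQ : ∀ w, J (Q w) = Q' (J w)) : frameRepL F' Q = frameRepL F Q' :=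
  frameRep_trans (P := (J : E4 →ₗ[ℝ] E4)) hF hQ

theorem frameRepL_gaugeCurvature {F F' : E4 ≃L[ℝ] E4} {f : E4 → E4}
    {G G' : E4 → Mat4} {y : E4} (hF : ∀ u, F u = fderiv ℝ f y (F' u)) (hG : RegularAt G y)
    (hG' : RegularAt G' (f y)) (hf : ∀ᶠ z in 𝓝 y, ContDiffAt ℝ ∞ f z)
    (hiso : ∀ᶠ z in 𝓝 y, ∀ u v,
      bilin (G z) u v = bilin (G' (f z)) (fderiv ℝ f z u) (fderiv ℝ f z v)) (u v : E4) :
    frameRepL F' (gaugeCurvature (christoffelMap G) y u v) =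
      frameRepL F (gaugeCurvature (christoffelMap G') (f y) (fderiv ℝ f y u)
        (fderiv ℝ f y v)) := by
  have h := gaugeCurvature_transform hG hG' hf hiso u v
  generalize gaugeCurvature (christoffelMap G) y u v = Q at *
  generalize gaugeCurvature (christoffelMap G') (f y) (fderiv ℝ f y u) (fderiv ℝ f y v) = Q'
    at *
  generalize fderiv ℝ f y = J at *
  exact frameRepL_trans hF h

theorem stdMatrix_form (F : E4 → E4) (G : Mat4) (a b : Fin 4) :
    ((stdMatrix F)ᵀ * G * stdMatrix F) a b = bilin G (F (basisVec a)) (F (basisVec b)) := by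
  rw [bilin_eq_dotProduct, mul_assoc, Matrix.mul_apply]
  simp only [dotProduct, Matrix.mulVec, Matrix.mul_apply, Matrix.transpose_apply, stdMatrix_apply]

theorem mul_stdMatrix_apply {G : Mat4} (hG : ∀ i j, G i j = G j i) (A : E4 → E4) (i j : Fin 4) :
    (G * stdMatrix A) i j = bilin G (A (basisVec j)) (basisVec i) := by
  rw [bilin_symm hG, bilin_apply]
  simp [basisVec_apply, Matrix.mul_apply, stdMatrix_apply]

/-- The algebraic step: operators containing, in an orthonormal frame, the curvature operators of
the metric `nutModel` at a point generate the Lie algebra of the Lorentz group. -/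
theorem lorentzAlgebra_le_of_nutCurvature {E G K : Mat4} {a c d s : ℝ} (hs : s ≠ 0) (hc : c ≠ 0)
    (hK : K = nutModelInv a s) (hGK : G * K = 1) (hG : Gᵀ = G) (hE : Eᵀ * G * E = minkowski)
    {T : Submodule ℝ Mat4} (hT : ∀ X ∈ T, ∀ Y ∈ T, X * Y - Y * X ∈ T)
    (h : ∀ μ ν, minkowski * Eᵀ * G * (K * nutCurvature a c d ν μ) * E ∈ T) :
    lorentzAlgebra ≤ T := by
  intro Z hZ
  set D : Mat4 := minkowski * Eᵀ * G with hD
  have hDE : D * E = 1 := by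
    rw [hD, mul_assoc minkowski, mul_assoc minkowski, hE, minkowski_mul_self]
  have hED : E * D = 1 := mul_eq_one_comm.1 hDE
  have hKG : K * G = 1 := mul_eq_one_comm.1 hGK
  let T' : Submodule ℝ Mat4 :=
    T.comap ((LinearMap.mulRight ℝ E).comp (LinearMap.mulLeft ℝ D))
  have hT' : ∀ X ∈ T', ∀ Y ∈ T', X * Y - Y * X ∈ T' := fun X hX Y hY => by
    have h1 := hT _ hX _ hY
    have h2 : ∀ X Y : Mat4, D * X * E * (D * Y * E) = D * (X * Y) * E := fun X Y => by
      calc D * X * E * (D * Y * E) = D * X * (E * D) * Y * E := by simp only [mul_assoc]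
        _ = D * (X * Y) * E := by rw [hED, mul_one, mul_assoc D]
    change D * X * E * (D * Y * E) - D * Y * E * (D * X * E) ∈ T at h1
    change D * (X * Y - Y * X) * E ∈ T
    rw [h2, h2] at h1
    rwa [mul_sub, sub_mul]
  have hZ' : minkowski * Zᵀ * minkowski = -Z := hZ
  have hZ2 : minkowski * Zᵀ = -(Z * minkowski) := by
    rw [← neg_mul, ← hZ', mul_assoc _ minkowski, minkowski_mul_self, mul_one]
  have hskew : (G * E * Z * D)ᵀ = -(G * E * Z * D) := by
    have h1 : G * E * Z * D = G * E * (Z * minkowski) * Eᵀ * G := by simp only [hD, mul_assoc]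
    rw [h1]
    simp only [Matrix.transpose_mul, Matrix.transpose_transpose, hG, minkowski_transpose]
    rw [hZ2]
    simp only [mul_neg, neg_mul, mul_assoc]
  have hmem : K * (G * E * Z * D) ∈ T' := by
    rw [hK]
    exact mem_of_nutCurvature_mem hs hc hT' (fun μ ν => by rw [← hK]; exact h μ ν) hskew
  have h3 : D * (K * (G * E * Z * D)) * E = Z := by
    calc D * (K * (G * E * Z * D)) * E = D * (K * G) * E * Z * (D * E) := by simp only [mul_assoc]
      _ = Z := by rw [hKG, hDE, mul_one, mul_one, hDE, one_mul]
  rw [← h3]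
  exact hmem

/-- A subalgebra that contains the curvature operators at a point around which the metric is
isometric to `nutModel` contains the Lie algebra of the Lorentz group. -/
theorem lorentzAlgebra_le_of_isometry (hg : IsMetricOn (M := E4) g U) {A : ℝ → ℝ} {N : ℝ} {y : E4}
    {P : E4 → E4} (hA : ∀ᶠ r in 𝓝 (y 1), ContDiffAt ℝ ∞ A r) (hs : y 1 ^ 2 + N ^ 2 ≠ 0)
    (h2 : y 2 = 0) (hc : y 1 * deriv A (y 1) / 2 + N ^ 2 * A (y 1) / (y 1 ^ 2 + N ^ 2) ≠ 0)
    (hP : ∀ᶠ z in 𝓝 y, ContDiffAt ℝ ∞ P z) (hPU : P y ∈ U)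
    (hiso : ∀ᶠ z in 𝓝 y, ∀ u v,
      bilin (nutModel A N z) u v = g (P z) (fderiv ℝ P z u) (fderiv ℝ P z v))
    {F : E4 ≃L[ℝ] E4} (hF : IsFrame (M := E4) g minkowski (P y) fun a => F (basisVec a))
    {T : Submodule ℝ Mat4} (hT : ∀ X ∈ T, ∀ Y ∈ T, X * Y - Y * X ∈ T)
    (h : ∀ u v, frameRepL F (curvatureAt (M := E4) g (P y) u v) ∈ T) : lorentzAlgebra ≤ T := by
  have hreg := regularAt_nutModel hA hs h2
  obtain ⟨J, hJ0⟩ : ∃ J, J = fderiv ℝ P y := ⟨_, rfl⟩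
  have hJ : ∀ u, J u = 0 → u = 0 := fun u hu => eq_zero_of_bilin hreg.det fun v => by
    obtain ⟨B, hB⟩ := hg.bilinear _ hPU
    rw [hiso.self_of_nhds u v, hB, ← hJ0, hu]; simp
  have hinj : Function.Injective (J : E4 →ₗ[ℝ] E4) :=
    (injective_iff_map_eq_zero (J : E4 →ₗ[ℝ] E4)).2 hJ
  let Je : E4 ≃L[ℝ] E4 :=
    (LinearEquiv.ofInjectiveEndo (J : E4 →ₗ[ℝ] E4) hinj).toContinuousLinearEquiv
  have hJe : ∀ u, Je u = J u := fun u => rfl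
  obtain ⟨F', hF'⟩ : ∃ F' : E4 ≃L[ℝ] E4, ∀ u, F u = J (F' u) :=
    ⟨F.trans Je.symm, fun u => by rw [← hJe]; exact (Je.apply_symm_apply (F u)).symm⟩
  have hiso' : ∀ᶠ z in 𝓝 y, ∀ u v, bilin (nutModel A N z) u v =
      bilin (componentMatrix g (P z)) (fderiv ℝ P z u) (fderiv ℝ P z v) := by
    filter_upwards [hiso, hP.self_of_nhds.continuousAt.eventually (hg.isOpen.mem_nhds hPU)]
      with z hz hzU u v
    obtain ⟨B, hB⟩ := hg.bilinear _ hzU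
    rw [hz, bilin_componentMatrix hB]
  have hR : ∀ u v, frameRepL F'
      (gaugeCurvature (christoffelMap (nutModel A N)) y u v) ∈ T := fun u v => by
    have h1 := h (J u) (J v)
    rw [curvatureAt_model] at h1
    rw [frameRepL_gaugeCurvature (f := P) (fun u => by rw [hF', hJ0]) hreg
      (regularAt_componentMatrix hg hPU) hP hiso' u v, ← hJ0]
    exact h1
  have hE : (stdMatrix F')ᵀ * nutModel A N y * stdMatrix F' = minkowski := by
    ext a b
    have h1 := hiso.self_of_nhds (F' (basisVec a)) (F' (basisVec b))
    rw [stdMatrix_form, h1]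
    have h2 : ∀ a, fderiv ℝ P y (F' (basisVec a)) = F (basisVec a) := fun a => by
      rw [← hJ0, hF']
    rw [h2, h2]
    exact hF a b
  have hsymm := nutModel_symm A N y
  have hGT : (nutModel A N y)ᵀ = nutModel A N y := by
    ext i j
    exact hsymm j i
  have hGK := nutModel_mul_inv (A := A) hs h2
  refine lorentzAlgebra_le_of_nutCurvature hs hc rfl hGK hGT hE hT
    (d := N * deriv A (y 1) / 2 - N * A (y 1) * y 1 / (y 1 ^ 2 + N ^ 2)) fun μ ν => ?_
  have hRμν := hR (basisVec (Fin.castLE (by norm_num) μ)) (basisVec (Fin.natAdd 2 ν))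
  have hcurv := bilin_curvature_nutModel hA hs h2 μ ν
  set R := gaugeCurvature (christoffelMap (nutModel A N)) y
    (basisVec (Fin.castLE (by norm_num) μ)) (basisVec (Fin.natAdd 2 ν))
  set Q := nutCurvature (A (y 1)) (y 1 * deriv A (y 1) / 2 + N ^ 2 * A (y 1) / (y 1 ^ 2 + N ^ 2))
    (N * deriv A (y 1) / 2 - N * A (y 1) * y 1 / (y 1 ^ 2 + N ^ 2)) ν μ with hQ
  have hQT : Qᵀ = -Q := nutCurvature_transpose _ _ _ _ _
  have e1 : nutModel A N y * stdMatrix R = -Q := by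
    rw [← hQT]
    ext i j
    rw [mul_stdMatrix_apply hsymm]
    exact hcurv j i
  have e2 : nutModelInv (A (y 1)) (y 1 ^ 2 + N ^ 2) * Q = -stdMatrix R := by
    rw [← neg_neg Q, ← e1, mul_neg, ← mul_assoc, mul_eq_one_comm.1 hGK, one_mul]
  have e3 : frameRep F' (R : E4 →ₗ[ℝ] E4) =
      minkowski * (stdMatrix F')ᵀ * nutModel A N y * stdMatrix R * stdMatrix F' := by
    have h3 := stdMatrix_mul_frame F' (R : E4 →ₗ[ℝ] E4)
    calc frameRep F' (R : E4 →ₗ[ℝ] E4)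
        = minkowski * ((stdMatrix F')ᵀ * nutModel A N y * stdMatrix F')
            * frameRep F' (R : E4 →ₗ[ℝ] E4) := by rw [hE, minkowski_mul_self, one_mul]
      _ = minkowski * (stdMatrix F')ᵀ * nutModel A N y
            * (stdMatrix F' * frameRep F' (R : E4 →ₗ[ℝ] E4)) := by simp only [mul_assoc]
      _ = _ := by rw [← h3, mul_assoc _ (stdMatrix R)]; rfl
  rw [e2, mul_neg, neg_mul]
  rw [frameRepL_apply, e3] at hRμν
  exact T.neg_mem hRμν

/-- Orthonormal frames at `p` exist, and in each of them the holonomy group of `g` on `U` is the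
restricted Lorentz group. -/
def HasLorentzHolonomy (g : E4 → E4 → E4 → ℝ) (U : Set E4) (p : E4) : Prop :=
  (∃ e : Fin 4 → E4, IsFrame (M := E4) g minkowski p e) ∧
    ∀ e : Fin 4 → E4, IsFrame (M := E4) g minkowski p e →
      matricesInFrame (M := E4) (p := p) e (holonomyGroup (M := E4) g U p) = lorentzGroup

/-- A Lorentz metric on a connected domain of `ℝ⁴` with a continuous field of orthonormal frames
that is locally isometric to the metric `nutModel` around one point, with generic curvature there,
has the full Lorentz group as its holonomy group. -/
theorem holonomyGroup_eq_lorentzGroup (hg : IsMetricOn (M := E4) g U) (hU : IsPreconnected U)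
    {e : E4 → Fin 4 → E4} (he : ∀ x ∈ U, IsFrame (M := E4) g minkowski x (e x))
    (hec : ∀ a, ContinuousOn (fun x => e x a) U) {A : ℝ → ℝ} {N : ℝ} {y : E4}
    {P : E4 → E4} (hA : ∀ᶠ r in 𝓝 (y 1), ContDiffAt ℝ ∞ A r) (hs : y 1 ^ 2 + N ^ 2 ≠ 0)
    (h2 : y 2 = 0) (hc : y 1 * deriv A (y 1) / 2 + N ^ 2 * A (y 1) / (y 1 ^ 2 + N ^ 2) ≠ 0)
    (hP : ∀ᶠ z in 𝓝 y, ContDiffAt ℝ ∞ P z) (hPU : P y ∈ U)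
    (hiso : ∀ᶠ z in 𝓝 y, ∀ u v,
      bilin (nutModel A N z) u v = g (P z) (fderiv ℝ P z u) (fderiv ℝ P z v))
    {p : E4} (hp : p ∈ U) :
    HasLorentzHolonomy g U p := by
  refine ⟨⟨_, he p hp⟩, fun f hf => ?_⟩
  obtain ⟨B, hB⟩ := hg.bilinear p hp
  obtain ⟨F, hFf⟩ := exists_frameEquiv (M := E4) (by rw [det_minkowski]; norm_num) hB hf
  have hF : IsFrame (M := E4) g minkowski p fun a => F (basisVec a) := fun a b => by
    simp only [hFf]
    exact hf a b
  have hH : matricesInFrame (M := E4) (p := p) f (holonomyGroup (M := E4) g U p) =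
      frameRep F '' loopHolonomy (M := E4) g U (fun _ : Path p p => True) := by
    rw [← holonomyGroup_eq]
    ext Λ
    exact mem_matricesInFrame_iff hFf
  rw [hH]
  obtain ⟨σ, Q, hσ⟩ := exists_isTransport hg hU hp hPU
  obtain ⟨F', hF'⟩ := exists_transported_frame hg hσ F
  refine lorentzGroup_eq_of_tangent (isUnitGroup_loopHolonomy hg hp isLoopClass_true) ?_ ?_
  · rintro _ ⟨L, ⟨γ, -, hL⟩, rfl⟩
    exact frameRep_mem_lorentzGroup hg he hec hL hF
  · refine lorentzAlgebra_le_of_isometry hg hA hs h2 hc hP hPU hiso (F := F') ?_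
      (fun X hX Y hY => lie_mem_tangentSpaceOne _ hX hY)
      fun u v => curvatureAt_mem_tangentSpaceOne hg hp isLoopClass_true hσ hF' u v
    intro a b
    simp only [hF']
    exact (hσ.metric_eq hg _ _).trans (hF a b)

end FullHolonomy

end

/-! ### Polar coordinates -/

section Polar

/-- Polar coordinates `(v, r, ψ, φ)` on `ℝ⁴`: `ψ` is the latitude, `φ` the azimuth, and the time
is `v - h(r)`. -/
def polarMap (h : ℝ → ℝ) (z : E4) : E4 :=
  !₂[z 0 - h (z 1), z 1 * (Real.cos (z 2) * Real.cos (z 3)),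
    z 1 * (Real.cos (z 2) * Real.sin (z 3)), z 1 * Real.sin (z 2)]

theorem contDiffAt_polarMap {h : ℝ → ℝ} {z : E4} (hh : ContDiffAt ℝ ∞ h (z 1)) :
    ContDiffAt ℝ ∞ (polarMap h) z := by
  have hc : ∀ i : Fin 4, ContDiffAt ℝ ∞ (fun z : E4 => z i) z := fun i =>
    (coordMap i).contDiff.contDiffAt
  rw [contDiffAt_euclidean]
  intro i
  fin_cases i
  · exact (hc 0).sub (hh.comp z (hc 1))
  · exact (hc 1).mul ((hc 2).cos.mul (hc 3).cos)
  · exact (hc 1).mul ((hc 2).cos.mul (hc 3).sin)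
  · exact (hc 1).mul (hc 2).sin

theorem fderiv_apply_of_hasFDerivAt {f : E4 → E4} {z : E4} (hf : DifferentiableAt ℝ f z) {i : Fin 4}
    {c : E4 →L[ℝ] ℝ} (h : HasFDerivAt (fun z => f z i) c z) (w : E4) : fderiv ℝ f z w i = c w := by
  have h1 := (coordMap i).hasFDerivAt.comp z hf.hasFDerivAt
  rw [← h1.unique h]
  rfl

theorem fderiv_polarMap {h : ℝ → ℝ} {z : E4} (hh : ContDiffAt ℝ ∞ h (z 1)) (w : E4) :
    fderiv ℝ (polarMap h) z w =
      !₂[w 0 - deriv h (z 1) * w 1,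
        w 1 * (Real.cos (z 2) * Real.cos (z 3)) - z 1 * Real.sin (z 2) * Real.cos (z 3) * w 2
          - z 1 * Real.cos (z 2) * Real.sin (z 3) * w 3,
        w 1 * (Real.cos (z 2) * Real.sin (z 3)) - z 1 * Real.sin (z 2) * Real.sin (z 3) * w 2
          + z 1 * Real.cos (z 2) * Real.cos (z 3) * w 3,
        w 1 * Real.sin (z 2) + z 1 * Real.cos (z 2) * w 2] := by
  have hd : DifferentiableAt ℝ (polarMap h) z := (contDiffAt_polarMap hh).differentiableAt (by simp)
  have hc : ∀ i : Fin 4, HasFDerivAt (fun z : E4 => z i) (coordMap i) z := fun i =>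
    (coordMap i).hasFDerivAt
  have h0 : HasFDerivAt (fun z : E4 => z 0 - h (z 1)) _ z := (hc 0).sub
    ((hh.differentiableAt (by simp)).hasDerivAt.comp_hasFDerivAt z (hc 1))
  have h1 : HasFDerivAt (fun z : E4 => z 1 * (Real.cos (z 2) * Real.cos (z 3))) _ z :=
    (hc 1).mul ((hc 2).cos.mul (hc 3).cos)
  have h2 : HasFDerivAt (fun z : E4 => z 1 * (Real.cos (z 2) * Real.sin (z 3))) _ z :=
    (hc 1).mul ((hc 2).cos.mul (hc 3).sin)
  have h3 : HasFDerivAt (fun z : E4 => z 1 * Real.sin (z 2)) _ z := (hc 1).mul (hc 2).sin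
  ext i
  fin_cases i
  · refine (fderiv_apply_of_hasFDerivAt (i := 0) hd h0 w).trans ?_
    simp
  · refine (fderiv_apply_of_hasFDerivAt (i := 1) hd h1 w).trans ?_
    simp
    ring
  · refine (fderiv_apply_of_hasFDerivAt (i := 2) hd h2 w).trans ?_
    simp
    ring
  · refine (fderiv_apply_of_hasFDerivAt (i := 3) hd h3 w).trans ?_
    simp
    ring

theorem radius_polarMap {h : ℝ → ℝ} {z : E4} (hz : 0 ≤ z 1) : radius (polarMap h z) = z 1 := by
  rw [radius, Real.sqrt_eq_iff_mul_self_eq (by positivity) hz]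
  simp [polarMap]
  linear_combination (z 1) ^ 2 * Real.cos_sq_add_sin_sq (z 2) * 1
    + (z 1) ^ 2 * Real.cos (z 2) ^ 2 * Real.cos_sq_add_sin_sq (z 3)

theorem spatialDot_fderiv_polarMap {h : ℝ → ℝ} {z : E4} (hh : ContDiffAt ℝ ∞ h (z 1)) (w w' : E4) :
    spatialDot (fderiv ℝ (polarMap h) z w) (fderiv ℝ (polarMap h) z w') =
      w 1 * w' 1 + z 1 ^ 2 * (w 2 * w' 2 + Real.cos (z 2) ^ 2 * (w 3 * w' 3)) := by
  rw [fderiv_polarMap hh, fderiv_polarMap hh]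
  have h2 := Real.cos_sq_add_sin_sq (z 2)
  have h3 := Real.cos_sq_add_sin_sq (z 3)
  simp [spatialDot]
  linear_combination ((w 1 * Real.cos (z 2) - z 1 * Real.sin (z 2) * w 2)
      * (w' 1 * Real.cos (z 2) - z 1 * Real.sin (z 2) * w' 2)
      + (z 1 * Real.cos (z 2) * w 3) * (z 1 * Real.cos (z 2) * w' 3)) * h3
    + (w 1 * w' 1 + z 1 ^ 2 * w 2 * w' 2) * h2

theorem dRadius_fderiv_polarMap {h : ℝ → ℝ} {z : E4} (hh : ContDiffAt ℝ ∞ h (z 1)) (hz : 0 < z 1)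
    (w : E4) : dRadius (polarMap h z) (fderiv ℝ (polarMap h) z w) = w 1 := by
  rw [dRadius, radius_polarMap hz.le, fderiv_polarMap hh, div_eq_iff hz.ne']
  have h2 := Real.cos_sq_add_sin_sq (z 2)
  have h3 := Real.cos_sq_add_sin_sq (z 3)
  simp [spatialDot, polarMap]
  linear_combination
    (z 1 * Real.cos (z 2) * (w 1 * Real.cos (z 2) - z 1 * Real.sin (z 2) * w 2)) * h3
    + z 1 * w 1 * h2

theorem polarMap_axis (h : ℝ → ℝ) (z : E4) : polarMap h z 1 ^ 2 + polarMap h z 2 ^ 2 =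
    (z 1 * Real.cos (z 2)) ^ 2 := by
  simp [polarMap]
  linear_combination (z 1) ^ 2 * Real.cos (z 2) ^ 2 * Real.cos_sq_add_sin_sq (z 3)

theorem dAzimuth_fderiv_polarMap {h : ℝ → ℝ} {z : E4} (hh : ContDiffAt ℝ ∞ h (z 1)) (hz : 0 < z 1)
    (hcos : Real.cos (z 2) ≠ 0) (w : E4) :
    dAzimuth (polarMap h z) (fderiv ℝ (polarMap h) z w) = w 3 := by
  have h3 := Real.cos_sq_add_sin_sq (z 3)
  rw [dAzimuth, polarMap_axis, fderiv_polarMap hh, div_eq_iff (by positivity)]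
  simp [polarMap]
  linear_combination (z 1) ^ 2 * Real.cos (z 2) ^ 2 * w 3 * h3

/-- Every point has polar coordinates. -/
theorem exists_polarMap_eq (x : E4) : ∃ z : E4, z 1 = radius x ∧
    z 2 ∈ Icc (-(Real.pi / 2)) (Real.pi / 2) ∧ polarMap 0 z = x := by
  have hρ : x 1 ^ 2 + x 2 ^ 2 + x 3 ^ 2 = radius x ^ 2 := (Real.sq_sqrt (by positivity)).symm
  have hr : 0 ≤ radius x := Real.sqrt_nonneg _
  set r := radius x
  have h3 : |x 3| ≤ r := abs_le_of_sq_le_sq (by nlinarith [sq_nonneg (x 1), sq_nonneg (x 2)]) hr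
  have hx3 : r * (x 3 / r) = x 3 := mul_div_cancel_of_imp' fun h => by
    rw [h] at h3
    exact abs_eq_zero.1 (le_antisymm h3 (abs_nonneg _))
  have hle : |x 3 / r| ≤ 1 := by
    rw [abs_div, abs_of_nonneg hr]
    exact div_le_one_of_le₀ h3 hr
  have hle' := abs_le.1 hle
  set w : ℂ := ⟨x 1, x 2⟩
  have hw : r * Real.cos (Real.arcsin (x 3 / r)) = ‖w‖ := by
    refine (pow_left_inj₀ (mul_nonneg hr (Real.cos_arcsin_nonneg _)) (norm_nonneg w)
      two_ne_zero).1 ?_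
    rw [Real.cos_arcsin, mul_pow, Real.sq_sqrt (by nlinarith [hle'.1, hle'.2]),
      ← Complex.normSq_eq_norm_sq,
      Complex.normSq_mk, mul_sub, mul_one, ← mul_pow, hx3]
    linarith
  refine ⟨!₂[x 0, r, Real.arcsin (x 3 / r), Complex.arg w], rfl,
    ⟨Real.neg_pi_div_two_le_arcsin _, Real.arcsin_le_pi_div_two _⟩, ?_⟩
  ext i
  fin_cases i
  · simp [polarMap]
  · simp only [polarMap]
    simp [-Real.cos_arcsin]
    rw [← mul_assoc, hw, Complex.norm_mul_cos_arg]
  · simp only [polarMap]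
    simp [-Real.cos_arcsin]
    rw [← mul_assoc, hw, Complex.norm_mul_sin_arg]
  · simp only [polarMap]
    simp
    rw [Real.sin_arcsin hle'.1 hle'.2, hx3]

theorem continuous_polarMap_zero : Continuous (polarMap 0) :=
  continuous_iff_continuousAt.2 fun _ => (contDiffAt_polarMap contDiffAt_const).continuousAt

theorem isPreconnected_radius_gt {ρ : ℝ} (hρ : 0 ≤ ρ) : IsPreconnected {x : E4 | ρ < radius x} := by
  have h : {x : E4 | ρ < radius x} = polarMap 0 '' {z | ρ < z 1} := by
    ext x
    constructor
    · intro hx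
      obtain ⟨z, h1, -, h3⟩ := exists_polarMap_eq x
      exact ⟨z, lt_of_lt_of_eq hx h1.symm, h3⟩
    · rintro ⟨z, hz, rfl⟩
      have hz' : ρ < z 1 := hz
      exact lt_of_lt_of_eq hz' (radius_polarMap (hρ.trans hz'.le)).symm
  rw [h]
  exact ((convex_Ioi ρ).linear_preimage (coordMap 1).toLinearMap).isPreconnected.image _
    continuous_polarMap_zero.continuousOn

theorem rPlus_zero (N : ℝ) : rPlus 0 N = |N| := by
  simp [rPlus, Real.sqrt_sq_eq_abs]

theorem isPreconnected_nutRegion (N : ℝ) : IsPreconnected (nutRegion 0 N) := by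
  have h : nutRegion 0 N = polarMap 0 '' ({z | |N| < z 1} ∩
      {z | z 2 ∈ Ioo (-(Real.pi / 2)) (Real.pi / 2)}) := by
    ext x
    constructor
    · rintro ⟨hx, hx'⟩
      rw [rPlus_zero] at hx
      obtain ⟨z, h1, h2, rfl⟩ := exists_polarMap_eq x
      refine ⟨z, ⟨lt_of_lt_of_eq hx h1.symm, ?_⟩, rfl⟩
      have hne : Real.cos (z 2) ≠ 0 := fun h0 => by
        have h3 := polarMap_axis 0 z
        rw [h0, mul_zero] at h3
        rcases hx' with h | h <;> [have := pow_pos (abs_pos.2 h) 2;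
          have := pow_pos (abs_pos.2 h) 2] <;>
          rw [sq_abs] at this <;> nlinarith [sq_nonneg (polarMap 0 z 1), sq_nonneg (polarMap 0 z 2)]
      refine ⟨lt_of_le_of_ne h2.1 fun h => hne ?_, lt_of_le_of_ne h2.2 fun h => hne ?_⟩
      · rw [← h]; simp
      · rw [h]; simp
    · rintro ⟨z, ⟨hz, hz2⟩, rfl⟩
      have hz' : |N| < z 1 := hz
      have hz0 : 0 < z 1 := (abs_nonneg N).trans_lt hz'
      refine ⟨by rw [rPlus_zero, radius_polarMap hz0.le]; exact hz', ?_⟩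
      by_contra! hcon
      have h3 := polarMap_axis 0 z
      rw [hcon.1, hcon.2] at h3
      have := mul_pos hz0 (Real.cos_pos_of_mem_Ioo hz2)
      nlinarith
  rw [h]
  exact (((convex_Ioi |N|).linear_preimage (coordMap 1).toLinearMap).inter
    ((convex_Ioo _ _).linear_preimage (coordMap 2).toLinearMap)).isPreconnected.image _
    continuous_polarMap_zero.continuousOn

end Polar

/-! ### The Schwarzschild metric -/

section Schwarzschild

theorem contDiffAt_coord (i : Fin 4) (x : E4) : ContDiffAt ℝ ∞ (fun z : E4 => z i) x :=
  (coordMap i).contDiff.contDiffAt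

theorem contDiffAt_radius {x : E4} (hx : 0 < radius x) : ContDiffAt ℝ ∞ radius x := by
  refine ContDiffAt.sqrt ?_ (Real.sqrt_pos.1 hx).ne'
  exact (((contDiffAt_coord 1 x).pow 2).add ((contDiffAt_coord 2 x).pow 2)).add
    ((contDiffAt_coord 3 x).pow 2)

theorem contDiffAt_dRadius {x : E4} (hx : 0 < radius x) (u : E4) :
    ContDiffAt ℝ ∞ (fun z => dRadius z u) x := by
  refine ContDiffAt.div ?_ (contDiffAt_radius hx) hx.ne'
  exact (((contDiffAt_coord 1 x).mul contDiffAt_const).add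
    ((contDiffAt_coord 2 x).mul contDiffAt_const)).add ((contDiffAt_coord 3 x).mul contDiffAt_const)

/-- The one-form `dr` as a continuous linear form. -/
def dRadiusL (x : E4) : E4 →L[ℝ] ℝ :=
  (x 1 / radius x) • coordMap 1 + (x 2 / radius x) • coordMap 2 + (x 3 / radius x) • coordMap 3

theorem dRadiusL_apply (x u : E4) : dRadiusL x u = dRadius x u := by
  simp [dRadiusL, dRadius, spatialDot]
  ring

/-- The Euclidean product of the spatial parts as a bilinear map. -/
def spatialDotL : E4 →L[ℝ] E4 →L[ℝ] ℝ :=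
  (coordMap 1).smulRight (coordMap 1) + (coordMap 2).smulRight (coordMap 2)
    + (coordMap 3).smulRight (coordMap 3)

theorem spatialDotL_apply (u v : E4) : spatialDotL u v = spatialDot u v := by
  simp [spatialDotL, spatialDot]

theorem spatialDot_comm (u v : E4) : spatialDot u v = spatialDot v u := by
  simp only [spatialDot]; ring

/-- The normal vector `-∂_t + ∂_r`, which is null and metrically equivalent to `dt + dr`. -/
def nullVector (x : E4) : E4 :=
  !₂[-1, x 1 / radius x, x 2 / radius x, x 3 / radius x]

/-- An orthonormal frame of the Schwarzschild metric in Kerr–Schild form. -/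
def schwarzschildFrame (m : ℝ) (x : E4) (a : Fin 4) : E4 :=
  basisVec a - (m / (4 * Real.pi * radius x) / 2 * (basisVec a 0 + dRadius x (basisVec a))) •
    nullVector x

theorem sum_sq_div_radius {x : E4} (hx : 0 < radius x) :
    (x 1 / radius x) ^ 2 + (x 2 / radius x) ^ 2 + (x 3 / radius x) ^ 2 = 1 := by
  have h : x 1 ^ 2 + x 2 ^ 2 + x 3 ^ 2 = radius x ^ 2 := (Real.sq_sqrt (by positivity)).symm
  rw [div_pow, div_pow, div_pow, ← add_div, ← add_div, h, div_self (by positivity)]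

theorem dRadius_eq (x u : E4) :
    dRadius x u = x 1 / radius x * u 1 + x 2 / radius x * u 2 + x 3 / radius x * u 3 := by
  simp only [dRadius, spatialDot]; ring

theorem isFrame_schwarzschildFrame (m : ℝ) {x : E4} (hx : 0 < radius x) :
    IsFrame (M := E4) (schwarzschild m) minkowski x (schwarzschildFrame m x) := by
  have key : ∀ u v : E4, schwarzschild m x
      (u - (m / (4 * Real.pi * radius x) / 2 * (u 0 + dRadius x u)) • nullVector x)
      (v - (m / (4 * Real.pi * radius x) / 2 * (v 0 + dRadius x v)) • nullVector x) =
      -(u 0 * v 0) + spatialDot u v := by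
    intro u v
    have hn := sum_sq_div_radius hx
    simp only [schwarzschild, dRadius_eq, spatialDot, nullVector, PiLp.sub_apply, PiLp.smul_apply,
      smul_eq_mul]
    simp
    generalize x 1 / radius x = n1 at *
    generalize x 2 / radius x = n2 at *
    generalize x 3 / radius x = n3 at *
    generalize m / (4 * Real.pi * radius x) = H at *
    set k := u 0 + (n1 * u 1 + n2 * u 2 + n3 * u 3)
    set l := v 0 + (n1 * v 1 + n2 * v 2 + n3 * v 3)
    linear_combination (H / 2 * k * (H / 2 * l) - H * (H / 2 * k * l + H / 2 * l * k)
      + H * (H / 2 * k) * (H / 2 * l) * (n1 ^ 2 + n2 ^ 2 + n3 ^ 2 - 1)) * hn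
  intro a b
  refine (key (basisVec a) (basisVec b)).trans ?_
  simp only [spatialDot, minkowski, basisVec_apply]
  fin_cases a <;> fin_cases b <;> simp

theorem schwarzschild_comm (m : ℝ) (x u v : E4) :
    schwarzschild m x u v = schwarzschild m x v u := by
  simp only [schwarzschild, spatialDot_comm u v]; ring

theorem contDiffAt_coeff (m : ℝ) {x : E4} (hx : 0 < radius x) :
    ContDiffAt ℝ ∞ (fun z => m / (4 * Real.pi * radius z)) x :=
  contDiffAt_const.div (contDiffAt_const.mul (contDiffAt_radius hx)) (by positivity)

theorem isMetricOn_schwarzschild (m : ℝ) {ρ : ℝ} (hρ : 0 ≤ ρ) :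
    IsMetricOn (M := E4) (schwarzschild m) {x | ρ < radius x} := by
  refine isMetricOn_model (isOpen_radius_gt ρ) (fun x _ => ?_) (schwarzschild_comm m)
    (fun x hx u v => ?_) fun x hx => ⟨_, isFrame_schwarzschildFrame m (hρ.trans_lt hx)⟩
  · refine ⟨spatialDotL - (coordMap 0).smulRight (coordMap 0)
      + (m / (4 * Real.pi * radius x)) • (coordMap 0 + dRadiusL x).smulRight
        (coordMap 0 + dRadiusL x), fun u v => ?_⟩
    simp [schwarzschild, spatialDotL_apply, dRadiusL_apply]
    ring
  · have hx0 : 0 < radius x := hρ.trans_lt hx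
    exact contDiffAt_const.add ((contDiffAt_coeff m hx0).mul
      ((contDiffAt_const.add (contDiffAt_dRadius hx0 u)).mul
        (contDiffAt_const.add (contDiffAt_dRadius hx0 v))))

theorem continuousOn_schwarzschildFrame (m : ℝ) (a : Fin 4) :
    ContinuousOn (fun x => schwarzschildFrame m x a) {x | 0 < radius x} := by
  intro x hx
  have hx0 : 0 < radius x := hx
  have hd : ∀ i, ContDiffAt ℝ ∞ (fun z : E4 => z i / radius z) x := fun i =>
    (contDiffAt_coord i x).div (contDiffAt_radius hx0) hx0.ne'
  have hn : ContDiffAt ℝ ∞ nullVector x := by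
    rw [contDiffAt_euclidean]
    intro i
    fin_cases i
    · exact contDiffAt_const
    · exact hd 1
    · exact hd 2
    · exact hd 3
  exact (contDiffAt_const.sub ((((contDiffAt_coeff m hx0).div_const 2).mul
    (contDiffAt_const.add (contDiffAt_dRadius hx0 _))).smul hn)).continuousAt.continuousWithinAt

/-- The holonomy group of the Schwarzschild metric. -/
theorem holonomyGroup_schwarzschild {m : ℝ} (hm : m ≠ 0) {ρ : ℝ} (hρ : 0 ≤ ρ) {p : E4}
    (hp : ρ < radius p) : HasLorentzHolonomy (schwarzschild m) {x | ρ < radius x} p := by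
  have hR : 0 < ρ + 1 := by positivity
  set y : E4 := !₂[0, ρ + 1, 0, 0]
  have hy1 : y 1 = ρ + 1 := rfl
  have hy2 : y 2 = 0 := rfl
  have hA : ∀ r : ℝ, 0 < r → HasDerivAt (fun r => 1 - m / (4 * Real.pi * r))
      (m / (4 * Real.pi * r ^ 2)) r := fun r hr => by
    have h : HasDerivAt (fun r => 1 - m / (4 * Real.pi * r)) _ r :=
      ((((hasDerivAt_id r).const_mul (4 * Real.pi)).fun_inv (by simp; positivity)).const_mul
        m).const_sub 1
    refine h.congr_deriv ?_
    simp only [id, mul_one]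
    field_simp
  refine holonomyGroup_eq_lorentzGroup (isMetricOn_schwarzschild m hρ) (isPreconnected_radius_gt hρ)
    (e := schwarzschildFrame m) (fun x hx => isFrame_schwarzschildFrame m (hρ.trans_lt hx))
    (fun a => (continuousOn_schwarzschildFrame m a).mono fun x hx => hρ.trans_lt hx)
    (A := fun r => 1 - m / (4 * Real.pi * r)) (N := 0) (y := y) (P := polarMap id) ?_ ?_ hy2 ?_ ?_
    ?_ ?_ hp
  · rw [hy1]
    filter_upwards [lt_mem_nhds hR] with r hr
    exact contDiffAt_const.sub (contDiffAt_const.div (contDiffAt_const.mul contDiffAt_id)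
      (by simp; positivity))
  · rw [hy1]; positivity
  · rw [hy1, (hA _ hR).deriv]
    field_simp
    simp [hm, hR.ne']
  · exact .of_forall fun z => contDiffAt_polarMap contDiffAt_id
  · rw [mem_setOf_eq, radius_polarMap (by rw [hy1]; positivity), hy1]
    exact lt_add_one ρ
  · have hev : ∀ᶠ z : E4 in 𝓝 y, 0 < z 1 :=
      (coordMap 1).continuous.continuousAt.eventually (lt_mem_nhds (by
        change 0 < y 1
        rw [hy1]; exact hR))
    filter_upwards [hev] with z hz u v
    rw [bilin_nutModel, schwarzschild, dRadius_fderiv_polarMap contDiffAt_id hz,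
      dRadius_fderiv_polarMap contDiffAt_id hz, spatialDot_fderiv_polarMap contDiffAt_id,
      radius_polarMap hz.le, fderiv_polarMap contDiffAt_id, fderiv_polarMap contDiffAt_id]
    simp
    ring

end Schwarzschild

/-! ### The Taub–NUT metric with zero mass -/

section Nut

theorem nutA_zero (N r : ℝ) : nutA 0 N r = (r ^ 2 - N ^ 2) / (r ^ 2 + N ^ 2) := by
  have h : rMinus 0 N = -|N| := by simp [rMinus, Real.sqrt_sq_eq_abs]
  rw [nutA, rPlus_zero, h, ← sq_abs N]
  ring

theorem sq_lt_of_abs_lt {N r : ℝ} (h : |N| < r) : N ^ 2 < r ^ 2 :=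
  sq_lt_sq' (by linarith [neg_abs_le N]) ((le_abs_self N).trans_lt h)

theorem nutA_pos {N r : ℝ} (h : |N| < r) : 0 < nutA 0 N r := by
  have h1 := sq_lt_of_abs_lt h
  rw [nutA_zero]
  exact div_pos (by linarith) (by nlinarith [sq_nonneg N])

theorem contDiffAt_nutA {N r : ℝ} (h : 0 < r) : ContDiffAt ℝ ∞ (nutA 0 N) r := by
  have e : nutA 0 N = fun r => (r ^ 2 - N ^ 2) / (r ^ 2 + N ^ 2) := funext (nutA_zero N)
  rw [e]
  exact ((contDiffAt_id.pow 2).sub contDiffAt_const).div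
    ((contDiffAt_id.pow 2).add contDiffAt_const) (by simp; positivity)

theorem hasDerivAt_nutA (N : ℝ) {r : ℝ} (h : 0 < r) :
    HasDerivAt (nutA 0 N) (4 * r * N ^ 2 / (r ^ 2 + N ^ 2) ^ 2) r := by
  have e : nutA 0 N = fun r => (r ^ 2 - N ^ 2) / (r ^ 2 + N ^ 2) := funext (nutA_zero N)
  rw [e]
  have h1 : HasDerivAt (fun r : ℝ => (r ^ 2 - N ^ 2) / (r ^ 2 + N ^ 2)) _ r :=
    (((hasDerivAt_id r).fun_pow 2).sub_const (N ^ 2)).fun_div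
      (((hasDerivAt_id r).fun_pow 2).add_const (N ^ 2)) (by simp; positivity)
  convert h1 using 1
  simp
  ring

/-- The distance from the axis. -/
def axisDist (x : E4) : ℝ := Real.sqrt (x 1 ^ 2 + x 2 ^ 2)

theorem axis_pos {N : ℝ} {x : E4} (hx : x ∈ nutRegion 0 N) : 0 < x 1 ^ 2 + x 2 ^ 2 := by
  rcases hx.2 with h | h <;> positivity

theorem radius_pos_of_mem {N : ℝ} {x : E4} (hx : x ∈ nutRegion 0 N) : |N| < radius x := by
  rw [← rPlus_zero]; exact hx.1

/-- The orthonormal frame dual to the forms `√A (dt + 2N cos θ dφ)`, `dr / √A`,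
`√(r² + N²) dψ`, `√(r² + N²) cos ψ dφ`, where `ψ` is the latitude. -/
def nutFrame (N : ℝ) (x : E4) : Fin 4 → E4 :=
  ![(Real.sqrt (nutA 0 N (radius x)))⁻¹ • basisVec 0,
    Real.sqrt (nutA 0 N (radius x)) •
      !₂[0, x 1 / radius x, x 2 / radius x, x 3 / radius x],
    (Real.sqrt (radius x ^ 2 + N ^ 2))⁻¹ •
      !₂[0, -(x 3 * x 1 / axisDist x), -(x 3 * x 2 / axisDist x), axisDist x],
    (Real.sqrt (radius x ^ 2 + N ^ 2))⁻¹ •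
      !₂[-(2 * N * x 3 / axisDist x), -(radius x * x 2 / axisDist x),
        radius x * x 1 / axisDist x, 0]]

theorem isFrame_nutFrame {N : ℝ} {x : E4} (hx : x ∈ nutRegion 0 N) :
    IsFrame (M := E4) (taubNUT 0 N) minkowski x (nutFrame N x) := by
  have hN := radius_pos_of_mem hx
  have hr : 0 < radius x := (abs_nonneg N).trans_lt hN
  have hax := axis_pos hx
  have hρ : 0 < axisDist x := Real.sqrt_pos.2 hax
  have hρ2 : axisDist x ^ 2 = x 1 ^ 2 + x 2 ^ 2 := Real.sq_sqrt hax.le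
  have hr2 : radius x ^ 2 = axisDist x ^ 2 + x 3 ^ 2 := by
    rw [hρ2]; exact Real.sq_sqrt (by positivity)
  have hA := nutA_pos hN
  have hα : 0 < Real.sqrt (nutA 0 N (radius x)) := Real.sqrt_pos.2 hA
  have hα2 : Real.sqrt (nutA 0 N (radius x)) ^ 2 = nutA 0 N (radius x) := Real.sq_sqrt hA.le
  have hS : 0 < radius x ^ 2 + N ^ 2 := by positivity
  have hσ : 0 < Real.sqrt (radius x ^ 2 + N ^ 2) := Real.sqrt_pos.2 hS
  have hσ2 : Real.sqrt (radius x ^ 2 + N ^ 2) ^ 2 = radius x ^ 2 + N ^ 2 := Real.sq_sqrt hS.le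
  have hν : ∀ a, nutForm N x (nutFrame N x a) =
      ![(Real.sqrt (nutA 0 N (radius x)))⁻¹, 0, 0, 0] a := by
    simp only [nutForm, dAzimuth, ← hρ2, nutFrame]
    generalize Real.sqrt (nutA 0 N (radius x)) = α at *
    generalize Real.sqrt (radius x ^ 2 + N ^ 2) = σ at *
    generalize radius x = r, axisDist x = ρ, x 1 = X, x 2 = Y, x 3 = Z at *
    intro a
    fin_cases a <;> simp [basisVec_apply]
    · exact Or.inr (Or.inl (by ring))
    · exact Or.inr (Or.inl (by ring))
    · field_simp
      linear_combination (-2 * Z * N) * hρ2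
  have hd : ∀ a, dRadius x (nutFrame N x a) = ![0, Real.sqrt (nutA 0 N (radius x)), 0, 0] a := by
    simp only [dRadius, spatialDot, nutFrame]
    generalize Real.sqrt (nutA 0 N (radius x)) = α at *
    generalize Real.sqrt (radius x ^ 2 + N ^ 2) = σ at *
    generalize radius x = r, axisDist x = ρ, x 1 = X, x 2 = Y, x 3 = Z at *
    intro a
    fin_cases a <;> simp [basisVec_apply]
    · field_simp
      linear_combination -hr2 - hρ2
    · left
      field_simp
      linear_combination Z * hρ2
    · left
      ring
  have hs : ∀ a b, spatialDot (nutFrame N x a) (nutFrame N x b) =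
      Matrix.diagonal ![0, nutA 0 N (radius x), radius x ^ 2 / (radius x ^ 2 + N ^ 2),
        radius x ^ 2 / (radius x ^ 2 + N ^ 2)] a b := by
    simp only [spatialDot, nutFrame]
    generalize Real.sqrt (nutA 0 N (radius x)) = α at *
    rw [← hα2]
    generalize hσ' : Real.sqrt (radius x ^ 2 + N ^ 2) = σ at *
    rw [← hσ2]
    clear hσ' hν hd
    generalize radius x = r, axisDist x = ρ, x 1 = X, x 2 = Y, x 3 = Z at *
    intro a b
    fin_cases a <;> fin_cases b <;> simp [basisVec_apply]
    · field_simp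
      linear_combination -hr2 - hρ2
    · field_simp
      linear_combination α * Z * hρ2
    · ring
    · field_simp
      linear_combination α * Z * hρ2
    · field_simp
      linear_combination (-(Z ^ 2)) * hρ2 - ρ ^ 2 * hr2
    · ring
    · ring
    · ring
    · field_simp
      linear_combination -hρ2
  intro a b
  simp only [taubNUT, hν, hd, hs]
  clear hν hd hs
  generalize hα' : Real.sqrt (nutA 0 N (radius x)) = α at *
  clear hα'
  generalize nutA 0 N (radius x) = A at *
  subst hα2
  fin_cases a <;> fin_cases b <;> simp [minkowski]
  · field_simp
  · field_simp
    ring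
  · field_simp
  · field_simp

theorem isOpen_nutRegion (m N : ℝ) : IsOpen (nutRegion m N) :=
  (isOpen_radius_gt _).inter (((isOpen_ne (x := (0 : ℝ))).preimage (coordMap 1).continuous).union
    ((isOpen_ne (x := (0 : ℝ))).preimage (coordMap 2).continuous))

theorem contDiffAt_nutForm {N : ℝ} {x : E4} (hx : x ∈ nutRegion 0 N) (u : E4) :
    ContDiffAt ℝ ∞ (fun z => nutForm N z u) x := by
  have hr : 0 < radius x := (abs_nonneg N).trans_lt (radius_pos_of_mem hx)
  have h : ContDiffAt ℝ ∞ (fun z => dAzimuth z u) x :=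
    (((contDiffAt_coord 1 x).mul contDiffAt_const).sub
      ((contDiffAt_coord 2 x).mul contDiffAt_const)).div
      (((contDiffAt_coord 1 x).pow 2).add ((contDiffAt_coord 2 x).pow 2)) (axis_pos hx).ne'
  exact contDiffAt_const.add ((contDiffAt_const.mul
    ((contDiffAt_coord 3 x).div (contDiffAt_radius hr) hr.ne')).mul h)

/-- The one-form `dt + 2N cos θ dφ` as a continuous linear form. -/
def nutFormL (N : ℝ) (x : E4) : E4 →L[ℝ] ℝ :=
  coordMap 0 + (2 * N * (x 3 / radius x) / (x 1 ^ 2 + x 2 ^ 2)) •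
    (x 1 • coordMap 2 - x 2 • coordMap 1)

theorem nutFormL_apply (N : ℝ) (x u : E4) : nutFormL N x u = nutForm N x u := by
  simp [nutFormL, nutForm, dAzimuth]
  ring

theorem isMetricOn_taubNUT (N : ℝ) : IsMetricOn (M := E4) (taubNUT 0 N) (nutRegion 0 N) := by
  refine isMetricOn_model (isOpen_nutRegion 0 N) (fun x _ => ?_) (fun x u v => ?_)
    (fun x hx u v => ?_) fun x hx => ⟨_, isFrame_nutFrame hx⟩
  · refine ⟨(-nutA 0 N (radius x)) • (nutFormL N x).smulRight (nutFormL N x)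
      + (nutA 0 N (radius x))⁻¹ • (dRadiusL x).smulRight (dRadiusL x)
      + ((radius x ^ 2 + N ^ 2) / radius x ^ 2) •
        (spatialDotL - (dRadiusL x).smulRight (dRadiusL x)), fun u v => ?_⟩
    simp [taubNUT, spatialDotL_apply, dRadiusL_apply, nutFormL_apply]
    ring
  · simp only [taubNUT, spatialDot_comm u v]
    ring
  · have hN := radius_pos_of_mem hx
    have hr : 0 < radius x := (abs_nonneg N).trans_lt hN
    have hA : ContDiffAt ℝ ∞ (fun z => nutA 0 N (radius z)) x :=
      (contDiffAt_nutA hr).comp x (contDiffAt_radius hr)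
    have hd : ∀ u, ContDiffAt ℝ ∞ (fun z => dRadius z u) x := contDiffAt_dRadius hr
    exact ((hA.neg.mul ((contDiffAt_nutForm hx u).mul (contDiffAt_nutForm hx v))).add
      ((hA.inv (nutA_pos hN).ne').mul ((hd u).mul (hd v)))).add
      ((((contDiffAt_radius hr).pow 2).add contDiffAt_const).mul
        ((contDiffAt_const.sub ((hd u).mul (hd v))).div ((contDiffAt_radius hr).pow 2)
          (by positivity)))

theorem continuousOn_nutFrame (N : ℝ) (a : Fin 4) :
    ContinuousOn (fun x => nutFrame N x a) (nutRegion 0 N) := by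
  intro x hx
  refine ContinuousAt.continuousWithinAt ?_
  have hN := radius_pos_of_mem hx
  have hr : 0 < radius x := (abs_nonneg N).trans_lt hN
  have hrc : ContinuousAt radius x := continuous_radius.continuousAt
  have hA : ContinuousAt (fun z => Real.sqrt (nutA 0 N (radius z))) x :=
    ((contDiffAt_nutA hr).continuousAt.comp hrc).sqrt
  have hA0 : Real.sqrt (nutA 0 N (radius x)) ≠ 0 := (Real.sqrt_pos.2 (nutA_pos hN)).ne'
  have hS0 : Real.sqrt (radius x ^ 2 + N ^ 2) ≠ 0 := (Real.sqrt_pos.2 (by positivity)).ne'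
  have hS : ContinuousAt (fun z => (Real.sqrt (radius z ^ 2 + N ^ 2))⁻¹) x :=
    (((hrc.pow 2).add continuousAt_const).sqrt).inv₀ hS0
  have hc : ∀ i : Fin 4, ContinuousAt (fun z : E4 => z i) x := fun i =>
    (coordMap i).continuous.continuousAt
  have hρ : ContinuousAt axisDist x := (((hc 1).pow 2).add ((hc 2).pow 2)).sqrt
  have hρ0 : axisDist x ≠ 0 := (Real.sqrt_pos.2 (axis_pos hx)).ne'
  have hvec : ∀ {f : E4 → Fin 4 → ℝ}, (∀ i, ContinuousAt (fun z => f z i) x) →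
      ContinuousAt (fun z => (WithLp.toLp 2 (f z) : E4)) x := fun h =>
    (PiLp.continuous_toLp 2 _).continuousAt.comp (continuousAt_pi.2 h)
  fin_cases a
  · exact (hA.inv₀ hA0).smul continuousAt_const
  · refine hA.smul (hvec fun i => ?_)
    fin_cases i
    · exact continuousAt_const
    · exact (hc 1).div hrc hr.ne'
    · exact (hc 2).div hrc hr.ne'
    · exact (hc 3).div hrc hr.ne'
  · refine hS.smul (hvec fun i => ?_)
    fin_cases i
    · exact continuousAt_const
    · exact (((hc 3).mul (hc 1)).div hρ hρ0).neg
    · exact (((hc 3).mul (hc 2)).div hρ hρ0).neg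
    · exact hρ
  · refine hS.smul (hvec fun i => ?_)
    fin_cases i
    · exact ((continuousAt_const.mul (hc 3)).div hρ hρ0).neg
    · exact ((hrc.mul (hc 2)).div hρ hρ0).neg
    · exact (hrc.mul (hc 1)).div hρ hρ0
    · exact continuousAt_const

/-- The tortoise coordinate: a primitive of `1 / A`. -/
def nutTortoise (N r : ℝ) : ℝ := r + N * Real.log (r - N) - N * Real.log (r + N)

theorem hasDerivAt_nutTortoise {N r : ℝ} (h : |N| < r) :
    HasDerivAt (nutTortoise N) (nutA 0 N r)⁻¹ r := by
  have h1 : r - N ≠ 0 := by linarith [le_abs_self N]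
  have h2 : r + N ≠ 0 := by linarith [neg_abs_le N]
  have h3 : HasDerivAt (nutTortoise N) _ r := ((hasDerivAt_id r).add
    ((((hasDerivAt_id r).sub_const N).log h1).const_mul N)).sub
      ((((hasDerivAt_id r).add_const N).log h2).const_mul N)
  refine h3.congr_deriv ?_
  rw [nutA_zero, inv_div, show r ^ 2 - N ^ 2 = (r - N) * (r + N) by ring]
  simp only [id]
  field_simp
  ring

theorem contDiffAt_nutTortoise {N r : ℝ} (h : |N| < r) : ContDiffAt ℝ ∞ (nutTortoise N) r := by
  have h1 : r - N ≠ 0 := by linarith [le_abs_self N]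
  have h2 : r + N ≠ 0 := by linarith [neg_abs_le N]
  exact (contDiffAt_id.add (contDiffAt_const.mul ((contDiffAt_id.sub contDiffAt_const).log h1))).sub
    (contDiffAt_const.mul ((contDiffAt_id.add contDiffAt_const).log h2))

/-- The holonomy group of the Taub–NUT metric with zero mass. -/
theorem holonomyGroup_taubNUT {N : ℝ} (hN : N ≠ 0) {p : E4} (hp : p ∈ nutRegion 0 N) :
    HasLorentzHolonomy (taubNUT 0 N) (nutRegion 0 N) p := by
  set y : E4 := !₂[0, |N| + 1, 0, 0]
  have hy1 : y 1 = |N| + 1 := rfl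
  have hy2 : y 2 = 0 := rfl
  have hy3 : y 3 = 0 := rfl
  have hR : 0 < |N| + 1 := by positivity
  have hlt : |N| < |N| + 1 := lt_add_one _
  have hev1 : ∀ᶠ z : E4 in 𝓝 y, |N| < z 1 :=
    (coordMap 1).continuous.continuousAt.eventually (lt_mem_nhds hlt)
  have hev2 : ∀ᶠ z : E4 in 𝓝 y, 0 < Real.cos (z 2) :=
    (Real.continuous_cos.comp (coordMap 2).continuous).continuousAt.eventually (lt_mem_nhds (by
      change 0 < Real.cos (y 2)
      rw [hy2, Real.cos_zero]; exact one_pos))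
  refine holonomyGroup_eq_lorentzGroup (isMetricOn_taubNUT N) (isPreconnected_nutRegion N)
    (e := nutFrame N) (fun x hx => isFrame_nutFrame hx) (continuousOn_nutFrame N)
    (A := nutA 0 N) (N := N) (y := y) (P := polarMap (nutTortoise N)) ?_ ?_ hy2 ?_ ?_
    ?_ ?_ hp
  · rw [hy1]
    filter_upwards [lt_mem_nhds hR] with r hr using contDiffAt_nutA hr
  · rw [hy1]; positivity
  · rw [hy1, (hasDerivAt_nutA N hR).deriv]
    have h1 := nutA_pos hlt
    have h2 : 0 < N ^ 2 := by positivity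
    positivity
  · filter_upwards [hev1] with z hz using contDiffAt_polarMap (contDiffAt_nutTortoise hz)
  · refine ⟨?_, Or.inl ?_⟩
    · rw [rPlus_zero, radius_polarMap (by rw [hy1]; positivity), hy1]
      exact hlt
    · simp only [polarMap, hy1, hy2, hy3]
      simp [hR.ne']
  · filter_upwards [hev1, hev2] with z hz hcos u v
    have hz0 : 0 < z 1 := (abs_nonneg N).trans_lt hz
    have hh := contDiffAt_nutTortoise hz
    have hsin : polarMap (nutTortoise N) z 3 / z 1 = Real.sin (z 2) := by
      simp only [polarMap]
      simp [hz0.ne']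
    have h0 : ∀ w, fderiv ℝ (polarMap (nutTortoise N)) z w 0 = w 0 - (nutA 0 N (z 1))⁻¹ * w 1 :=
      fun w => by
        rw [fderiv_polarMap hh, (hasDerivAt_nutTortoise hz).deriv]
        simp
    rw [bilin_nutModel, taubNUT, dRadius_fderiv_polarMap hh hz0,
      dRadius_fderiv_polarMap hh hz0, spatialDot_fderiv_polarMap hh, nutForm, nutForm,
      dAzimuth_fderiv_polarMap hh hz0 hcos.ne', dAzimuth_fderiv_polarMap hh hz0 hcos.ne',
      radius_polarMap hz0.le, hsin, h0, h0]
    have hA := (nutA_pos hz).ne'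
    generalize nutA 0 N (z 1) = A at *
    field_simp
    ring

end Nut

end SingleCopyHolonomy

end

end

open SingleCopyHolonomy in
theorem mainTheorem9 :
    -- Schwarzschild: the holonomy group is SO(1,3)
    (∀ m : ℝ, m ≠ 0 → ∀ ρ : ℝ, 0 ≤ ρ → ∀ p : E4, ρ < radius p →
      (∃ e : Fin 4 → E4, IsFrame (M := E4) (schwarzschild m) minkowski p e) ∧
      ∀ e : Fin 4 → E4, IsFrame (M := E4) (schwarzschild m) minkowski p e →
        matricesInFrame (M := E4) (p := p) e
          (holonomyGroup (M := E4) (schwarzschild m) {x | ρ < radius x} p) = lorentzGroup) ∧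
    -- point charge: the SCH group is SO(1,3)
    (∀ Q κ : ℝ, Q ≠ 0 → κ ≠ 0 → ∀ 𝒞 : Set ClosedCurve, arcLengthCurves ⊆ 𝒞 →
      schGroup minkowski κ (pointCharge Q) {x | 0 < radius x} 𝒞 = lorentzGroup) ∧
    -- pure NUT charge: the holonomy group is SO(1,3)
    (∀ N : ℝ, N ≠ 0 → ∀ p ∈ nutRegion 0 N,
      (∃ e : Fin 4 → E4, IsFrame (M := E4) (taubNUT 0 N) minkowski p e) ∧
      ∀ e : Fin 4 → E4, IsFrame (M := E4) (taubNUT 0 N) minkowski p e →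
        matricesInFrame (M := E4) (p := p) e
          (holonomyGroup (M := E4) (taubNUT 0 N) (nutRegion 0 N) p) = lorentzGroup) ∧
    -- magnetic monopole: the SCH group is SO(3)
    (∀ q κ : ℝ, q ≠ 0 → κ ≠ 0 → ∀ 𝒞 : Set ClosedCurve, arcLengthCurves ⊆ 𝒞 →
      schGroup minkowski κ (monopole q) {x | 0 < radius x} 𝒞 = rotationGroup) ∧
    -- the self-dual factor of SO(4) is a copy of SU(2)
    IsSU2 selfDualSU2 ∧
    -- self-dual Riemannian four-manifolds: the holonomy group reduces to SU(2)
    (∀ (M : Type*) [TopologicalSpace M] [T2Space M] [ConnectedSpace M] [ChartedSpace E4 M]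
      [IsManifold 𝓘(ℝ, E4) ∞ M]
      (g : Bundle.ContMDiffRiemannianMetric 𝓘(ℝ, E4) ∞ E4
        (fun x : M => TangentSpace 𝓘(ℝ, E4) x)),
      IsOrientedAtlas M → HasSelfDualCurvature (fun x u v => g.inner x u v) →
      ∀ p : M,
        (∃ e : Fin 4 → TangentSpace 𝓘(ℝ, E4) p,
          IsFrame (fun x u v => g.inner x u v) 1 p e ∧ IsPositiveFrame p e) ∧
        ∀ e : Fin 4 → TangentSpace 𝓘(ℝ, E4) p,
          IsFrame (fun x u v => g.inner x u v) 1 p e → IsPositiveFrame p e →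
          matricesInFrame e
            (restrictedHolonomyGroup (fun x u v => g.inner x u v) Set.univ p) ⊆ selfDualSU2 ∧
          ((∃ x ρ σ μ ν, riemannAt (M := M) (fun x u v => g.inner x u v) x ρ σ μ ν ≠ 0) →
            matricesInFrame e
              (restrictedHolonomyGroup (fun x u v => g.inner x u v) Set.univ p) = selfDualSU2 ∧
            (SimplyConnectedSpace M → matricesInFrame e
              (holonomyGroup (fun x u v => g.inner x u v) Set.univ p) = selfDualSU2))) ∧
    -- self-dual gauge fields on Euclidean space: the SCH group reduces to SU(2)
    (∀ (U : Set E4) (F : E4 → Mat4) (κ : ℝ), IsOpen U → ContinuousOn F U → κ ≠ 0 →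
      (∀ x ∈ U, (F x)ᵀ = -F x) → (∀ x ∈ U, antiSelfDualPart 1 (F x) = 0) →
      ∀ 𝒞 : Set ClosedCurve, arcLengthCurves ⊆ 𝒞 →
        schGroup 1 κ F U 𝒞 ⊆ selfDualSU2 ∧
        (schGroup 1 κ F U 𝒞 = selfDualSU2 ↔
          ∃ x ∈ U, ∃ y ∈ U, LinearIndependent ℝ ![F x, F y])) := by
  refine ⟨fun m hm ρ hρ p hp => holonomyGroup_schwarzschild hm hρ hp,
    fun Q κ hQ hκ 𝒞 h𝒞 => schGroup_pointCharge hQ hκ h𝒞,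
    fun N hN p hp => holonomyGroup_taubNUT hN hp,
    fun q κ hq hκ 𝒞 h𝒞 => schGroup_monopole hq hκ h𝒞,
    isSU2_selfDualSU2, ?_, ?_⟩
  · intro M _ _ _ _ _ g hor hsd p
    exact holonomy_selfDual M g hor hsd p
  · intro U F κ hU hF hκ hanti hsd 𝒞 h𝒞
    exact ⟨schGroup_selfDual_subset hF hanti hsd, schGroup_selfDual_eq_iff hU hF hκ hanti hsd h𝒞⟩
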